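/- Let $\Bbbk$ be a field. By a symmetric monoidal category we mean a $\Bbbk$-linear abelian symmetric monoidal category with $\mathbb 1\neq 0$ whose tensor product is $\Bbbk$-linear and right exact in both variables; it is a tensor category over $\Bbbk$ if moreover it is essentially small, the canonical map $\Bbbk\to\mathrm{End}(\mathbb 1)$ is an isomorphism and every object is dualisable. A tensor functor between such symmetric monoidal categories is a right exact $\Bbbk$-linear symmetric (strong) monoidal functor. A tensor category $\mathbf T$ is locally semisimple if there is a tensor functor $F$ from $\mathbf T$ to some symmetric monoidal category as above such that $F$ maps every short exact sequence to a split short exact sequence. Let $\mathbf T$ and $\mathbf V$ be tensor categories over $\Bbbk$, where $\mathbf V$ is schurian ($\mathrm{End}(S)=\Bbbk$ for every simple object $S$) and semisimple (every object is a finite direct sum of simple objects). Let $\mathbf T\boxtimes\mathbf V$ be the idempotent completion of the $\Bbbk$-linear category $\mathbf T\otimes_{\Bbbk}\mathbf V$, whose objects are pairs $(X,V)$ and whose morphism spaces are $\mathrm{Hom}(X,Y)\otimes_{\Bbbk}\mathrm{Hom}(V,W)$, with the factorwise symmetric monoidal structure; it is a tensor category, and it contains $\mathbf T$ and $\mathbf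 V$ via $X\mapsto (X,\mathbb 1)$ and $V\mapsto(\mathbb 1,V)$. For an essentially small symmetric monoidal category $\mathbf C$, let $\mathrm{Alg}\,\mathbf C$ be the category of commutative algebras in the category $\mathrm{Ind}\,\mathbf C$ of ind-objects of $\mathbf C$, and for $0\neq\mathscr A\in\mathrm{Alg}\,\mathbf C$ let $\mathbf{Mod}_{\mathscr A}^{\mathbf C}$ be the category of $\mathscr A$-modules in $\mathrm{Ind}\,\mathbf C$, with the tensor product $\otimes_{\mathscr A}$. Assume the following. (a) Every object $X$ of $\mathbf T$ is locally $\mathbf V$-free: there are a non-zero $\mathscr A\in\mathrm{Alg}(\mathbf T\boxtimes\mathbf V)$ and an object $X_0$ of $\mathbf V$ with $\mathscr A\otimes X\simeq\mathscr A\otimes X_0$ in $\mathbf{Mod}^{\mathbf T\boxtimes\mathbf V}_{\mathscr A}$. (b) For every simple object $S\not\simeq\mathbb 1$ of $\mathbf V$ there is $N\in\mathbb N$ with $\mathrm{Sym}^N S=0$, where $\mathrm{Sym}^N S$ is the cokernel of the morphism $\bigoplus_{i=1}^{N-1}S^{\otimes N}\to S^{\otimes N}$ with components $s_i-1$, and $s_i$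 is the braiding of the $i$-th and the $(i+1)$-st factor. Then: (i) the tensor categories $\mathbf T$ and $\mathbf T\boxtimes\mathbf V$ are locally semisimple; (ii) there is a $\mathbf V$-splitting algebra for $\mathbf T$, that is, a non-zero $\mathscr A\in\mathrm{Alg}(\mathbf T\boxtimes\mathbf V)$ such that for every short exact sequence $\Sigma$ in $\mathbf T$ the sequence $\mathscr A\otimes\Sigma$ splits in $\mathbf{Mod}^{\mathbf T\boxtimes\mathbf V}_{\mathscr A}$, and such that for every object $X$ of $\mathbf T$ there is an object $X_0$ of $\mathbf V$ with $\mathscr A\otimes X\simeq\mathscr A\otimes X_0$ in $\mathbf{Mod}^{\mathbf T\boxtimes\mathbf V}_{\mathscr A}$; (iii) there are a non-zero $\mathscr R\in\mathrm{Alg}\,\mathbf V$ and a fibre functor of $\mathbf T$ over $\mathscr R$, that is, a tensor functor $\mathbf T\to\mathbf{Mod}^{\mathbf V}_{\mathscr R}$. -/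

import Mathlib

open CategoryTheory MonoidalCategory Limits Opposite Idempotents
open scoped MonoidalCategory.ExternalProduct TensorProduct

universe w v u v₁ v₂ v₃ u₁ u₂ u₃

noncomputable section

/-! ### The symmetric monoidal structure on ind-objects -/

namespace IndTensor

lemma essentiallySmall_prod (D E: Type*) [Category* D] [Category* E] [EssentiallySmall.{v} D]
    [EssentiallySmall.{v} E] : EssentiallySmall.{v} (D × E) :=
  EssentiallySmall.mk' ((equivSmallModel.{v} D).prod (equivSmallModel.{v} E))

lemma hasColimits_essSmall (J : Type*) [Category* J] [EssentiallySmall.{v} J] :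
    HasColimitsOfShape J (Type v) :=
  hasColimitsOfShape_of_equivalence (equivSmallModel.{v} J).symm

/-- A left Kan extension of a functor corepresenting evaluation at `d` corepresents evaluation at
`L.obj d`. -/
def corepresentableByLan {D : Type u₁} {E : Type u₂} [Category.{v₁} D] [Category.{v} E] (L : D ⥤ E)
    {F : D ⥤ Type v} {d : D} (h : ((evaluation D (Type v)).obj d).CorepresentableBy F)
    (F' : E ⥤ Type v) (α : F ⟶ L ⋙ F') [F'.IsLeftKanExtension α] :
    ((evaluation E (Type v)).obj (L.obj d)).CorepresentableBy F' where
  homEquiv {G} := (F'.homEquivOfIsLeftKanExtension α G).trans h.homEquiv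
  homEquiv_comp g f := by
    have := h.homEquiv_comp (L.whiskerLeft g) (F'.homEquivOfIsLeftKanExtension α _ f)
    simpa [Functor.homEquivOfIsLeftKanExtension] using this

def corepresentableByYoneda {C : Type u} [Category.{v} C] (X : C) :
    ((evaluation Cᵒᵖ (Type v)).obj (op X)).CorepresentableBy (yoneda.obj X) where
  homEquiv := yonedaEquiv
  homEquiv_comp _ _ := rfl

variable {C : Type u} [Category.{v} C]

/-- The external product of representable presheaves corepresents evaluation. -/
def corepresentableByProd (X Y : C) :
    ((evaluation (Cᵒᵖ × Cᵒᵖ) (Type v)).obj (op X, op Y)).CorepresentableBy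
     (yoneda.obj X ⊠ yoneda.obj Y) where
  homEquiv {G} := 
    { toFun α := α.app (op X, op Y) (𝟙 X, 𝟙 Y)
      invFun g₀ :=
       { app p := ↾ fun fg => G.map ((fg.1.op, fg.2.op) : (op X, op Y) ⟶ p) g₀
         naturality := by
           rintro ⟨a, b⟩ ⟨a', b'⟩ ⟨f, g⟩
           ext ⟨x, y⟩
           change G.map ((f.unop ≫ x).op, (g.unop ≫ y).op) g₀ =
             G.map ((f, g) : (a, b) ⟶ (a', b')) (G.map ((x.op, y.op) : (op X, op Y) ⟶ (a, b)) g₀)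
           rw [← ConcreteCategory.comp_apply, ← G.map_comp]
           rfl }
      left_inv α := by
        ext ⟨a, b⟩ ⟨x, y⟩
        have h := α.naturality ((x.op, y.op) : (op X, op Y) ⟶ (a, b))
        have h' := congrArg (fun f => f.hom (𝟙 X, 𝟙 Y)) h
        refine h'.symm.trans ?_
        change α.app (a, b) (x ≫ 𝟙 X, y ≫ 𝟙 Y) = _
        rw [Category.comp_id, Category.comp_id]
        rfl
      right_inv g := by
        change G.map (𝟙 (op X, op Y)) g = g
        simp }
  homEquiv_comp _ _ := rfl

variable [EssentiallySmall.{v} C]  [MonoidalCategory C]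

instance pwLKE (F : Cᵒᵖ × Cᵒᵖ ⥤ Type v) :
    (tensor Cᵒᵖ).HasPointwiseLeftKanExtension F := fun d => by
  have := essentiallySmall_prod.{v} Cᵒᵖ Cᵒᵖ
  have := hasColimits_essSmall.{v} (CostructuredArrow (tensor Cᵒᵖ) d)
  unfold Functor.HasPointwiseLeftKanExtensionAt
  infer_instance

instance pwLKEunit (F : Discrete PUnit.{1} ⥤ Type v) :
    (Functor.fromPUnit.{0} (𝟙_ Cᵒᵖ)).HasPointwiseLeftKanExtension F := fun d => by
  have := hasColimits_essSmall.{v} (CostructuredArrow (Functor.fromPUnit.{0} (𝟙_ Cᵒᵖ)) d)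
  unfold Functor.HasPointwiseLeftKanExtensionAt
  infer_instance

instance tensorRightLA (X : Type v) : (tensorRight X).IsLeftAdjoint :=
  Functor.isLeftAdjoint_of_iso (BraidedCategory.tensorLeftIsoTensorRight X)

lemma isIndObject_lan_repr (X Y : C) :
    IsIndObject ((tensor Cᵒᵖ).lan.obj (yoneda.obj X ⊠ yoneda.obj Y)) :=
  (isIndObject_yoneda (X ⊗ Y)).map ((corepresentableByYoneda (X ⊗ Y)).uniqueUpToIso 
   (corepresentableByLan (tensor Cᵒᵖ) (corepresentableByProd X Y) _ 
   ((tensor Cᵒᵖ).lanUnit.app _))).hom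

lemma isIndObject_unit :
    IsIndObject ((Functor.fromPUnit.{0} (𝟙_ Cᵒᵖ)).pointwiseLeftKanExtension
          (Functor.fromPUnit.{0} (𝟙_ (Type v)))) :=
  (isIndObject_yoneda (𝟙_ C)).map ((corepresentableByYoneda (𝟙_ C)).uniqueUpToIso 
   (corepresentableByLan (Functor.fromPUnit.{0} (𝟙_ Cᵒᵖ)) (d := ⟨⟨⟩⟩)
     { homEquiv {G} := 
        { toFun α := α.app _ PUnit.unit
          invFun g := { app p := ↾ fun _ => g 
                        naturality := by
                          rintro ⟨⟨⟩⟩ ⟨⟨⟩⟩ f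
                          ext
                          obtain rfl : f = 𝟙 _ := Subsingleton.elim _ _
                          simp }
          left_inv α := by
            ext ⟨⟨⟩⟩ ⟨⟩
            rfl
          right_inv g := rfl }
       homEquiv_comp _ _ := rfl } _ 
   (Functor.pointwiseLeftKanExtensionUnit _ _))).hom

/-- Day convolution with a fixed presheaf, as a functor of the first variable. -/
def convLeft (G : Cᵒᵖ ⥤ Type v) : (Cᵒᵖ ⥤ Type v) ⥤ (Cᵒᵖ ⥤ Type v) :=
   (externalProductBifunctorCurried Cᵒᵖ Cᵒᵖ (Type v)).flip.obj G ⋙ Functor.uncurry ⋙ (tensor Cᵒᵖ).lan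

/-- Day convolution with a fixed presheaf, as a functor of the second variable. -/
def convRight (G : Cᵒᵖ ⥤ Type v) : (Cᵒᵖ ⥤ Type v) ⥤ (Cᵒᵖ ⥤ Type v) :=
   (externalProductBifunctorCurried Cᵒᵖ Cᵒᵖ (Type v)).obj G ⋙ Functor.uncurry ⋙ (tensor Cᵒᵖ).lan

lemma pcU (J : Type v) [SmallCategory J] :
   PreservesColimitsOfShape J (Functor.uncurry ⋙ (tensor Cᵒᵖ).lan :
      (Cᵒᵖ ⥤ Cᵒᵖ ⥤ Type v) ⥤ Cᵒᵖ ⥤ Type v) := by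
  have : PreservesColimitsOfShape J (Functor.uncurry : (Cᵒᵖ ⥤ Cᵒᵖ ⥤ Type v) ⥤ _) :=
    have : (Functor.uncurry : (Cᵒᵖ ⥤ Cᵒᵖ ⥤ Type v) ⥤ _).IsEquivalence := 
       inferInstanceAs (Functor.currying).functor.IsEquivalence
    inferInstance
  have : PreservesColimitsOfShape J ((tensor Cᵒᵖ).lan : (_ ⥤ Type v) ⥤ _) :=
    ((tensor Cᵒᵖ).lanAdjunction (Type v)).leftAdjoint_preservesColimits.1
  infer_instance

lemma pcL (J : Type v) [SmallCategory J] (G : Cᵒᵖ ⥤ Type v) :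
   PreservesColimitsOfShape J (convLeft G) := by
  have : PreservesColimitsOfShape J ((externalProductBifunctorCurried Cᵒᵖ Cᵒᵖ (Type v)).flip.obj G) := by
    apply preservesColimitsOfShape_of_evaluation
    intro a
    apply preservesColimitsOfShape_of_evaluation
    intro b
    exact inferInstanceAs (PreservesColimitsOfShape J 
       ((evaluation _ (Type v)).obj a ⋙ tensorRight (G.obj b)))
  have := pcU (C := C) J
  unfold convLeft
  infer_instance

lemma pcR (J : Type v) [SmallCategory J] (G : Cᵒᵖ ⥤ Type v) :
   PreservesColimitsOfShape J (convRight G) := by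
  have : PreservesColimitsOfShape J ((externalProductBifunctorCurried Cᵒᵖ Cᵒᵖ (Type v)).obj G) := by
    apply preservesColimitsOfShape_of_evaluation
    intro a
    apply preservesColimitsOfShape_of_evaluation
    intro b
    exact inferInstanceAs (PreservesColimitsOfShape J 
       ((evaluation _ (Type v)).obj b ⋙ tensorLeft (G.obj a)))
  have := pcU (C := C) J
  unfold convRight
  infer_instance

lemma isInd_conv {F G : Cᵒᵖ ⥤ Type v} (hF : IsIndObject F) (hG : IsIndObject G) :
    IsIndObject ((tensor Cᵒᵖ).lan.obj (F ⊠ G)) := by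
  have h1 (Y : C) : IsIndObject ((tensor Cᵒᵖ).lan.obj (F ⊠ yoneda.obj Y)) := by
    have P := hF.presentation
    have := pcL P.I (yoneda.obj Y)
    exact ObjectProperty.prop_of_isColimit (J := P.I) IsIndObject 
      (isColimitOfPreserves (convLeft (yoneda.obj Y)) P.coconeIsColimit)
      (fun j => isIndObject_lan_repr (P.F.obj j) Y)
  have P := hG.presentation
  have := pcR P.I F
  exact ObjectProperty.prop_of_isColimit (J := P.I) IsIndObject 
      (isColimitOfPreserves (convRight F) P.coconeIsColimit)
      (fun j => h1 (P.F.obj j))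


lemma isInd_essImage {F : Cᵒᵖ ⥤ Type v} (h : IsIndObject F) : (Ind.inclusion C).essImage F :=
  ⟨(Ind.equivalence C).inverse.obj ⟨F, h⟩, 
    ⟨(ObjectProperty.ι _).mapIso ((Ind.equivalence C).counitIso.app ⟨F, h⟩)⟩⟩

/-- The tensor product of ind-objects: the restriction to ind-objects of the Day convolution of
presheaves, hence the extension of the tensor product of `C` that commutes with filtered colimits
in both variables. -/
instance monoidalInd : MonoidalCategory (Ind C) :=
  monoidalOfHasDayConvolutions (C := Cᵒᵖ) (V := Type v) (Ind.inclusion C) Ind.inclusion.fullyFaithful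
   (fun d d' => isInd_essImage ((isInd_conv d.isIndObject_inclusion_obj d'.isIndObject_inclusion_obj).map
       (Functor.leftKanExtensionUnique _ ((tensor Cᵒᵖ).lanUnit.app _) _
          ((tensor Cᵒᵖ).pointwiseLeftKanExtensionUnit _)).hom)) 
   (isInd_essImage isIndObject_unit)



/-- The monoidal structure on ind-objects is given by Day convolution of presheaves. -/
instance lawfulInd : LawfulDayConvolutionMonoidalCategoryStruct Cᵒᵖ (Type v) (Ind C) :=
  lawfulDayConvolutionMonoidalCategoryStructOfHasDayConvolutions 
   (C := Cᵒᵖ) (V := Type v) (Ind.inclusion C) Ind.inclusion.fullyFaithful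
   (fun d d' => isInd_essImage ((isInd_conv d.isIndObject_inclusion_obj d'.isIndObject_inclusion_obj).map
       (Functor.leftKanExtensionUnique _ ((tensor Cᵒᵖ).lanUnit.app _) _
          ((tensor Cᵒᵖ).pointwiseLeftKanExtensionUnit _)).hom)) 
   (isInd_essImage isIndObject_unit)

section braided
open LawfulDayConvolutionMonoidalCategoryStruct
attribute [local instance] convolution convolution₂ convolution₂' convolutionUnit
open DayConvolution
variable (A : Type u₁) [Category.{v₁} A] (B : Type u₂) [Category.{v₂} B]
    [MonoidalCategory A] [MonoidalCategory B]
    {D : Type u₃} [Category.{v₃} D] [MonoidalCategory D] [LawfulDayConvolutionMonoidalCategoryStruct A B D]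
    (ff : (ι A B D).FullyFaithful) 

/-- The braiding on a full subcategory closed under Day convolution. -/
abbrev lawfulBraided [BraidedCategory A] [BraidedCategory B] 
  [∀ (v : B) (d : A), Limits.PreservesColimitsOfShape
      (CostructuredArrow (tensor A) d) (tensorLeft v)]
    [∀ (v : B) (d : A), Limits.PreservesColimitsOfShape
      (CostructuredArrow (tensor A) d) (tensorRight v)] : BraidedCategory D where
  braiding X Y := ff.preimageIso (braiding ((ι A B D).obj X) ((ι A B D).obj Y))
  braiding_naturality_right X Y Z f := ff.map_injective (by
    have := braiding_naturality_right (V := B) ((ι A B D).obj X) ((ι A B D).map f)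
    rw [← id_tensorHom, ← tensorHom_id, Functor.map_comp, Functor.map_comp,
      ι_map_tensorHom_hom_eq_tensorHom, ι_map_tensorHom_hom_eq_tensorHom]
    simpa using this)
  braiding_naturality_left f X := ff.map_injective (by
    have := braiding_naturality_left (V := B) ((ι A B D).map f) ((ι A B D).obj X) 
    rw [← id_tensorHom, ← tensorHom_id, Functor.map_comp, Functor.map_comp,
      ι_map_tensorHom_hom_eq_tensorHom, ι_map_tensorHom_hom_eq_tensorHom]
    simpa using this)
  hexagon_forward X Y Z := ff.map_injective (by
    have := hexagon_forward (V := B) ((ι A B D).obj X) ((ι A B D).obj Y) ((ι A B D).obj Z)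
    rw [← id_tensorHom, ← tensorHom_id, Functor.map_comp, Functor.map_comp, Functor.map_comp, Functor.map_comp,
      ι_map_tensorHom_hom_eq_tensorHom, ι_map_tensorHom_hom_eq_tensorHom, 
      ι_map_associator_hom_eq_associator_hom,
      ι_map_associator_hom_eq_associator_hom, ι_map_associator_hom_eq_associator_hom]
    simp only [Functor.FullyFaithful.preimageIso_hom, Functor.FullyFaithful.map_preimage,
      CategoryTheory.Functor.map_id]
    exact this)
  hexagon_reverse X Y Z := ff.map_injective (by
    have := hexagon_reverse (V := B) ((ι A B D).obj X) ((ι A B D).obj Y) ((ι A B D).obj Z)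
    have h (X Y Z : D) : (ι A B D).map (α_ X Y Z).inv =
      (DayConvolution.associator ((ι A B D).obj X) ((ι A B D).obj Y) ((ι A B D).obj Z)).inv := by
      rw [← Functor.mapIso_inv, Iso.inv_eq_inv]
      exact ι_map_associator_hom_eq_associator_hom ..
    rw [← id_tensorHom, ← tensorHom_id, Functor.map_comp, Functor.map_comp, Functor.map_comp, Functor.map_comp,
      ι_map_tensorHom_hom_eq_tensorHom, ι_map_tensorHom_hom_eq_tensorHom, h, h, h]
    simp only [Functor.FullyFaithful.preimageIso_hom, Functor.FullyFaithful.map_preimage,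
      CategoryTheory.Functor.map_id]
    exact this)

/-- The Day convolution braiding is symmetric. -/
abbrev lawfulSymmetric [SymmetricCategory A] [SymmetricCategory B] 
  [∀ (v : B) (d : A), Limits.PreservesColimitsOfShape
      (CostructuredArrow (tensor A) d) (tensorLeft v)]
    [∀ (v : B) (d : A), Limits.PreservesColimitsOfShape
      (CostructuredArrow (tensor A) d) (tensorRight v)] : SymmetricCategory D where
  __ := lawfulBraided A B ff
  symmetry X Y := ff.map_injective (by
    rw [Functor.map_comp, CategoryTheory.Functor.map_id]
    have := symmetry (V := B) ((ι A B D).obj X) ((ι A B D).obj Y)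
    rwa [← Functor.FullyFaithful.map_preimage ff (braiding ((ι A B D).obj X) ((ι A B D).obj Y)).hom,
      ← Functor.FullyFaithful.map_preimage ff (braiding ((ι A B D).obj Y) ((ι A B D).obj X)).hom] at this)
end braided
instance [SymmetricCategory C] : SymmetricCategory Cᵒᵖ where
  symmetry X Y := Quiver.Hom.unop_inj (by simp)
/-- The braiding of ind-objects is that of the Day convolution of presheaves. -/
instance indSymmetric [SymmetricCategory C] : SymmetricCategory (Ind C) := 
  lawfulSymmetric Cᵒᵖ (Type v) Ind.inclusion.fullyFaithful 


end IndTensor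
/-! ### The linear structure on ind-objects -/

namespace IndTensor
variable {C : Type u} [Category.{v} C]

lemma preservesFiniteLimits_of_isIndObject {A : Cᵒᵖ ⥤ Type v} (hA : IsIndObject A) :
    PreservesFiniteLimits A := by
  have P := hA.presentation
  have e : (P.F ⋙ yoneda).flip ⋙ colim ≅ A :=
    (colimitFlipIsoCompColim (P.F ⋙ yoneda).flip).symm ≪≫
      (P.coconeIsColimit.coconePointUniqueUpToIso (colimit.isColimit _)).symm
  have : PreservesFiniteLimits ((P.F ⋙ yoneda).flip : Cᵒᵖ ⥤ P.I ⥤ Type v) := by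
    refine ⟨fun J _ _ => preservesLimitsOfShape_of_evaluation _ _ fun i => ?_⟩
    exact inferInstanceAs (PreservesLimitsOfShape J (yoneda.obj (P.F.obj i)))
  exact preservesFiniteLimits_of_natIso e

variable [Preadditive C] [HasFiniteProducts C]

instance hasFiniteBiproductsOp : HasFiniteBiproducts Cᵒᵖ :=
  .of_hasFiniteCoproducts

variable (C) in
/-- Ind-objects are left exact presheaves. -/
def indToLexType : Ind C ⥤ (Cᵒᵖ ⥤ₗ Type v) := 
  ObjectProperty.lift _ (Ind.inclusion C) (fun M => by
     have := preservesFiniteLimits_of_isIndObject M.isIndObject_inclusion_obj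
     rw [leftExactFunctor_iff]; exact this)

instance : (indToLexType C).Full := inferInstanceAs (ObjectProperty.lift _ _ _).Full
instance : (indToLexType C).Faithful := inferInstanceAs (ObjectProperty.lift _ _ _).Faithful

variable (C) in
/-- Left exact presheaves of sets lift uniquely to presheaves of abelian groups. -/
def indToLex : Ind C ⥤ (Cᵒᵖ ⥤ₗ AddCommGrpCat.{v}) := 
  indToLexType C ⋙ (AddCommGrpCat.leftExactFunctorForgetEquivalence Cᵒᵖ).inverse

variable (C) in
/-- The presheaf of abelian groups underlying an ind-object. -/
def indToAb : Ind C ⥤ (Cᵒᵖ ⥤ AddCommGrpCat.{v}) := 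
  indToLex C ⋙ ObjectProperty.ι _

variable (C) in
/-- Ind-objects form a full subcategory of presheaves of abelian groups. -/
def indToAbFF : (indToAb C).FullyFaithful :=
  ((Functor.FullyFaithful.ofFullyFaithful (indToLexType C)).comp 
     (AddCommGrpCat.leftExactFunctorForgetEquivalence Cᵒᵖ).symm.fullyFaithfulFunctor).comp
   (ObjectProperty.fullyFaithfulι _)

instance indToAb_additive (M : Ind C) : ((indToAb C).obj M).Additive := by
  have : PreservesFiniteLimits ((indToAb C).obj M) := ((indToLex C).obj M).2
  exact Functor.additive_of_preserves_binary_products _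

variable (C) in
/-- The additive structure on morphisms of ind-objects, the one of the corresponding morphisms of
presheaves of abelian groups. -/
abbrev indPreadditive : Preadditive (Ind C) := Preadditive.ofFullyFaithful (indToAbFF C)

attribute [local instance] indPreadditive

variable {k : Type w} [Field k] [Linear k C]

/-- The natural endomorphism of an ind-object given by the action of a scalar on its sections. -/
def indScalar (a : k) (M : Ind C) : M ⟶ M :=
  (indToAbFF C).preimage
    { app X := ((indToAb C).obj M).map (a • 𝟙 X.unop).op
      naturality X Y f := by
        rw [← Functor.map_comp, ← Functor.map_comp]
        congr 1
        exact Quiver.Hom.unop_inj (by simp) }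

@[simp]
lemma indToAb_map_indScalar_app (a : k) (M : Ind C) (X : Cᵒᵖ) :
   ((indToAb C).map (indScalar a M)).app X = ((indToAb C).obj M).map (a • 𝟙 X.unop).op := by
  simp [indScalar]

lemma ind_hom_ext {M N : Ind C} {f g : M ⟶ N} 
   (h : ∀ X, ((indToAb C).map f).app X = ((indToAb C).map g).app X) : f = g :=
  (indToAbFF C).map_injective (NatTrans.ext (funext h))

instance : (indToAb C).Additive := (indToAbFF C).additive_ofFullyFaithful 

variable (k C) in
/-- The action of scalars on ind-objects, induced from the one on objects of `C`. -/
def indCenter : k →+* CatCenter (Ind C) where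
  toFun a := 
    { app M := indScalar a M
      naturality M N f := ind_hom_ext fun X => by simp }
  map_one' := by
    ext M
    change indScalar (1 : k) M = 𝟙 M
    exact ind_hom_ext fun X => by simp
  map_zero' := by
    ext M
    change indScalar (0 : k) M = 0
    exact ind_hom_ext fun X => by simp
  map_mul' a b := by
    ext M
    change indScalar (a * b) M = indScalar b M ≫ indScalar a M
    refine ind_hom_ext fun X => ?_
    rw [Functor.map_comp, NatTrans.comp_app, indToAb_map_indScalar_app,
      indToAb_map_indScalar_app, indToAb_map_indScalar_app, ← Functor.map_comp, ← op_comp]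
    simp [smul_smul, mul_comm]
  map_add' a b := by
    ext M
    change indScalar (a + b) M = indScalar a M + indScalar b M
    exact ind_hom_ext fun X => by simp [add_smul]

variable (k C) in
/-- The `k`-linear structure on ind-objects, induced from the one on `C`. -/
abbrev indLinear : Linear k (Ind C) := Linear.ofRingMorphism (indCenter C k)

end IndTensor

/-- Objects of the `k`-linear tensor product `T ⊗ₖ V` of two `k`-linear categories: pairs. -/
structure LinTensor (k : Type w) (T : Type u₁) (V : Type u₂) where
  fst : T
  snd : V

namespace LinTensor
variable {k : Type w} [Field k] {T : Type u₁} {V : Type u₂} [Category.{v} T] [Category.{v} V]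
  [Preadditive T] [Preadditive V] [Linear k T] [Linear k V]

/-- Morphisms `(X, V) ⟶ (Y, W)` are the elements of `Hom(X, Y) ⊗ₖ Hom(V, W)`, composed
factorwise. -/
instance : Category.{v} (LinTensor k T V) where
  Hom X Y := (X.fst ⟶ Y.fst) ⊗[k] (X.snd ⟶ Y.snd)
  id X := 𝟙 X.fst ⊗ₜ 𝟙 X.snd
  comp {X Y Z} f g := TensorProduct.map₂ (Linear.comp X.fst Y.fst Z.fst)
    (Linear.comp X.snd Y.snd Z.snd) f g
  id_comp {X Y} f := by
    induction f using TensorProduct.induction_on with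
    | zero => simp
    | tmul a b => simp
    | add a b ha hb => rw [map_add, ha, hb]
  comp_id {X Y} f := by
    induction f using TensorProduct.induction_on with
    | zero => simp
    | tmul a b => simp
    | add a b ha hb => rw [map_add, LinearMap.add_apply, ha, hb]
  assoc {W X Y Z} f g h := by
    induction f using TensorProduct.induction_on with
    | zero => simp
    | add a b ha hb => simp only [map_add, LinearMap.add_apply, ha, hb]
    | tmul a b =>
      induction g using TensorProduct.induction_on with
      | zero => simp
      | add a b ha hb => simp only [map_add, LinearMap.add_apply, ha, hb]
      | tmul c d =>
        induction h using TensorProduct.induction_on with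
        | zero => simp
        | add a b ha hb => simp only [map_add, ha, hb]
        | tmul e f => simp

instance : Preadditive (LinTensor k T V) where
  homGroup X Y := inferInstanceAs (AddCommGroup ((X.fst ⟶ Y.fst) ⊗[k] (X.snd ⟶ Y.snd)))
  add_comp X Y Z f f' g := LinearMap.map_add₂ (TensorProduct.map₂
    (Linear.comp (S := k) X.fst Y.fst Z.fst) (Linear.comp (S := k) X.snd Y.snd Z.snd)) f f' g
  comp_add X Y Z f g g' := (TensorProduct.map₂ (Linear.comp (S := k) X.fst Y.fst Z.fst)
    (Linear.comp (S := k) X.snd Y.snd Z.snd) f).map_add g g'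

instance : Linear k (LinTensor k T V) where
  homModule X Y := inferInstanceAs (Module k ((X.fst ⟶ Y.fst) ⊗[k] (X.snd ⟶ Y.snd)))
  smul_comp X Y Z r f g := LinearMap.map_smul₂ (TensorProduct.map₂
    (Linear.comp (S := k) X.fst Y.fst Z.fst) (Linear.comp (S := k) X.snd Y.snd Z.snd)) r f g
  comp_smul X Y Z f r g := (TensorProduct.map₂ (Linear.comp (S := k) X.fst Y.fst Z.fst)
    (Linear.comp (S := k) X.snd Y.snd Z.snd) f).map_smul r g

/-- The morphism `f ⊗ g`. -/
def homMk {X Y : LinTensor k T V} (f : X.fst ⟶ Y.fst) (g : X.snd ⟶ Y.snd) : X ⟶ Y := f ⊗ₜ g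

@[elab_as_elim]
lemma hom_induction {X Y : LinTensor k T V} {P : (X ⟶ Y) → Prop} (f : X ⟶ Y) (zero : P 0)
    (mk : ∀ a b, P (homMk a b)) (add : ∀ a b, P a → P b → P (a + b)) : P f :=
  TensorProduct.induction_on f zero mk add

@[simp]
lemma homMk_id (X : LinTensor k T V) : homMk (𝟙 X.fst) (𝟙 X.snd) = 𝟙 X := rfl

@[simp]
lemma homMk_comp {X Y Z : LinTensor k T V} (f : X.fst ⟶ Y.fst) (g : X.snd ⟶ Y.snd)
    (f' : Y.fst ⟶ Z.fst) (g' : Y.snd ⟶ Z.snd) :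
    homMk f g ≫ homMk f' g' = homMk (Y := Z) (f ≫ f') (g ≫ g') := rfl

lemma homMk_add_left {X Y : LinTensor k T V} (f f' : X.fst ⟶ Y.fst) (g : X.snd ⟶ Y.snd) :
    homMk (f + f') g = homMk f g + homMk (Y := Y) f' g := TensorProduct.add_tmul ..

lemma homMk_add_right {X Y : LinTensor k T V} (f : X.fst ⟶ Y.fst) (g g' : X.snd ⟶ Y.snd) :
    homMk f (g + g') = homMk f g + homMk (Y := Y) f g' := TensorProduct.tmul_add ..

lemma homMk_smul_left {X Y : LinTensor k T V} (a : k) (f : X.fst ⟶ Y.fst) (g : X.snd ⟶ Y.snd) :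
    homMk (a • f) g = a • homMk (Y := Y) f g := TensorProduct.smul_tmul' ..

lemma homMk_smul_right {X Y : LinTensor k T V} (a : k) (f : X.fst ⟶ Y.fst) (g : X.snd ⟶ Y.snd) :
    homMk f (a • g) = a • homMk (Y := Y) f g := TensorProduct.tmul_smul ..

/-- Isomorphisms from isomorphisms of the components. -/
@[simps]
def isoMk {X Y : LinTensor k T V} (e : X.fst ≅ Y.fst) (e' : X.snd ≅ Y.snd) : X ≅ Y where
  hom := homMk e.hom e'.hom
  inv := homMk e.inv e'.inv

section monoidal
variable [MonoidalCategory T] [MonoidalCategory V] [MonoidalPreadditive T]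
  [MonoidalPreadditive V] [MonoidalLinear k T] [MonoidalLinear k V]

/-- Left whiskering as a linear map. -/
def whiskerLeftLin (k : Type w) [Field k] {C : Type u} [Category.{v} C] [Preadditive C]
    [Linear k C] [MonoidalCategory C]
    [MonoidalPreadditive C] [MonoidalLinear k C] (X Y Z : C) :
    (Y ⟶ Z) →ₗ[k] (X ⊗ Y ⟶ X ⊗ Z) where
  toFun f := X ◁ f
  map_add' _ _ := by simp
  map_smul' _ _ := by simp

/-- Right whiskering as a linear map. -/
def whiskerRightLin (k : Type w) [Field k] {C : Type u} [Category.{v} C] [Preadditive C]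
    [Linear k C] [MonoidalCategory C]
    [MonoidalPreadditive C] [MonoidalLinear k C] (X Y Z : C) :
    (Y ⟶ Z) →ₗ[k] (Y ⊗ X ⟶ Z ⊗ X) where
  toFun f := f ▷ X
  map_add' _ _ := by simp
  map_smul' _ _ := by simp

/-- The tensor product is formed factorwise on objects and on morphisms. -/
instance : MonoidalCategoryStruct (LinTensor k T V) where
  tensorObj X Y := ⟨X.fst ⊗ Y.fst, X.snd ⊗ Y.snd⟩
  tensorUnit := ⟨𝟙_ T, 𝟙_ V⟩
  whiskerLeft X Y Z f :=
    TensorProduct.map (whiskerLeftLin k X.fst Y.fst Z.fst) (whiskerLeftLin k X.snd Y.snd Z.snd) f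
  whiskerRight {Y Z} f X :=
    TensorProduct.map (whiskerRightLin k X.fst Y.fst Z.fst) (whiskerRightLin k X.snd Y.snd Z.snd) f
  tensorHom {X Y X' Y'} f g :=
    (show (⟨X.fst ⊗ X'.fst, X.snd ⊗ X'.snd⟩ : LinTensor k T V) ⟶
        ⟨Y.fst ⊗ X'.fst, Y.snd ⊗ X'.snd⟩ from
      TensorProduct.map (whiskerRightLin k X'.fst X.fst Y.fst)
        (whiskerRightLin k X'.snd X.snd Y.snd) f) ≫
    (show (⟨Y.fst ⊗ X'.fst, Y.snd ⊗ X'.snd⟩ : LinTensor k T V) ⟶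
        ⟨Y.fst ⊗ Y'.fst, Y.snd ⊗ Y'.snd⟩ from
      TensorProduct.map (whiskerLeftLin k Y.fst X'.fst Y'.fst)
        (whiskerLeftLin k Y.snd X'.snd Y'.snd) g)
  associator X Y Z := isoMk (α_ _ _ _) (α_ _ _ _)
  leftUnitor X := isoMk (λ_ _) (λ_ _)
  rightUnitor X := isoMk (ρ_ _) (ρ_ _)

lemma tensorHom_def' {X Y X' Y' : LinTensor k T V} (f : X ⟶ Y) (g : X' ⟶ Y') :
    f ⊗ₘ g = f ▷ X' ≫ Y ◁ g := rfl

lemma whiskerLeft_homMk (X : LinTensor k T V) {Y Z : LinTensor k T V} (f : Y.fst ⟶ Z.fst)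
    (g : Y.snd ⟶ Z.snd) :
    X ◁ (homMk f g : Y ⟶ Z) = (homMk (X.fst ◁ f) (X.snd ◁ g) : (X ⊗ Y : LinTensor k T V) ⟶ X ⊗ Z) :=
  rfl

lemma whiskerRight_homMk (X : LinTensor k T V) {Y Z : LinTensor k T V} (f : Y.fst ⟶ Z.fst)
    (g : Y.snd ⟶ Z.snd) :
    (homMk f g : Y ⟶ Z) ▷ X = (homMk (f ▷ X.fst) (g ▷ X.snd) : (Y ⊗ X : LinTensor k T V) ⟶ Z ⊗ X) :=
  rfl

lemma tensorHom_homMk {X Y X' Y' : LinTensor k T V} (f : X.fst ⟶ Y.fst) (g : X.snd ⟶ Y.snd)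
    (f' : X'.fst ⟶ Y'.fst) (g' : X'.snd ⟶ Y'.snd) :
    (homMk f g : X ⟶ Y) ⊗ₘ (homMk f' g' : X' ⟶ Y') =
      (homMk (f ⊗ₘ f') (g ⊗ₘ g') : (X ⊗ X' : LinTensor k T V) ⟶ Y ⊗ Y') := by
  rw [MonoidalCategory.tensorHom_def, MonoidalCategory.tensorHom_def]
  rfl

lemma whiskerLeft_add' (X : LinTensor k T V) {Y Z : LinTensor k T V} (f g : Y ⟶ Z) :
    X ◁ (f + g) = X ◁ f + X ◁ g := map_add (TensorProduct.map
      (whiskerLeftLin k X.fst Y.fst Z.fst) (whiskerLeftLin k X.snd Y.snd Z.snd)) f g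

lemma whiskerRight_add' (X : LinTensor k T V) {Y Z : LinTensor k T V} (f g : Y ⟶ Z) :
    (f + g) ▷ X = f ▷ X + g ▷ X := map_add (TensorProduct.map
      (whiskerRightLin k X.fst Y.fst Z.fst) (whiskerRightLin k X.snd Y.snd Z.snd)) f g

lemma whiskerLeft_zero' (X Y Z : LinTensor k T V) :
    X ◁ (0 : Y ⟶ Z) = 0 := map_zero (TensorProduct.map
      (whiskerLeftLin k X.fst Y.fst Z.fst) (whiskerLeftLin k X.snd Y.snd Z.snd))

lemma whiskerRight_zero' (X Y Z : LinTensor k T V) :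
    (0 : Y ⟶ Z) ▷ X = 0 := map_zero (TensorProduct.map
      (whiskerRightLin k X.fst Y.fst Z.fst) (whiskerRightLin k X.snd Y.snd Z.snd))

lemma whiskerLeft_smul' (X : LinTensor k T V) {Y Z : LinTensor k T V} (a : k) (f : Y ⟶ Z) :
    X ◁ (a • f) = a • X ◁ f := map_smul (TensorProduct.map
      (whiskerLeftLin k X.fst Y.fst Z.fst) (whiskerLeftLin k X.snd Y.snd Z.snd)) a f

lemma whiskerRight_smul' (X : LinTensor k T V) {Y Z : LinTensor k T V} (a : k) (f : Y ⟶ Z) :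
    (a • f) ▷ X = a • f ▷ X := map_smul (TensorProduct.map
      (whiskerRightLin k X.fst Y.fst Z.fst) (whiskerRightLin k X.snd Y.snd Z.snd)) a f

lemma tensorHom_add_left {X Y X' Y' : LinTensor k T V} (f g : X ⟶ Y) (h : X' ⟶ Y') :
    (f + g) ⊗ₘ h = f ⊗ₘ h + g ⊗ₘ h := by
  simp only [tensorHom_def', whiskerRight_add', Preadditive.add_comp]

lemma tensorHom_add_right {X Y X' Y' : LinTensor k T V} (f : X ⟶ Y) (g h : X' ⟶ Y') :
    f ⊗ₘ (g + h) = f ⊗ₘ g + f ⊗ₘ h := by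
  simp only [tensorHom_def', whiskerLeft_add', Preadditive.comp_add]

lemma tensorHom_zero_left {X Y X' Y' : LinTensor k T V} (h : X' ⟶ Y') :
    (0 : X ⟶ Y) ⊗ₘ h = 0 := by
  simp only [tensorHom_def', whiskerRight_zero', zero_comp]

lemma tensorHom_zero_right {X Y X' Y' : LinTensor k T V} (h : X ⟶ Y) :
    h ⊗ₘ (0 : X' ⟶ Y') = 0 := by
  simp only [tensorHom_def', whiskerLeft_zero', comp_zero]

lemma associator_hom_eq (X Y Z : LinTensor k T V) :
    (α_ X Y Z).hom = homMk (α_ X.fst Y.fst Z.fst).hom (α_ X.snd Y.snd Z.snd).hom := rfl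

lemma leftUnitor_hom_eq (X : LinTensor k T V) :
    (λ_ X).hom = homMk (λ_ X.fst).hom (λ_ X.snd).hom := rfl

lemma rightUnitor_hom_eq (X : LinTensor k T V) :
    (ρ_ X).hom = homMk (ρ_ X.fst).hom (ρ_ X.snd).hom := rfl

instance : MonoidalCategory (LinTensor k T V) :=
  MonoidalCategory.ofTensorHom
    (id_tensorHom_id := fun X Y => by
      rw [← homMk_id, ← homMk_id, tensorHom_homMk, id_tensorHom_id, id_tensorHom_id]; rfl)
    (id_tensorHom := fun X Y Z f => by
      refine hom_induction f ?_ (fun a b => ?_) (fun a b ha hb => ?_)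
      · rw [tensorHom_zero_right, whiskerLeft_zero']
      · rw [← homMk_id, tensorHom_homMk, id_tensorHom, id_tensorHom]; rfl
      · rw [tensorHom_add_right, whiskerLeft_add', ha, hb])
    (tensorHom_id := fun {X Y} f Z => by
      refine hom_induction f ?_ (fun a b => ?_) (fun a b ha hb => ?_)
      · rw [tensorHom_zero_left, whiskerRight_zero']
      · rw [← homMk_id, tensorHom_homMk, tensorHom_id, tensorHom_id]; rfl
      · rw [tensorHom_add_left, whiskerRight_add', ha, hb])
    (tensorHom_comp_tensorHom := fun {X₁ Y₁ Z₁ X₂ Y₂ Z₂} f₁ f₂ g₁ g₂ => by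
      refine hom_induction f₁ ?_ (fun a b => ?_) (fun a b ha hb => ?_)
      · simp only [tensorHom_zero_left, zero_comp]
      · refine hom_induction f₂ ?_ (fun a b => ?_) (fun a b ha hb => ?_)
        · simp only [tensorHom_zero_right, tensorHom_zero_left, zero_comp]
        · refine hom_induction g₁ ?_ (fun a b => ?_) (fun a b ha hb => ?_)
          · simp only [tensorHom_zero_left, comp_zero]
          · refine hom_induction g₂ ?_ (fun a b => ?_) (fun a b ha hb => ?_)
            · simp only [tensorHom_zero_right, comp_zero]
            · simp only [tensorHom_homMk, homMk_comp, tensorHom_comp_tensorHom]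
            · simp only [tensorHom_add_right, Preadditive.comp_add, ha, hb]
          · simp only [tensorHom_add_left, Preadditive.comp_add, ha, hb]
        · simp only [tensorHom_add_right, Preadditive.add_comp, ha, hb]
      · simp only [tensorHom_add_left, Preadditive.add_comp, ha, hb])
    (associator_naturality := fun {X₁ X₂ X₃ Y₁ Y₂ Y₃} f₁ f₂ f₃ => by
      refine hom_induction f₁ ?_ (fun a b => ?_) (fun a b ha hb => ?_)
      · simp only [tensorHom_zero_left, zero_comp, comp_zero]
      · refine hom_induction f₂ ?_ (fun a b => ?_) (fun a b ha hb => ?_)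
        · simp only [tensorHom_zero_right, tensorHom_zero_left, zero_comp, comp_zero]
        · refine hom_induction f₃ ?_ (fun a b => ?_) (fun a b ha hb => ?_)
          · simp only [tensorHom_zero_right, zero_comp, comp_zero]
          · simp only [tensorHom_homMk, associator_hom_eq, homMk_comp]
            exact congrArg₂ homMk (associator_naturality ..) (associator_naturality ..)
          · simp only [tensorHom_add_right, Preadditive.add_comp, Preadditive.comp_add, ha, hb]
        · simp only [tensorHom_add_left, tensorHom_add_right, Preadditive.add_comp,
            Preadditive.comp_add, ha, hb]
      · simp only [tensorHom_add_left, Preadditive.add_comp, Preadditive.comp_add, ha, hb])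
    (leftUnitor_naturality := fun {X Y} f => by
      refine hom_induction f ?_ (fun a b => ?_) (fun a b ha hb => ?_)
      · simp only [tensorHom_zero_right, zero_comp, comp_zero]
      · rw [← homMk_id, tensorHom_homMk, leftUnitor_hom_eq, leftUnitor_hom_eq, homMk_comp,
          homMk_comp]
        exact congrArg₂ homMk (by erw [id_tensorHom]; exact leftUnitor_naturality _)
          (by erw [id_tensorHom]; exact leftUnitor_naturality _)
      · simp only [tensorHom_add_right, Preadditive.add_comp, Preadditive.comp_add, ha, hb])
    (rightUnitor_naturality := fun {X Y} f => by
      refine hom_induction f ?_ (fun a b => ?_) (fun a b ha hb => ?_)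
      · simp only [tensorHom_zero_left, zero_comp, comp_zero]
      · rw [← homMk_id, tensorHom_homMk, rightUnitor_hom_eq, rightUnitor_hom_eq, homMk_comp,
          homMk_comp]
        exact congrArg₂ homMk (by erw [tensorHom_id]; exact rightUnitor_naturality _)
          (by erw [tensorHom_id]; exact rightUnitor_naturality _)
      · simp only [tensorHom_add_left, Preadditive.add_comp, Preadditive.comp_add, ha, hb])
    (pentagon := fun W X Y Z => by
      rw [← homMk_id, ← homMk_id]
      simp only [associator_hom_eq, tensorHom_homMk, homMk_comp]
      exact congrArg₂ homMk (by rw [tensorHom_id, id_tensorHom]; exact pentagon ..)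
        (by rw [tensorHom_id, id_tensorHom]; exact pentagon ..))
    (triangle := fun X Y => by
      rw [← homMk_id, ← homMk_id]
      simp only [associator_hom_eq, tensorHom_homMk, homMk_comp, leftUnitor_hom_eq,
        rightUnitor_hom_eq]
      exact congrArg₂ homMk (by rw [tensorHom_id, id_tensorHom]; exact triangle ..)
        (by rw [tensorHom_id, id_tensorHom]; exact triangle ..))

instance : MonoidalPreadditive (LinTensor k T V) where
  whiskerLeft_zero := whiskerLeft_zero' _ _ _
  zero_whiskerRight := whiskerRight_zero' _ _ _
  whiskerLeft_add := whiskerLeft_add' _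
  add_whiskerRight := whiskerRight_add' _

instance : MonoidalLinear k (LinTensor k T V) where
  whiskerLeft_smul X _ _ r f := whiskerLeft_smul' X r f
  smul_whiskerRight r _ _ f X := whiskerRight_smul' X r f

instance [SymmetricCategory T] [SymmetricCategory V] : BraidedCategory (LinTensor k T V) where
  braiding X Y := isoMk (β_ _ _) (β_ _ _)
  braiding_naturality_right X Y Z f := by
    refine hom_induction f ?_ (fun a b => ?_) (fun a b ha hb => ?_)
    · simp only [whiskerLeft_zero', whiskerRight_zero', zero_comp, comp_zero]
    · exact congrArg₂ homMk (BraidedCategory.braiding_naturality_right ..)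
        (BraidedCategory.braiding_naturality_right ..)
    · simp only [whiskerLeft_add', whiskerRight_add', Preadditive.add_comp, Preadditive.comp_add,
        ha, hb]
  braiding_naturality_left f Z := by
    refine hom_induction f ?_ (fun a b => ?_) (fun a b ha hb => ?_)
    · simp only [whiskerLeft_zero', whiskerRight_zero', zero_comp, comp_zero]
    · exact congrArg₂ homMk (BraidedCategory.braiding_naturality_left ..)
        (BraidedCategory.braiding_naturality_left ..)
    · simp only [whiskerLeft_add', whiskerRight_add', Preadditive.add_comp, Preadditive.comp_add,
        ha, hb]
  hexagon_forward X Y Z := congrArg₂ homMk (BraidedCategory.hexagon_forward ..)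
    (BraidedCategory.hexagon_forward ..)
  hexagon_reverse X Y Z := congrArg₂ homMk (BraidedCategory.hexagon_reverse ..)
    (BraidedCategory.hexagon_reverse ..)

instance [SymmetricCategory T] [SymmetricCategory V] : SymmetricCategory (LinTensor k T V) where
  symmetry X Y := congrArg₂ homMk (SymmetricCategory.symmetry ..) (SymmetricCategory.symmetry ..)

end monoidal
end LinTensor

/-! ### The symmetric monoidal structure of the idempotent completion -/

namespace KaroubiTensor
variable {C : Type u} [Category.{v} C]

section linear
variable {k : Type w} [Field k] [Preadditive C] [Linear k C]

instance (P Q : Karoubi C) : SMul k (P ⟶ Q) where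
  smul a f := ⟨a • f.f, by
    rw [Linear.smul_comp, Linear.comp_smul, f.comm]⟩

@[simp]
lemma smul_f {P Q : Karoubi C} (a : k) (f : P ⟶ Q) : (a • f).f = a • f.f := rfl

@[simp]
lemma add_f {P Q : Karoubi C} (f g : P ⟶ Q) : (f + g).f = f.f + g.f := rfl

@[simp]
lemma zero_f (P Q : Karoubi C) : (0 : P ⟶ Q).f = 0 := rfl

instance : Linear k (Karoubi C) where
  homModule P Q :=
    { one_smul f := by ext; simp
      mul_smul a b f := by ext; simp [mul_smul]
      smul_zero a := by ext; simp
      smul_add a f g := by ext; simp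
      add_smul a b f := by ext; simp [add_smul]
      zero_smul f := by ext; simp }
  smul_comp _ _ _ a f g := by ext; simp
  comp_smul _ _ _ f a g := by ext; simp

end linear

variable [MonoidalCategory C]

/-- Objects `(X, p)` and `(Y, q)` have the tensor product `(X ⊗ Y, p ⊗ q)`. -/
instance : MonoidalCategoryStruct (Karoubi C) where
  tensorObj P Q := ⟨P.X ⊗ Q.X, P.p ⊗ₘ Q.p, by simp⟩
  tensorUnit := ⟨𝟙_ C, 𝟙 _, by simp⟩
  tensorHom f g := ⟨f.f ⊗ₘ g.f, by simp⟩
  whiskerLeft P _ _ f := ⟨P.p ⊗ₘ f.f, by simp⟩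
  whiskerRight f P := ⟨f.f ⊗ₘ P.p, by simp⟩
  associator P Q R :=
    { hom := ⟨((P.p ⊗ₘ Q.p) ⊗ₘ R.p) ≫ (α_ _ _ _).hom, by
        simp [-associator_conjugation, associator_naturality,
          associator_naturality_assoc]⟩
      inv := ⟨(P.p ⊗ₘ (Q.p ⊗ₘ R.p)) ≫ (α_ _ _ _).inv, by
        simp [-associator_conjugation, associator_inv_naturality,
          associator_inv_naturality_assoc]⟩
      hom_inv_id := by ext; simp
      inv_hom_id := by ext; simp }
  leftUnitor P :=
    { hom := ⟨(𝟙 _ ⊗ₘ P.p) ≫ (λ_ _).hom, by simp⟩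
      inv := ⟨(λ_ _).inv ≫ (𝟙 _ ⊗ₘ P.p), by simp⟩
      hom_inv_id := by ext; simp
      inv_hom_id := by ext; simp }
  rightUnitor P :=
    { hom := ⟨(P.p ⊗ₘ 𝟙 _) ≫ (ρ_ _).hom, by simp⟩
      inv := ⟨(ρ_ _).inv ≫ (P.p ⊗ₘ 𝟙 _), by simp⟩
      hom_inv_id := by ext; simp
      inv_hom_id := by ext; simp }

@[simp]
lemma tensorObj_p (P Q : Karoubi C) : (P ⊗ Q).p = P.p ⊗ₘ Q.p := rfl
@[simp]
lemma tensorObj_X (P Q : Karoubi C) : (P ⊗ Q).X = (P.X ⊗ Q.X) := rfl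
@[simp]
lemma tensorUnit_p : (𝟙_ (Karoubi C)).p = 𝟙 (𝟙_ C) := rfl
@[simp]
lemma tensorUnit_X : (𝟙_ (Karoubi C)).X = 𝟙_ C := rfl
@[simp]
lemma tensorHom_f {P P' Q Q' : Karoubi C} (f : P ⟶ P') (g : Q ⟶ Q') :
    (f ⊗ₘ g).f = f.f ⊗ₘ g.f := rfl
@[simp]
lemma whiskerLeft_f (P : Karoubi C) {Q Q' : Karoubi C} (g : Q ⟶ Q') :
    (P ◁ g).f = P.p ⊗ₘ g.f := rfl
@[simp]
lemma whiskerRight_f (P : Karoubi C) {Q Q' : Karoubi C} (g : Q ⟶ Q') :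
    (g ▷ P).f = g.f ⊗ₘ P.p := rfl
@[simp]
lemma associator_hom_f (P Q R : Karoubi C) :
    (α_ P Q R).hom.f = ((P.p ⊗ₘ Q.p) ⊗ₘ R.p) ≫ (α_ _ _ _).hom := rfl
@[simp]
lemma associator_inv_f (P Q R : Karoubi C) :
    (α_ P Q R).inv.f = (P.p ⊗ₘ (Q.p ⊗ₘ R.p)) ≫ (α_ _ _ _).inv := rfl
@[simp]
lemma leftUnitor_hom_f (P : Karoubi C) :
    (λ_ P).hom.f = (𝟙 _ ⊗ₘ P.p) ≫ (λ_ _).hom := rfl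
@[simp]
lemma rightUnitor_hom_f (P : Karoubi C) :
    (ρ_ P).hom.f = (P.p ⊗ₘ 𝟙 _) ≫ (ρ_ _).hom := rfl

instance : MonoidalCategory (Karoubi C) :=
  MonoidalCategory.ofTensorHom
    (id_tensorHom_id := fun _ _ => by ext; rfl)
    (id_tensorHom := fun _ _ _ _ => by ext; rfl)
    (tensorHom_id := fun _ _ => by ext; rfl)
    (tensorHom_comp_tensorHom := fun _ _ _ _ => by ext; simp)
    (associator_naturality := fun _ _ _ => by
      ext; simp [-associator_conjugation, associator_naturality,
          associator_naturality_assoc])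
    (leftUnitor_naturality := fun _ => by ext; simp)
    (rightUnitor_naturality := fun _ => by ext; simp)
    (pentagon := fun W X Y Z => by
      ext
      simp only [Karoubi.comp_f, tensorHom_f, associator_hom_f, Karoubi.id_f, tensorObj_p, tensorObj_X]
      have e1 : (((W.p ⊗ₘ X.p) ⊗ₘ Y.p) ≫ (α_ W.X X.X Y.X).hom) ⊗ₘ Z.p =
          (((W.p ⊗ₘ X.p) ⊗ₘ Y.p) ⊗ₘ Z.p) ≫ (α_ W.X X.X Y.X).hom ▷ Z.X := by
        simp [← tensorHom_id]
      have e2 : W.p ⊗ₘ (((X.p ⊗ₘ Y.p) ⊗ₘ Z.p) ≫ (α_ X.X Y.X Z.X).hom) =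
          (W.p ⊗ₘ ((X.p ⊗ₘ Y.p) ⊗ₘ Z.p)) ≫ W.X ◁ (α_ X.X Y.X Z.X).hom := by
        simp [← id_tensorHom]
      have e3 : (α_ W.X X.X Y.X).hom ▷ Z.X ≫ ((W.p ⊗ₘ (X.p ⊗ₘ Y.p)) ⊗ₘ Z.p) =
          (((W.p ⊗ₘ X.p) ⊗ₘ Y.p) ⊗ₘ Z.p) ≫ (α_ W.X X.X Y.X).hom ▷ Z.X := by
        rw [← tensorHom_id, tensorHom_comp_tensorHom, tensorHom_comp_tensorHom,
          associator_naturality, Category.id_comp, Category.comp_id]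
      have e4 : (α_ W.X (X.X ⊗ Y.X) Z.X).hom ≫ (W.p ⊗ₘ ((X.p ⊗ₘ Y.p) ⊗ₘ Z.p)) =
          ((W.p ⊗ₘ (X.p ⊗ₘ Y.p)) ⊗ₘ Z.p) ≫ (α_ W.X (X.X ⊗ Y.X) Z.X).hom :=
        (associator_naturality ..).symm
      have e5 : (α_ (W.X ⊗ X.X) Y.X Z.X).hom ≫ ((W.p ⊗ₘ X.p) ⊗ₘ (Y.p ⊗ₘ Z.p)) =
          (((W.p ⊗ₘ X.p) ⊗ₘ Y.p) ⊗ₘ Z.p) ≫ (α_ (W.X ⊗ X.X) Y.X Z.X).hom :=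
        (associator_naturality ..).symm
      have e6 : (((W.p ⊗ₘ X.p) ⊗ₘ Y.p) ⊗ₘ Z.p) ≫ (((W.p ⊗ₘ X.p) ⊗ₘ Y.p) ⊗ₘ Z.p) =
          (((W.p ⊗ₘ X.p) ⊗ₘ Y.p) ⊗ₘ Z.p) := by simp
      have e7 : ((W.p ⊗ₘ (X.p ⊗ₘ Y.p)) ⊗ₘ Z.p) ≫ ((W.p ⊗ₘ (X.p ⊗ₘ Y.p)) ⊗ₘ Z.p) =
          ((W.p ⊗ₘ (X.p ⊗ₘ Y.p)) ⊗ₘ Z.p) := by simp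
      rw [e1, e2]
      simp only [Category.assoc]
      rw [reassoc_of% e4, reassoc_of% e7, reassoc_of% e3, reassoc_of% e6, reassoc_of% e5,
        reassoc_of% e6, pentagon])
    (triangle := fun X Y => by
      ext
      simp only [Karoubi.comp_f, tensorHom_f, associator_hom_f, Karoubi.id_f, leftUnitor_hom_f,
        rightUnitor_hom_f, tensorUnit_p, tensorUnit_X]
      have e1 : (X.p ⊗ₘ (𝟙 (𝟙_ C) ⊗ₘ Y.p) ≫ (λ_ Y.X).hom) =
          (X.p ⊗ₘ (𝟙 (𝟙_ C) ⊗ₘ Y.p)) ≫ X.X ◁ (λ_ Y.X).hom := by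
        simp [← id_tensorHom]
      have e2 : ((X.p ⊗ₘ 𝟙 (𝟙_ C)) ≫ (ρ_ X.X).hom) ⊗ₘ Y.p =
          ((X.p ⊗ₘ 𝟙 (𝟙_ C)) ⊗ₘ Y.p) ≫ (ρ_ X.X).hom ▷ Y.X := by
        rw [← tensorHom_id, tensorHom_comp_tensorHom, Category.comp_id]
      have e3 : ((X.p ⊗ₘ 𝟙 (𝟙_ C)) ⊗ₘ Y.p) ≫ ((X.p ⊗ₘ 𝟙 (𝟙_ C)) ⊗ₘ Y.p) =
          ((X.p ⊗ₘ 𝟙 (𝟙_ C)) ⊗ₘ Y.p) := by simp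
      rw [e1, e2, Category.assoc, ← associator_naturality_assoc, reassoc_of% e3, triangle])

instance [SymmetricCategory C] : BraidedCategory (Karoubi C) where
  braiding P Q :=
    { hom := ⟨(P.p ⊗ₘ Q.p) ≫ (β_ _ _).hom, by simp⟩
      inv := ⟨(Q.p ⊗ₘ P.p) ≫ (β_ _ _).inv, by simp⟩
      hom_inv_id := by ext; simp
      inv_hom_id := by ext; simp }
  braiding_naturality_right P _ _ f := by ext; simp
  braiding_naturality_left f P := by ext; simp
  hexagon_forward P Q R := by
    ext
    simp only [Karoubi.comp_f, associator_hom_f, whiskerRight_f, whiskerLeft_f, tensorObj_p,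
      tensorObj_X, Category.assoc]
    have e1 : ((P.p ⊗ₘ Q.p) ≫ (β_ P.X Q.X).hom) ⊗ₘ R.p =
        ((P.p ⊗ₘ Q.p) ⊗ₘ R.p) ≫ (β_ P.X Q.X).hom ▷ R.X := by
      rw [← tensorHom_id, tensorHom_comp_tensorHom, Category.comp_id]
    have e2 : Q.p ⊗ₘ ((P.p ⊗ₘ R.p) ≫ (β_ P.X R.X).hom) =
        (Q.p ⊗ₘ (P.p ⊗ₘ R.p)) ≫ Q.X ◁ (β_ P.X R.X).hom := by
      rw [← id_tensorHom, tensorHom_comp_tensorHom, Category.comp_id]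
    have e3 : (β_ P.X Q.X).hom ▷ R.X ≫ ((Q.p ⊗ₘ P.p) ⊗ₘ R.p) =
        ((P.p ⊗ₘ Q.p) ⊗ₘ R.p) ≫ (β_ P.X Q.X).hom ▷ R.X := by
      rw [← tensorHom_id, tensorHom_comp_tensorHom, tensorHom_comp_tensorHom,
        BraidedCategory.braiding_naturality, Category.id_comp, Category.comp_id]
    have e4 : (β_ P.X (Q.X ⊗ R.X)).hom ≫ ((Q.p ⊗ₘ R.p) ⊗ₘ P.p) =
        (P.p ⊗ₘ (Q.p ⊗ₘ R.p)) ≫ (β_ P.X (Q.X ⊗ R.X)).hom :=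
      (BraidedCategory.braiding_naturality ..).symm
    rw [e1, e2]
    simp only [Category.assoc]
    rw [reassoc_of% e4, ← associator_naturality_assoc Q.p, reassoc_of% e3,
      ← associator_naturality_assoc P.p, ← associator_naturality_assoc P.p]
    simp only [← Category.assoc, tensorHom_comp_tensorHom, Karoubi.idem]
    simp only [Category.assoc, BraidedCategory.hexagon_forward]
    have e5 : ((P.p ⊗ₘ Q.p) ⊗ₘ R.p) ≫ ((P.p ⊗ₘ Q.p) ⊗ₘ R.p) = ((P.p ⊗ₘ Q.p) ⊗ₘ R.p) := by simp
    rw [reassoc_of% e3, reassoc_of% e5]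
  hexagon_reverse P Q R := by
    ext
    simp only [Karoubi.comp_f, associator_inv_f, whiskerRight_f, whiskerLeft_f, tensorObj_p,
      tensorObj_X, Category.assoc]
    have e1 : P.p ⊗ₘ ((Q.p ⊗ₘ R.p) ≫ (β_ Q.X R.X).hom) =
        (P.p ⊗ₘ (Q.p ⊗ₘ R.p)) ≫ P.X ◁ (β_ Q.X R.X).hom := by
      rw [← id_tensorHom, tensorHom_comp_tensorHom, Category.comp_id]
    have e2 : ((P.p ⊗ₘ R.p) ≫ (β_ P.X R.X).hom) ⊗ₘ Q.p =
        ((P.p ⊗ₘ R.p) ⊗ₘ Q.p) ≫ (β_ P.X R.X).hom ▷ Q.X := by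
      rw [← tensorHom_id, tensorHom_comp_tensorHom, Category.comp_id]
    have e3 : P.X ◁ (β_ Q.X R.X).hom ≫ (P.p ⊗ₘ (R.p ⊗ₘ Q.p)) =
        (P.p ⊗ₘ (Q.p ⊗ₘ R.p)) ≫ P.X ◁ (β_ Q.X R.X).hom := by
      rw [← id_tensorHom, tensorHom_comp_tensorHom, tensorHom_comp_tensorHom,
        BraidedCategory.braiding_naturality, Category.id_comp, Category.comp_id]
    have e4 : (β_ (P.X ⊗ Q.X) R.X).hom ≫ (R.p ⊗ₘ (P.p ⊗ₘ Q.p)) =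
        ((P.p ⊗ₘ Q.p) ⊗ₘ R.p) ≫ (β_ (P.X ⊗ Q.X) R.X).hom :=
      (BraidedCategory.braiding_naturality ..).symm
    rw [e1, e2]
    simp only [Category.assoc]
    rw [reassoc_of% e4, ← associator_inv_naturality_assoc P.p R.p, reassoc_of% e3,
      ← associator_inv_naturality_assoc P.p, ← associator_inv_naturality_assoc P.p]
    simp only [← Category.assoc, tensorHom_comp_tensorHom, Karoubi.idem]
    simp only [Category.assoc, BraidedCategory.hexagon_reverse]
    have e5 : (P.p ⊗ₘ (Q.p ⊗ₘ R.p)) ≫ (P.p ⊗ₘ (Q.p ⊗ₘ R.p)) = (P.p ⊗ₘ (Q.p ⊗ₘ R.p)) := by simp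
    rw [reassoc_of% e3, reassoc_of% e5]

instance [SymmetricCategory C] : SymmetricCategory (Karoubi C) where
  symmetry P Q := by
    ext
    change ((P.p ⊗ₘ Q.p) ≫ (β_ _ _).hom) ≫ (Q.p ⊗ₘ P.p) ≫ (β_ _ _).hom = P.p ⊗ₘ Q.p
    simp

instance [Preadditive C] [MonoidalPreadditive C] : MonoidalPreadditive (Karoubi C) where
  whiskerLeft_zero := by intros; ext; simp
  zero_whiskerRight := by intros; ext; simp
  whiskerLeft_add := by intros; ext; simp [MonoidalPreadditive.tensor_add]
  add_whiskerRight := by intros; ext; simp [MonoidalPreadditive.add_tensor]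

instance {k : Type w} [Field k] [Preadditive C] [Linear k C] [MonoidalPreadditive C]
    [MonoidalLinear k C] : MonoidalLinear k (Karoubi C) where
  whiskerLeft_smul := by intros; ext; simp [MonoidalCategory.tensorHom_def]
  smul_whiskerRight := by intros; ext; simp [MonoidalCategory.tensorHom_def]

end KaroubiTensor
namespace TensorCat

/-! ### Symmetric monoidal categories and tensor categories over a field -/

/-- The preadditive category `C` is abelian. -/
class IsAbelian (C : Type u) [Category.{v} C] [Preadditive C] : Prop where
  hasFiniteProducts : HasFiniteProducts C
  hasKernels : HasKernels C
  hasCokernels : HasCokernels C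
  normalMono : IsNormalMonoCategory C
  normalEpi : IsNormalEpiCategory C

attribute [instance 100] IsAbelian.hasFiniteProducts IsAbelian.hasKernels IsAbelian.hasCokernels
  IsAbelian.normalMono IsAbelian.normalEpi

instance (priority := 100) (C : Type u) [Category.{v} C] [Preadditive C] [IsAbelian C] :
    HasFiniteBiproducts C :=
  HasFiniteBiproducts.of_hasFiniteProducts

/-- A `k`-linear abelian symmetric monoidal category, with non-zero unit, whose tensor product is
right exact and `k`-linear in both variables. -/
structure IsSMC (k : Type w) [Field k] (C : Type u) [Category.{v} C] [Preadditive C] [IsAbelian C]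
    [Linear k C] [MonoidalCategory C] [SymmetricCategory C] [MonoidalPreadditive C]
    [MonoidalLinear k C] : Prop where
  unit_nonzero : ¬ IsZero (𝟙_ C)
  rightExact_left (X : C) : PreservesFiniteColimits (tensorLeft X)
  rightExact_right (X : C) : PreservesFiniteColimits (tensorRight X)

/-- An (essentially small) tensor category over `k`. -/
structure IsTensorCategory (k : Type w) [Field k] (C : Type u) [Category.{v} C]
    [EssentiallySmall.{v} C] [Preadditive C] [IsAbelian C] [Linear k C] [MonoidalCategory C]
    [SymmetricCategory C] [MonoidalPreadditive C] [MonoidalLinear k C] : Prop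
    extends IsSMC k C where
  /-- the canonical map from `k` to the endomorphism ring of the unit is bijective -/
  scalars : Function.Bijective fun a : k => a • 𝟙 (𝟙_ C)
  /-- every object is dualisable -/
  dualisable (X : C) : ∃ Y : C, Nonempty (ExactPairing X Y)

/-- `C` is schurian (simple objects have no endomorphisms but scalars) and semisimple (every object
is a finite direct sum of simple objects). -/
structure IsSchurianSemisimple (k : Type w) [Field k] (C : Type u) [Category.{v} C] [Preadditive C]
    [Linear k C] : Prop where
  schurian (S : C) [Simple S] : Function.Bijective fun a : k => a • 𝟙 S
  semisimple (X : C) : ∃ (n : ℕ) (S : Fin n → C) (i : ∀ j, S j ⟶ X), (∀ j, Simple (S j)) ∧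
    Nonempty (IsColimit (Cofan.mk X i))

/-! ### Symmetric powers -/

section sym
variable {C : Type u} [Category.{v} C] [MonoidalCategory C]

/-- The tensor power `X ⊗ ⋯ ⊗ X`, bracketed to the left. -/
def tensorPow (X : C) : ℕ → C
  | 0 => 𝟙_ C
  | n + 1 => tensorPow X n ⊗ X

/-- The endomorphism of the `n`-th tensor power that swaps the neighbouring factors `i` and
`i + 1` (counted from `0`), for `i + 1 < n`. -/
def swap [SymmetricCategory C] (X : C) : (n : ℕ) → Fin (n - 1) → (tensorPow X n ⟶ tensorPow X n)
  | 0 => Fin.elim0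
  | 1 => Fin.elim0
  | n + 2 => Fin.lastCases
      ((α_ (tensorPow X n) X X).hom ≫ tensorPow X n ◁ (β_ X X).hom ≫ (α_ (tensorPow X n) X X).inv)
      (fun i : Fin n => swap X (n + 1) i ▷ X)

variable [SymmetricCategory C] [Preadditive C] [IsAbelian C]

/-- The symmetric power: the cokernel of the endomorphisms `swap - 1` of the tensor power. -/
def symPow (X : C) (n : ℕ) : C :=
  cokernel (Sigma.desc fun i : Fin (n - 1) => swap X n i - 𝟙 (tensorPow X n))

variable (C) in
/-- Every simple object not isomorphic to the unit has some vanishing symmetric power. -/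
def SymPowersVanish : Prop :=
  ∀ S : C, Simple S → ¬ Nonempty (S ≅ 𝟙_ C) → ∃ N : ℕ, IsZero (symPow S N)

end sym

/-! ### Tensor functors and local semisimplicity -/

/-- A right exact `k`-linear symmetric (strong) monoidal functor. -/
structure TensorFunctor (k : Type w) [Field k] (C : Type u₁) [Category.{v₁} C] [Preadditive C]
    [Linear k C] [MonoidalCategory C] [SymmetricCategory C]
    (D : Type u₂) [Category.{v₂} D] [Preadditive D]
    [Linear k D] [MonoidalCategory D] [SymmetricCategory D] where
  functor : C ⥤ D
  additive : functor.Additive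
  linear : functor.Linear k
  braided : functor.Braided
  rightExact : PreservesFiniteColimits functor

attribute [instance] TensorFunctor.additive

/-- The tensor category `T` is locally semisimple: some tensor functor to a category `C` as in
`IsSMC` maps every short exact sequence to a split one. -/
def LocallySemisimple (k : Type w) [Field k] (T : Type u) [Category.{v} T] [Preadditive T]
    [Linear k T] [MonoidalCategory T] [SymmetricCategory T] : Prop :=
  ∃ (C : Type (max u (v + 1))) (_ : Category.{v} C) (_ : Preadditive C) (_ : IsAbelian C)
    (_ : Linear k C) (_ : MonoidalCategory C) (_ : SymmetricCategory C) (_ : MonoidalPreadditive C)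
    (_ : MonoidalLinear k C), IsSMC k C ∧ ∃ F : TensorFunctor k T C,
      ∀ S : ShortComplex T, S.ShortExact → Nonempty (S.map F.functor).Splitting

/-! ### The product `T ⊠ V` -/

section box
variable (k : Type w) [Field k] (T : Type u₁) (V : Type u₂) [Category.{v} T] [Category.{v} V]
  [Preadditive T] [Preadditive V] [Linear k T] [Linear k V]

/-- The product `T ⊠ V`: the idempotent completion of `T ⊗ₖ V`. -/
abbrev Box := Karoubi (LinTensor k T V)

instance essentiallySmall_box [EssentiallySmall.{v} T] [EssentiallySmall.{v} V] :
    EssentiallySmall.{v} (Box k T V) := by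
  rw [essentiallySmall_iff]
  refine ⟨?_, ⟨fun X Y => small_of_injective (f := fun f : X ⟶ Y => f.f)
    fun f g h => Karoubi.hom_ext f g h⟩⟩
  let eT := equivSmallModel.{v} T
  let eV := equivSmallModel.{v} V
  let ob (a : SmallModel.{v} T) (b : SmallModel.{v} V) : LinTensor k T V :=
    ⟨eT.inverse.obj a, eV.inverse.obj b⟩
  let I := Σ ab : SmallModel.{v} T × SmallModel.{v} V, { p : ob ab.1 ab.2 ⟶ ob ab.1 ab.2 // p ≫ p = p }
  let f : I → Skeleton (Box k T V) := fun x => toSkeleton ⟨ob x.1.1 x.1.2, x.2.1, x.2.2⟩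
  refine small_of_surjective (f := f) fun Y => ?_
  let P : Box k T V := (fromSkeleton _).obj Y
  let a := eT.functor.obj P.X.fst
  let b := eV.functor.obj P.X.snd
  let e : ob a b ≅ P.X :=
    LinTensor.isoMk (eT.unitIso.symm.app P.X.fst) (eV.unitIso.symm.app P.X.snd)
  refine ⟨⟨(a, b), e.hom ≫ P.p ≫ e.inv, by simp⟩, ?_⟩
  have e' : (⟨ob a b, e.hom ≫ P.p ≫ e.inv, by simp⟩ : Box k T V) ≅ P :=
    { hom := ⟨e.hom ≫ P.p, by simp⟩
      inv := ⟨P.p ≫ e.inv, by simp⟩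
      hom_inv_id := by ext; simp
      inv_hom_id := by ext; simp }
  exact (congr_toSkeleton_of_iso e').trans (Quotient.out_eq Y)

variable [MonoidalCategory T] [MonoidalCategory V]

/-- The embedding `X ↦ X ⊠ 𝟙` of `T`. -/
def inT : T ⥤ Box k T V where
  obj X := (toKaroubi _).obj ⟨X, 𝟙_ V⟩
  map f := (toKaroubi _).map (LinTensor.homMk f (𝟙 _))
  map_comp f g := by rw [← Functor.map_comp, LinTensor.homMk_comp, Category.comp_id]

/-- The embedding `Y ↦ 𝟙 ⊠ Y` of `V`. -/
def inV : V ⥤ Box k T V where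
  obj Y := (toKaroubi _).obj ⟨𝟙_ T, Y⟩
  map f := (toKaroubi _).map (LinTensor.homMk (𝟙 _) f)
  map_comp f g := by rw [← Functor.map_comp, LinTensor.homMk_comp, Category.comp_id]

end box

/-! ### Free modules -/

section free
variable {D : Type u} [Category.{v} D] [MonoidalCategory D] (A : D) [MonObj A]
open MonObj

/-- The functor sending `X` to the free `A`-module `A ⊗ X`. -/
def freeMod : D ⥤ Mod D A where
  obj X :=
    { X := A ⊗ X
      mod :=
        { smul := (α_ A A X).inv ≫ μ ▷ X
          one_smul := by
            change η ▷ (A ⊗ X) ≫ (α_ A A X).inv ≫ μ ▷ X = (λ_ (A ⊗ X)).hom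
            rw [associator_inv_naturality_left_assoc, ← comp_whiskerRight, MonObj.one_mul,
              leftUnitor_tensor_hom]
          mul_smul := by
            change μ ▷ (A ⊗ X) ≫ (α_ A A X).inv ≫ μ ▷ X =
              (α_ A A (A ⊗ X)).hom ≫ A ◁ ((α_ A A X).inv ≫ μ ▷ X) ≫ (α_ A A X).inv ≫ μ ▷ X
            rw [associator_inv_naturality_left_assoc, ← comp_whiskerRight, MonObj.mul_assoc]
            simp } }
  map f := Mod.Hom.mk' (A ◁ f) (by
    change ((α_ A A _).inv ≫ μ ▷ _) ≫ A ◁ f = A ◁ A ◁ f ≫ (α_ A A _).inv ≫ μ ▷ _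
    rw [Category.assoc, ← whisker_exchange, associator_inv_naturality_right_assoc])
  map_id X := by ext; exact whiskerLeft_id ..
  map_comp f g := by ext; exact whiskerLeft_comp ..

end free

/-! ### Locally free objects and splitting algebras -/

section split
open IndTensor
variable (k : Type w) [Field k] (T : Type u₁) (V : Type u₂) [Category.{v} T] [Category.{v} V]
  [Preadditive T] [Preadditive V] [Linear k T] [Linear k V]
  [MonoidalCategory T] [MonoidalCategory V] [SymmetricCategory T] [SymmetricCategory V]
  [MonoidalPreadditive T] [MonoidalPreadditive V] [MonoidalLinear k T] [MonoidalLinear k V]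
  [EssentiallySmall.{v} T] [EssentiallySmall.{v} V]

/-- The free `A`-module `A ⊗ X` on an object `X` of `T`. -/
abbrev freeT (A : CommMon (Ind (Box k T V))) : T ⥤ Mod (Ind (Box k T V)) A.X :=
  inT k T V ⋙ Ind.yoneda ⋙ freeMod A.X

/-- The free `A`-module `A ⊗ Y` on an object `Y` of `V`. -/
abbrev freeV (A : CommMon (Ind (Box k T V))) : V ⥤ Mod (Ind (Box k T V)) A.X :=
  inV k T V ⋙ Ind.yoneda ⋙ freeMod A.X

variable {T} in
/-- The object `X` of `T` is locally `V`-free. -/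
def LocallyFree (X : T) : Prop :=
  ∃ A : CommMon (Ind (Box k T V)), ¬ IsZero A.X ∧
    ∃ X₀ : V, Nonempty ((freeT k T V A).obj X ≅ (freeV k T V A).obj X₀)

/-- `A` is a `V`-splitting algebra for `T`. -/
structure IsSplittingAlgebra (A : CommMon (Ind (Box k T V))) : Prop where
  nonzero : ¬ IsZero A.X
  /-- The sequence `A ⊗ S` of `A`-modules is split: `A ⊗ S.f` has a retraction and `A ⊗ S.g` has
  a section. -/
  splits (S : ShortComplex T) (hS : S.ShortExact) :
    IsSplitMono ((freeT k T V A).map S.f) ∧ IsSplitEpi ((freeT k T V A).map S.g)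
  free (X : T) : ∃ X₀ : V, Nonempty ((freeT k T V A).obj X ≅ (freeV k T V A).obj X₀)

end split

/-! ### Fibre functors -/

section fibre
open IndTensor Functor.LaxMonoidal
attribute [local instance] indPreadditive indLinear
variable (k : Type w) [Field k] (T : Type u₁) (V : Type u₂) [Category.{v₁} T] [Category.{v} V]
  [Preadditive T] [Preadditive V] [IsAbelian V] [Linear k T] [Linear k V]
  [MonoidalCategory T] [MonoidalCategory V] [SymmetricCategory T] [SymmetricCategory V]
  [EssentiallySmall.{v} V]

/-- The action of `A` on a module. -/
abbrev act {D : Type u} [Category.{v} D] [MonoidalCategory D] {A : D} [MonObj A] (M : Mod D A) :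
    A ⊗ M.X ⟶ M.X := ModObj.smul (M := A) (X := M.X)

/-- A fibre functor of `T` over the commutative algebra `R` in ind-objects of `V`: a right exact
`k`-linear symmetric monoidal functor from `T` to `R`-modules with the tensor product over `R`.
The monoidal structure is given by a lax symmetric monoidal structure on the functor to
ind-objects; the structure map `F X ⊗ F Y ⟶ F (X ⊗ Y)` is `R`-linear and exhibits `F (X ⊗ Y)` as
the tensor product over `R`, that is, as the coequaliser of the two actions
`(F X ⊗ R) ⊗ F Y ⇉ F X ⊗ F Y`, and the unit map `R ⟶ F 𝟙` is invertible. -/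
structure FibreFunctor (R : CommMon (Ind V)) where
  F : T ⥤ Mod (Ind V) R.X
  additive : (F ⋙ Mod.forget R.X).Additive
  linear : (F ⋙ Mod.forget R.X).Linear k
  rightExact : PreservesFiniteColimits F
  laxBraided : (F ⋙ Mod.forget R.X).LaxBraided
  μ_linear (X Y : T) : (act (F.obj X) ▷ (F.obj Y).X) ≫ μ (F ⋙ Mod.forget R.X) X Y =
    (α_ _ _ _).hom ≫ R.X ◁ μ (F ⋙ Mod.forget R.X) X Y ≫ act (F.obj (X ⊗ Y))
  μ_balanced (X Y : T) :
    (((β_ (F.obj X).X R.X).hom ≫ act (F.obj X)) ▷ (F.obj Y).X) ≫ μ (F ⋙ Mod.forget R.X) X Y =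
      ((α_ _ _ _).hom ≫ (F.obj X).X ◁ act (F.obj Y)) ≫ μ (F ⋙ Mod.forget R.X) X Y
  isColimit (X Y : T) : IsColimit (Cofork.ofπ _ (μ_balanced X Y))
  unit_isIso : IsIso ((ρ_ R.X).inv ≫ R.X ◁ ε (F ⋙ Mod.forget R.X) ≫ act (F.obj (𝟙_ T)))

end fibre
end TensorCat

end

/-! Write B for `Box k T V`. Everything is deduced from a single functor: a tensor functor F from B
to a semisimple symmetric monoidal category C that splits all short exact sequences and makes every
X in T isomorphic to some X₀ in V (`exists_splitting_functor`). That B is itself a tensor category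
rests on the isotypic decomposition of its objects along the simple objects of V.

Given F, local semisimplicity is immediate, for T by restriction. The functor Z ↦ Hom(F -, Z) takes
values in left exact presheaves, that is, in ind-objects, and is lax symmetric monoidal, so it sends
the unit of C to a commutative algebra A. Since the objects of B are dualisable, the projection
formula `isIso_projection` identifies A ⊗ Q with the image of F(Q). Hence whatever splits or becomes
isomorphic in C does so over A, and A is a splitting algebra. The same construction for the
restriction of F to V gives the algebra R. The fibre functor sends X to the R-module attached to
F(X). It is monoidal over R because F(X) ≅ F(X₀) makes this module free, and right exact because
every additive functor on the semisimple category C is.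

To construct F, choose for each X an algebra over which X becomes free. Finite tensor products of
these algebras are non-zero, because the unit of a tensor category is simple
(`IsTensorCategory.tensorHom_ne_zero`). Instead of an infinite tensor product, the category `Kl` of
families of free modules over all finite products is used. Its unit has for each X an idempotent
indicator, the identity over the products containing the factor of X and zero over the others; up to
this indicator X and X₀ are isomorphic. Finite products of indicators are non-zero, so some minimal
prime of End(𝟙) contains none of them. Let K be its residue field and M the set of endomorphisms
with non-zero image in K. By minimality every endomorphism outside M is nilpotent up to
multiplication by an element of M.

By duality, splitting a short exact sequence up to M reduces to an epimorphism g : P ⟶ 𝟙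
(`exists_splitting`), for which a point of P with value in M is wanted. Suppose there is none, and
look at g on the object of V to which P has become close. On a simple summand other than 𝟙 the
tensor powers of g are symmetric, so they vanish with Sym^N; on a summand 𝟙 the value of g is a
scalar outside M. So g is nilpotent up to M. But tensoring with an epimorphism to the unit kills no
non-zero morphism to the unit, so 0 would lie in M (`exists_section_of_epi`).

Finally, C arises by extending scalars to K, dividing by negligible morphisms and completing
idempotents. The elements of M become invertible, so nothing has to be said up to M any more.
Morphisms to the unit are now detected on points, and the vanishing of Sym^N kills all morphisms
from the image of a simple object S ≇ 𝟙 to the unit. By duality, morphisms between images of simple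
objects are zero or invertible (`IsPointed.zeroOrIso`). Gaussian elimination then makes all
morphisms of C von Neumann regular, which is why C is abelian with right exact tensor product. -/

open CategoryTheory MonoidalCategory Limits Opposite Idempotents
open scoped MonoidalCategory.ExternalProduct TensorProduct

noncomputable section
/-! ### Semisimple preadditive categories -/

namespace TensorCat

section sums
variable {E : Type u₁} [Category.{v₁} E] [Preadditive E]

/-- The relations exhibiting `Z` as the direct sum of `X` and `Y`. -/
structure DirectSum (X Y Z : E) where
  inl : X ⟶ Z
  inr : Y ⟶ Z
  fst : Z ⟶ X
  snd : Z ⟶ Y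
  inl_fst : inl ≫ fst = 𝟙 X
  inr_snd : inr ≫ snd = 𝟙 Y
  inl_snd : inl ≫ snd = 0
  inr_fst : inr ≫ fst = 0
  total : fst ≫ inl + snd ≫ inr = 𝟙 Z

namespace DirectSum

attribute [simp] inl_fst inr_snd inl_snd inr_fst

variable {X Y Z : E} (d : DirectSum X Y Z)

@[simp]
lemma inl_fst_assoc {W : E} (h : X ⟶ W) : d.inl ≫ d.fst ≫ h = h := by
  rw [← Category.assoc, d.inl_fst, Category.id_comp]

@[simp]
lemma inr_snd_assoc {W : E} (h : Y ⟶ W) : d.inr ≫ d.snd ≫ h = h := by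
  rw [← Category.assoc, d.inr_snd, Category.id_comp]

@[simp]
lemma inl_snd_assoc {W : E} (h : Y ⟶ W) : d.inl ≫ d.snd ≫ h = 0 := by
  rw [← Category.assoc, d.inl_snd, zero_comp]

@[simp]
lemma inr_fst_assoc {W : E} (h : X ⟶ W) : d.inr ≫ d.fst ≫ h = 0 := by
  rw [← Category.assoc, d.inr_fst, zero_comp]

lemma hom_ext {W : E} {f g : Z ⟶ W} (h₁ : d.inl ≫ f = d.inl ≫ g) (h₂ : d.inr ≫ f = d.inr ≫ g) :
    f = g := by
  rw [← Category.id_comp f, ← Category.id_comp g, ← d.total, Preadditive.add_comp,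
    Preadditive.add_comp, Category.assoc, Category.assoc, h₁, h₂, Category.assoc, Category.assoc]

/-- Direct sums are biproducts. -/
def binaryBicone {X Y Z : E} (d : DirectSum X Y Z) : BinaryBicone X Y where
  pt := Z
  fst := d.fst
  snd := d.snd
  inl := d.inl
  inr := d.inr

lemma hasBinaryBiproduct {X Y Z : E} (d : DirectSum X Y Z) : HasBinaryBiproduct X Y :=
  ⟨⟨⟨d.binaryBicone, isBinaryBilimitOfTotal _ d.total⟩⟩⟩

/-- The biproduct as a direct sum. -/
def biprod (X Y : E) [HasBinaryBiproduct X Y] : DirectSum X Y (X ⊞ Y) where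
  inl := biprod.inl
  inr := biprod.inr
  fst := biprod.fst
  snd := biprod.snd
  inl_fst := by simp
  inr_snd := by simp
  inl_snd := by simp
  inr_fst := by simp
  total := biprod.total

/-- Additive functors preserve direct sums. -/
def map {E' : Type u₂} [Category.{v₂} E'] [Preadditive E'] {X Y Z : E} (d : DirectSum X Y Z)
    (F : E ⥤ E') [F.Additive] : DirectSum (F.obj X) (F.obj Y) (F.obj Z) where
  inl := F.map d.inl
  inr := F.map d.inr
  fst := F.map d.fst
  snd := F.map d.snd
  inl_fst := by simp [← F.map_comp]
  inr_snd := by simp [← F.map_comp]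
  inl_snd := by simp [← F.map_comp]
  inr_fst := by simp [← F.map_comp]
  total := by rw [← F.map_comp, ← F.map_comp, ← F.map_add, d.total, F.map_id]

/-- Transport of a direct sum along isomorphisms of the summands. -/
def ofIso {X Y Z X' Y' : E} (d : DirectSum X Y Z) (e : X ≅ X') (e' : Y ≅ Y') :
    DirectSum X' Y' Z where
  inl := e.inv ≫ d.inl
  inr := e'.inv ≫ d.inr
  fst := d.fst ≫ e.hom
  snd := d.snd ≫ e'.hom
  inl_fst := by simp
  inr_snd := by simp
  inl_snd := by simp
  inr_fst := by simp
  total := by simp [d.total]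

end DirectSum

/-- `Z` is a finite direct sum of objects with the property `P`. -/
inductive IsSum (P : ObjectProperty E) : E → Prop
  | zero {Z : E} (h : 𝟙 Z = 0) : IsSum P Z
  | add {S Y Z : E} (hS : P S) (hY : IsSum P Y) (d : DirectSum S Y Z) : IsSum P Z

/-- Morphisms between objects with the property `P` are zero or invertible. -/
def ZeroOrIso (P : ObjectProperty E) : Prop :=
  ∀ ⦃S S' : E⦄ (_ : P S) (_ : P S') (f : S ⟶ S'), f = 0 ∨ IsIso f

/-- Von Neumann regular morphisms. -/
def IsRegular {X Y : E} (f : X ⟶ Y) : Prop := ∃ g : Y ⟶ X, f ≫ g ≫ f = f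

variable {P : ObjectProperty E}

lemma IsSum.map {E' : Type u₂} [Category.{v₂} E'] [Preadditive E'] (F : E ⥤ E') [F.Additive]
    {P' : ObjectProperty E'} (hP : ∀ S, P S → P' (F.obj S)) {Z : E} (hZ : IsSum P Z) :
    IsSum P' (F.obj Z) := by
  induction hZ with
  | zero h => exact .zero (by rw [← F.map_id, h, F.map_zero])
  | add hS _ d ih => exact .add (hP _ hS) ih (d.map F)

/-- Schur's lemma in components: a non-zero component is invertible, and projecting to it and
inverting gives the retraction. -/
lemma IsSum.eq_zero_or_splitMono (hP : ZeroOrIso P) {Y : E} (hY : IsSum P Y) {S : E} (hS : P S)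
    (a : S ⟶ Y) : a = 0 ∨ ∃ r : Y ⟶ S, a ≫ r = 𝟙 S := by
  induction hY with
  | zero h => exact .inl (by rw [← Category.comp_id a, h, comp_zero])
  | @add S₀ Y' Y hS₀ _ d ih =>
    obtain h | h := hP hS hS₀ (a ≫ d.fst)
    · obtain h' | ⟨r, hr⟩ := ih (a ≫ d.snd)
      · left
        rw [← Category.comp_id a, ← d.total, Preadditive.comp_add, reassoc_of% h,
          reassoc_of% h', zero_comp, zero_comp, add_zero]
      · exact .inr ⟨d.snd ≫ r, by rw [← Category.assoc, hr]⟩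
    · exact .inr ⟨d.fst ≫ inv (a ≫ d.fst), by rw [← Category.assoc, IsIso.hom_inv_id]⟩

/-- Gaussian elimination, by induction on the summands of the source. Where `f` is non-zero on a new
summand it is a split monomorphism there; its image is split off the target and the induction
continues in the complement. -/
lemma IsSum.isRegular (hP : ZeroOrIso P) {X Y : E} (hX : IsSum P X) (hY : IsSum P Y) (f : X ⟶ Y) :
    IsRegular f := by
  induction hX with
  | zero h =>
    refine ⟨0, ?_⟩
    rw [zero_comp, comp_zero, ← Category.id_comp f, h, zero_comp]
  | @add S X' X hS _ d ih =>
    obtain ha | ⟨r, hr⟩ := hY.eq_zero_or_splitMono hP hS (d.inl ≫ f)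
    · obtain ⟨g, hg⟩ := ih (d.inr ≫ f)
      have hf : f = d.snd ≫ d.inr ≫ f := by
        conv_lhs => rw [← Category.id_comp f, ← d.total]
        simp [ha]
      refine ⟨g ≫ d.inr, ?_⟩
      conv_rhs => rw [hf, ← hg]
      conv_lhs => rw [hf]
      simp
    -- The idempotent `r ≫ a` projects `Y` onto the image of the new summand; `f'` is `f` on the
    -- remaining summands, cut down to the complement.
    · set a := d.inl ≫ f with ha
      obtain ⟨g, hg⟩ := ih (d.inr ≫ f ≫ (𝟙 Y - r ≫ a))
      set f' := d.inr ≫ f ≫ (𝟙 Y - r ≫ a) with hf'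
      set b := d.inr ≫ f ≫ r with hb
      have hae : a ≫ (𝟙 Y - r ≫ a) = 0 := by simp [reassoc_of% hr]
      have hfr : f' ≫ r = 0 := by simp [hf', hr]
      have hfe : f' ≫ (𝟙 Y - r ≫ a) = f' := by
        rw [Preadditive.comp_sub, reassoc_of% hfr, zero_comp, Category.comp_id, sub_zero]
      have hf : f = (d.fst + d.snd ≫ b) ≫ a + d.snd ≫ f' := by
        conv_lhs => rw [← Category.id_comp f, ← d.total]
        simp only [hf', hb, ha, Preadditive.add_comp, Preadditive.comp_sub, Category.assoc,
          Category.comp_id]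
        abel
      have hq : (d.inr - b ≫ d.inl) ≫ f = f' := by
        rw [Preadditive.sub_comp, Category.assoc, ← ha, hf', hb]
        simp
      -- The quasi-inverse is `r` on the image of `a` and `g` on the complement. Subtracting `b ≫
      -- d.inl` is the column operation that turns the restriction of `f` to `X'` into `f'`, by
      -- `hq`.
      refine ⟨r ≫ d.inl + (𝟙 Y - r ≫ a) ≫ g ≫ (d.inr - b ≫ d.inl), ?_⟩
      rw [Preadditive.add_comp, Category.assoc, Category.assoc, Category.assoc, hq, ← ha]
      rw [hf]
      simp only [Preadditive.add_comp, Preadditive.comp_add, Category.assoc, reassoc_of% hr,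
        reassoc_of% hae, reassoc_of% hfr, reassoc_of% hfe, hg, zero_comp, comp_zero, add_zero,
        zero_add]

/-- Regularity passes to retracts. -/
lemma IsRegular.of_retract {X Y X' Y' : E} (rX : Retract X X') (rY : Retract Y Y') (f : X ⟶ Y)
    (h : ∀ f : X' ⟶ Y', IsRegular f) : IsRegular f := by
  obtain ⟨g, hg⟩ := h (rX.r ≫ f ≫ rY.i)
  refine ⟨rY.i ≫ g ≫ rX.r, ?_⟩
  have := congrArg (fun t => rX.i ≫ t ≫ rY.r) hg
  simpa using this

lemma IsSum.of_iso {Y Z : E} (hY : IsSum P Y) (e : Y ≅ Z) : IsSum P Z := by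
  cases hY with
  | zero h =>
    exact .zero (by rw [← e.inv_hom_id, ← Category.id_comp e.hom, h, zero_comp, comp_zero])
  | add hS hY d =>
    refine .add hS hY ⟨d.inl ≫ e.hom, d.inr ≫ e.hom, e.inv ≫ d.fst, e.inv ≫ d.snd, by simp, by simp,
      by simp, by simp, ?_⟩
    have := congrArg (fun q => e.inv ≫ q ≫ e.hom) d.total
    simpa using this

end sums

/-! ### Von Neumann regular morphisms and abelian categories. -/

section regular
variable {E : Type u₁} [Category.{v₁} E] [Preadditive E]

/-- The cokernel of a regular morphism. -/
lemma IsRegular.exists_cokernel [IsIdempotentComplete E] {X Y : E} {f : X ⟶ Y} (hf : IsRegular f) :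
    ∃ (Z : E) (π : Y ⟶ Z) (s : Z ⟶ Y) (g : Y ⟶ X), f ≫ π = 0 ∧ s ≫ π = 𝟙 Z ∧
      π ≫ s + g ≫ f = 𝟙 Y := by
  obtain ⟨g, hg⟩ := hf
  obtain ⟨Z, s, π, h₁, h₂⟩ := IsIdempotentComplete.idempotents_split Y (𝟙 Y - g ≫ f) (by simp [hg])
  refine ⟨Z, π, s, g, ?_, h₁, by simp [h₂]⟩
  have : f ≫ (π ≫ s) ≫ π = 0 := by rw [h₂, ← Category.assoc]; simp [hg]
  simpa [h₁] using this

lemma IsRegular.exists_kernel [IsIdempotentComplete E] {X Y : E} {f : X ⟶ Y} (hf : IsRegular f) :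
    ∃ (Z : E) (π : X ⟶ Z) (s : Z ⟶ X) (g : Y ⟶ X), s ≫ f = 0 ∧ s ≫ π = 𝟙 Z ∧
      π ≫ s + f ≫ g = 𝟙 X := by
  obtain ⟨g, hg⟩ := hf
  obtain ⟨Z, s, π, h₁, h₂⟩ := IsIdempotentComplete.idempotents_split X (𝟙 X - f ≫ g) (by simp [reassoc_of% hg])
  refine ⟨Z, π, s, g, ?_, h₁, by simp [h₂]⟩
  have : s ≫ (π ≫ s) ≫ f = 0 := by rw [h₂]; simp [hg]
  simpa [reassoc_of% h₁] using this

lemma IsRegular.splitMono {X Y : E} {f : X ⟶ Y} [Mono f] (hf : IsRegular f) :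
    ∃ g : Y ⟶ X, f ≫ g = 𝟙 X := by
  obtain ⟨g, hg⟩ := hf
  exact ⟨g, by rw [← cancel_mono f, Category.assoc, hg, Category.id_comp]⟩

lemma IsRegular.splitEpi {X Y : E} {f : X ⟶ Y} [Epi f] (hf : IsRegular f) :
    ∃ g : Y ⟶ X, g ≫ f = 𝟙 Y := by
  obtain ⟨g, hg⟩ := hf
  exact ⟨g, by rw [← cancel_epi f, hg, Category.comp_id]⟩

/-- An idempotent complete additive category all of whose morphisms are regular is abelian. -/
lemma isAbelian_of_isRegular [IsIdempotentComplete E] [HasFiniteProducts E]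
    (h : ∀ ⦃X Y : E⦄ (f : X ⟶ Y), IsRegular f) : IsAbelian E where
  hasFiniteProducts := inferInstance
  hasKernels := ⟨fun {X Y} f => by
    obtain ⟨Z, π, s, g, h₁, h₂, h₃⟩ := (h f).exists_kernel
    exact ⟨⟨⟨KernelFork.ofι s h₁, KernelFork.IsLimit.ofι _ _ (fun t _ => t ≫ π)
      (fun t ht => by
        have := congrArg (fun q => t ≫ q) h₃
        simpa [reassoc_of% ht] using this)
      (fun t _ m hm => by rw [← hm, Category.assoc, h₂, Category.comp_id])⟩⟩⟩⟩
  hasCokernels := ⟨fun {X Y} f => by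
    obtain ⟨Z, π, s, g, h₁, h₂, h₃⟩ := (h f).exists_cokernel
    exact ⟨⟨⟨CokernelCofork.ofπ π h₁, CokernelCofork.IsColimit.ofπ _ _ (fun t _ => s ≫ t)
      (fun t ht => by
        have := congrArg (fun q => q ≫ t) h₃
        simpa [ht] using this)
      (fun t _ m hm => by rw [← hm, ← Category.assoc, h₂, Category.id_comp])⟩⟩⟩⟩
  normalMono := ⟨fun {X Y} f _ => by
    obtain ⟨g, hg⟩ := (h f).splitMono
    exact ⟨⟨Y, 𝟙 Y - g ≫ f, by simp [reassoc_of% hg], KernelFork.IsLimit.ofι _ _ (fun t _ => t ≫ g)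
      (fun t ht => by
        rw [Preadditive.comp_sub, Category.comp_id, sub_eq_zero] at ht
        rw [Category.assoc, ← ht])
      (fun t _ m hm => by rw [← hm, Category.assoc, hg, Category.comp_id])⟩⟩⟩
  normalEpi := ⟨fun {X Y} f _ => by
    obtain ⟨g, hg⟩ := (h f).splitEpi
    exact ⟨⟨X, 𝟙 X - f ≫ g, by simp [hg], CokernelCofork.IsColimit.ofπ _ _ (fun t _ => g ≫ t)
      (fun t ht => by
        rw [Preadditive.sub_comp, Category.id_comp, sub_eq_zero] at ht
        rw [← Category.assoc, ← ht])
      (fun t _ m hm => by rw [← hm, ← Category.assoc, hg, Category.id_comp])⟩⟩⟩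

end regular

/-- The abelian structure of a category with the property `IsAbelian`. -/
abbrev abelianOfIsAbelian (C : Type u) [Category.{v} C] [Preadditive C] [IsAbelian C] : Abelian C where
  normalMonoOfMono f _ := IsNormalMonoCategory.normalMonoOfMono f
  normalEpiOfEpi f _ := IsNormalEpiCategory.normalEpiOfEpi f

end TensorCat
/-! ### Elements of ind-objects -/

namespace IndTensor

section elements
variable {C : Type u} [Category.{v} C]

/-- The elements of an ind-object at an object of `C`. -/
def El (M : Ind C) (P : C) : Type v := ((Ind.inclusion C).obj M).obj (op P)

/-- Restriction of elements along a morphism of `C`. -/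
def El.res {M : Ind C} {P Q : C} (m : El M P) (f : Q ⟶ P) : El M Q :=
  ((Ind.inclusion C).obj M).map f.op m

/-- The action of a morphism of ind-objects on elements. -/
def elMap {M N : Ind C} (φ : M ⟶ N) {P : C} (m : El M P) : El N P :=
  ((Ind.inclusion C).map φ).app (op P) m

@[simp]
lemma El.res_id {M : Ind C} {P : C} (m : El M P) : m.res (𝟙 P) = m :=
  congrArg (fun t => t.hom m) (((Ind.inclusion C).obj M).map_id (op P))

@[simp]
lemma El.res_res {M : Ind C} {P Q R : C} (m : El M P) (f : Q ⟶ P) (g : R ⟶ Q) :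
    (m.res f).res g = m.res (g ≫ f) :=
  (congrArg (fun t => t.hom m) (((Ind.inclusion C).obj M).map_comp f.op g.op)).symm

@[simp]
lemma elMap_id {M : Ind C} {P : C} (m : El M P) : elMap (𝟙 M) m = m :=
  congrArg (fun t => (t.app (op P)).hom m) ((Ind.inclusion C).map_id M)

@[simp]
lemma elMap_comp {M N L : Ind C} (φ : M ⟶ N) (ψ : N ⟶ L) {P : C} (m : El M P) :
    elMap (φ ≫ ψ) m = elMap ψ (elMap φ m) :=
  congrArg (fun t => (t.app (op P)).hom m) ((Ind.inclusion C).map_comp φ ψ)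

lemma elMap_res {M N : Ind C} (φ : M ⟶ N) {P Q : C} (m : El M P) (f : Q ⟶ P) :
    elMap φ (m.res f) = (elMap φ m).res f :=
  congrArg (fun t => t.hom m) (((Ind.inclusion C).map φ).naturality f.op)

lemma hom_ext_el {M N : Ind C} {φ ψ : M ⟶ N} (h : ∀ (P : C) (m : El M P), elMap φ m = elMap ψ m) :
    φ = ψ := by
  apply (Ind.inclusion C).map_injective
  ext P m
  exact h P.unop m

/-- A morphism of ind-objects from a natural map on elements. -/
def homOfEl {M N : Ind C} (φ : ∀ P, El M P → El N P)
    (h : ∀ (P Q : C) (f : Q ⟶ P) (m : El M P), φ Q (m.res f) = (φ P m).res f) : M ⟶ N :=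
  Ind.inclusion.fullyFaithful.preimage
    { app P := ↾ φ P.unop
      naturality P Q f := by
        ext m
        exact h _ _ f.unop m }

@[simp]
lemma elMap_homOfEl {M N : Ind C} (φ : ∀ P, El M P → El N P)
    (h : ∀ (P Q : C) (f : Q ⟶ P) (m : El M P), φ Q (m.res f) = (φ P m).res f) {P : C} (m : El M P) :
    elMap (homOfEl φ h) m = φ P m := by
  rw [elMap, homOfEl, Functor.FullyFaithful.map_preimage]
  rfl

variable [MonoidalCategory C] [EssentiallySmall.{v} C]

/-- The product of two elements, an element of the tensor product. -/
def tmul {M N : Ind C} {P Q : C} (m : El M P) (n : El N Q) : El (M ⊗ N) (P ⊗ Q) :=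
  (LawfulDayConvolutionMonoidalCategoryStruct.convolutionExtensionUnit Cᵒᵖ (Type v) M N).app
    (op P, op Q) (m, n)

/-- Naturality of the unit of the Day convolution. Together with the formulas below for whiskerings,
associator, unitors and braiding, it reduces identities between morphisms of ind-objects to
identities in `C`. -/
lemma tmul_res {M N : Ind C} {P Q P' Q' : C} (m : El M P) (n : El N Q) (f : P' ⟶ P) (g : Q' ⟶ Q) :
    tmul (m.res f) (n.res g) = (tmul m n).res (f ⊗ₘ g) :=
  congrArg (fun t => t.hom (m, n)) ((LawfulDayConvolutionMonoidalCategoryStruct.convolutionExtensionUnit Cᵒᵖ (Type v) M N).naturality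
    ((f.op, g.op) : (op P, op Q) ⟶ (op P', op Q')))

lemma elMap_tensorHom {M N M' N' : Ind C} (φ : M ⟶ M') (ψ : N ⟶ N') {P Q : C} (m : El M P)
    (n : El N Q) : elMap (φ ⊗ₘ ψ) (tmul m n) = tmul (elMap φ m) (elMap ψ n) :=
  congrArg (fun t => t.hom (m, n)) (LawfulDayConvolutionMonoidalCategoryStruct.convolutionExtensionUnit_comp_ι_map_tensorHom_app
    Cᵒᵖ (Type v) φ ψ (op P) (op Q))

lemma elMap_whiskerLeft {M N N' : Ind C} (ψ : N ⟶ N') {P Q : C} (m : El M P)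
    (n : El N Q) : elMap (M ◁ ψ) (tmul m n) = tmul m (elMap ψ n) := by
  rw [← id_tensorHom, elMap_tensorHom, elMap_id]

lemma elMap_whiskerRight {M N M' : Ind C} (φ : M ⟶ M') {P Q : C} (m : El M P)
    (n : El N Q) : elMap (φ ▷ N) (tmul m n) = tmul (elMap φ m) n := by
  rw [← tensorHom_id, elMap_tensorHom, elMap_id]

lemma elMap_associator {M N L : Ind C} {P Q R : C} (m : El M P) (n : El N Q) (l : El L R) :
    elMap (α_ M N L).hom (tmul (tmul m n) l) = (tmul m (tmul n l)).res (α_ P Q R).hom :=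
  congrArg (fun t => t.hom ((m, n), l)) (LawfulDayConvolutionMonoidalCategoryStruct.associator_hom_unit_unit
    (C := Cᵒᵖ) (Type v) M N L (op P) (op Q) (op R))

/-- The element of the unit ind-object at the unit. -/
def elUnit : El (𝟙_ (Ind C)) (𝟙_ C) :=
  LawfulDayConvolutionMonoidalCategoryStruct.unitUnit Cᵒᵖ (Type v) (Ind C) PUnit.unit

lemma elMap_leftUnitor {M : Ind C} {P : C} (m : El M P) :
    elMap (λ_ M).hom (tmul elUnit m) = m.res (λ_ P).hom :=
  congrArg (fun t => t.hom (PUnit.unit, m)) (LawfulDayConvolutionMonoidalCategoryStruct.leftUnitor_hom_unit_app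
    (C := Cᵒᵖ) (Type v) M (op P))

lemma elMap_rightUnitor {M : Ind C} {P : C} (m : El M P) :
    elMap (ρ_ M).hom (tmul m elUnit) = m.res (ρ_ P).hom :=
  congrArg (fun t => t.hom (m, PUnit.unit)) (LawfulDayConvolutionMonoidalCategoryStruct.rightUnitor_hom_unit_app
    (C := Cᵒᵖ) (Type v) M (op P))

/-- The tensor product of ind-objects as a Day convolution. -/
abbrev dayConvolution (M N : Ind C) :
    DayConvolution ((Ind.inclusion C).obj M) ((Ind.inclusion C).obj N) :=
  LawfulDayConvolutionMonoidalCategoryStruct.convolution Cᵒᵖ (Type v) (Ind C) M N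

lemma elMap_braiding [SymmetricCategory C] {M N : Ind C} {P Q : C} (m : El M P) (n : El N Q) :
    elMap (β_ M N).hom (tmul m n) = (tmul n m).res (β_ P Q).hom := by
  let := dayConvolution M N
  let := dayConvolution N M
  have h : (Ind.inclusion C).map (β_ M N).hom =
      (DayConvolution.braiding ((Ind.inclusion C).obj M) ((Ind.inclusion C).obj N)).hom :=
    Ind.inclusion.fullyFaithful.map_preimage (DayConvolution.braiding
      ((Ind.inclusion C).obj M) ((Ind.inclusion C).obj N)).hom
  rw [elMap, h]
  exact congrArg (fun t => t.hom (m, n)) (DayConvolution.unit_app_braiding_hom_app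
    ((Ind.inclusion C).obj M) ((Ind.inclusion C).obj N) (op P) (op Q))

/-- Morphisms out of a tensor product of ind-objects agree if they agree on products. -/
lemma tensor_hom_ext {M N L : Ind C} {φ ψ : M ⊗ N ⟶ L}
    (h : ∀ (P Q : C) (m : El M P) (n : El N Q), elMap φ (tmul m n) = elMap ψ (tmul m n)) :
    φ = ψ := by
  apply (Ind.inclusion C).map_injective
  let := dayConvolution M N
  refine Functor.hom_ext_of_isLeftKanExtension _ (DayConvolution.unit ((Ind.inclusion C).obj M)
    ((Ind.inclusion C).obj N)) _ _ ?_
  ext ⟨P, Q⟩ ⟨m, n⟩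
  exact h P.unop Q.unop m n

/-- A natural pairing of elements as a natural transformation. -/
def pairingNatTrans {M N L : Ind C} (b : ∀ P Q, El M P → El N Q → El L (P ⊗ Q))
    (h : ∀ (P Q P' Q' : C) (f : P' ⟶ P) (g : Q' ⟶ Q) (m : El M P) (n : El N Q),
      b P' Q' (m.res f) (n.res g) = (b P Q m n).res (f ⊗ₘ g)) :
    (Ind.inclusion C).obj M ⊠ (Ind.inclusion C).obj N ⟶ tensor Cᵒᵖ ⋙ (Ind.inclusion C).obj L where
  app PQ := ↾ fun mn => b PQ.1.unop PQ.2.unop mn.1 mn.2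
  naturality PQ PQ' fg := by
    ext ⟨m, n⟩
    exact h _ _ _ _ fg.1.unop fg.2.unop m n

/-- The morphism out of a tensor product of ind-objects given by a natural pairing of elements. -/
def tensorDesc {M N L : Ind C} (b : ∀ P Q, El M P → El N Q → El L (P ⊗ Q))
    (h : ∀ (P Q P' Q' : C) (f : P' ⟶ P) (g : Q' ⟶ Q) (m : El M P) (n : El N Q),
      b P' Q' (m.res f) (n.res g) = (b P Q m n).res (f ⊗ₘ g)) : M ⊗ N ⟶ L :=
  let := dayConvolution M N
  Ind.inclusion.fullyFaithful.preimage (Functor.descOfIsLeftKanExtension _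
    (DayConvolution.unit ((Ind.inclusion C).obj M) ((Ind.inclusion C).obj N))
    ((Ind.inclusion C).obj L) (pairingNatTrans b h))

@[simp]
lemma elMap_tensorDesc {M N L : Ind C} (b : ∀ P Q, El M P → El N Q → El L (P ⊗ Q))
    (h : ∀ (P Q P' Q' : C) (f : P' ⟶ P) (g : Q' ⟶ Q) (m : El M P) (n : El N Q),
      b P' Q' (m.res f) (n.res g) = (b P Q m n).res (f ⊗ₘ g)) {P Q : C} (m : El M P) (n : El N Q) :
    elMap (tensorDesc b h) (tmul m n) = b P Q m n := by
  let := dayConvolution M N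
  rw [elMap, tensorDesc, Functor.FullyFaithful.map_preimage]
  have := Functor.descOfIsLeftKanExtension_fac_app _
    (DayConvolution.unit ((Ind.inclusion C).obj M) ((Ind.inclusion C).obj N))
    ((Ind.inclusion C).obj L) (pairingNatTrans b h) (op P, op Q)
  exact congrArg (fun t : (((Ind.inclusion C).obj M) ⊠ ((Ind.inclusion C).obj N)).obj (op P, op Q) ⟶
    (tensor Cᵒᵖ ⋙ (Ind.inclusion C).obj L).obj (op P, op Q) => t.hom (m, n)) this

end elements
end IndTensor
/-! ### The embedding into ind-objects -/

namespace IndTensor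

section embedding
variable {C : Type u} [Category.{v} C]

/-- The element of an embedded object corresponding to a morphism. -/
def elOfHom {P Q : C} (f : Q ⟶ P) : El (Ind.yoneda.obj P) Q :=
  (Ind.yonedaCompInclusion.inv.app P).app (op Q) f

/-- The morphism corresponding to an element of an embedded object. -/
def homOfElt {P Q : C} (m : El (Ind.yoneda.obj P) Q) : Q ⟶ P :=
  (Ind.yonedaCompInclusion.hom.app P).app (op Q) m

@[simp]
lemma homOfElt_elOfHom {P Q : C} (f : Q ⟶ P) : homOfElt (elOfHom f) = f :=
  congrArg (fun t => (t.app (op Q)).hom f) (Ind.yonedaCompInclusion.inv_hom_id_app P)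

@[simp]
lemma elOfHom_homOfElt {P Q : C} (m : El (Ind.yoneda.obj P) Q) : elOfHom (homOfElt m) = m :=
  congrArg (fun t => (t.app (op Q)).hom m) (Ind.yonedaCompInclusion.hom_inv_id_app P)

lemma elOfHom_res {P Q R : C} (f : Q ⟶ P) (g : R ⟶ Q) : (elOfHom f).res g = elOfHom (g ≫ f) :=
  (congrArg (fun t => t.hom f) ((Ind.yonedaCompInclusion.inv.app P).naturality g.op)).symm

lemma elMap_yoneda_map {P P' Q : C} (h : P ⟶ P') (f : Q ⟶ P) :
    elMap (Ind.yoneda.map h) (elOfHom f) = elOfHom (f ≫ h) :=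
  (congrArg (fun t => (t.app (op Q)).hom f) (Ind.yonedaCompInclusion.inv.naturality h)).symm

lemma homOfElt_res {P Q R : C} (m : El (Ind.yoneda.obj P) Q) (g : R ⟶ Q) :
    homOfElt (m.res g) = g ≫ homOfElt m := by
  rw [← elOfHom_homOfElt m, elOfHom_res, homOfElt_elOfHom, homOfElt_elOfHom]

/-- The morphism from an embedded object corresponding to an element. -/
def elHom {M : Ind C} {P : C} (m : El M P) : Ind.yoneda.obj P ⟶ M :=
  homOfEl (fun _ f => m.res (homOfElt f)) (fun _ _ _ _ => by rw [homOfElt_res, El.res_res])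

lemma elMap_elHom {M : Ind C} {P Q : C} (m : El M P) (f : Q ⟶ P) :
    elMap (elHom m) (elOfHom f) = m.res f := by
  rw [elHom, elMap_homOfEl, homOfElt_elOfHom]

@[simp]
lemma elMap_elHom_id {M : Ind C} {P : C} (m : El M P) :
    elMap (elHom m) (elOfHom (𝟙 P)) = m := by
  rw [elMap_elHom, El.res_id]

lemma yoneda_hom_ext {M : Ind C} {P : C} {φ ψ : Ind.yoneda.obj P ⟶ M}
    (h : elMap φ (elOfHom (𝟙 P)) = elMap ψ (elOfHom (𝟙 P))) : φ = ψ := by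
  refine hom_ext_el fun Q m => ?_
  rw [← elOfHom_homOfElt m, ← Category.comp_id (homOfElt m), ← elOfHom_res, elMap_res, elMap_res, h]

variable [MonoidalCategory C] [EssentiallySmall.{v} C]

/-- Morphisms out of the unit ind-object agree if they agree on the unit element. -/
lemma unit_hom_ext {M : Ind C} {φ ψ : 𝟙_ (Ind C) ⟶ M} (h : elMap φ elUnit = elMap ψ elUnit) :
    φ = ψ := by
  apply (Ind.inclusion C).map_injective
  let := LawfulDayConvolutionMonoidalCategoryStruct.convolutionUnit Cᵒᵖ (Type v) (Ind C)
  ext P m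
  have := DayConvolutionUnit.hom_ext (U := (Ind.inclusion C).obj (𝟙_ (Ind C))) (c := P)
    (g := ((Ind.inclusion C).map φ).app P) (h := ((Ind.inclusion C).map ψ).app P) (fun f => by
      ext ⟨⟩
      change elMap φ (elUnit.res f.unop) = elMap ψ (elUnit.res f.unop)
      rw [elMap_res, elMap_res, h])
  exact congrArg (fun t => t.hom m) this

/-- The unit ind-object is a left Kan extension from a point; its universal property gives the
inverse, which sends the unit element to the identity of the unit of `C`. -/
instance isIso_yonedaUnit : IsIso (elHom (elUnit (C := C))) := by
  let := LawfulDayConvolutionMonoidalCategoryStruct.convolutionUnit Cᵒᵖ (Type v) (Ind C)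
  let h := (LawfulDayConvolutionMonoidalCategoryStruct.isPointwiseLeftKanExtensionUnitUnit Cᵒᵖ
    (Type v) (Ind C)).isUniversal
  let G := (Ind.inclusion C).obj (Ind.yoneda.obj (𝟙_ C))
  let E : (Functor.fromPUnit.{0} (𝟙_ Cᵒᵖ)).LeftExtension (Functor.fromPUnit.{0} (𝟙_ (Type v))) :=
    Functor.LeftExtension.mk G { app _ := ↾ fun _ => elOfHom (𝟙 (𝟙_ C)) }
  let φ : 𝟙_ (Ind C) ⟶ Ind.yoneda.obj (𝟙_ C) :=
    Ind.inclusion.fullyFaithful.preimage (h.desc E)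
  have hφ : elMap φ elUnit = elOfHom (𝟙 (𝟙_ C)) := by
    have h₁ : (Ind.inclusion C).map φ = h.desc E :=
      Ind.inclusion.fullyFaithful.map_preimage (h.desc E)
    rw [elMap, h₁]
    exact congrArg (fun t => (t.app ⟨⟨⟩⟩).hom PUnit.unit) (h.fac E)
  refine ⟨φ, yoneda_hom_ext ?_, unit_hom_ext ?_⟩
  · rw [elMap_comp, elMap_elHom_id, hφ, elMap_id]
  · rw [elMap_comp, hφ, elMap_elHom_id, elMap_id]

/-- The comparison between the tensor product of `C` and that of ind-objects. -/
def yonedaδ (P Q : C) : Ind.yoneda.obj (P ⊗ Q) ⟶ Ind.yoneda.obj P ⊗ Ind.yoneda.obj Q :=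
  elHom (tmul (elOfHom (𝟙 P)) (elOfHom (𝟙 Q)))

lemma elMap_yonedaδ {P Q R : C} (f : R ⟶ P ⊗ Q) :
    elMap (yonedaδ P Q) (elOfHom f) = (tmul (elOfHom (𝟙 P)) (elOfHom (𝟙 Q))).res f :=
  elMap_elHom _ _

/-- The inverse comes from the pairing that tensors two morphisms of `C`. -/
instance (P Q : C) : IsIso (yonedaδ P Q) := by
  let φ : Ind.yoneda.obj P ⊗ Ind.yoneda.obj Q ⟶ Ind.yoneda.obj (P ⊗ Q) :=
    tensorDesc (fun _ _ m n => elOfHom (homOfElt m ⊗ₘ homOfElt n)) (fun _ _ _ _ f g m n => by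
      rw [homOfElt_res, homOfElt_res, elOfHom_res, tensorHom_comp_tensorHom])
  refine ⟨φ, yoneda_hom_ext ?_, tensor_hom_ext fun A B m n => ?_⟩
  · rw [elMap_comp, elMap_yonedaδ, El.res_id, elMap_tensorDesc, homOfElt_elOfHom,
      homOfElt_elOfHom, id_tensorHom_id, elMap_id]
  · rw [elMap_comp, elMap_tensorDesc, elMap_yonedaδ, elMap_id, ← tmul_res, elOfHom_res, elOfHom_res,
      Category.comp_id, Category.comp_id, elOfHom_homOfElt, elOfHom_homOfElt]

lemma tmul_elHom {M N : Ind C} {P Q : C} (m : El M P) (n : El N Q) :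
    yonedaδ P Q ≫ (elHom m ⊗ₘ elHom n) = elHom (tmul m n) :=
  yoneda_hom_ext (by rw [elMap_comp, elMap_yonedaδ, El.res_id, elMap_tensorHom, elMap_elHom_id,
    elMap_elHom_id, elMap_elHom_id])

/-- The oplax monoidal structure of the embedding into ind-objects. -/
abbrev yonedaOplax : (Ind.yoneda (C := C)).OplaxMonoidal where
  η := elHom elUnit
  δ := yonedaδ
  δ_natural_left f X := yoneda_hom_ext (by
    rw [elMap_comp, elMap_comp, elMap_yonedaδ, elMap_yoneda_map, elMap_yonedaδ, El.res_id,
      elMap_whiskerRight, elMap_yoneda_map, Category.id_comp, Category.id_comp, ← tensorHom_id,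
      ← tmul_res, elOfHom_res, El.res_id, Category.comp_id])
  δ_natural_right X f := yoneda_hom_ext (by
    rw [elMap_comp, elMap_comp, elMap_yonedaδ, elMap_yoneda_map, elMap_yonedaδ, El.res_id,
      elMap_whiskerLeft, elMap_yoneda_map, Category.id_comp, Category.id_comp, ← id_tensorHom,
      ← tmul_res, elOfHom_res, elOfHom_res, Category.comp_id, Category.comp_id])
  oplax_associativity P Q R := yoneda_hom_ext (by
    simp only [elMap_comp, elMap_yonedaδ, El.res_id, elMap_yoneda_map, Category.id_comp,
      elMap_whiskerRight, elMap_associator, elMap_res, elMap_whiskerLeft])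
  oplax_left_unitality P := by
    rw [← cancel_mono (λ_ _).hom, Iso.inv_hom_id]
    refine yoneda_hom_ext ?_
    simp only [elMap_comp, elMap_yonedaδ, elMap_yoneda_map, Category.id_comp, elMap_id, elMap_res,
      elMap_whiskerRight, elMap_elHom_id, elMap_leftUnitor, El.res_res, Iso.inv_hom_id, El.res_id]
  oplax_right_unitality P := by
    rw [← cancel_mono (ρ_ _).hom, Iso.inv_hom_id]
    refine yoneda_hom_ext ?_
    simp only [elMap_comp, elMap_yonedaδ, elMap_yoneda_map, Category.id_comp, elMap_id, elMap_res,
      elMap_whiskerLeft, elMap_elHom_id, elMap_rightUnitor, El.res_res, Iso.inv_hom_id, El.res_id]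

/-- The embedding into ind-objects is monoidal. -/
instance yonedaMonoidal : (Ind.yoneda (C := C)).Monoidal :=
  let := yonedaOplax (C := C)
  have : IsIso (Functor.OplaxMonoidal.η (Ind.yoneda (C := C))) := isIso_yonedaUnit
  have (P Q : C) : IsIso (Functor.OplaxMonoidal.δ (Ind.yoneda (C := C)) P Q) :=
    inferInstanceAs (IsIso (yonedaδ P Q))
  .ofOplaxMonoidal _

lemma δ_yoneda (P Q : C) : Functor.OplaxMonoidal.δ (Ind.yoneda (C := C)) P Q = yonedaδ P Q := rfl

lemma η_yoneda : Functor.OplaxMonoidal.η (Ind.yoneda (C := C)) = elHom elUnit := rfl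

instance yonedaBraided [SymmetricCategory C] : (Ind.yoneda (C := C)).Braided where
  braided P Q := by
    rw [← cancel_epi (Functor.OplaxMonoidal.δ (Ind.yoneda (C := C)) P Q),
      ← cancel_mono (Functor.OplaxMonoidal.δ (Ind.yoneda (C := C)) Q P)]
    simp only [Category.assoc, Functor.Monoidal.δ_μ_assoc, Functor.Monoidal.μ_δ, Category.comp_id]
    rw [δ_yoneda, δ_yoneda]
    refine yoneda_hom_ext ?_
    simp only [elMap_comp, elMap_yonedaδ, elMap_yoneda_map, Category.id_comp, El.res_id,
      elMap_braiding]

/-- Morphisms out of a tensor product agree if they agree on generalised elements. -/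
lemma tensor_hom_ext_left {M N L : Ind C} {φ ψ : M ⊗ N ⟶ L}
    (h : ∀ (P : C) (x : Ind.yoneda.obj P ⟶ M), x ▷ N ≫ φ = x ▷ N ≫ ψ) : φ = ψ := by
  refine tensor_hom_ext fun P Q m n => ?_
  have := congrArg (fun t => elMap t (tmul (elOfHom (𝟙 P)) n)) (h P (elHom m))
  simpa [elMap_whiskerRight] using this

lemma tensor_hom_ext_right {M N L : Ind C} {φ ψ : M ⊗ N ⟶ L}
    (h : ∀ (P : C) (x : Ind.yoneda.obj P ⟶ N), M ◁ x ≫ φ = M ◁ x ≫ ψ) : φ = ψ := by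
  refine tensor_hom_ext fun P Q m n => ?_
  have := congrArg (fun t => elMap t (tmul m (elOfHom (𝟙 Q)))) (h Q (elHom n))
  simpa [elMap_whiskerLeft] using this

end embedding

/-! ### Linearity of the embedding and of the tensor product of ind-objects. -/

section linear
attribute [local instance] indPreadditive indLinear HasFiniteBiproducts.of_hasFiniteProducts
  hasBinaryBiproducts_of_finite_biproducts
variable {C : Type u} [Category.{v} C] [Preadditive C] [HasFiniteProducts C]

instance yonedaAdditive : (Ind.yoneda (C := C)).Additive := by
  have : HasZeroObject C := hasZeroObject_of_hasFiniteBiproducts _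
  have : PreservesLimitsOfShape (Discrete.{0} PEmpty) (Ind.yoneda (C := C)) := by
    exact preservesLimitsOfShape_of_equiv (Discrete.equivalence (Equiv.equivPEmpty PEmpty)) _
  have : PreservesLimitsOfShape (Discrete WalkingPair) (Ind.yoneda (C := C)) := by
    exact preservesLimitsOfShape_of_equiv (Discrete.equivalence Equiv.ulift) _
  exact Functor.additive_of_preserves_binary_products _

variable {k : Type w} [Field k] [Linear k C]

lemma elMap_indScalar (a : k) {M : Ind C} {P : C} (m : El M P) :
    elMap (indScalar a M) m = m.res (a • 𝟙 P) :=
  congrArg (fun t => t.hom m) (indToAb_map_indScalar_app a M (op P))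

lemma smul_eq_indScalar (a : k) {M N : Ind C} (φ : M ⟶ N) : a • φ = φ ≫ indScalar a N :=
  Linear.smulOfRingMorphism_smul_eq' ..

lemma elMap_smul (a : k) {M N : Ind C} (φ : M ⟶ N) {P : C} (m : El M P) :
    elMap (a • φ) m = (elMap φ m).res (a • 𝟙 P) := by
  rw [smul_eq_indScalar, elMap_comp, elMap_indScalar]

instance yonedaLinear : (Ind.yoneda (C := C)).Linear k where
  map_smul f a := yoneda_hom_ext (by
    rw [elMap_smul, elMap_yoneda_map, elMap_yoneda_map, elOfHom_res]; simp)

variable [MonoidalCategory C] [EssentiallySmall.{v} C] [MonoidalPreadditive C]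

/-- The zero morphism factors through the image of the zero endomorphism of `P`, and whiskering in
`C` preserves zero. -/
lemma zero_whiskerRight_yoneda {M : Ind C} (P Q : C) :
    (0 : Ind.yoneda.obj P ⟶ M) ▷ Ind.yoneda.obj Q = 0 := by
  have h : (0 : Ind.yoneda.obj P ⟶ M) = Ind.yoneda.map (0 : P ⟶ P) ≫ 0 := by simp
  rw [h, comp_whiskerRight, ← cancel_epi (Functor.OplaxMonoidal.δ Ind.yoneda P Q),
    Functor.OplaxMonoidal.δ_natural_left_assoc]
  simp

/-- The sum is the restriction of the morphism `c` on `P ⊞ P` with components `a` and `b` along `inl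
+ inr`, and for morphisms of `C` whiskering is additive. -/
lemma add_whiskerRight_yoneda {M : Ind C} {P : C} (a b : Ind.yoneda.obj P ⟶ M) (Q : C) :
    (a + b) ▷ Ind.yoneda.obj Q = a ▷ _ + b ▷ _ := by
  set c := Ind.yoneda.map biprod.fst ≫ a + Ind.yoneda.map biprod.snd ≫ b with hc
  have h₁ : Ind.yoneda.map biprod.inl ≫ c = a := by
    rw [hc, Preadditive.comp_add, ← Category.assoc, ← Category.assoc, ← Functor.map_comp,
      ← Functor.map_comp]
    simp
  have h₂ : Ind.yoneda.map biprod.inr ≫ c = b := by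
    rw [hc, Preadditive.comp_add, ← Category.assoc, ← Category.assoc, ← Functor.map_comp,
      ← Functor.map_comp]
    simp
  have h₃ : a + b = Ind.yoneda.map (biprod.inl + biprod.inr) ≫ c := by
    rw [Functor.map_add, Preadditive.add_comp, h₁, h₂]
  rw [h₃, comp_whiskerRight, ← h₁, ← h₂, comp_whiskerRight, comp_whiskerRight, ← Preadditive.add_comp]
  congr 1
  rw [← cancel_epi (Functor.OplaxMonoidal.δ Ind.yoneda P Q), Preadditive.comp_add,
    Functor.OplaxMonoidal.δ_natural_left, Functor.OplaxMonoidal.δ_natural_left,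
    Functor.OplaxMonoidal.δ_natural_left, ← Preadditive.add_comp, ← Functor.map_add,
    MonoidalPreadditive.add_whiskerRight]

variable [SymmetricCategory C]

/-- Morphisms out of a tensor product are tested on generalised elements with representable sources,
which reduces right whiskering to the two lemmas above; left whiskering follows by the braiding. -/
instance indMonoidalPreadditive : MonoidalPreadditive (Ind C) := by
  have h₀ (M M' N : Ind C) : (0 : M ⟶ M') ▷ N = 0 := by
    refine tensor_hom_ext_left fun P x => tensor_hom_ext_right fun Q z => ?_
    rw [← comp_whiskerRight, comp_zero, whisker_exchange, zero_whiskerRight_yoneda]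
    simp
  have h₁ (M M' N : Ind C) (a b : M ⟶ M') : (a + b) ▷ N = a ▷ N + b ▷ N := by
    refine tensor_hom_ext_left fun P x => tensor_hom_ext_right fun Q z => ?_
    rw [← comp_whiskerRight, Preadditive.comp_add, whisker_exchange, add_whiskerRight_yoneda,
      Preadditive.add_comp, ← whisker_exchange, ← whisker_exchange]
    simp
  have hβ {M N N' : Ind C} (f : N ⟶ N') : M ◁ f = (β_ _ _).hom ≫ f ▷ M ≫ (β_ _ _).hom := by simp
  refine ⟨fun {X Y Z} => ?_, fun {X Y Z} => h₀ _ _ _, fun f g => ?_, fun f g => h₁ _ _ _ _ _⟩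
  · rw [hβ, h₀]; simp
  · rw [hβ, h₁]; simp

variable [MonoidalLinear k C]

instance indMonoidalLinear : MonoidalLinear k (Ind C) where
  whiskerLeft_smul M N N' a f := by
    rw [smul_eq_indScalar, smul_eq_indScalar, whiskerLeft_comp]
    congr 1
    refine tensor_hom_ext fun P Q m n => ?_
    rw [elMap_whiskerLeft, elMap_indScalar, elMap_indScalar, ← El.res_id m, tmul_res]
    simp
  smul_whiskerRight a M M' f N := by
    rw [smul_eq_indScalar, smul_eq_indScalar, comp_whiskerRight]
    congr 1
    refine tensor_hom_ext fun P Q m n => ?_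
    rw [elMap_whiskerRight, elMap_indScalar, elMap_indScalar, ← El.res_id n, tmul_res]
    simp

end linear
end IndTensor
/-! ### Rigid abelian categories -/

namespace TensorCat

section rigid
variable {C : Type u} [Category.{v} C] [MonoidalCategory C] [SymmetricCategory C]

/-- Tensoring with a dualisable object is a right adjoint, and after swapping the pairing by the
braiding also a left adjoint; the epimorphism version uses the latter. -/
lemma whiskerLeft_mono_of_exactPairing (X Y : C) [ExactPairing X Y] {Z W : C} (f : Z ⟶ W) [Mono f] :
    Mono (X ◁ f) :=
  have := (tensorLeftAdjunction X Y).isRightAdjoint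
  inferInstanceAs (Mono ((tensorLeft X).map f))

lemma whiskerLeft_epi_of_exactPairing (X Y : C) [ExactPairing X Y] {Z W : C} (f : Z ⟶ W) [Epi f] :
    Epi (X ◁ f) :=
  let := BraidedCategory.exactPairing_swap X Y
  have := (tensorLeftAdjunction Y X).isLeftAdjoint
  inferInstanceAs (Epi ((tensorLeft X).map f))

lemma whiskerRight_mono_of_exactPairing (X Y : C) [ExactPairing X Y] {Z W : C} (f : Z ⟶ W)
    [Mono f] : Mono (f ▷ X) := by
  have := whiskerLeft_mono_of_exactPairing X Y f
  have h : f ▷ X = (β_ _ _).hom ≫ X ◁ f ≫ (β_ _ _).hom := by simp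
  rw [h]
  infer_instance

lemma whiskerRight_epi_of_exactPairing (X Y : C) [ExactPairing X Y] {Z W : C} (f : Z ⟶ W)
    [Epi f] : Epi (f ▷ X) := by
  have := whiskerLeft_epi_of_exactPairing X Y f
  have h : f ▷ X = (β_ _ _).hom ≫ X ◁ f ≫ (β_ _ _).hom := by simp
  rw [h]
  infer_instance

/-- The transpose of a morphism out of the unit. -/
def coTranspose {X Y : C} [ExactPairing X Y] (u : 𝟙_ C ⟶ X) : Y ⟶ 𝟙_ C :=
  (ρ_ Y).inv ≫ Y ◁ u ≫ ε_ X Y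

variable [Preadditive C] [MonoidalPreadditive C]

/-- Transposition is a bijection that preserves zero, so only the zero morphism has zero transpose.
-/
lemma coTranspose_ne_zero {X Y : C} [ExactPairing X Y] {u : 𝟙_ C ⟶ X} (hu : u ≠ 0) :
    coTranspose u (Y := Y) ≠ 0 := by
  intro h
  apply hu
  have h₁ : Y ◁ u ≫ ε_ X Y = 0 := by
    rw [← cancel_epi (ρ_ Y).inv, comp_zero]
    exact h
  have h₂ : (tensorLeftHomEquiv (𝟙_ C) X Y (𝟙_ C)).symm (u ≫ (ρ_ X).inv) = 0 := by
    rw [tensorLeftHomEquiv_symm_naturality]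
    have : (tensorLeftHomEquiv X X Y (𝟙_ C)).symm (ρ_ X).inv = ε_ X Y := by
      simp [tensorLeftHomEquiv, unitors_equal]
    rw [this, h₁]
  have h₃ : u ≫ (ρ_ X).inv = 0 := by
    rw [Equiv.symm_apply_eq] at h₂
    rw [h₂]
    simp [tensorLeftHomEquiv]
  simpa using h₃

/-- By a triangle identity `Z` is a retract of `Z ⊗ Y ⊗ Z`; hence `X ⊗ Z` is a retract of an object
with `X ⊗ Y` as a tensor factor. -/
lemma id_eq_zero_of_exactPairing {X Y Z : C} [ExactPairing Y Z] (h : 𝟙 (X ⊗ Y) = 0) :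
    𝟙 (X ⊗ Z) = 0 := by
  let e : X ⊗ (Z ⊗ Y) ⊗ Z ≅ (X ⊗ Y) ⊗ (Z ⊗ Z) :=
    whiskerLeftIso X (whiskerRightIso (β_ Z Y) Z ≪≫ α_ _ _ _) ≪≫ (α_ _ _ _).symm
  have h₀ : 𝟙 ((X ⊗ Y) ⊗ (Z ⊗ Z)) = 0 := by
    rw [← id_whiskerRight, h, MonoidalPreadditive.zero_whiskerRight]
  have h₁ : 𝟙 (X ⊗ (Z ⊗ Y) ⊗ Z) = 0 := by
    rw [← e.hom_inv_id, ← Category.id_comp e.inv, h₀, zero_comp, comp_zero]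
  have h₂ := ExactPairing.coevaluation_evaluation Y Z
  have h₃ : 𝟙 Z = ((ρ_ Z).inv ≫ Z ◁ η_ Y Z ≫ (α_ Z Y Z).inv) ≫ (ε_ Y Z ▷ Z ≫ (λ_ Z).hom) := by
    simp [reassoc_of% h₂]
  rw [← whiskerLeft_id, h₃, whiskerLeft_comp, ← Category.comp_id (X ◁ ((ρ_ Z).inv ≫ _)), h₁,
    comp_zero, zero_comp]

end rigid

/-! ### Simplicity of the unit of a tensor category. -/

section unit
variable {k : Type w} [Field k] {C : Type u} [Category.{v} C] [EssentiallySmall.{v} C]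
  [Preadditive C] [IsAbelian C] [Linear k C] [MonoidalCategory C] [SymmetricCategory C]
  [MonoidalPreadditive C] [MonoidalLinear k C]

/-- Non-zero subobjects of the unit of a tensor category are everything. -/
lemma IsTensorCategory.epi_of_mono_unit (hC : IsTensorCategory k C) {J : C} (i : J ⟶ 𝟙_ C) [Mono i]
    (hi : i ≠ 0) : Epi i := by
  let := abelianOfIsAbelian C
  let Q := cokernel i
  let q : 𝟙_ C ⟶ Q := cokernel.π i
  obtain ⟨J', ⟨_⟩⟩ := hC.dualisable J
  obtain ⟨Q', ⟨_⟩⟩ := hC.dualisable Q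
  -- The monomorphism `i ▷ Q` is zero: precomposed with the epimorphism `J ◁ q` it becomes, up to
  -- unitors, `i` followed by its own cokernel.
  have hJQ : 𝟙 (J ⊗ Q) = 0 := by
    have : Mono (i ▷ Q) := whiskerRight_mono_of_exactPairing Q Q' i
    have : Epi (J ◁ q) := whiskerLeft_epi_of_exactPairing J J' q
    have h : i ▷ Q = 0 := by
      rw [← cancel_epi (J ◁ q), whisker_exchange, ← cancel_mono (λ_ Q).hom, Category.assoc,
        leftUnitor_naturality, unitors_equal, ← Category.assoc, rightUnitor_naturality,
        Category.assoc, cokernel.condition]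
      simp
    rw [← cancel_mono (i ▷ Q), h, comp_zero, comp_zero]
  have hJQ' : 𝟙 (J ⊗ Q') = 0 := id_eq_zero_of_exactPairing hJQ
  -- Since `J ⊗ Q'` vanishes, tensoring the cokernel sequence of `i` with `Q'` makes `q ▷ Q'` an
  -- isomorphism, with inverse `r`.
  obtain ⟨r, hr⟩ : ∃ r : Q ⊗ Q' ⟶ 𝟙_ C ⊗ Q', q ▷ Q' ≫ r = 𝟙 _ := by
    have := hC.rightExact_right Q'
    have h : i ▷ Q' = 0 := by rw [← Category.id_comp (i ▷ Q'), hJQ', zero_comp]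
    let c := isColimitOfPreserves (tensorRight Q') (cokernelIsCokernel i)
    refine ⟨c.desc ⟨_, { app := fun | .zero => 0 | .one => 𝟙 _, naturality := ?_ }⟩, c.fac _ .one⟩
    rintro _ _ (_ | _ | _)
    · simpa using h
    · simp
    · simp
  have : Epi (q ▷ Q') := by
    let := BraidedCategory.exactPairing_swap Q Q'
    exact whiskerRight_epi_of_exactPairing Q' Q q
  have hr' : r ≫ q ▷ Q' = 𝟙 _ := by
    rw [← cancel_epi (q ▷ Q'), reassoc_of% hr, Category.comp_id]
  -- Dually to `q` being an epimorphism, its transpose is a monomorphism.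
  let t : Q' ⟶ 𝟙_ C := coTranspose q
  have ht : Mono t := by
    refine Preadditive.mono_of_cancel_zero _ fun {Z} x hx => ?_
    obtain ⟨Z', ⟨_⟩⟩ := hC.dualisable Z
    have : Epi (Z ◁ q) := whiskerLeft_epi_of_exactPairing Z Z' q
    have h₁ : x ▷ Q ≫ ε_ Q Q' = 0 := by
      rw [← cancel_epi (Z ◁ q), whisker_exchange_assoc, comp_zero, ← cancel_epi (ρ_ Z).inv,
        comp_zero, ← rightUnitor_inv_naturality_assoc]
      exact hx
    have h₂ : (tensorRightHomEquiv Z Q Q' (𝟙_ C)).symm (x ≫ (λ_ Q').inv) = 0 := by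
      rw [tensorRightHomEquiv_symm_naturality]
      have : (tensorRightHomEquiv Q' Q Q' (𝟙_ C)).symm (λ_ Q').inv = ε_ Q Q' := by
        simp [tensorRightHomEquiv, ← unitors_equal]
      rw [this, h₁]
    rw [Equiv.symm_apply_eq] at h₂
    rw [← cancel_mono (λ_ Q').inv, h₂]
    simp [tensorRightHomEquiv]
  -- The composite of the coevaluation of `Q`, the isomorphism `r` and `t` is a scalar. If it is
  -- zero, the coevaluation vanishes, so `Q` vanishes and `i` is an epimorphism. Otherwise the unit
  -- is a retract of `Q'`, so `J` is a retract of `J ⊗ Q'`, which is zero, against `i ≠ 0`.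
  obtain ⟨c, hc⟩ := hC.scalars.2 ((η_ Q Q' ≫ r ≫ (λ_ Q').hom) ≫ t)
  by_cases h0 : c = 0
  · subst h0
    have h₁ : η_ Q Q' ≫ r ≫ (λ_ Q').hom = 0 := by
      rw [← cancel_mono t, ← hc]; simp
    have h₂ : η_ Q Q' = 0 := by
      have := congrArg (fun s => s ≫ (λ_ Q').inv ≫ q ▷ Q') h₁
      simpa [hr'] using this
    have h₃ : 𝟙 Q = 0 := by
      have := ExactPairing.evaluation_coevaluation Q Q'
      rw [h₂, MonoidalPreadditive.zero_whiskerRight, zero_comp] at this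
      rw [← cancel_epi (λ_ Q).hom, ← cancel_mono (ρ_ Q).inv, comp_zero, zero_comp, Category.comp_id,
        ← this]
    refine Preadditive.epi_of_cokernel_zero ?_
    rw [← Category.comp_id (cokernel.π i), h₃, comp_zero]
  · exfalso
    apply hi
    have h₁ : 𝟙 (J ⊗ 𝟙_ C) = 0 := by
      have h₂ : 𝟙 (𝟙_ C) = c⁻¹ • (η_ Q Q' ≫ r ≫ (λ_ Q').hom) ≫ t := by
        rw [← hc]
        simp [smul_smul, h0]
      rw [← whiskerLeft_id, h₂, MonoidalLinear.whiskerLeft_smul, whiskerLeft_comp,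
        ← Category.id_comp (J ◁ t), hJQ', zero_comp, comp_zero, smul_zero]
    rw [← cancel_epi (ρ_ J).hom, ← Category.id_comp (ρ_ J).hom, h₁]
    simp

/-- The unit of a tensor category is simple. -/
lemma IsTensorCategory.epi_to_unit (hC : IsTensorCategory k C) {P : C} (h : P ⟶ 𝟙_ C) (hh : h ≠ 0) :
    Epi h := by
  let := abelianOfIsAbelian C
  have : Epi (Abelian.image.ι h) := hC.epi_of_mono_unit _ (fun h0 => hh (by
    rw [← Abelian.image.fac h, h0, comp_zero]))
  rw [← Abelian.image.fac h]
  infer_instance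

end unit
end TensorCat
/-! ### Left exact presheaves and non-vanishing of tensor products -/

namespace IndTensor

section lex
variable {C : Type u} [Category.{v} C] [EssentiallySmall.{v} C] [HasFiniteColimits C]

/-- Left exact presheaves on an essentially small category are ind-objects. -/
lemma isIndObject_of_lex (G : Cᵒᵖ ⥤ Type v) [PreservesFiniteLimits G] : IsIndObject G := by
  have : IsFiltered (CostructuredArrow yoneda G) :=
    isFiltered_costructuredArrow_yoneda_of_preservesFiniteLimits G
  refine (isIndObject_iff G).2 ⟨this, ?_⟩
  let e := equivSmallModel.{v} C
  let f : (Σ a : SmallModel.{v} C, G.obj (op (e.inverse.obj a))) → CostructuredArrow yoneda G :=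
    fun x => CostructuredArrow.mk (yonedaEquiv.symm x.2)
  refine finallySmall_of_small_weakly_terminal_set (Set.range f) fun i => ?_
  let i' := e.unitIso.app i.left
  refine ⟨_, ⟨⟨e.functor.obj i.left, G.map i'.inv.op (yonedaEquiv i.hom)⟩, rfl⟩,
    ⟨CostructuredArrow.homMk i'.hom ?_⟩⟩
  apply yonedaEquiv.injective
  change yonedaEquiv (yoneda.map i'.hom ≫ yonedaEquiv.symm _) = yonedaEquiv i.hom
  rw [← yonedaEquiv_naturality, Equiv.apply_symm_apply, ← ConcreteCategory.comp_apply,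
    ← Functor.map_comp, ← op_comp, Iso.hom_inv_id]
  simp

variable {E : Type u₁} [Category.{v} E] (F : C ⥤ E) [PreservesFiniteColimits F]

/-- The functor to ind-objects right adjoint to a right exact functor: the elements of the value
at `Z` are the morphisms `F P ⟶ Z`. -/
def adj : E ⥤ Ind C :=
  ObjectProperty.lift IsIndObject (yoneda ⋙ (Functor.whiskeringLeft _ _ _).obj F.op) (fun Z =>
    have := preservesFiniteLimits_op F
    have : PreservesFiniteLimits (F.op ⋙ yoneda.obj Z) := comp_preservesFiniteLimits _ _
    isIndObject_of_lex (F.op ⋙ yoneda.obj Z)) ⋙ (Ind.equivalence C).inverse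

/-- The presheaf underlying the right adjoint. -/
def adjCompInclusion :
    adj F ⋙ Ind.inclusion C ≅ yoneda ⋙ (Functor.whiskeringLeft _ _ _).obj F.op :=
  Functor.isoWhiskerLeft (ObjectProperty.lift IsIndObject _ _)
    (Functor.isoWhiskerRight (Ind.equivalence C).counitIso (ObjectProperty.ι _))

variable {F}

/-- The element of the right adjoint corresponding to a morphism. -/
def elAdj {P : C} {Z : E} (a : F.obj P ⟶ Z) : El ((adj F).obj Z) P :=
  ((adjCompInclusion F).inv.app Z).app (op P) a

/-- The morphism corresponding to an element of the right adjoint. -/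
def homAdj {P : C} {Z : E} (m : El ((adj F).obj Z) P) : F.obj P ⟶ Z :=
  ((adjCompInclusion F).hom.app Z).app (op P) m

@[simp]
lemma homAdj_elAdj {P : C} {Z : E} (a : F.obj P ⟶ Z) : homAdj (elAdj a) = a :=
  congrArg (fun t => (t.app (op P)).hom a) ((adjCompInclusion F).inv_hom_id_app Z)

@[simp]
lemma elAdj_homAdj {P : C} {Z : E} (m : El ((adj F).obj Z) P) : elAdj (homAdj m) = m :=
  congrArg (fun t => (t.app (op P)).hom m) ((adjCompInclusion F).hom_inv_id_app Z)

lemma elAdj_res {P Q : C} {Z : E} (a : F.obj P ⟶ Z) (g : Q ⟶ P) :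
    (elAdj a).res g = elAdj (F.map g ≫ a) :=
  (congrArg (fun t => t.hom a) (((adjCompInclusion F).inv.app Z).naturality g.op)).symm

lemma homAdj_res {P Q : C} {Z : E} (m : El ((adj F).obj Z) P) (g : Q ⟶ P) :
    homAdj (m.res g) = F.map g ≫ homAdj m := by
  rw [← elAdj_homAdj m, elAdj_res, homAdj_elAdj, homAdj_elAdj]

lemma elMap_adj {P : C} {Z Z' : E} (φ : Z ⟶ Z') (a : F.obj P ⟶ Z) :
    elMap ((adj F).map φ) (elAdj a) = elAdj (a ≫ φ) :=
  (congrArg (fun t => (t.app (op P)).hom a) ((adjCompInclusion F).inv.naturality φ)).symm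

end lex

/-! ### Linearity of the right adjoint. -/

section additive
attribute [local instance] indPreadditive indLinear HasFiniteBiproducts.of_hasFiniteProducts
  hasBinaryBiproducts_of_finite_biproducts
variable {C : Type u} [Category.{v} C] [Preadditive C] [HasFiniteProducts C]

instance (M : Ind C) (P : C) : AddCommGroup (El M P) :=
  inferInstanceAs (AddCommGroup (((indToAb C).obj M).obj (op P)))

lemma El.res_add {M : Ind C} {P Q : C} (m : El M P) (f g : Q ⟶ P) :
    m.res (f + g) = m.res f + m.res g :=
  congrArg (fun t => t.hom m) (((indToAb C).obj M).map_add (f := f.op) (g := g.op))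

lemma elMap_add {M N : Ind C} (φ ψ : M ⟶ N) {P : C} (m : El M P) :
    elMap (φ + ψ) m = elMap φ m + elMap ψ m :=
  congrArg (fun t => (t.app (op P)).hom m) ((indToAb C).map_add (f := φ) (g := ψ))

variable [EssentiallySmall.{v} C] [HasFiniteColimits C]
  {E : Type u₁} [Category.{v} E] [Preadditive E] {F : C ⥤ E} [PreservesFiniteColimits F] [F.Additive]

/-- Restriction along a sum of morphisms of `C` computes sums of elements; this is applied to the
element at `P ⊞ P` with components `a` and `b`. -/
lemma elAdj_add {P : C} {Z : E} (a b : F.obj P ⟶ Z) : elAdj (a + b) = elAdj a + elAdj b := by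
  set c : El ((adj F).obj Z) (P ⊞ P) := elAdj (F.map biprod.fst ≫ a + F.map biprod.snd ≫ b) with hc
  have h := c.res_add biprod.inl biprod.inr
  rw [hc, elAdj_res, elAdj_res, elAdj_res] at h
  simpa [← Functor.map_comp_assoc] using h

instance : (adj F).Additive where
  map_add {Z Z'} φ ψ := by
    refine hom_ext_el fun P m => ?_
    rw [elMap_add, ← elAdj_homAdj m, elMap_adj, elMap_adj, elMap_adj, Preadditive.comp_add,
      elAdj_add]

variable {k : Type w} [Field k] [Linear k C] [Linear k E] [F.Linear k]

instance : (adj F).Linear k where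
  map_smul {Z Z'} φ a := by
    refine hom_ext_el fun P m => ?_
    rw [elMap_smul, ← elAdj_homAdj m, elMap_adj, elMap_adj, elAdj_res]
    simp

end additive

/-! ### Relations in tensor products of ind-objects at finite stages. -/

section compact
variable {C : Type u} [Category.{v} C] [EssentiallySmall.{v} C] [MonoidalCategory C]

/-- The product of two elements of presheaves. -/
def presheafTmul {G H : Cᵒᵖ ⥤ Type v} {P Q : C} (g : G.obj (op P)) (h : H.obj (op Q)) :
    ((convRight G).obj H).obj (op (P ⊗ Q)) :=
  ((tensor Cᵒᵖ).lanUnit.app (G ⊠ H)).app (op P, op Q) (g, h)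

lemma convRight_map_presheafTmul {G H H' : Cᵒᵖ ⥤ Type v} (φ : H ⟶ H') {P Q : C}
    (g : G.obj (op P)) (h : H.obj (op Q)) :
    ((convRight G).map φ).app _ (presheafTmul g h) = presheafTmul g (φ.app _ h) :=
  (congrArg (fun t => (t.app (op P, op Q)).hom (g, h)) ((tensor Cᵒᵖ).lanUnit.naturality
    (Functor.uncurry.map (((externalProductBifunctorCurried Cᵒᵖ Cᵒᵖ (Type v)).obj G).map φ)))).symm

lemma exists_tmul_eq_presheafTmul (M N : Ind C) :
    ∃ e : (convRight ((Ind.inclusion C).obj M)).obj ((Ind.inclusion C).obj N) ≅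
      (Ind.inclusion C).obj (M ⊗ N), ∀ (P Q : C) (m : El M P) (n : El N Q),
        e.hom.app (op (P ⊗ Q)) (presheafTmul m n) = tmul m n := by
  let := dayConvolution M N
  let G := (Ind.inclusion C).obj M ⊠ (Ind.inclusion C).obj N
  let e := Functor.leftKanExtensionUnique ((tensor Cᵒᵖ).lan.obj G) ((tensor Cᵒᵖ).lanUnit.app G) _
    (DayConvolution.unit ((Ind.inclusion C).obj M) ((Ind.inclusion C).obj N))
  refine ⟨e, fun P Q m n => ?_⟩
  have := Functor.descOfIsLeftKanExtension_fac_app ((tensor Cᵒᵖ).lan.obj G)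
    ((tensor Cᵒᵖ).lanUnit.app G) _ ((Iso.refl G).hom ≫
    (DayConvolution.unit ((Ind.inclusion C).obj M) ((Ind.inclusion C).obj N))) (op P, op Q)
  exact congrArg (fun t : G.obj (op P, op Q) ⟶ (tensor Cᵒᵖ ⋙ (Ind.inclusion C).obj (M ⊗ N)).obj
    (op P, op Q) => t.hom (m, n)) (this.trans (NatTrans.congr_app
    (Category.id_comp (DayConvolution.unit _ _)) _))

/-- Relations in a tensor product of ind-objects hold at a finite stage. -/
lemma exists_of_tmul_eq {M N : Ind C} {P Q : C} {m : El M P} {n n' : El N Q}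
    (h : tmul m n = tmul m n') : ∃ (Q' : C) (z : El N Q') (f f' : Q ⟶ Q'),
      z.res f = n ∧ z.res f' = n' ∧ tmul m (elOfHom f) = tmul m (elOfHom f') := by
  -- Present `N` as a filtered colimit of representables. Both elements come from one stage, and Day
  -- convolution with `M` commutes with this colimit, so the relation already holds at a later stage
  -- `j'`, whose object serves as `Q'`.
  let p := N.presentation
  let c := isColimitOfPreserves ((evaluation _ _).obj (op Q)) p.coconeIsColimit
  obtain ⟨j, x, x', hx, hx'⟩ := Types.FilteredColimit.jointly_surjective_of_isColimit₂ c n n'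
  have := pcR p.I ((Ind.inclusion C).obj M)
  let c' := isColimitOfPreserves ((evaluation _ _).obj (op (P ⊗ Q)))
    (isColimitOfPreserves (convRight ((Ind.inclusion C).obj M)) p.coconeIsColimit)
  obtain ⟨e, he⟩ := exists_tmul_eq_presheafTmul M N
  have h₁ : presheafTmul (G := (Ind.inclusion C).obj M) (H := (Ind.inclusion C).obj N) m n =
      presheafTmul (G := (Ind.inclusion C).obj M) (H := (Ind.inclusion C).obj N) m n' := by
    rw [← he, ← he] at h
    have h' := congrArg (fun t => e.inv.app _ t) h
    simpa [← ConcreteCategory.comp_apply, ← NatTrans.comp_app] using h'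
  obtain ⟨j', g, hg⟩ := (Types.FilteredColimit.isColimit_eq_iff' c'
    (presheafTmul (G := (Ind.inclusion C).obj M) (H := yoneda.obj (p.F.obj j)) m x)
    (presheafTmul (G := (Ind.inclusion C).obj M) (H := yoneda.obj (p.F.obj j)) m x')).1 (by
      refine ((convRight_map_presheafTmul _ _ _).trans ?_).trans
        (convRight_map_presheafTmul _ _ _).symm
      exact (congrArg _ hx).trans (h₁.trans (congrArg _ hx'.symm)))
  have hg' := ((convRight_map_presheafTmul (yoneda.map (p.F.map g)) m x).symm.trans hg).trans
    (convRight_map_presheafTmul (yoneda.map (p.F.map g)) m x')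
  obtain ⟨e', he'⟩ := exists_tmul_eq_presheafTmul M (Ind.yoneda.obj (p.F.obj j'))
  have key (y : Q ⟶ p.F.obj j') : tmul m (elOfHom y) = e'.hom.app (op (P ⊗ Q))
      (((convRight ((Ind.inclusion C).obj M)).map (Ind.yonedaCompInclusion.inv.app _)).app _
        (presheafTmul (G := (Ind.inclusion C).obj M) (H := yoneda.obj (p.F.obj j')) m y)) :=
    (he' P Q m (elOfHom y)).symm.trans
      (congrArg (e'.hom.app (op (P ⊗ Q))) (convRight_map_presheafTmul _ _ _).symm)
  have hz (y : Q ⟶ p.F.obj j) : El.res (M := N) ((p.ι.app j').app _ (𝟙 (p.F.obj j')))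
      (y ≫ p.F.map g) = (p.ι.app j).app _ y := by
    have h₂ := congrArg (fun t => t.hom (𝟙 (p.F.obj j')))
      ((p.ι.app j').naturality (y ≫ p.F.map g).op)
    have h₃ := congrArg (fun t => (t.app (op Q)).hom y) (p.ι.naturality g)
    refine h₂.symm.trans (Eq.trans ?_ h₃)
    change (p.ι.app j').app (op Q) ((y ≫ p.F.map g) ≫ 𝟙 _) =
      (p.ι.app j').app (op Q) (y ≫ p.F.map g)
    rw [Category.comp_id]
  refine ⟨p.F.obj j', (p.ι.app j').app _ (𝟙 _), x ≫ p.F.map g, x' ≫ p.F.map g, ?_, ?_, ?_⟩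
  · exact (hz x).trans hx
  · exact (hz x').trans hx'
  · rw [key, key]
    exact congrArg (fun t => e'.hom.app (op (P ⊗ Q)) (((convRight ((Ind.inclusion C).obj M)).map
      (Ind.yonedaCompInclusion.inv.app _)).app _ t)) hg'

end compact
end IndTensor

namespace TensorCat

/-! ### Non-vanishing of tensor products. -/

section nonvanishing
open IndTensor
attribute [local instance] indPreadditive indLinear
variable {k : Type w} [Field k] {C : Type u} [Category.{v} C] [EssentiallySmall.{v} C]
  [Preadditive C] [IsAbelian C] [Linear k C] [MonoidalCategory C] [SymmetricCategory C]
  [MonoidalPreadditive C] [MonoidalLinear k C]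

/-- Products of non-zero elements of degree zero are non-zero. -/
lemma IsTensorCategory.tensorHom_ne_zero (hC : IsTensorCategory k C) {M N : Ind C}
    {a : 𝟙_ (Ind C) ⟶ M} {b : 𝟙_ (Ind C) ⟶ N} (ha : a ≠ 0) (hb : b ≠ 0) : a ⊗ₘ b ≠ 0 := by
  let := abelianOfIsAbelian C
  intro h
  have h₀ : a ⊗ₘ b = a ⊗ₘ 0 := by rw [h, MonoidalCategory.tensorHom_def]; simp
  have h₁ : tmul (elMap a elUnit) (elMap b elUnit) = tmul (elMap a elUnit) (elMap 0 elUnit) := by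
    rw [← elMap_tensorHom, ← elMap_tensorHom, h₀]
  -- Apply this to `a ⊗ b = a ⊗ 0`: both `b` and `0` lift to morphisms from the unit to an object
  -- `Q` of `C`, with the same product with `a`. Their difference `g` is non-zero because `b` is.
  obtain ⟨Q, z, f, f', hf, hf', hff⟩ := exists_of_tmul_eq h₁
  obtain ⟨g, hg⟩ : ∃ g, g = f - f' := ⟨_, rfl⟩
  have hne : g ≠ 0 := by
    intro h0
    apply hb
    apply unit_hom_ext
    rw [← hf, ← hf', sub_eq_zero.1 (hg.symm.trans h0)]
  obtain ⟨Q', ⟨_⟩⟩ := hC.dualisable Q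
  -- The transpose of `g` is an epimorphism to the unit. The vanishing of `a ⊗ g` says that its
  -- tensor product with `a` is zero; cancelling it gives `a = 0`.
  have hepi := hC.epi_to_unit _ (coTranspose_ne_zero hne (Y := Q'))
  set u : 𝟙_ (Ind C) ⟶ Ind.yoneda.obj (𝟙_ C) := Functor.LaxMonoidal.ε _ with hu
  have hff' : a ⊗ₘ (u ≫ Ind.yoneda.map f) = a ⊗ₘ (u ≫ Ind.yoneda.map f') := by
    have huu : elMap u elUnit = elOfHom (𝟙 _) := by
      rw [← elMap_elHom_id elUnit, ← η_yoneda, ← elMap_comp, hu, Functor.Monoidal.η_ε, elMap_id]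
    have := congrArg elHom hff
    rw [← tmul_elHom, ← tmul_elHom, cancel_epi] at this
    have h₂ (y : 𝟙_ C ⟶ Q) : elHom (elOfHom y) = Ind.yoneda.map y := yoneda_hom_ext (by
      rw [elMap_elHom_id, elMap_yoneda_map, Category.id_comp])
    have h₃ : a = u ≫ elHom (elMap a elUnit) := unit_hom_ext (by simp [huu])
    rw [h₃, ← tensorHom_comp_tensorHom, ← tensorHom_comp_tensorHom, ← h₂, ← h₂, this]
  set w := u ≫ Ind.yoneda.map g with hw
  have h₄ : a ⊗ₘ w = 0 := by
    have h₅ (x y : 𝟙_ (Ind C) ⟶ Ind.yoneda.obj Q) : M ◁ (x - y) = M ◁ x - M ◁ y :=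
      (tensorLeft M).map_sub
    rw [hw, hg, Functor.map_sub, Preadditive.comp_sub, ← sub_eq_zero.2 hff',
      MonoidalCategory.tensorHom_def, MonoidalCategory.tensorHom_def,
      MonoidalCategory.tensorHom_def, h₅, Preadditive.comp_sub]
  have ht : Ind.yoneda.map (coTranspose g (Y := Q')) = (ρ_ (Ind.yoneda.obj Q')).inv ≫
      Ind.yoneda.obj Q' ◁ w ≫ Functor.LaxMonoidal.μ _ _ _ ≫ Ind.yoneda.map (ε_ Q Q') := by
    rw [coTranspose, Functor.map_comp, Functor.map_comp, Functor.Monoidal.map_rightUnitor_inv, hw,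
      hu]
    simp
  have h₅ : a ▷ (Ind.yoneda.obj Q' ⊗ 𝟙_ _) ≫ M ◁ Ind.yoneda.obj Q' ◁ w = 0 := by
    have h₆ : Ind.yoneda.obj Q' ◁ w = (β_ _ _).hom ≫ w ▷ Ind.yoneda.obj Q' ≫ (β_ _ _).hom := by
      simp
    have h₇ : a ▷ (𝟙_ _ ⊗ Ind.yoneda.obj Q') ≫ M ◁ w ▷ Ind.yoneda.obj Q' = 0 := by
      have := congrArg (fun t => (α_ _ _ _).inv ≫ t ▷ Ind.yoneda.obj Q' ≫ (α_ _ _ _).hom) h₄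
      simpa [MonoidalCategory.tensorHom_def] using this
    rw [h₆, whiskerLeft_comp, ← whisker_exchange_assoc, whiskerLeft_comp, reassoc_of% h₇]
    simp
  have h₈ : 𝟙_ _ ◁ Ind.yoneda.map (coTranspose g (Y := Q')) ≫ a ▷ Ind.yoneda.obj (𝟙_ C) =
      0 := by
    rw [whisker_exchange, ht, whiskerLeft_comp, ← whisker_exchange_assoc, whiskerLeft_comp,
      reassoc_of% h₅]
    simp
  have : Epi (𝟙_ (Ind C) ◁ Ind.yoneda.map (coTranspose g (Y := Q'))) := by
    rw [id_whiskerLeft]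
    infer_instance
  have h₉ : a ▷ Ind.yoneda.obj (𝟙_ C) = 0 := by
    rw [← cancel_epi (𝟙_ (Ind C) ◁ Ind.yoneda.map (coTranspose g (Y := Q'))), h₈, comp_zero]
  apply ha
  have h₁₀ : a ▷ 𝟙_ (Ind C) = 0 := by
    rw [← cancel_mono (M ◁ u), ← whisker_exchange, h₉]
    simp
  simpa using h₁₀

end nonvanishing
end TensorCat
/-! ### Kernels, cokernels and abelian categories -/

namespace TensorCat

section kernels
variable {E : Type u₁} [Category.{v₁} E] [Preadditive E]

/-- `ι` is a kernel of `f`. -/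
structure IsKer {K A B : E} (ι : K ⟶ A) (f : A ⟶ B) : Prop where
  cancel : ∀ ⦃W : E⦄ (w : W ⟶ K), w ≫ ι = 0 → w = 0
  comp : ι ≫ f = 0
  lift : ∀ ⦃W : E⦄ (w : W ⟶ A), w ≫ f = 0 → ∃ l, l ≫ ι = w

/-- `π` is a cokernel of `f`. -/
structure IsCok {A B Q : E} (f : A ⟶ B) (π : B ⟶ Q) : Prop where
  cancel : ∀ ⦃W : E⦄ (w : Q ⟶ W), π ≫ w = 0 → w = 0
  comp : f ≫ π = 0
  desc : ∀ ⦃W : E⦄ (w : B ⟶ W), f ≫ w = 0 → ∃ l, π ≫ l = w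

lemma IsKer.mono {K A B : E} {ι : K ⟶ A} {f : A ⟶ B} (h : IsKer ι f) : Mono ι :=
  Preadditive.mono_of_cancel_zero _ fun w hw => h.cancel w hw

lemma IsCok.epi {A B Q : E} {f : A ⟶ B} {π : B ⟶ Q} (h : IsCok f π) : Epi π :=
  Preadditive.epi_of_cancel_zero _ fun w hw => h.cancel w hw

/-- The limit cone of a kernel. -/
def IsKer.isLimit {K A B : E} {ι : K ⟶ A} {f : A ⟶ B} (h : IsKer ι f) :
    IsLimit (KernelFork.ofι ι h.comp) :=
  have := h.mono
  KernelFork.IsLimit.ofι' ι h.comp (fun w hw => ⟨(h.lift w hw).choose, (h.lift w hw).choose_spec⟩)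

/-- The colimit cocone of a cokernel. -/
def IsCok.isColimit {A B Q : E} {f : A ⟶ B} {π : B ⟶ Q} (h : IsCok f π) :
    IsColimit (CokernelCofork.ofπ π h.comp) :=
  have := h.epi
  CokernelCofork.IsColimit.ofπ' π h.comp
    (fun w hw => ⟨(h.desc w hw).choose, (h.desc w hw).choose_spec⟩)

lemma isKer_kernel {A B : E} (f : A ⟶ B) [HasKernel f] : IsKer (kernel.ι f) f where
  cancel _ w hw := by rw [← cancel_mono (kernel.ι f), hw, zero_comp]
  comp := kernel.condition f
  lift _ w hw := ⟨kernel.lift f w hw, kernel.lift_ι f w hw⟩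

lemma isCok_cokernel {A B : E} (f : A ⟶ B) [HasCokernel f] : IsCok f (cokernel.π f) where
  cancel _ w hw := by rw [← cancel_epi (cokernel.π f), hw, comp_zero]
  comp := cokernel.condition f
  desc _ w hw := ⟨cokernel.desc f w hw, cokernel.π_desc f w hw⟩

/-- `f` factors as a cokernel of its kernel followed by a kernel of its cokernel. -/
def HasCanonicalFactorization {A B : E} (f : A ⟶ B) : Prop :=
  ∃ (K Q I : E) (ι : K ⟶ A) (π : B ⟶ Q) (e : A ⟶ I) (m : I ⟶ B),
    e ≫ m = f ∧ IsKer ι f ∧ IsCok f π ∧ IsCok ι e ∧ IsKer m π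

/-- A monomorphism has zero kernel, so its coimage part is invertible and it is a kernel of its
cokernel; dually for epimorphisms. -/
lemma isAbelian_of_canonicalFactorization [HasFiniteProducts E]
    (h : ∀ ⦃A B : E⦄ (f : A ⟶ B), HasCanonicalFactorization f) : IsAbelian E where
  hasFiniteProducts := inferInstance
  hasKernels := ⟨fun {A B} f => by
    obtain ⟨K, Q, I, ι, π, e, m, rfl, h₁, h₂, h₃, h₄⟩ := h f
    exact ⟨⟨⟨_, h₁.isLimit⟩⟩⟩⟩
  hasCokernels := ⟨fun {A B} f => by
    obtain ⟨K, Q, I, ι, π, e, m, rfl, h₁, h₂, h₃, h₄⟩ := h f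
    exact ⟨⟨⟨_, h₂.isColimit⟩⟩⟩⟩
  normalMono := ⟨fun {A B} f _ => by
    obtain ⟨K, Q, I, ι, π, e, m, hf, h₁, h₂, h₃, h₄⟩ := h f
    have hι : ι = 0 := by rw [← cancel_mono f, h₁.comp, zero_comp]
    obtain ⟨l, hl⟩ := h₃.desc (𝟙 A) (by rw [hι, zero_comp])
    have hl' : l ≫ e = 𝟙 I := by
      have := h₃.epi
      rw [← cancel_epi e, reassoc_of% hl, Category.comp_id]
    have hk : IsKer f π := ⟨fun W w hw => by rw [← cancel_mono f, hw, zero_comp], h₂.comp,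
      fun W w hw => by
        obtain ⟨t, ht⟩ := h₄.lift w hw
        exact ⟨t ≫ l, by rw [← hf, Category.assoc, reassoc_of% hl', ht]⟩⟩
    exact ⟨⟨Q, π, hk.comp, hk.isLimit⟩⟩⟩
  normalEpi := ⟨fun {A B} f _ => by
    obtain ⟨K, Q, I, ι, π, e, m, hf, h₁, h₂, h₃, h₄⟩ := h f
    have hπ : π = 0 := by rw [← cancel_epi f, h₂.comp, comp_zero]
    obtain ⟨l, hl⟩ := h₄.lift (𝟙 B) (by rw [hπ, comp_zero])
    have hl' : m ≫ l = 𝟙 I := by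
      have := h₄.mono
      rw [← cancel_mono m, Category.assoc, hl, Category.comp_id, Category.id_comp]
    have hk : IsCok ι f := ⟨fun W w hw => by rw [← cancel_epi f, hw, comp_zero], h₁.comp,
      fun W w hw => by
        obtain ⟨t, ht⟩ := h₃.desc w hw
        exact ⟨l ≫ t, by rw [← hf, Category.assoc, reassoc_of% hl', ht]⟩⟩
    exact ⟨⟨K, ι, hk.comp, hk.isColimit⟩⟩⟩

lemma hasCanonicalFactorization [IsAbelian E] {A B : E} (f : A ⟶ B) :
    HasCanonicalFactorization f := by
  let := abelianOfIsAbelian E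
  refine ⟨_, _, _, kernel.ι f, cokernel.π f, Abelian.factorThruImage f, Abelian.image.ι f,
    Abelian.image.fac f, isKer_kernel f, isCok_cokernel f, ⟨fun W w hw => ?_, ?_, fun W w hw => ?_⟩,
    isKer_kernel _⟩
  · rw [← cancel_epi (Abelian.factorThruImage f), hw, comp_zero]
  · rw [← cancel_mono (Abelian.image.ι f), Category.assoc, Abelian.image.fac, kernel.condition,
      zero_comp]
  · have h : kernel.ι (Abelian.factorThruImage f) ≫ w = 0 := by
      have : kernel.ι (Abelian.factorThruImage f) ≫ f = 0 := by
        have h := Abelian.image.fac f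
        calc _ = kernel.ι (Abelian.factorThruImage f) ≫ Abelian.factorThruImage f ≫
              Abelian.image.ι f := by rw [h]
          _ = 0 := by rw [kernel.condition_assoc, zero_comp]
      rw [← kernel.lift_ι f _ this, Category.assoc, hw, comp_zero]
    exact ⟨_, Abelian.comp_epiDesc _ _ h⟩

/-- Stated with elementary kernels and cokernels, so that it applies to a target category not yet
known to be abelian. -/
lemma HasCanonicalFactorization.map {E' : Type u₂} [Category.{v₂} E'] [Preadditive E'] (F : E ⥤ E')
    (hK : ∀ ⦃K A B : E⦄ (ι : K ⟶ A) (f : A ⟶ B), IsKer ι f → IsKer (F.map ι) (F.map f))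
    (hC : ∀ ⦃A B Q : E⦄ (f : A ⟶ B) (π : B ⟶ Q), IsCok f π → IsCok (F.map f) (F.map π))
    {A B : E} {f : A ⟶ B} (h : HasCanonicalFactorization f) :
    HasCanonicalFactorization (F.map f) := by
  obtain ⟨K, Q, I, ι, π, e, m, rfl, h₁, h₂, h₃, h₄⟩ := h
  exact ⟨_, _, _, F.map ι, F.map π, F.map e, F.map m, (F.map_comp _ _).symm, hK _ _ h₁, hC _ _ h₂,
    hC _ _ h₃, hK _ _ h₄⟩

namespace DirectSum

/-- The direct sum of two morphisms. -/
def mapHom {A₁ A₂ A B₁ B₂ B : E} (dA : DirectSum A₁ A₂ A) (dB : DirectSum B₁ B₂ B) (f₁ : A₁ ⟶ B₁)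
    (f₂ : A₂ ⟶ B₂) : A ⟶ B := dA.fst ≫ f₁ ≫ dB.inl + dA.snd ≫ f₂ ≫ dB.inr

variable {A₁ A₂ A B₁ B₂ B C₁ C₂ C : E} (dA : DirectSum A₁ A₂ A) (dB : DirectSum B₁ B₂ B)
  (dC : DirectSum C₁ C₂ C) (f₁ : A₁ ⟶ B₁) (f₂ : A₂ ⟶ B₂) (g₁ : B₁ ⟶ C₁) (g₂ : B₂ ⟶ C₂)

@[simp]
lemma inl_mapHom : dA.inl ≫ dA.mapHom dB f₁ f₂ = f₁ ≫ dB.inl := by simp [mapHom]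

@[simp]
lemma inr_mapHom : dA.inr ≫ dA.mapHom dB f₁ f₂ = f₂ ≫ dB.inr := by simp [mapHom]

@[simp]
lemma mapHom_fst : dA.mapHom dB f₁ f₂ ≫ dB.fst = dA.fst ≫ f₁ := by simp [mapHom]

@[simp]
lemma mapHom_snd : dA.mapHom dB f₁ f₂ ≫ dB.snd = dA.snd ≫ f₂ := by simp [mapHom]

lemma mapHom_comp : dA.mapHom dB f₁ f₂ ≫ dB.mapHom dC g₁ g₂ = dA.mapHom dC (f₁ ≫ g₁) (f₂ ≫ g₂) := by
  simp [mapHom]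

lemma hom_ext' {W : E} {f g : W ⟶ A} (h₁ : f ≫ dA.fst = g ≫ dA.fst) (h₂ : f ≫ dA.snd = g ≫ dA.snd) :
    f = g := by
  rw [← Category.comp_id f, ← Category.comp_id g, ← dA.total, Preadditive.comp_add,
    Preadditive.comp_add, reassoc_of% h₁, reassoc_of% h₂]

lemma mapHom_zero : dA.mapHom dB (0 : A₁ ⟶ B₁) (0 : A₂ ⟶ B₂) = 0 := by simp [mapHom]

variable {dA dB dC f₁ f₂ g₁ g₂}

lemma isKer (h₁ : IsKer f₁ g₁) (h₂ : IsKer f₂ g₂) :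
    IsKer (dA.mapHom dB f₁ f₂) (dB.mapHom dC g₁ g₂) where
  cancel W w hw := by
    refine dA.hom_ext' ?_ ?_
    · rw [zero_comp]
      exact h₁.cancel _ (by rw [Category.assoc, ← dA.mapHom_fst dB f₁ f₂, reassoc_of% hw, zero_comp])
    · rw [zero_comp]
      exact h₂.cancel _ (by rw [Category.assoc, ← dA.mapHom_snd dB f₁ f₂, reassoc_of% hw, zero_comp])
  comp := by rw [mapHom_comp, h₁.comp, h₂.comp, mapHom_zero]
  lift W w hw := by
    obtain ⟨l₁, hl₁⟩ := h₁.lift (w ≫ dB.fst) (by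
      rw [Category.assoc, ← dB.mapHom_fst dC g₁ g₂, reassoc_of% hw, zero_comp])
    obtain ⟨l₂, hl₂⟩ := h₂.lift (w ≫ dB.snd) (by
      rw [Category.assoc, ← dB.mapHom_snd dC g₁ g₂, reassoc_of% hw, zero_comp])
    exact ⟨l₁ ≫ dA.inl + l₂ ≫ dA.inr, dB.hom_ext' (by simp [hl₁]) (by simp [hl₂])⟩

lemma isCok (h₁ : IsCok f₁ g₁) (h₂ : IsCok f₂ g₂) :
    IsCok (dA.mapHom dB f₁ f₂) (dB.mapHom dC g₁ g₂) where
  cancel W w hw := by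
    refine dC.hom_ext ?_ ?_
    · rw [comp_zero]
      exact h₁.cancel _ (by rw [← Category.assoc, ← dB.inl_mapHom dC g₁ g₂, Category.assoc, hw,
        comp_zero])
    · rw [comp_zero]
      exact h₂.cancel _ (by rw [← Category.assoc, ← dB.inr_mapHom dC g₁ g₂, Category.assoc, hw,
        comp_zero])
  comp := by rw [mapHom_comp, h₁.comp, h₂.comp, mapHom_zero]
  desc W w hw := by
    obtain ⟨l₁, hl₁⟩ := h₁.desc (dB.inl ≫ w) (by
      rw [← Category.assoc, ← dA.inl_mapHom dB f₁ f₂, Category.assoc, hw, comp_zero])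
    obtain ⟨l₂, hl₂⟩ := h₂.desc (dB.inr ≫ w) (by
      rw [← Category.assoc, ← dA.inr_mapHom dB f₁ f₂, Category.assoc, hw, comp_zero])
    refine ⟨dC.fst ≫ l₁ + dC.snd ≫ l₂, dB.hom_ext ?_ ?_⟩
    · rw [← Category.assoc, inl_mapHom]; simp [hl₁]
    · rw [← Category.assoc, inr_mapHom]; simp [hl₂]

end DirectSum

/-- Direct sums exist. -/
def HasDirectSums (E : Type u₁) [Category.{v₁} E] [Preadditive E] : Prop :=
  ∀ A B : E, ∃ C, Nonempty (DirectSum A B C)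

lemma hasFiniteProducts_of_hasDirectSums (hE : HasDirectSums E) {Z : E} (hZ : 𝟙 Z = 0) :
    HasFiniteProducts E := by
  have : HasBinaryBiproducts E := ⟨fun A B => by
    obtain ⟨C, ⟨d⟩⟩ := hE A B
    exact d.hasBinaryBiproduct⟩
  have : HasZeroObject E := ⟨⟨Z, (IsZero.iff_id_eq_zero Z).2 hZ⟩⟩
  exact hasFiniteProducts_of_has_binary_and_terminal

lemma HasCanonicalFactorization.directSum (hE : HasDirectSums E) {A₁ A₂ A B₁ B₂ B : E}
    (dA : DirectSum A₁ A₂ A) (dB : DirectSum B₁ B₂ B) {f₁ : A₁ ⟶ B₁} {f₂ : A₂ ⟶ B₂}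
    (h₁ : HasCanonicalFactorization f₁) (h₂ : HasCanonicalFactorization f₂) :
    HasCanonicalFactorization (dA.mapHom dB f₁ f₂) := by
  obtain ⟨K₁, Q₁, I₁, ι₁, π₁, e₁, m₁, rfl, hk₁, hc₁, he₁, hm₁⟩ := h₁
  obtain ⟨K₂, Q₂, I₂, ι₂, π₂, e₂, m₂, rfl, hk₂, hc₂, he₂, hm₂⟩ := h₂
  obtain ⟨K, ⟨dK⟩⟩ := hE K₁ K₂
  obtain ⟨Q, ⟨dQ⟩⟩ := hE Q₁ Q₂
  obtain ⟨I, ⟨dI⟩⟩ := hE I₁ I₂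
  exact ⟨K, Q, I, dK.mapHom dA ι₁ ι₂, dB.mapHom dQ π₁ π₂, dA.mapHom dI e₁ e₂, dI.mapHom dB m₁ m₂,
    DirectSum.mapHom_comp .., DirectSum.isKer hk₁ hk₂, DirectSum.isCok hc₁ hc₂,
    DirectSum.isCok he₁ he₂, DirectSum.isKer hm₁ hm₂⟩

lemma hasCanonicalFactorization_of_id_eq_zero {A B : E} (hA : 𝟙 A = 0) (hB : 𝟙 B = 0) (f : A ⟶ B) :
    HasCanonicalFactorization f := by
  have h (W : E) (w : W ⟶ A) : w = 0 := by rw [← Category.comp_id w, hA, comp_zero]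
  have h' (W : E) (w : A ⟶ W) : w = 0 := by rw [← Category.id_comp w, hA, zero_comp]
  have k (W : E) (w : W ⟶ B) : w = 0 := by rw [← Category.comp_id w, hB, comp_zero]
  have k' (W : E) (w : B ⟶ W) : w = 0 := by rw [← Category.id_comp w, hB, zero_comp]
  exact ⟨A, A, A, 𝟙 A, 0, 0, 0, (h' _ _).trans (h' _ _).symm, ⟨fun _ _ _ => h _ _, h' _ _,
    fun _ _ _ => ⟨0, (h _ _).trans (h _ _).symm⟩⟩, ⟨fun _ _ _ => h' _ _, h' _ _,
    fun _ _ _ => ⟨0, (k' _ _).trans (k' _ _).symm⟩⟩, ⟨fun _ _ _ => h' _ _, h' _ _,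
    fun _ _ _ => ⟨0, (h' _ _).trans (h' _ _).symm⟩⟩, ⟨fun _ _ _ => h _ _, h' _ _,
    fun _ _ _ => ⟨0, (k _ _).trans (k _ _).symm⟩⟩⟩

/-- Additive functors preserving cokernels are right exact. -/
lemma preservesFiniteColimits_of_isCok [IsAbelian E] {E' : Type u₂} [Category.{v₂} E']
    [Preadditive E'] [HasZeroObject E'] (F : E ⥤ E') [F.Additive]
    (hF : ∀ ⦃A B Q : E⦄ (f : A ⟶ B) (π : B ⟶ Q), IsCok f π → IsCok (F.map f) (F.map π)) :
    PreservesFiniteColimits F := by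
  let := abelianOfIsAbelian E
  have {X Y : E} (f : X ⟶ Y) : PreservesColimit (parallelPair f 0) F := by
    have h := isCok_cokernel f
    refine preservesColimit_of_preserves_colimit_cocone h.isColimit ?_
    exact (CokernelCofork.isColimitMapCoconeEquiv _ F).symm (hF f _ h).isColimit
  exact F.preservesFiniteColimits_of_preservesCokernels

/-- Additive functors from semisimple categories are right exact. -/
lemma preservesFiniteColimits_of_isRegular [IsAbelian E] (hE : ∀ ⦃X Y : E⦄ (f : X ⟶ Y), IsRegular f)
    {E' : Type u₂} [Category.{v₂} E'] [Preadditive E'] [HasZeroObject E'] (F : E ⥤ E')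
    [F.Additive] : PreservesFiniteColimits F := by
  refine preservesFiniteColimits_of_isCok F fun A B Q f π h => ?_
  obtain ⟨g, hg⟩ := hE f
  obtain ⟨l, hl⟩ := h.desc (𝟙 B - g ≫ f) (by simp [hg])
  have hl' : l ≫ π = 𝟙 Q := by
    have := h.epi
    rw [← cancel_epi π, reassoc_of% hl]
    simp [h.comp]
  refine ⟨fun W w hw => ?_, by rw [← F.map_comp, h.comp, F.map_zero], fun W w hw => ⟨F.map l ≫ w, ?_⟩⟩
  · rw [← Category.id_comp w, ← F.map_id, ← hl', F.map_comp, Category.assoc, hw, comp_zero]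
  · rw [← Category.assoc, ← F.map_comp, hl]
    simp [hw]

end kernels

/-! ### Semisimple categories as categories of finite sums of simple objects. -/

section semisimple
variable {k : Type w} [Field k] {V : Type u} [Category.{v} V] [Preadditive V] [IsAbelian V] [Linear k V]

lemma isSum_biproduct {n : ℕ} (S : Fin n → V) {P : ObjectProperty V} (hS : ∀ j, P (S j)) :
    IsSum P (⨁ S) := by
  induction n with
  | zero => exact .zero (biproduct.hom_ext _ _ (fun j => j.elim0))
  | succ n ih =>
    refine .add (hS 0) (ih (fun j => S j.succ) fun j => hS _)
      { inl := biproduct.ι S 0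
        inr := biproduct.desc fun j => biproduct.ι S j.succ
        fst := biproduct.π S 0
        snd := biproduct.lift fun j => biproduct.π S j.succ
        inl_fst := by simp
        inr_snd := ?_
        inl_snd := ?_
        inr_fst := ?_
        total := ?_ }
    · ext i j
      by_cases h : i = j
      · subst h; simp
      · have h' : j ≠ i := fun h' => h h'.symm
        simp [biproduct.ι_π_ne _ (fun h₂ => h' (Fin.succ_injective _ h₂)), biproduct.ι_π_ne _ h']
    · ext j
      simp [biproduct.ι_π_ne _ (Fin.succ_ne_zero j).symm]
    · ext j
      simp [biproduct.ι_π_ne _ (Fin.succ_ne_zero j)]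
    · rw [← biproduct.total, Fin.sum_univ_succ, biproduct.lift_desc]

lemma IsSchurianSemisimple.isSum (hV : IsSchurianSemisimple k V) (X : V) :
    IsSum (fun S => Simple S) X := by
  obtain ⟨n, S, i, hS, ⟨h⟩⟩ := hV.semisimple X
  exact (isSum_biproduct S hS).of_iso ((biproduct.isColimit S).coconePointUniqueUpToIso h)

lemma zeroOrIso_simple : ZeroOrIso (fun S : V => Simple S) := fun _ _ h h' f => by
  have : Simple _ := h
  have : Simple _ := h'
  by_cases hf : f = 0
  · exact .inl hf
  · exact .inr (isIso_of_hom_simple hf)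

lemma IsSchurianSemisimple.isRegular (hV : IsSchurianSemisimple k V) {X Y : V} (f : X ⟶ Y) :
    IsRegular f :=
  (hV.isSum X).isRegular zeroOrIso_simple (hV.isSum Y) f

end semisimple

/-! ### Duals of retracts. -/

section dual
variable {C : Type u} [Category.{v} C] [MonoidalCategory C]

/-- Retracts of dualisable objects are dualisable. -/
lemma exists_exactPairing_of_retract [IsIdempotentComplete C] {P Y Y' : C} [ExactPairing Y Y']
    (h : Retract P Y) : ∃ P', Nonempty (ExactPairing P P') := by
  let : HasRightDual Y := ⟨Y'⟩
  let e : Y ⟶ Y := h.r ≫ h.i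
  -- The dual of the idempotent defining the retract is again idempotent. The object splitting it is
  -- the dual of `P`, with the pairing restricted from that of `Y` and `Y'`.
  let e' : Y' ⟶ Y' := rightAdjointMate e
  have he : e ≫ e = e := by simp [e]
  have he' : e' ≫ e' = e' := by
    rw [← comp_rightAdjointMate, he]
  have h₁ : e' ▷ Y ≫ ε_ Y Y' = Y' ◁ e ≫ ε_ Y Y' := rightAdjointMate_comp_evaluation e
  have h₂ : η_ Y Y' ≫ Y ◁ e' = η_ Y Y' ≫ e ▷ Y' := coevaluation_comp_rightAdjointMate e
  obtain ⟨P', i, r, hir, hri⟩ := IsIdempotentComplete.idempotents_split Y' e' he'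
  have hie : i ≫ e' = i := by rw [← hri, reassoc_of% hir]
  have her : e' ≫ r = r := by rw [← hri, Category.assoc, hir, Category.comp_id]
  have hee : h.i ≫ e = h.i := by simp [e]
  have h₃ : (i ⊗ₘ e) ≫ ε_ Y Y' = i ▷ Y ≫ ε_ Y Y' := by
    rw [MonoidalCategory.tensorHom_def, Category.assoc, ← h₁, ← comp_whiskerRight_assoc, hie]
  have h₄ : η_ Y Y' ≫ (e ⊗ₘ r) = η_ Y Y' ≫ Y ◁ r := by
    rw [MonoidalCategory.tensorHom_def, ← Category.assoc, ← h₂, Category.assoc,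
      ← whiskerLeft_comp, her]
  refine ⟨P', ⟨⟨η_ Y Y' ≫ (h.r ⊗ₘ r), (i ⊗ₘ h.i) ≫ ε_ Y Y', ?_, ?_⟩⟩⟩
  · calc P' ◁ (η_ Y Y' ≫ (h.r ⊗ₘ r)) ≫ (α_ P' P P').inv ≫ ((i ⊗ₘ h.i) ≫ ε_ Y Y') ▷ P'
        = P' ◁ η_ Y Y' ≫ (𝟙 P' ⊗ₘ (h.r ⊗ₘ r)) ≫ (α_ P' P P').inv ≫
            ((i ⊗ₘ h.i) ⊗ₘ 𝟙 P') ≫ (ε_ Y Y' ▷ P') := by simp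
      _ = P' ◁ η_ Y Y' ≫ (α_ P' Y Y').inv ≫ ((i ⊗ₘ e) ⊗ₘ r) ≫ (ε_ Y Y' ▷ P') := by
          rw [associator_inv_naturality_assoc, tensorHom_comp_tensorHom_assoc,
            tensorHom_comp_tensorHom, Category.id_comp, Category.comp_id]
      _ = P' ◁ η_ Y Y' ≫ (α_ P' Y Y').inv ≫ ((i ⊗ₘ e) ≫ ε_ Y Y') ▷ Y' ≫ 𝟙_ C ◁ r := by
          rw [MonoidalCategory.tensorHom_def (i ⊗ₘ e) r, Category.assoc, whisker_exchange,
            comp_whiskerRight, Category.assoc]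
      _ = (i ▷ 𝟙_ C ≫ Y' ◁ η_ Y Y') ≫ (α_ Y' Y Y').inv ≫ ε_ Y Y' ▷ Y' ≫ 𝟙_ C ◁ r := by
          rw [h₃, ← whisker_exchange i (η_ Y Y'), comp_whiskerRight]
          simp
      _ = _ := by
          rw [Category.assoc, ExactPairing.coevaluation_evaluation_assoc]
          simp [reassoc_of% hir]
  · calc (η_ Y Y' ≫ (h.r ⊗ₘ r)) ▷ P ≫ (α_ P P' P).hom ≫ P ◁ ((i ⊗ₘ h.i) ≫ ε_ Y Y')
        = η_ Y Y' ▷ P ≫ ((h.r ⊗ₘ r) ⊗ₘ 𝟙 P) ≫ (α_ P P' P).hom ≫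
            (𝟙 P ⊗ₘ (i ⊗ₘ h.i)) ≫ P ◁ ε_ Y Y' := by simp
      _ = η_ Y Y' ▷ P ≫ (α_ Y Y' P).hom ≫ (h.r ⊗ₘ (e' ⊗ₘ h.i)) ≫ P ◁ ε_ Y Y' := by
          rw [associator_naturality_assoc, tensorHom_comp_tensorHom_assoc,
            tensorHom_comp_tensorHom, Category.id_comp, Category.comp_id, hri]
      _ = η_ Y Y' ▷ P ≫ (α_ Y Y' P).hom ≫ (Y ◁ Y' ◁ h.i) ≫ Y ◁ (e' ▷ Y ≫ ε_ Y Y') ≫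
            h.r ▷ 𝟙_ C := by
          rw [MonoidalCategory.tensorHom_def' h.r, Category.assoc, ← whisker_exchange,
            MonoidalCategory.tensorHom_def' e', whiskerLeft_comp, whiskerLeft_comp]
          simp only [Category.assoc]
      _ = (η_ Y Y' ▷ P ≫ (Y ⊗ Y') ◁ h.i) ≫ (α_ Y Y' Y).hom ≫ Y ◁ ε_ Y Y' ≫ h.r ▷ 𝟙_ C := by
          rw [h₁, ← whiskerLeft_comp_assoc, ← whiskerLeft_comp_assoc, hee]
          simp
      _ = _ := by
          rw [← whisker_exchange, Category.assoc, ExactPairing.evaluation_coevaluation_assoc]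
          simp

end dual
end TensorCat
/-! ### The product of two tensor categories -/

namespace LinTensor

section linear
variable {k : Type w} [Field k] {T : Type u₁} {V : Type u₂} [Category.{v} T] [Category.{v} V]
  [Preadditive T] [Preadditive V] [Linear k T] [Linear k V]

lemma homMk_zero_left {X Y : LinTensor k T V} (g : X.snd ⟶ Y.snd) :
    homMk (0 : X.fst ⟶ Y.fst) g = (0 : X ⟶ Y) := TensorProduct.zero_tmul ..

lemma homMk_zero_right {X Y : LinTensor k T V} (f : X.fst ⟶ Y.fst) :
    homMk f (0 : X.snd ⟶ Y.snd) = (0 : X ⟶ Y) := TensorProduct.tmul_zero ..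

/-- The functor `X ↦ (X, S)`. -/
def fix (k : Type w) [Field k] (T : Type u₁) [Category.{v} T] [Preadditive T] [Linear k T]
    {V : Type u₂} [Category.{v} V] [Preadditive V] [Linear k V] (S : V) : T ⥤ LinTensor k T V where
  obj X := ⟨X, S⟩
  map f := homMk f (𝟙 S)
  map_id X := homMk_id (k := k) ⟨X, S⟩
  map_comp f g := by rw [homMk_comp, Category.comp_id]

/-- The functor `S ↦ (X, S)`. -/
def fixLeft (k : Type w) [Field k] {T : Type u₁} [Category.{v} T] [Preadditive T] [Linear k T]
    (V : Type u₂) [Category.{v} V] [Preadditive V] [Linear k V] (X : T) : V ⥤ LinTensor k T V where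
  obj S := ⟨X, S⟩
  map f := homMk (𝟙 X) f
  map_id S := homMk_id (k := k) ⟨X, S⟩
  map_comp f g := by rw [homMk_comp, Category.comp_id]

instance (S : V) : (fix k T S).Additive where
  map_add := homMk_add_left ..

instance (S : V) : (fix k T S).Linear k where
  map_smul _ _ := homMk_smul_left ..

instance (X : T) : (fixLeft k V X).Additive where
  map_add := homMk_add_right ..

instance (X : T) : (fixLeft k V X).Linear k where
  map_smul _ _ := homMk_smul_right ..

/-- On Hom spaces composition with the image of `ι` is a linear map tensored with the space
`Hom(W.snd, S)`. Exactness of the functor thus becomes flatness of vector spaces. -/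
lemma comp_fix_map {W : LinTensor k T V} {K X : T} (S : V) (ι : K ⟶ X)
    (t : W ⟶ (fix k T S).obj K) :
    t ≫ (fix k T S).map ι = LinearMap.rTensor (W.snd ⟶ S) (Linear.rightComp k W.fst ι) t := by
  refine hom_induction t ?_ (fun a b => ?_) (fun a b ha hb => ?_)
  · rw [zero_comp]; exact (map_zero _).symm
  · exact congrArg (homMk (X := W) (Y := (⟨X, S⟩ : LinTensor k T V)) (a ≫ ι)) (Category.comp_id b)
  · rw [Preadditive.add_comp, ha, hb]; exact (map_add _ _ _).symm

lemma fix_map_comp {W : LinTensor k T V} {K X : T} (S : V) (ι : K ⟶ X)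
    (t : (fix k T S).obj X ⟶ W) :
    (fix k T S).map ι ≫ t = LinearMap.rTensor (S ⟶ W.snd) (Linear.leftComp k W.fst ι) t := by
  refine hom_induction t ?_ (fun a b => ?_) (fun a b ha hb => ?_)
  · rw [comp_zero]; exact (map_zero _).symm
  · exact congrArg (homMk (X := (⟨K, S⟩ : LinTensor k T V)) (Y := W) (ι ≫ a)) (Category.id_comp b)
  · rw [Preadditive.comp_add, ha, hb]; exact (map_add _ _ _).symm

open TensorCat

lemma isKer_fix (S : V) {K X Y : T} {ι : K ⟶ X} {f : X ⟶ Y} (h : IsKer ι f) :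
    IsKer ((fix k T S).map ι) ((fix k T S).map f) where
  cancel W w hw := by
    rw [comp_fix_map] at hw
    refine Module.Flat.rTensor_preserves_injective_linearMap (Linear.rightComp k W.fst ι) ?_
      (hw.trans (map_zero _).symm)
    exact (injective_iff_map_eq_zero _).2 fun a ha => h.cancel a ha
  comp := by rw [← Functor.map_comp, h.comp, Functor.map_zero]
  lift W w hw := by
    rw [comp_fix_map] at hw
    have hex : Function.Exact (Linear.rightComp k W.fst ι) (Linear.rightComp k W.fst f) := by
      intro a
      refine ⟨fun ha => h.lift a ha, ?_⟩
      rintro ⟨b, rfl⟩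
      change (b ≫ ι) ≫ f = 0
      rw [Category.assoc, h.comp, comp_zero]
    have hE := Module.Flat.rTensor_exact (R := k) (W.snd ⟶ S) hex
    obtain ⟨l, hl⟩ := (hE w).1 hw
    exact ⟨l, (comp_fix_map S ι l).trans hl⟩

lemma isCok_fix (S : V) {X Y Q : T} {f : X ⟶ Y} {π : Y ⟶ Q} (h : IsCok f π) :
    IsCok ((fix k T S).map f) ((fix k T S).map π) where
  cancel W w hw := by
    rw [fix_map_comp] at hw
    refine Module.Flat.rTensor_preserves_injective_linearMap (Linear.leftComp k W.fst π) ?_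
      (hw.trans (map_zero _).symm)
    exact (injective_iff_map_eq_zero _).2 fun a ha => h.cancel a ha
  comp := by rw [← Functor.map_comp, h.comp, Functor.map_zero]
  desc W w hw := by
    rw [fix_map_comp] at hw
    have hex : Function.Exact (Linear.leftComp k W.fst π) (Linear.leftComp k W.fst f) := by
      intro a
      refine ⟨fun ha => h.desc a ha, ?_⟩
      rintro ⟨b, rfl⟩
      change f ≫ π ≫ b = 0
      rw [← Category.assoc, h.comp, zero_comp]
    have hE := Module.Flat.rTensor_exact (R := k) (S ⟶ W.snd) hex
    obtain ⟨l, hl⟩ := (hE w).1 hw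
    exact ⟨l, (fix_map_comp S π l).trans hl⟩

/-- Since End(S) consists of scalars, the Hom space between `(X, S)` and `(Y, S)` is that of `T`
tensored with `k`. The next lemma uses the same identification for injectivity. -/
lemma fix_map_surjective {S : V} (hS : Function.Bijective fun a : k => a • 𝟙 S) {X Y : T}
    (t : (fix k T S).obj X ⟶ (fix k T S).obj Y) : ∃ g, (fix k T S).map g = t := by
  refine hom_induction t ⟨0, Functor.map_zero _ _ _⟩ (fun a b => ?_) (fun a b ha hb => ?_)
  · obtain ⟨c, rfl⟩ := hS.2 b
    exact ⟨c • a, (homMk_smul_left ..).trans (homMk_smul_right ..).symm⟩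
  · obtain ⟨⟨g, rfl⟩, ⟨g', rfl⟩⟩ := And.intro ha hb
    exact ⟨g + g', Functor.map_add _⟩

lemma fix_map_injective {S : V} (hS : Function.Bijective fun a : k => a • 𝟙 S) {X Y : T}
    {g : X ⟶ Y} (h : (fix k T S).map g = 0) : g = 0 := by
  let φ : k ≃ₗ[k] (S ⟶ S) := LinearEquiv.ofBijective (LinearMap.toSpanSingleton k _ (𝟙 S)) hS
  have hφ : φ.symm (𝟙 S) = 1 := by
    rw [LinearEquiv.symm_apply_eq]
    exact (one_smul _ _).symm
  have := congrArg (fun t : (X ⟶ Y) ⊗[k] (S ⟶ S) =>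
    TensorProduct.rid k _ (LinearMap.lTensor _ φ.symm.toLinearMap t)) h
  change TensorProduct.rid k _ (LinearMap.lTensor _ φ.symm.toLinearMap (g ⊗ₜ 𝟙 S)) = _ at this
  rw [LinearMap.lTensor_tmul, LinearEquiv.coe_coe, hφ, TensorProduct.rid_tmul, one_smul] at this
  exact this.trans ((congrArg _ (map_zero _)).trans (map_zero _))

lemma hom_eq_zero {X Y : LinTensor k T V} (h : ∀ b : X.snd ⟶ Y.snd, b = 0) (t : X ⟶ Y) : t = 0 := by
  refine hom_induction t rfl (fun a b => ?_) (fun a b ha hb => ?_)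
  · rw [h b, homMk_zero_right]
  · rw [ha, hb, add_zero]

end linear
end LinTensor

namespace TensorCat

/-! ### Isotypic decomposition and kernels and cokernels in the product. -/

section box
open LinTensor
variable {k : Type w} [Field k] {T : Type u₁} {V : Type u₂} [Category.{v} T] [Category.{v} V]
  [Preadditive T] [Preadditive V] [Linear k T] [Linear k V]

instance {C : Type u} [Category.{v} C] [Preadditive C] [Linear k C] :
    (toKaroubi C).Linear k where

/-- The functor `X ↦ (X, S)` to the product. -/
def boxFix (k : Type w) [Field k] (T : Type u₁) [Category.{v} T] [Preadditive T] [Linear k T]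
    {V : Type u₂} [Category.{v} V] [Preadditive V] [Linear k V] (S : V) : T ⥤ Box k T V :=
  fix k T S ⋙ toKaroubi _

/-- The functor `S ↦ (X, S)` to the product. -/
def boxFixLeft (k : Type w) [Field k] {T : Type u₁} [Category.{v} T] [Preadditive T]
    [Linear k T] (V : Type u₂) [Category.{v} V] [Preadditive V] [Linear k V] (X : T) :
    V ⥤ Box k T V :=
  fixLeft k V X ⋙ toKaroubi _

instance (S : V) : (boxFix k T S).Additive := inferInstanceAs (fix k T S ⋙ toKaroubi _).Additive

instance (S : V) : (boxFix k T S).Linear k := inferInstanceAs ((fix k T S ⋙ toKaroubi _).Linear k)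

instance (X : T) : (boxFixLeft k V X).Additive :=
  inferInstanceAs (fixLeft k V X ⋙ toKaroubi _).Additive

instance (X : T) : (boxFixLeft k V X).Linear k :=
  inferInstanceAs ((fixLeft k V X ⋙ toKaroubi _).Linear k)

lemma isKer_toKaroubi {C : Type u} [Category.{v} C] [Preadditive C] {K A B : C} {ι : K ⟶ A}
    {f : A ⟶ B} (h : IsKer ι f) : IsKer ((toKaroubi C).map ι) ((toKaroubi C).map f) where
  cancel W w hw := by
    ext
    exact h.cancel w.f (congrArg Karoubi.Hom.f hw)
  comp := by rw [← Functor.map_comp, h.comp, Functor.map_zero]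
  lift W w hw := by
    obtain ⟨l, hl⟩ := h.lift w.f (congrArg Karoubi.Hom.f hw)
    refine ⟨⟨W.p ≫ l, by simp⟩, ?_⟩
    ext
    simp [hl]

lemma isCok_toKaroubi {C : Type u} [Category.{v} C] [Preadditive C] {A B Q : C} {f : A ⟶ B}
    {π : B ⟶ Q} (h : IsCok f π) : IsCok ((toKaroubi C).map f) ((toKaroubi C).map π) where
  cancel W w hw := by
    ext
    exact h.cancel w.f (congrArg Karoubi.Hom.f hw)
  comp := by rw [← Functor.map_comp, h.comp, Functor.map_zero]
  desc W w hw := by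
    obtain ⟨l, hl⟩ := h.desc w.f (congrArg Karoubi.Hom.f hw)
    refine ⟨⟨l ≫ W.p, by simp⟩, ?_⟩
    ext
    simp [reassoc_of% hl]

lemma isKer_boxFix (S : V) {K X Y : T} {ι : K ⟶ X} {f : X ⟶ Y} (h : IsKer ι f) :
    IsKer ((boxFix k T S).map ι) ((boxFix k T S).map f) := isKer_toKaroubi (isKer_fix S h)

lemma isCok_boxFix (S : V) {X Y Q : T} {f : X ⟶ Y} {π : Y ⟶ Q} (h : IsCok f π) :
    IsCok ((boxFix k T S).map f) ((boxFix k T S).map π) := isCok_toKaroubi (isCok_fix S h)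

/-- The pair of biproducts has four blocks, of which only the two diagonal ones are wanted. They are
cut out by the idempotent `p`, which is possible because the product is idempotent complete. -/
lemma hasDirectSums_box [HasBinaryBiproducts T] [HasBinaryBiproducts V] :
    HasDirectSums (Box k T V) := fun A B => by
  let P : LinTensor k T V := ⟨A.X.fst ⊞ B.X.fst, A.X.snd ⊞ B.X.snd⟩
  let iA : A.X ⟶ P := homMk biprod.inl biprod.inl
  let iB : B.X ⟶ P := homMk biprod.inr biprod.inr
  let rA : P ⟶ A.X := homMk biprod.fst biprod.fst
  let rB : P ⟶ B.X := homMk biprod.snd biprod.snd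
  have hA : iA ≫ rA = 𝟙 _ := by simp only [iA, rA, homMk_comp, biprod.inl_fst, homMk_id]
  have hB : iB ≫ rB = 𝟙 _ := by simp only [iB, rB, homMk_comp, biprod.inr_snd, homMk_id]
  have hAB : iA ≫ rB = 0 := by simp only [iA, rB, homMk_comp, biprod.inl_snd, homMk_zero_left]
  have hBA : iB ≫ rA = 0 := by simp only [iB, rA, homMk_comp, biprod.inr_fst, homMk_zero_left]
  let p := rA ≫ A.p ≫ iA + rB ≫ B.p ≫ iB
  refine ⟨⟨P, p, ?_⟩, ⟨{
    inl := ⟨A.p ≫ iA, ?_⟩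
    inr := ⟨B.p ≫ iB, ?_⟩
    fst := ⟨rA ≫ A.p, ?_⟩
    snd := ⟨rB ≫ B.p, ?_⟩
    inl_fst := ?_
    inr_snd := ?_
    inl_snd := ?_
    inr_fst := ?_
    total := ?_ }⟩⟩
  all_goals try ext
  all_goals simp [p, hA, hB, hAB, hBA, reassoc_of% hA, reassoc_of% hB, reassoc_of% hAB,
    reassoc_of% hBA]


namespace DirectSum
variable {E : Type u₁} [Category.{v₁} E] [Preadditive E] {A B C Z Z' Z'' : E}

/-- Associativity of direct sums. -/
def assoc (d : DirectSum A Z' Z) (d' : DirectSum B Z'' Z') (d'' : DirectSum A B C) :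
    DirectSum C Z'' Z where
  inl := d''.fst ≫ d.inl + d''.snd ≫ d'.inl ≫ d.inr
  inr := d'.inr ≫ d.inr
  fst := d.fst ≫ d''.inl + d.snd ≫ d'.fst ≫ d''.inr
  snd := d.snd ≫ d'.snd
  inl_fst := by simp [d''.total]
  inr_snd := by simp
  inl_snd := by simp
  inr_fst := by simp
  total := d.hom_ext (by simp) (by
    simp only [Preadditive.comp_add, Preadditive.add_comp, Category.assoc, inr_fst_assoc,
      inl_fst_assoc, inl_snd_assoc, inr_snd_assoc, comp_zero, add_zero, zero_add, zero_comp,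
      Category.comp_id]
    rw [← Category.assoc, ← Category.assoc d'.snd, ← Preadditive.add_comp, d'.total,
      Category.id_comp])

/-- Exchanging the first two summands of a direct sum. -/
def leftComm (d : DirectSum A Z' Z) (d' : DirectSum B Z'' Z') (d'' : DirectSum A Z'' C) :
    DirectSum B C Z where
  inl := d'.inl ≫ d.inr
  inr := d''.fst ≫ d.inl + d''.snd ≫ d'.inr ≫ d.inr
  fst := d.snd ≫ d'.fst
  snd := d.fst ≫ d''.inl + d.snd ≫ d'.snd ≫ d''.inr
  inl_fst := by simp
  inr_snd := by simp [d''.total]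
  inl_snd := by simp
  inr_fst := by simp
  total := d.hom_ext (by simp) (by
    simp only [Preadditive.comp_add, Preadditive.add_comp, Category.assoc, inr_fst_assoc,
      inl_fst_assoc, inl_snd_assoc, inr_snd_assoc, comp_zero, add_zero, zero_add, zero_comp,
      Category.comp_id]
    rw [← Category.assoc, ← Category.assoc d'.snd, ← Preadditive.add_comp, d'.total,
      Category.id_comp])

lemma eq_mapHom {A₁ A₂ A B₁ B₂ B : E} (dA : DirectSum A₁ A₂ A) (dB : DirectSum B₁ B₂ B) (f : A ⟶ B)
    (h₁ : dA.inl ≫ f ≫ dB.snd = 0) (h₂ : dA.inr ≫ f ≫ dB.fst = 0) :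
    f = dA.mapHom dB (dA.inl ≫ f ≫ dB.fst) (dA.inr ≫ f ≫ dB.snd) := by
  refine dA.hom_ext (dB.hom_ext' ?_ ?_) (dB.hom_ext' ?_ ?_) <;> simp [h₁, h₂]

end DirectSum

/-- There are no morphisms between `S` and `S'`. -/
def HomZero {E : Type u₁} [Category.{v₁} E] [Preadditive E] (S S' : E) : Prop :=
  (∀ f : S ⟶ S', f = 0) ∧ ∀ f : S' ⟶ S, f = 0

/-- `Z` is a direct sum of objects `(X, S)`, for `S` in the list. -/
def IsotypicSum (k : Type w) [Field k] (T : Type u₁) {V : Type u₂} [Category.{v} T] [Category.{v} V]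
    [Preadditive T] [Preadditive V] [Linear k T] [Linear k V] : List V → Box k T V → Prop
  | [], Z => 𝟙 Z = 0
  | S :: L, Z => ∃ (X : T) (Z' : Box k T V),
      Nonempty (DirectSum ((boxFix k T S).obj X) Z' Z) ∧ IsotypicSum k T L Z'

lemma boxFix_map_surjective {S : V} (hS : Function.Bijective fun a : k => a • 𝟙 S) {X Y : T}
    (t : (boxFix k T S).obj X ⟶ (boxFix k T S).obj Y) : ∃ g, (boxFix k T S).map g = t := by
  obtain ⟨t', rfl⟩ := (toKaroubi _).map_surjective t
  obtain ⟨g, rfl⟩ := fix_map_surjective hS t'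
  exact ⟨g, rfl⟩

lemma boxFix_map_injective {S : V} (hS : Function.Bijective fun a : k => a • 𝟙 S) {X Y : T}
    {g g' : X ⟶ Y} (h : (boxFix k T S).map g = (boxFix k T S).map g') : g = g' := by
  refine sub_eq_zero.1 (fix_map_injective (k := k) hS ?_)
  rw [Functor.map_sub, sub_eq_zero]
  exact (toKaroubi _).map_injective h

lemma boxFix_homZero {S S' : V} (h : HomZero S S') (X X' : T) :
    HomZero ((boxFix k T S).obj X) ((boxFix k T S').obj X') :=
  ⟨fun f => Karoubi.hom_ext _ _ (hom_eq_zero (X := ⟨X, S⟩) (Y := ⟨X', S'⟩) h.1 f.f),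
    fun f => Karoubi.hom_ext _ _ (hom_eq_zero (X := ⟨X', S'⟩) (Y := ⟨X, S⟩) h.2 f.f)⟩

lemma IsotypicSum.homZero {L : List V} {S : V} (hS : ∀ S' ∈ L, HomZero S S') (X : T) {Z : Box k T V}
    (hZ : IsotypicSum k T L Z) : HomZero ((boxFix k T S).obj X) Z := by
  induction L generalizing Z with
  | nil =>
    have hZ : 𝟙 Z = 0 := hZ
    exact ⟨fun f => by rw [← Category.comp_id f, hZ, comp_zero],
      fun f => by rw [← Category.id_comp f, hZ, zero_comp]⟩
  | cons S' L ih =>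
    obtain ⟨X', Z', ⟨d⟩, hZ'⟩ := hZ
    have h₁ := boxFix_homZero (k := k) (hS S' (by simp)) X X'
    have h₂ := ih (fun S'' h => hS S'' (by simp [h])) hZ'
    exact ⟨fun f => d.hom_ext' (by rw [zero_comp]; exact h₁.1 _) (by rw [zero_comp]; exact h₂.1 _),
      fun f => d.hom_ext (by rw [comp_zero]; exact h₁.2 _) (by rw [comp_zero]; exact h₂.2 _)⟩

/-- The list consists of orthogonal objects without endomorphisms but scalars. -/
def IsOrthogonal (k : Type w) [Field k] {V : Type u₂} [Category.{v} V] [Preadditive V] [Linear k V]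
    (L : List V) : Prop :=
  L.Pairwise HomZero ∧ ∀ S ∈ L, Function.Bijective fun a : k => a • 𝟙 S

lemma IsOrthogonal.tail {S : V} {L : List V} (h : IsOrthogonal k (S :: L)) : IsOrthogonal k L :=
  ⟨(List.pairwise_cons.1 h.1).2, fun S' hS' => h.2 S' (by simp [hS'])⟩

/-- Orthogonality makes every morphism block diagonal. The block at `S` comes from a morphism of the
abelian category `T`, whose canonical factorisation is carried over by the functor `X ↦ (X, S)`,
which preserves kernels and cokernels. -/
lemma IsotypicSum.hasCanonicalFactorization [IsAbelian T] (hE : HasDirectSums (Box k T V))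
    {L : List V} (hL : IsOrthogonal k L) {A B : Box k T V} (hA : IsotypicSum k T L A)
    (hB : IsotypicSum k T L B) (f : A ⟶ B) : HasCanonicalFactorization f := by
  induction L generalizing A B with
  | nil => exact hasCanonicalFactorization_of_id_eq_zero hA hB f
  | cons S L ih =>
    obtain ⟨X, A', ⟨dA⟩, hA'⟩ := hA
    obtain ⟨Y, B', ⟨dB⟩, hB'⟩ := hB
    have hp := (List.pairwise_cons.1 hL.1).1
    rw [dA.eq_mapHom dB f ((hB'.homZero hp X).1 _) ((hA'.homZero hp Y).2 _)]
    obtain ⟨g, hg⟩ := boxFix_map_surjective (hL.2 S (by simp)) (dA.inl ≫ f ≫ dB.fst)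
    rw [← hg]
    refine .directSum hE dA dB (.map _ (fun _ _ _ _ _ h => isKer_boxFix S h)
      (fun _ _ _ _ _ h => isCok_toKaroubi (isCok_fix S h)) (TensorCat.hasCanonicalFactorization g))
      (ih hL.tail hA' hB' _)

/-- The idempotent of the retract is block diagonal. Its block at `S` comes from an idempotent of
`T` and splits there; the other block is treated by induction. -/
lemma IsotypicSum.of_retract [IsIdempotentComplete T] {L : List V} (hL : IsOrthogonal k L)
    {A Z : Box k T V} (hZ : IsotypicSum k T L Z) (ρ : Retract A Z) : IsotypicSum k T L A := by
  induction L generalizing A Z with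
  | nil =>
    have hZ : 𝟙 Z = 0 := hZ
    change 𝟙 A = 0
    rw [← ρ.retract, ← Category.id_comp ρ.r, hZ, zero_comp, comp_zero]
  | cons S L ih =>
    obtain ⟨X, Z', ⟨d⟩, hZ'⟩ := hZ
    have hp := (List.pairwise_cons.1 hL.1).1
    have hS := hL.2 S (by simp)
    set e : Z ⟶ Z := ρ.r ≫ ρ.i with he
    have hee : e ≫ e = e := by simp [he]
    have hd := d.eq_mapHom d e ((hZ'.homZero hp X).1 _) ((hZ'.homZero hp X).2 _)
    set e₂ := d.inr ≫ e ≫ d.snd with he₂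
    obtain ⟨e₁, he₁⟩ := boxFix_map_surjective hS (d.inl ≫ e ≫ d.fst)
    rw [← he₁] at hd
    have h1 : d.inl ≫ e = (boxFix k T S).map e₁ ≫ d.inl := by rw [hd, DirectSum.inl_mapHom]
    have h2 : d.inr ≫ e = e₂ ≫ d.inr := by rw [hd, DirectSum.inr_mapHom]
    have h3 : e ≫ d.fst = d.fst ≫ (boxFix k T S).map e₁ := by rw [hd, DirectSum.mapHom_fst]
    have h4 : e ≫ d.snd = d.snd ≫ e₂ := by rw [hd, DirectSum.mapHom_snd]
    have hid₁ : e₁ ≫ e₁ = e₁ := by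
      refine boxFix_map_injective (k := k) hS ?_
      rw [Functor.map_comp]
      calc _ = (d.inl ≫ e ≫ d.fst) ≫ (boxFix k T S).map e₁ := by rw [← he₁]
        _ = d.inl ≫ (e ≫ e) ≫ d.fst := by simp only [Category.assoc, ← h3]
        _ = _ := by rw [hee, he₁]
    have hid₂ : e₂ ≫ e₂ = e₂ := by
      calc _ = (d.inr ≫ e ≫ d.snd) ≫ e₂ := by rw [← he₂]
        _ = d.inr ≫ (e ≫ e) ≫ d.snd := by simp only [Category.assoc, ← h4]
        _ = _ := by rw [hee, he₂]
    obtain ⟨X₁, i₁, r₁, hir₁, hri₁⟩ := IsIdempotentComplete.idempotents_split X e₁ hid₁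
    obtain ⟨A₂, i₂, r₂, hir₂, hri₂⟩ := IsIdempotentComplete.idempotents_split Z' e₂ hid₂
    have hFir : (boxFix k T S).map i₁ ≫ (boxFix k T S).map r₁ = 𝟙 _ := by
      rw [← Functor.map_comp, hir₁, CategoryTheory.Functor.map_id]
    have hFri : (boxFix k T S).map r₁ ≫ (boxFix k T S).map i₁ = (boxFix k T S).map e₁ := by
      rw [← Functor.map_comp, hri₁]
    have hFie : (boxFix k T S).map i₁ ≫ (boxFix k T S).map e₁ = (boxFix k T S).map i₁ := by
      rw [← hFri, reassoc_of% hFir]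
    have hie₂ : i₂ ≫ e₂ = i₂ := by rw [← hri₂, reassoc_of% hir₂]
    have hre : ρ.r ≫ ρ.i = e := rfl
    refine ⟨X₁, A₂, ⟨{
      inl := (boxFix k T S).map i₁ ≫ d.inl ≫ ρ.r
      inr := i₂ ≫ d.inr ≫ ρ.r
      fst := ρ.i ≫ d.fst ≫ (boxFix k T S).map r₁
      snd := ρ.i ≫ d.snd ≫ r₂
      inl_fst := ?_
      inr_snd := ?_
      inl_snd := ?_
      inr_fst := ?_
      total := ?_ }⟩, ih hL.tail hZ' ⟨i₂, r₂, hir₂⟩⟩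
    · simp only [Category.assoc, reassoc_of% hre]
      rw [reassoc_of% h1, d.inl_fst_assoc, reassoc_of% hFie, hFir]
    · simp only [Category.assoc, reassoc_of% hre]
      rw [reassoc_of% h2, d.inr_snd_assoc, reassoc_of% hie₂, hir₂]
    · simp only [Category.assoc, reassoc_of% hre]
      rw [reassoc_of% h1, d.inl_snd_assoc, comp_zero, comp_zero]
    · simp only [Category.assoc, reassoc_of% hre]
      rw [reassoc_of% h2, d.inr_fst_assoc, comp_zero, comp_zero]
    · simp only [Category.assoc]
      rw [reassoc_of% hFri, reassoc_of% hri₂, ← reassoc_of% h3, ← reassoc_of% h4]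
      rw [← Preadditive.comp_add, ← Preadditive.comp_add, ← Category.assoc d.fst,
        ← Category.assoc d.snd, ← Preadditive.add_comp, d.total, Category.id_comp, ← hre]
      simp

/-- The new summand is merged with the one of the isomorphic object in the list, so that the list
stays orthogonal. -/
lemma IsotypicSum.insert [HasBinaryBiproducts T] (hE : HasDirectSums (Box k T V)) {L : List V}
    {S S' : V} (hS' : S' ∈ L) (e : S ≅ S') {X : T} {Z Z' : Box k T V} (hZ : IsotypicSum k T L Z)
    (d : DirectSum ((boxFix k T S).obj X) Z Z') : IsotypicSum k T L Z' := by
  induction L generalizing Z Z' with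
  | nil => simp at hS'
  | cons S₀ L ih =>
    obtain ⟨X₀, Z₀, ⟨d₀⟩, hZ₀⟩ := hZ
    obtain rfl | hS' := List.mem_cons.1 hS'
    · let e' : (boxFix k T S).obj X ≅ (boxFix k T S').obj X :=
        (toKaroubi _).mapIso ((fixLeft k V X).mapIso e)
      exact ⟨X ⊞ X₀, Z₀, ⟨(d.ofIso e' (Iso.refl _)).assoc d₀
        ((DirectSum.biprod X X₀).map (boxFix k T S'))⟩, hZ₀⟩
    · obtain ⟨W, ⟨dW⟩⟩ := hE ((boxFix k T S).obj X) Z₀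
      exact ⟨X₀, W, ⟨d.leftComm d₀ dW⟩, ih hS' hZ₀ dW⟩

/-- Decompose `Y` into simple objects and collect the isomorphic ones. Distinct members of the list
are then orthogonal by Schur's lemma. -/
lemma exists_isotypicSum [HasBinaryBiproducts T] (hE : HasDirectSums (Box k T V)) [IsAbelian V]
    (hV : IsSchurianSemisimple k V) (X : T) (Y : V) :
    ∃ L : List V, IsOrthogonal k L ∧ (∀ S ∈ L, Simple S) ∧
      IsotypicSum k T L ((boxFixLeft k V X).obj Y) := by
  induction hV.isSum Y with
  | @zero Z h =>
    refine ⟨[], ⟨List.Pairwise.nil, by simp⟩, by simp, ?_⟩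
    change 𝟙 _ = 0
    rw [← CategoryTheory.Functor.map_id, h, Functor.map_zero]
  | @add S Y Z hS hY d ih =>
    obtain ⟨L, hL, hs, h⟩ := ih
    have d' := d.map (boxFixLeft k V X)
    by_cases hSL : ∃ S' ∈ L, Nonempty (S ≅ S')
    · obtain ⟨S', hS', ⟨e⟩⟩ := hSL
      exact ⟨L, hL, hs, h.insert hE hS' e d'⟩
    · refine ⟨S :: L, ⟨List.pairwise_cons.2 ⟨fun S' hS' => ?_, hL.1⟩, ?_⟩, ?_, X, _, ⟨d'⟩, h⟩
      · have hn : IsEmpty (S ≅ S') := ⟨fun e => hSL ⟨S', hS', ⟨e⟩⟩⟩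
        refine ⟨fun f => (zeroOrIso_simple hS (hs S' hS') f).resolve_right fun h =>
            hn.false (asIso f), fun f => (zeroOrIso_simple (hs S' hS') hS f).resolve_right fun h =>
            hn.false (asIso f).symm⟩
      · have : Simple S := hS
        simpa using ⟨hV.schurian S, hL.2⟩
      · simpa using ⟨hS, hs⟩

lemma retract_box {A : Box k T V} {X : T} {Y : V} (ρ : Retract A.X.fst X) (ρ' : Retract A.X.snd Y) :
    Nonempty (Retract A ((boxFixLeft k V X).obj Y)) := by
  let i : A.X ⟶ ⟨X, Y⟩ := homMk ρ.i ρ'.i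
  let r : (⟨X, Y⟩ : LinTensor k T V) ⟶ A.X := homMk ρ.r ρ'.r
  have h : i ≫ r = 𝟙 _ := by
    simp only [i, r, homMk_comp, ρ.retract, ρ'.retract, homMk_id]
  refine ⟨⟨⟨A.p ≫ i, ?_⟩, ⟨r ≫ A.p, ?_⟩, ?_⟩⟩
  · change A.p ≫ (A.p ≫ i) ≫ 𝟙 _ = A.p ≫ i
    simp
  · change 𝟙 _ ≫ (r ≫ A.p) ≫ A.p = r ≫ A.p
    simp
  · ext
    change (A.p ≫ i) ≫ r ≫ A.p = A.p
    simp [reassoc_of% h]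

lemma isAbelian_box [IsAbelian T] [IsAbelian V] (hV : IsSchurianSemisimple k V) :
    IsAbelian (Box k T V) := by
  have : HasBinaryBiproducts T := hasBinaryBiproducts_of_finite_biproducts T
  have : HasBinaryBiproducts V := hasBinaryBiproducts_of_finite_biproducts V
  have : IsIdempotentComplete T := by
    let := abelianOfIsAbelian T
    infer_instance
  have hE : HasDirectSums (Box k T V) := hasDirectSums_box
  have hz : 𝟙 ((boxFixLeft k V (⊤_ T)).obj (⊤_ V)) = 0 := by
    rw [← CategoryTheory.Functor.map_id, Subsingleton.elim (𝟙 (⊤_ V)) 0, Functor.map_zero]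
  have := hasFiniteProducts_of_hasDirectSums hE hz
  refine isAbelian_of_canonicalFactorization fun A B f => ?_
  -- Source and target are both retracts of one pair formed from the biproducts, so they are
  -- isotypic for one and the same list.
  obtain ⟨L, hL, -, h⟩ := exists_isotypicSum hE hV (A.X.fst ⊞ B.X.fst) (A.X.snd ⊞ B.X.snd)
  obtain ⟨ρ⟩ := retract_box (k := k) (A := A) ⟨biprod.inl, biprod.fst, by simp⟩
    (⟨biprod.inl, biprod.fst, by simp⟩ : Retract A.X.snd (A.X.snd ⊞ B.X.snd))
  obtain ⟨ρ'⟩ := retract_box (k := k) (A := B) ⟨biprod.inr, biprod.snd, by simp⟩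
    (⟨biprod.inr, biprod.snd, by simp⟩ : Retract B.X.snd (A.X.snd ⊞ B.X.snd))
  exact (h.of_retract hL ρ).hasCanonicalFactorization hE hL (h.of_retract hL ρ') f

end box
end TensorCat
-- Exact pairings under monoidal functors.
section exactPairing
open Functor.LaxMonoidal Functor.OplaxMonoidal Functor.Monoidal

/-- Monoidal functors preserve exact pairings. -/
abbrev TensorCat.exactPairingMap {C : Type u₁} {D : Type u₂} [Category.{v₁} C] [Category.{v₂} D]
    [MonoidalCategory C] [MonoidalCategory D] (F : C ⥤ D) [F.Monoidal] (X Y : C)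
    [ExactPairing X Y] : ExactPairing (F.obj X) (F.obj Y) where
  coevaluation' := ε F ≫ F.map (η_ X Y) ≫ δ F X Y
  evaluation' := μ F Y X ≫ F.map (ε_ X Y) ≫ η F
  coevaluation_evaluation' := by
    have h := congrArg F.map (ExactPairing.coevaluation_evaluation X Y)
    simp only [Functor.map_comp, Functor.Monoidal.map_whiskerLeft,
      Functor.Monoidal.map_whiskerRight, Functor.Monoidal.map_associator_inv,
      Functor.Monoidal.map_rightUnitor, Functor.Monoidal.map_leftUnitor_inv, Category.assoc,
      μ_δ_assoc] at h
    rw [← cancel_mono (ε F ▷ F.obj Y), ← cancel_mono (μ F _ _), ← cancel_epi (F.obj Y ◁ η F),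
      ← cancel_epi (δ F _ _)]
    simpa using h
  evaluation_coevaluation' := by
    have h := congrArg F.map (ExactPairing.evaluation_coevaluation X Y)
    simp only [Functor.map_comp, Functor.Monoidal.map_whiskerLeft,
      Functor.Monoidal.map_whiskerRight, Functor.Monoidal.map_associator,
      Functor.Monoidal.map_rightUnitor_inv, Functor.Monoidal.map_leftUnitor, Category.assoc,
      μ_δ_assoc] at h
    rw [← cancel_mono (F.obj X ◁ ε F), ← cancel_mono (μ F _ _), ← cancel_epi (η F ▷ F.obj X),
      ← cancel_epi (δ F _ _)]
    simpa using h

end exactPairing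

/-! ### Monoidal structure of the embeddings into the product. -/

namespace KaroubiTensor
variable {C : Type u} [Category.{v} C] [MonoidalCategory C]

/-- The embedding into the idempotent completion is monoidal. -/
def coreMonoidal : (toKaroubi C).CoreMonoidal where
  εIso := Iso.refl _
  μIso X Y := ⟨⟨𝟙 (X ⊗ Y), by simp⟩, ⟨𝟙 (X ⊗ Y), by simp⟩, by ext; simp, by ext; simp⟩
  μIso_hom_natural_left f X' := by ext; simp
  μIso_hom_natural_right X' f := by ext; simp
  associativity X Y Z := by ext; simp
  left_unitality X := by ext; simp
  right_unitality X := by ext; simp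

instance : (toKaroubi C).Monoidal := coreMonoidal.toMonoidal

instance [SymmetricCategory C] : (toKaroubi C).Braided where
  braided X Y := by
    ext
    change 𝟙 (X ⊗ Y) ≫ (β_ X Y).hom = ((𝟙 X ⊗ₘ 𝟙 Y) ≫ (β_ X Y).hom) ≫ 𝟙 (Y ⊗ X)
    simp

end KaroubiTensor

namespace LinTensor
variable {k : Type w} [Field k] {T : Type u₁} {V : Type u₂} [Category.{v} T] [Category.{v} V]
  [Preadditive T] [Preadditive V] [Linear k T] [Linear k V]
  [MonoidalCategory T] [MonoidalCategory V] [MonoidalPreadditive T]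
  [MonoidalPreadditive V] [MonoidalLinear k T] [MonoidalLinear k V]

lemma homMk_congr {X Y : LinTensor k T V} {f f' : X.fst ⟶ Y.fst} {g g' : X.snd ⟶ Y.snd}
    (hf : f = f') (hg : g = g') : homMk f g = (homMk f' g' : X ⟶ Y) := by rw [hf, hg]

/-- The embedding `X ↦ (X, 𝟙)` is monoidal. -/
def fixCoreMonoidal : (fix k T (𝟙_ V)).CoreMonoidal where
  εIso := Iso.refl _
  μIso X Y := isoMk (Iso.refl (X ⊗ Y)) (λ_ (𝟙_ V))
  μIso_hom_natural_left f X' := homMk_congr (X := ⟨_, _⟩) (Y := ⟨_, _⟩)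
    (show f ▷ X' ≫ 𝟙 (_ ⊗ X') = 𝟙 (_ ⊗ X') ≫ f ▷ X' by
      simp)
    (show 𝟙 (𝟙_ V) ▷ 𝟙_ V ≫ (λ_ (𝟙_ V)).hom = (λ_ (𝟙_ V)).hom ≫ 𝟙 (𝟙_ V) by
      simp)
  μIso_hom_natural_right X' f := homMk_congr (X := ⟨_, _⟩) (Y := ⟨_, _⟩)
    (show X' ◁ f ≫ 𝟙 (X' ⊗ _) = 𝟙 (X' ⊗ _) ≫ X' ◁ f by
      simp)
    (show 𝟙_ V ◁ 𝟙 (𝟙_ V) ≫ (λ_ (𝟙_ V)).hom = (λ_ (𝟙_ V)).hom ≫ 𝟙 (𝟙_ V) by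
      simp)
  associativity X Y Z := homMk_congr (X := ⟨_, _⟩) (Y := ⟨_, _⟩)
    (show 𝟙 (X ⊗ Y) ▷ Z ≫ 𝟙 ((X ⊗ Y) ⊗ Z) ≫ (α_ X Y Z).hom = (α_ X Y Z).hom ≫ X ◁ 𝟙 (Y ⊗ Z) ≫ 𝟙 (X ⊗ Y ⊗ Z) by
      simp)
    (show (λ_ (𝟙_ V)).hom ▷ 𝟙_ V ≫ (λ_ (𝟙_ V)).hom ≫ 𝟙 (𝟙_ V) = (α_ (𝟙_ V) (𝟙_ V) (𝟙_ V)).hom ≫ 𝟙_ V ◁ (λ_ (𝟙_ V)).hom ≫ (λ_ (𝟙_ V)).hom by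
      simp [unitors_equal])
  left_unitality X := homMk_congr (X := ⟨_, _⟩) (Y := ⟨_, _⟩)
    (show (λ_ X).hom = 𝟙 (𝟙_ T) ▷ X ≫ 𝟙 (𝟙_ T ⊗ X) ≫ (λ_ X).hom by
      simp)
    (show (λ_ (𝟙_ V)).hom = 𝟙 (𝟙_ V) ▷ 𝟙_ V ≫ (λ_ (𝟙_ V)).hom ≫ 𝟙 (𝟙_ V) by
      simp)
  right_unitality X := homMk_congr (X := ⟨_, _⟩) (Y := ⟨_, _⟩)
    (show (ρ_ X).hom = X ◁ 𝟙 (𝟙_ T) ≫ 𝟙 (X ⊗ 𝟙_ T) ≫ (ρ_ X).hom by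
      simp)
    (show (ρ_ (𝟙_ V)).hom = 𝟙_ V ◁ 𝟙 (𝟙_ V) ≫ (λ_ (𝟙_ V)).hom ≫ 𝟙 (𝟙_ V) by
      simp [unitors_equal])

instance : (fix k T (𝟙_ V)).Monoidal := fixCoreMonoidal.toMonoidal

instance [SymmetricCategory T] [SymmetricCategory V] : (fix k T (𝟙_ V)).Braided where
  braided X Y := homMk_congr (X := ⟨_, _⟩) (Y := ⟨_, _⟩)
    (show 𝟙 (X ⊗ Y) ≫ (β_ X Y).hom = (β_ X Y).hom ≫ 𝟙 (Y ⊗ X) by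
      simp)
    (show (λ_ (𝟙_ V)).hom ≫ 𝟙 (𝟙_ V) = (β_ (𝟙_ V) (𝟙_ V)).hom ≫ (λ_ (𝟙_ V)).hom by
      simp [← unitors_equal])

/-- The embedding `Y ↦ (𝟙, Y)` is monoidal. -/
def fixLeftCoreMonoidal : (fixLeft k V (𝟙_ T)).CoreMonoidal where
  εIso := Iso.refl _
  μIso X Y := isoMk (λ_ (𝟙_ T)) (Iso.refl (X ⊗ Y))
  μIso_hom_natural_left f X' := homMk_congr (X := ⟨_, _⟩) (Y := ⟨_, _⟩)
    (show 𝟙 (𝟙_ T) ▷ 𝟙_ T ≫ (λ_ (𝟙_ T)).hom = (λ_ (𝟙_ T)).hom ≫ 𝟙 (𝟙_ T) by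
      simp)
    (show f ▷ X' ≫ 𝟙 (_ ⊗ X') = 𝟙 (_ ⊗ X') ≫ f ▷ X' by
      simp)
  μIso_hom_natural_right X' f := homMk_congr (X := ⟨_, _⟩) (Y := ⟨_, _⟩)
    (show 𝟙_ T ◁ 𝟙 (𝟙_ T) ≫ (λ_ (𝟙_ T)).hom = (λ_ (𝟙_ T)).hom ≫ 𝟙 (𝟙_ T) by
      simp)
    (show X' ◁ f ≫ 𝟙 (X' ⊗ _) = 𝟙 (X' ⊗ _) ≫ X' ◁ f by
      simp)
  associativity X Y Z := homMk_congr (X := ⟨_, _⟩) (Y := ⟨_, _⟩)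
    (show (λ_ (𝟙_ T)).hom ▷ 𝟙_ T ≫ (λ_ (𝟙_ T)).hom ≫ 𝟙 (𝟙_ T) = (α_ (𝟙_ T) (𝟙_ T) (𝟙_ T)).hom ≫ 𝟙_ T ◁ (λ_ (𝟙_ T)).hom ≫ (λ_ (𝟙_ T)).hom by
      simp [unitors_equal])
    (show 𝟙 (X ⊗ Y) ▷ Z ≫ 𝟙 ((X ⊗ Y) ⊗ Z) ≫ (α_ X Y Z).hom = (α_ X Y Z).hom ≫ X ◁ 𝟙 (Y ⊗ Z) ≫ 𝟙 (X ⊗ Y ⊗ Z) by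
      simp)
  left_unitality X := homMk_congr (X := ⟨_, _⟩) (Y := ⟨_, _⟩)
    (show (λ_ (𝟙_ T)).hom = 𝟙 (𝟙_ T) ▷ 𝟙_ T ≫ (λ_ (𝟙_ T)).hom ≫ 𝟙 (𝟙_ T) by
      simp)
    (show (λ_ X).hom = 𝟙 (𝟙_ V) ▷ X ≫ 𝟙 (𝟙_ V ⊗ X) ≫ (λ_ X).hom by
      simp)
  right_unitality X := homMk_congr (X := ⟨_, _⟩) (Y := ⟨_, _⟩)
    (show (ρ_ (𝟙_ T)).hom = 𝟙_ T ◁ 𝟙 (𝟙_ T) ≫ (λ_ (𝟙_ T)).hom ≫ 𝟙 (𝟙_ T) by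
      simp [unitors_equal])
    (show (ρ_ X).hom = X ◁ 𝟙 (𝟙_ V) ≫ 𝟙 (X ⊗ 𝟙_ V) ≫ (ρ_ X).hom by
      simp)

instance : (fixLeft k V (𝟙_ T)).Monoidal := fixLeftCoreMonoidal.toMonoidal

instance [SymmetricCategory T] [SymmetricCategory V] : (fixLeft k V (𝟙_ T)).Braided where
  braided X Y := homMk_congr (X := ⟨_, _⟩) (Y := ⟨_, _⟩)
    (show (λ_ (𝟙_ T)).hom ≫ 𝟙 (𝟙_ T) = (β_ (𝟙_ T) (𝟙_ T)).hom ≫ (λ_ (𝟙_ T)).hom by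
      simp [← unitors_equal])
    (show 𝟙 (X ⊗ Y) ≫ (β_ X Y).hom = (β_ X Y).hom ≫ 𝟙 (Y ⊗ X) by
      simp)

/-- Duals are formed componentwise. -/
abbrev exactPairing (X X' : T) (Y Y' : V) [ExactPairing X X'] [ExactPairing Y Y'] :
    ExactPairing (⟨X, Y⟩ : LinTensor k T V) ⟨X', Y'⟩ where
  coevaluation' := homMk (X := ⟨𝟙_ T, 𝟙_ V⟩) (Y := ⟨X ⊗ X', Y ⊗ Y'⟩) (η_ X X') (η_ Y Y')
  evaluation' := homMk (X := ⟨X' ⊗ X, Y' ⊗ Y⟩) (Y := ⟨𝟙_ T, 𝟙_ V⟩) (ε_ X X') (ε_ Y Y')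
  coevaluation_evaluation' := homMk_congr (X := ⟨_, _⟩) (Y := ⟨_, _⟩)
    (ExactPairing.coevaluation_evaluation ..) (ExactPairing.coevaluation_evaluation ..)
  evaluation_coevaluation' := homMk_congr (X := ⟨_, _⟩) (Y := ⟨_, _⟩)
    (ExactPairing.evaluation_coevaluation ..) (ExactPairing.evaluation_coevaluation ..)

end LinTensor

namespace TensorCat

section dual
variable {C : Type u} [Category.{v} C] [MonoidalCategory C]

lemma preservesColimits_tensorLeft_of_exactPairing (X Y : C) [ExactPairing X Y] :
    PreservesFiniteColimits (tensorLeft Y) :=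
  ⟨fun _ _ _ => (tensorLeftAdjunction X Y).leftAdjoint_preservesColimits.1⟩

lemma preservesColimits_tensorRight_of_exactPairing (X Y : C) [ExactPairing X Y] :
    PreservesFiniteColimits (tensorRight X) :=
  ⟨fun _ _ _ => (tensorRightAdjunction X Y).leftAdjoint_preservesColimits.1⟩

end dual

/-! ### The product is a tensor category. -/

section box
open LinTensor
variable {k : Type w} [Field k] {T : Type u₁} {V : Type u₂} [Category.{v} T] [Category.{v} V]
  [Preadditive T] [Preadditive V] [Linear k T] [Linear k V]
  [MonoidalCategory T] [MonoidalCategory V] [SymmetricCategory T] [SymmetricCategory V]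
  [MonoidalPreadditive T] [MonoidalPreadditive V] [MonoidalLinear k T] [MonoidalLinear k V]

instance : (inT k T V).Braided := inferInstanceAs (fix k T (𝟙_ V) ⋙ toKaroubi _).Braided

instance : (inV k T V).Braided := inferInstanceAs (fixLeft k V (𝟙_ T) ⋙ toKaroubi _).Braided

instance : (inT k T V).Additive := inferInstanceAs (boxFix k T (𝟙_ V)).Additive

instance : (inT k T V).Linear k := inferInstanceAs ((boxFix k T (𝟙_ V)).Linear k)

instance : (inV k T V).Additive := inferInstanceAs (boxFixLeft k V (𝟙_ T)).Additive

instance : (inV k T V).Linear k := inferInstanceAs ((boxFixLeft k V (𝟙_ T)).Linear k)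

/-- Every object is a retract of a pair, whose dual is formed componentwise, and retracts of
dualisable objects are dualisable. -/
lemma box_dualisable (hT : ∀ X : T, ∃ Y, Nonempty (ExactPairing X Y))
    (hV : ∀ X : V, ∃ Y, Nonempty (ExactPairing X Y)) (A : Box k T V) :
    ∃ A', Nonempty (ExactPairing A A') := by
  obtain ⟨X', ⟨h⟩⟩ := hT A.X.fst
  obtain ⟨Y', ⟨h'⟩⟩ := hV A.X.snd
  let := LinTensor.exactPairing (k := k) A.X.fst X' A.X.snd Y'
  let := exactPairingMap (toKaroubi _) (⟨A.X.fst, A.X.snd⟩ : LinTensor k T V) ⟨X', Y'⟩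
  refine exists_exactPairing_of_retract (Y := (toKaroubi (LinTensor k T V)).obj A.X)
    (Y' := (toKaroubi (LinTensor k T V)).obj ⟨X', Y'⟩) ⟨A.decompId_i, A.decompId_p, A.decompId.symm⟩

lemma box_scalars [EssentiallySmall.{v} T] [EssentiallySmall.{v} V] [IsAbelian T] [IsAbelian V]
    (hT : IsTensorCategory k T) (hV : IsTensorCategory k V) :
    Function.Bijective fun a : k => a • 𝟙 (𝟙_ (Box k T V)) := by
  have h (a : k) : a • 𝟙 (𝟙_ (Box k T V)) = (boxFix k T (𝟙_ V)).map (a • 𝟙 (𝟙_ T)) := by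
    rw [Functor.map_smul, CategoryTheory.Functor.map_id]; rfl
  constructor
  · intro a b hab
    refine hT.scalars.1 (boxFix_map_injective (k := k) hV.scalars ?_)
    exact (h a).symm.trans (Eq.trans hab (h b))
  · intro t
    obtain ⟨g, hg⟩ := boxFix_map_surjective (k := k) hV.scalars (X := 𝟙_ T) (Y := 𝟙_ T) t
    obtain ⟨a, rfl⟩ := hT.scalars.2 g
    exact ⟨a, (h a).trans hg⟩

lemma isTensorCategory_box [EssentiallySmall.{v} T] [EssentiallySmall.{v} V] [IsAbelian T]
    [IsAbelian V] [IsAbelian (Box k T V)] (hT : IsTensorCategory k T) (hV : IsTensorCategory k V) :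
    IsTensorCategory k (Box k T V) where
  unit_nonzero h := by
    have := (box_scalars hT hV).1 (a₁ := 1) (a₂ := 0) (h.eq_of_src _ _)
    exact one_ne_zero this
  rightExact_left A := by
    obtain ⟨A', ⟨h⟩⟩ := box_dualisable (k := k) hT.dualisable hV.dualisable A
    have := BraidedCategory.exactPairing_swap A A'
    exact preservesColimits_tensorLeft_of_exactPairing A' A
  rightExact_right A := by
    obtain ⟨A', ⟨h⟩⟩ := box_dualisable (k := k) hT.dualisable hV.dualisable A
    exact preservesColimits_tensorRight_of_exactPairing A A'
  scalars := box_scalars hT hV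
  dualisable := box_dualisable hT.dualisable hV.dualisable

lemma preservesFiniteColimits_inT [IsAbelian T] [IsAbelian (Box k T V)] :
    PreservesFiniteColimits (inT k T V) := by
  have : HasZeroObject (Box k T V) := hasZeroObject_of_hasFiniteBiproducts _
  exact preservesFiniteColimits_of_isCok _ fun _ _ _ _ _ h => isCok_boxFix (𝟙_ V) h

lemma preservesFiniteColimits_inV [IsAbelian V] [IsAbelian (Box k T V)]
    (hV : IsSchurianSemisimple k V) : PreservesFiniteColimits (inV k T V) := by
  have : HasZeroObject (Box k T V) := hasZeroObject_of_hasFiniteBiproducts _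
  exact preservesFiniteColimits_of_isRegular (fun _ _ f => hV.isRegular f) _

lemma mono_inT_map [IsAbelian T] {X Y : T} (f : X ⟶ Y) [Mono f] : Mono ((inT k T V).map f) := by
  refine (isKer_boxFix (𝟙_ V) (f := cokernel.π f) (ι := f) ?_).mono
  let := abelianOfIsAbelian T
  refine ⟨fun W w hw => by rw [← cancel_mono f, hw, zero_comp], cokernel.condition f,
    fun W w hw => ⟨Abelian.monoLift f w hw, Abelian.monoLift_comp ..⟩⟩

end box
end TensorCat
/-! ### Free modules over a family of commutative algebras -/

namespace TensorCat
open MonObj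

section linear
variable {D : Type u} [Category.{v} D] [MonoidalCategory D]

/-- `f : A ⊗ X ⟶ A ⊗ Y` is `A`-linear. -/
def IsLin (A : D) [MonObj A] {X Y : D} (f : A ⊗ X ⟶ A ⊗ Y) : Prop :=
  (α_ A A X).inv ≫ μ ▷ X ≫ f = A ◁ f ≫ (α_ A A Y).inv ≫ μ ▷ Y

/-- Tensoring a morphism of free modules on the right. -/
def twist (A : D) {X Y : D} (f : A ⊗ X ⟶ A ⊗ Y) (Z : D) : A ⊗ (X ⊗ Z) ⟶ A ⊗ (Y ⊗ Z) :=
  (α_ A X Z).inv ≫ f ▷ Z ≫ (α_ A Y Z).hom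

variable (A : D) [MonObj A]

lemma isLin_whiskerLeft {X Y : D} (g : X ⟶ Y) : IsLin A (A ◁ g) := by
  unfold IsLin
  rw [← whisker_exchange, associator_inv_naturality_right_assoc]

variable {A}

lemma IsLin.comp {X Y Z : D} {f : A ⊗ X ⟶ A ⊗ Y} {g : A ⊗ Y ⟶ A ⊗ Z} (hf : IsLin A f)
    (hg : IsLin A g) : IsLin A (f ≫ g) := by
  unfold IsLin at *
  rw [reassoc_of% hf, hg, MonoidalCategory.whiskerLeft_comp_assoc]

lemma IsLin.twist {X Y : D} {f : A ⊗ X ⟶ A ⊗ Y} (hf : IsLin A f) (Z : D) :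
    IsLin A (twist A f Z) := by
  unfold IsLin at *
  have h := congrArg (fun t => (α_ A (A ⊗ X) Z).inv ≫ t ▷ Z ≫ (α_ A Y Z).hom) hf
  simp only [comp_whiskerRight, Category.assoc] at h
  unfold TensorCat.twist
  calc _ = A ◁ (α_ A X Z).inv ≫ ((α_ A (A ⊗ X) Z).inv ≫ (α_ A A X).inv ▷ Z ≫ μ ▷ X ▷ Z ≫
        f ▷ Z ≫ (α_ A Y Z).hom) := by simp
    _ = _ := by rw [h]; simp

/-- A linear morphism on a free module is recovered from its restriction to the generators by
extending linearly. -/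
lemma IsLin.ext {X Y : D} {f g : A ⊗ X ⟶ A ⊗ Y} (hf : IsLin A f) (hg : IsLin A g)
    (h : η ▷ X ≫ f = η ▷ X ≫ g) : f = g := by
  unfold IsLin at *
  have key (f : A ⊗ X ⟶ A ⊗ Y) (hf : (α_ A A X).inv ≫ μ ▷ X ≫ f = A ◁ f ≫ (α_ A A Y).inv ≫ μ ▷ Y) :
      f = A ◁ ((λ_ X).inv ≫ η ▷ X ≫ f) ≫ (α_ A A Y).inv ≫ μ ▷ Y := by
    rw [MonoidalCategory.whiskerLeft_comp, MonoidalCategory.whiskerLeft_comp, Category.assoc,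
      Category.assoc, ← hf, associator_inv_naturality_middle_assoc, ← comp_whiskerRight_assoc,
      MonObj.mul_one]
    simp
  rw [key f hf, key g hg, h]

/-- The morphisms of free modules extending a morphism to a free module. -/
def extend {X Y : D} (f : X ⟶ A ⊗ Y) : A ⊗ X ⟶ A ⊗ Y := A ◁ f ≫ (α_ A A Y).inv ≫ μ ▷ Y

lemma isLin_extend {X Y : D} (f : X ⟶ A ⊗ Y) : IsLin A (extend f) := by
  unfold IsLin extend
  rw [← whisker_exchange_assoc, ← associator_inv_naturality_right_assoc]
  simp only [MonoidalCategory.whiskerLeft_comp, Category.assoc]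
  rw [associator_inv_naturality_left_assoc, ← comp_whiskerRight, MonObj.mul_assoc]
  simp

lemma unit_extend {X Y : D} (f : X ⟶ A ⊗ Y) : (λ_ X).inv ≫ η ▷ X ≫ extend f = f := by
  unfold extend
  rw [← whisker_exchange_assoc, associator_inv_naturality_left_assoc, ← comp_whiskerRight,
    MonObj.one_mul]
  simp

lemma IsLin.eq_extend {X Y : D} {f : A ⊗ X ⟶ A ⊗ Y} (hf : IsLin A f) :
    f = extend ((λ_ X).inv ≫ η ▷ X ≫ f) :=
  hf.ext (isLin_extend _) (by rw [← cancel_epi (λ_ X).inv, unit_extend])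

variable [SymmetricCategory D]

/-- A left linear and a right linear morphism commute. -/
lemma exchange_middle {W X Y Z : D} (f : W ⊗ A ⟶ X ⊗ A)
    (hf : (α_ W A A).hom ≫ W ◁ μ ≫ f = f ▷ A ≫ (α_ X A A).hom ≫ X ◁ μ)
    {g : A ⊗ Y ⟶ A ⊗ Z} (hg : IsLin A g) :
    (α_ W A Y).hom ≫ W ◁ g ≫ (α_ W A Z).inv ≫ f ▷ Z =
      f ▷ Y ≫ (α_ X A Y).hom ≫ X ◁ g ≫ (α_ X A Z).inv := by
  -- The morphism `m` multiplies two neighbouring copies of `A`. Right linearity of `f` and left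
  -- linearity of `g` say that both commute with it, and it is a split epimorphism; so the claim
  -- follows from the interchange law with two separate copies of `A`.
  let m (P Q : D) : (P ⊗ A) ⊗ (A ⊗ Q) ⟶ (P ⊗ A) ⊗ Q :=
    (α_ (P ⊗ A) A Q).inv ≫ ((α_ P A A).hom ≫ P ◁ μ) ▷ Q
  have hm (P Q : D) : m P Q = (α_ P A (A ⊗ Q)).hom ≫ P ◁ ((α_ A A Q).inv ≫ μ ▷ Q) ≫
      (α_ P A Q).inv := by
    simp [m]
  have hs (P Q : D) : ((P ⊗ A) ◁ ((λ_ Q).inv ≫ η ▷ Q)) ≫ m P Q = 𝟙 _ := by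
    simp only [m, MonoidalCategory.whiskerLeft_comp, Category.assoc]
    rw [associator_inv_naturality_middle_assoc, ← comp_whiskerRight,
      associator_naturality_right_assoc, ← MonoidalCategory.whiskerLeft_comp, MonObj.mul_one]
    simp
  have h₁ (Q : D) : f ▷ (A ⊗ Q) ≫ m X Q = m W Q ≫ f ▷ Q := by
    simp only [m]
    rw [associator_inv_naturality_left_assoc, ← comp_whiskerRight, ← hf]
    simp
  have h₂ (P : D) : (P ⊗ A) ◁ g ≫ m P Z =
      m P Y ≫ (α_ P A Y).hom ≫ P ◁ g ≫ (α_ P A Z).inv := by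
    unfold IsLin at hg
    rw [hm, hm, associator_naturality_right_assoc, ← MonoidalCategory.whiskerLeft_comp_assoc,
      ← hg]
    simp
  have : Epi (m W Y) := by
    have : IsSplitEpi (m W Y) := ⟨⟨_, hs W Y⟩⟩
    infer_instance
  rw [← cancel_epi (m W Y)]
  have e₁ := reassoc_of% (h₂ W)
  rw [← e₁, ← h₁, whisker_exchange_assoc, h₂, reassoc_of% (h₁ Y)]

/-- Linear morphisms in the two factors of a tensor product commute. -/
lemma IsLin.exchange [IsCommMonObj A] {W X Y Z : D} {f : A ⊗ W ⟶ A ⊗ X} {g : A ⊗ Y ⟶ A ⊗ Z}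
    (hf : IsLin A f) (hg : IsLin A g) :
    TensorCat.twist A f Y ≫ (A ◁ (β_ X Y).hom ≫ TensorCat.twist A g X ≫ A ◁ (β_ Z X).hom) =
      (A ◁ (β_ W Y).hom ≫ TensorCat.twist A g W ≫ A ◁ (β_ Z W).hom) ≫ TensorCat.twist A f Z := by
  -- Move `A` between the two factors. Then `f` acts on `A` together with its left neighbour and `g`
  -- on `A` together with its right neighbour, as in `exchange_middle`.
  let θ (P Q : D) : A ⊗ (P ⊗ Q) ≅ P ⊗ (A ⊗ Q) :=
    (α_ A P Q).symm ≪≫ whiskerRightIso (β_ A P) Q ≪≫ α_ P A Q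
  have hθ (P : D) : A ◁ (β_ P Y).hom ≫ TensorCat.twist A g P ≫ A ◁ (β_ Z P).hom =
      (θ P Y).hom ≫ P ◁ g ≫ (θ P Z).inv := by
    have h₁ : g ▷ P = (β_ (A ⊗ Y) P).hom ≫ P ◁ g ≫ (β_ P (A ⊗ Z)).hom := by
      rw [← BraidedCategory.braiding_naturality_left_assoc, SymmetricCategory.symmetry,
        Category.comp_id]
    have h₂ : A ◁ (β_ P Y).hom ≫ (α_ A Y P).inv ≫ (β_ (A ⊗ Y) P).hom = (θ P Y).hom := by
      have : A ◁ (β_ P Y).hom ≫ A ◁ (β_ Y P).hom = 𝟙 _ := by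
        rw [← MonoidalCategory.whiskerLeft_comp, SymmetricCategory.symmetry,
          MonoidalCategory.whiskerLeft_id]
      simp [θ, BraidedCategory.braiding_tensor_left_hom, reassoc_of% this]
    have h₃ : (β_ P (A ⊗ Z)).hom ≫ (α_ A Z P).hom ≫ A ◁ (β_ Z P).hom = (θ P Z).inv := by
      have : A ◁ (β_ P Z).hom ≫ A ◁ (β_ Z P).hom = 𝟙 _ := by
        rw [← MonoidalCategory.whiskerLeft_comp, SymmetricCategory.symmetry,
          MonoidalCategory.whiskerLeft_id]
      simp [θ, BraidedCategory.braiding_tensor_right_hom, this,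
        ← SymmetricCategory.braiding_swap_eq_inv_braiding]
    rw [TensorCat.twist, h₁]
    simp only [Category.assoc]
    rw [reassoc_of% h₂, h₃]
  -- Commutativity of `A` turns the left linear `f` into a right linear morphism.
  have hf' : (α_ W A A).hom ≫ W ◁ μ ≫ (β_ W A).hom ≫ f ≫ (β_ A X).hom =
      ((β_ W A).hom ≫ f ≫ (β_ A X).hom) ▷ A ≫ (α_ X A A).hom ≫ X ◁ μ := by
    unfold IsLin at hf
    have hc (P : D) : (α_ P A A).hom ≫ P ◁ μ ≫ (β_ P A).hom = ((β_ P A).hom ▷ A) ≫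
        (β_ (A ⊗ P) A).hom ≫ (α_ A A P).inv ≫ μ ▷ P := by
      have h := congrArg (· ▷ P) (IsCommMonObj.mul_comm A)
      rw [BraidedCategory.braiding_naturality_right]
      simp only [comp_whiskerRight] at h
      simp [BraidedCategory.braiding_tensor_left_hom, BraidedCategory.braiding_tensor_right_hom,
        h]
    have hc' (P : D) : (β_ (A ⊗ P) A).hom ≫ (α_ A A P).inv ≫ μ ▷ P ≫ (β_ A P).hom =
        ((β_ A P).hom ▷ A) ≫ (α_ P A A).hom ≫ P ◁ μ := by
      have := hc P
      rw [← cancel_epi ((β_ A P).hom ▷ A), ← comp_whiskerRight_assoc, SymmetricCategory.symmetry,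
        id_whiskerRight, Category.id_comp] at this
      rw [← reassoc_of% this, SymmetricCategory.symmetry, Category.comp_id]
    rw [reassoc_of% (hc W), reassoc_of% hf, ← BraidedCategory.braiding_naturality_left_assoc,
      hc']
    simp
  have key := exchange_middle ((β_ W A).hom ≫ f ≫ (β_ A X).hom) hf' hg
  rw [hθ, hθ]
  have sA (P : D) : (β_ A P).hom ▷ Y ≫ (β_ P A).hom ▷ Y = 𝟙 _ := by
    rw [← comp_whiskerRight, SymmetricCategory.symmetry, id_whiskerRight]
  have sB (P : D) : (β_ A P).hom ▷ Z ≫ (β_ P A).hom ▷ Z = 𝟙 _ := by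
    rw [← comp_whiskerRight, SymmetricCategory.symmetry, id_whiskerRight]
  have hA : TensorCat.twist A f Y ≫ (θ X Y).hom =
      (θ W Y).hom ≫ (α_ W A Y).inv ≫ ((β_ W A).hom ≫ f ≫ (β_ A X).hom) ▷ Y ≫ (α_ X A Y).hom := by
    simp [θ, TensorCat.twist, reassoc_of% (sA W)]
  have hB : (θ W Z).inv ≫ TensorCat.twist A f Z = (α_ W A Z).inv ≫
      ((β_ W A).hom ≫ f ≫ (β_ A X).hom) ▷ Z ≫ (α_ X A Z).hom ≫ (θ X Z).inv := by
    simp [θ, TensorCat.twist, ← SymmetricCategory.braiding_swap_eq_inv_braiding,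
      reassoc_of% (sB X)]
  rw [reassoc_of% hA, Category.assoc, Category.assoc, hB]
  have key' := congrArg (fun t => (α_ W A Y).inv ≫ t ≫ (α_ X A Z).hom ≫ (θ X Z).inv) key
  simp only [Category.assoc, Iso.inv_hom_id_assoc] at key'
  rw [key']

end linear

/-! ### The symmetric monoidal category of free modules over a family of algebras. -/

section family
variable {D : Type u} [Category.{v} D] [MonoidalCategory D] [Preadditive D]
  [MonoidalPreadditive D] (k : Type w) [Field k] [Linear k D] [MonoidalLinear k D]

/-- The module of `A`-linear morphisms `A ⊗ X ⟶ A ⊗ Y`. -/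
def linHom (A : D) [MonObj A] (X Y : D) : Submodule k (A ⊗ X ⟶ A ⊗ Y) where
  carrier := { f | IsLin A f }
  add_mem' {f g} hf hg := by
    change IsLin A (f + g)
    unfold IsLin
    simp only [Preadditive.comp_add, MonoidalPreadditive.whiskerLeft_add, Preadditive.add_comp]
    exact congrArg₂ (· + ·) hf hg
  zero_mem' := by
    change IsLin A 0
    unfold IsLin
    simp
  smul_mem' a f hf := by
    change IsLin A (a • f)
    unfold IsLin
    simp only [Linear.comp_smul, MonoidalLinear.whiskerLeft_smul, Linear.smul_comp]
    exact congrArg (a • ·) hf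

variable [SymmetricCategory D] {σ : Type v}

/-- Objects `X` of `D`, regarded as the families of free modules `A s ⊗ X`. -/
structure Kl (k : Type w) (A : σ → CommMon D) where
  of : D

namespace Kl
variable {k} {A : σ → CommMon D}

instance : Category.{v} (Kl k A) where
  Hom X Y := ∀ s, linHom k (A s).X X.of Y.of
  id X s := ⟨𝟙 _, by
    have := isLin_whiskerLeft (A s).X (𝟙 X.of)
    rwa [MonoidalCategory.whiskerLeft_id] at this⟩
  comp f g s := ⟨(f s).1 ≫ (g s).1, (f s).2.comp (g s).2⟩

instance : Preadditive (Kl k A) where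
  homGroup X Y := inferInstanceAs (AddCommGroup (∀ s, linHom k (A s).X X.of Y.of))
  add_comp _ _ _ _ _ _ := funext fun _ => Subtype.ext (Preadditive.add_comp ..)
  comp_add _ _ _ _ _ _ := funext fun _ => Subtype.ext (Preadditive.comp_add ..)

instance : Linear k (Kl k A) where
  homModule X Y := inferInstanceAs (Module k (∀ s, linHom k (A s).X X.of Y.of))
  smul_comp _ _ _ _ _ _ := funext fun _ => Subtype.ext (Linear.smul_comp ..)
  comp_smul _ _ _ _ _ _ := funext fun _ => Subtype.ext (Linear.comp_smul ..)

variable {X Y Z : Kl k A}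

lemma ext {f g : X ⟶ Y} (h : ∀ s, (f s).1 = (g s).1) : f = g := funext fun s => Subtype.ext (h s)

@[simp] lemma id_val (X : Kl k A) (s : σ) : (𝟙 X : X ⟶ X) s = (𝟙 _ : (A s).X ⊗ X.of ⟶ _) := rfl

@[simp] lemma comp_val (f : X ⟶ Y) (g : Y ⟶ Z) (s : σ) : ((f ≫ g) s).1 = (f s).1 ≫ (g s).1 := rfl

@[simp] lemma add_val (f g : X ⟶ Y) (s : σ) : ((f + g) s).1 = (f s).1 + (g s).1 := rfl

@[simp] lemma zero_val (s : σ) : ((0 : X ⟶ Y) s).1 = 0 := rfl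

@[simp] lemma smul_val (a : k) (f : X ⟶ Y) (s : σ) : ((a • f) s).1 = a • (f s).1 := rfl

/-- The morphism of free modules induced by a morphism of generators. -/
def free {X Y : D} (g : X ⟶ Y) : (⟨X⟩ : Kl k A) ⟶ ⟨Y⟩ := fun s =>
  ⟨(A s).X ◁ g, isLin_whiskerLeft (A s).X g⟩

@[simp] lemma free_val {X Y : D} (g : X ⟶ Y) (s : σ) :
    ((free g : (⟨X⟩ : Kl k A) ⟶ ⟨Y⟩) s).1 = (A s).X ◁ g := rfl

/-- Tensoring with an object on the right. -/
def tw (f : X ⟶ Y) (Z : D) : (⟨X.of ⊗ Z⟩ : Kl k A) ⟶ ⟨Y.of ⊗ Z⟩ := fun s =>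
  ⟨twist (A s).X (f s).1 Z, (f s).2.twist Z⟩

@[simp] lemma tw_val (f : X ⟶ Y) (Z : D) (s : σ) : (tw f Z s).1 = twist (A s).X (f s).1 Z := rfl

lemma free_id (X : D) : (free (𝟙 X) : (⟨X⟩ : Kl k A) ⟶ _) = 𝟙 _ := ext fun s => by simp

lemma free_comp {X Y Z : D} (f : X ⟶ Y) (g : Y ⟶ Z) :
    (free (f ≫ g) : (⟨X⟩ : Kl k A) ⟶ _) = free f ≫ free g := ext fun s => by simp

lemma free_add {X Y : D} (f g : X ⟶ Y) : (free (f + g) : (⟨X⟩ : Kl k A) ⟶ _) = free f + free g :=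
  ext fun s => by simp

lemma free_smul {X Y : D} (a : k) (f : X ⟶ Y) :
    (free (a • f) : (⟨X⟩ : Kl k A) ⟶ _) = a • free f := ext fun s => by simp

lemma tw_id (X : Kl k A) (Z : D) : tw (𝟙 X) Z = 𝟙 _ := ext fun s => by simp [twist]

lemma tw_comp (f : X ⟶ Y) (g : Y ⟶ Z) (W : D) : tw (f ≫ g) W = tw f W ≫ tw g W :=
  ext fun s => by simp [twist]

lemma tw_add (f g : X ⟶ Y) (W : D) : tw (f + g) W = tw f W + tw g W :=
  ext fun s => by simp [twist]

lemma tw_smul (a : k) (f : X ⟶ Y) (W : D) : tw (a • f) W = a • tw f W :=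
  ext fun s => by simp [twist]

lemma tw_free {X Y : D} (g : X ⟶ Y) (Z : D) :
    tw (free g : (⟨X⟩ : Kl k A) ⟶ _) Z = free (g ▷ Z) := ext fun s => by simp [twist]

lemma tw_tw (f : X ⟶ Y) (Z W : D) :
    tw (tw f Z) W ≫ free (α_ Y.of Z W).hom = free (α_ X.of Z W).hom ≫ tw f (Z ⊗ W) :=
  ext fun s => by simp [twist]

lemma tw_unit (f : X ⟶ Y) : tw f (𝟙_ D) ≫ free (ρ_ Y.of).hom = free (ρ_ X.of).hom ≫ f :=
  ext fun s => by simp [twist]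

lemma tw_naturality (f : X ⟶ Y) {Z W : D} (g : Z ⟶ W) :
    tw f Z ≫ free (Y.of ◁ g) = free (X.of ◁ g) ≫ tw f W := ext fun s => by
  simp only [comp_val, free_val, tw_val, twist, Category.assoc]
  rw [← associator_naturality_right, ← whisker_exchange_assoc,
    associator_inv_naturality_right_assoc]

/-- Tensoring with an object on the left. -/
def tl (Z : D) (f : X ⟶ Y) : (⟨Z ⊗ X.of⟩ : Kl k A) ⟶ ⟨Z ⊗ Y.of⟩ :=
  free (β_ Z X.of).hom ≫ tw f Z ≫ free (β_ Y.of Z).hom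

/-- Bifunctoriality of the tensor product of free modules; this is where commutativity of the
algebras enters. -/
lemma tw_tl_exchange {X' Y' : Kl k A} (f : X ⟶ Y) (g : X' ⟶ Y') :
    tw f X'.of ≫ tl Y.of g = tl X.of g ≫ tw f Y'.of := ext fun s =>
  IsLin.exchange (f s).2 (g s).2

instance : MonoidalCategoryStruct (Kl k A) where
  tensorObj X Y := ⟨X.of ⊗ Y.of⟩
  tensorUnit := ⟨𝟙_ D⟩
  whiskerLeft X _ _ f := tl X.of f
  whiskerRight f Y := tw f Y.of
  associator X Y Z :=
    { hom := free (α_ _ _ _).hom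
      inv := free (α_ _ _ _).inv
      hom_inv_id := by rw [← free_comp, Iso.hom_inv_id, free_id]
      inv_hom_id := by rw [← free_comp, Iso.inv_hom_id, free_id] }
  leftUnitor X :=
    { hom := free (λ_ X.of).hom
      inv := free (λ_ X.of).inv
      hom_inv_id := by rw [← free_comp, Iso.hom_inv_id, free_id]
      inv_hom_id := by rw [← free_comp, Iso.inv_hom_id, free_id] }
  rightUnitor X :=
    { hom := free (ρ_ X.of).hom
      inv := free (ρ_ X.of).inv
      hom_inv_id := by rw [← free_comp, Iso.hom_inv_id, free_id]
      inv_hom_id := by rw [← free_comp, Iso.inv_hom_id, free_id] }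

lemma tl_free (Z : D) {X Y : D} (g : X ⟶ Y) :
    tl Z (free g : (⟨X⟩ : Kl k A) ⟶ _) = free (Z ◁ g) := by
  rw [tl, tw_free, ← free_comp, ← free_comp, BraidedCategory.braiding_naturality_left]
  simp

lemma tl_id (X : Kl k A) (Z : D) : tl Z (𝟙 X) = 𝟙 _ := by
  rw [tl, tw_id, Category.id_comp, ← free_comp, SymmetricCategory.symmetry, free_id]

lemma tl_comp (f : X ⟶ Y) (g : Y ⟶ Z) (W : D) : tl W (f ≫ g) = tl W f ≫ tl W g := by
  rw [tl, tl, tl, tw_comp]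
  simp only [Category.assoc]
  rw [← Category.assoc (free _) (free _), ← free_comp, SymmetricCategory.symmetry, free_id,
    Category.id_comp]

lemma tw_swap (f : X ⟶ Y) (Z W : D) : tw f (Z ⊗ W) =
    free (X.of ◁ (β_ Z W).hom) ≫ tw f (W ⊗ Z) ≫ free (Y.of ◁ (β_ W Z).hom) := by
  rw [tw_naturality, ← Category.assoc, ← free_comp, ← MonoidalCategory.whiskerLeft_comp,
    SymmetricCategory.symmetry, MonoidalCategory.whiskerLeft_id, free_id, Category.id_comp]

lemma tw_assoc (f : X ⟶ Y) (Z W : D) :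
    tw (tw f Z) W = free (α_ X.of Z W).hom ≫ tw f (Z ⊗ W) ≫ free (α_ Y.of Z W).inv := by
  rw [← Category.assoc, ← tw_tw, Category.assoc, ← free_comp, Iso.hom_inv_id, free_id,
    Category.comp_id]

lemma tw_tl (Z : D) (f : X ⟶ Y) (W : D) : tw (tl Z f) W ≫ free (α_ Z Y.of W).hom =
    free (α_ Z X.of W).hom ≫ tl Z (tw f W) := by
  have h₁ : (β_ Z X.of).hom ▷ W ≫ (α_ X.of Z W).hom ≫ X.of ◁ (β_ Z W).hom =
      (α_ Z X.of W).hom ≫ (β_ Z (X.of ⊗ W)).hom ≫ (α_ X.of W Z).hom := by simp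
  have h₂ : Y.of ◁ (β_ W Z).hom ≫ (α_ Y.of Z W).inv ≫ (β_ Y.of Z).hom ▷ W ≫ (α_ Z Y.of W).hom =
      (α_ Y.of W Z).inv ≫ (β_ (Y.of ⊗ W) Z).hom := by
    simp [BraidedCategory.braiding_tensor_left_hom]
  rw [tl, tl, tw_comp, tw_comp, tw_free, tw_free, tw_assoc, tw_assoc, tw_swap f Z W]
  simp only [Category.assoc, ← free_comp, h₂]
  simp only [← Category.assoc, ← free_comp]
  simp only [Category.assoc, h₁]

lemma tl_tl (Z W : D) (f : X ⟶ Y) : tl (Z ⊗ W) f ≫ free (α_ Z W Y.of).hom =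
    free (α_ Z W X.of).hom ≫ tl Z (tl W f) := by
  have h₁ : (β_ (Z ⊗ W) X.of).hom ≫ X.of ◁ (β_ Z W).hom =
      (α_ Z W X.of).hom ≫ (β_ Z (W ⊗ X.of)).hom ≫ (β_ W X.of).hom ▷ Z ≫ (α_ X.of W Z).hom := by
    rw [← BraidedCategory.braiding_naturality_right_assoc]
    simp [BraidedCategory.braiding_tensor_left_hom, BraidedCategory.braiding_tensor_right_hom]
  have h₂ : Y.of ◁ (β_ W Z).hom ≫ (β_ Y.of (Z ⊗ W)).hom ≫ (α_ Z W Y.of).hom =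
      (α_ Y.of W Z).inv ≫ (β_ Y.of W).hom ▷ Z ≫ (β_ (W ⊗ Y.of) Z).hom := by
    rw [BraidedCategory.braiding_naturality_right_assoc]
    simp [BraidedCategory.braiding_tensor_left_hom, BraidedCategory.braiding_tensor_right_hom]
  rw [tl, tl, tl, tw_comp, tw_comp, tw_free, tw_free, tw_assoc, tw_swap f Z W]
  simp only [Category.assoc, ← free_comp, h₂]
  simp only [← Category.assoc, ← free_comp]
  simp only [Category.assoc, h₁]

instance : MonoidalCategory (Kl k A) where
  tensorHom_def _ _ := rfl
  id_tensorHom_id X Y := by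
    change tw (𝟙 X) Y.of ≫ tl X.of (𝟙 Y) = 𝟙 _
    rw [tw_id, tl_id, Category.id_comp]
  tensorHom_comp_tensorHom {X₁ Y₁ Z₁ X₂ Y₂ Z₂} f₁ f₂ g₁ g₂ := by
    change (tw f₁ X₂.of ≫ tl Y₁.of f₂) ≫ tw g₁ Y₂.of ≫ tl Z₁.of g₂ =
      tw (f₁ ≫ g₁) X₂.of ≫ tl Z₁.of (f₂ ≫ g₂)
    rw [tw_comp, tl_comp, Category.assoc, Category.assoc, ← reassoc_of% (tw_tl_exchange g₁ f₂)]
  whiskerLeft_id X Y := tl_id Y X.of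
  id_whiskerRight X Y := tw_id X Y.of
  associator_naturality {X₁ X₂ X₃ Y₁ Y₂ Y₃} f₁ f₂ f₃ := by
    change (tw (tw f₁ X₂.of ≫ tl Y₁.of f₂) X₃.of ≫ tl (Y₁.of ⊗ Y₂.of) f₃) ≫ free _ =
      free _ ≫ tw f₁ (X₂.of ⊗ X₃.of) ≫ tl Y₁.of (tw f₂ X₃.of ≫ tl Y₂.of f₃)
    rw [tw_comp, tl_comp, Category.assoc, Category.assoc, tl_tl, ← Category.assoc (tw (tl _ _) _),
      tw_tl, Category.assoc, ← Category.assoc (tw (tw _ _) _), tw_tw, Category.assoc]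
  leftUnitor_naturality {X Y} f := by
    change tl (𝟙_ D) f ≫ free _ = free _ ≫ f
    rw [tl, Category.assoc, Category.assoc, ← free_comp, braiding_leftUnitor, tw_unit,
      ← Category.assoc, ← free_comp]
    simp
  rightUnitor_naturality f := tw_unit f
  pentagon W X Y Z := by
    change tw (free _) Z.of ≫ free _ ≫ tl W.of (free _) = free _ ≫ free _
    rw [tw_free, tl_free, ← free_comp, ← free_comp, ← free_comp]
    exact congrArg free (MonoidalCategory.pentagon W.of X.of Y.of Z.of)
  triangle X Y := by
    change free _ ≫ tl X.of (free _) = tw (free _) Y.of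
    rw [tw_free, tl_free, ← free_comp]
    exact congrArg free (MonoidalCategory.triangle X.of Y.of)

instance : SymmetricCategory (Kl k A) where
  braiding X Y :=
    { hom := free (β_ _ _).hom
      inv := free (β_ _ _).inv
      hom_inv_id := (free_comp _ _).symm.trans
        ((congrArg free (Iso.hom_inv_id _)).trans (free_id _))
      inv_hom_id := (free_comp _ _).symm.trans
        ((congrArg free (Iso.inv_hom_id _)).trans (free_id _)) }
  braiding_naturality_right X Y Z f := by
    change tl X.of f ≫ free _ = free _ ≫ tw f X.of
    rw [tl, Category.assoc, Category.assoc, ← free_comp, SymmetricCategory.symmetry, free_id,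
      Category.comp_id]
  braiding_naturality_left {X Y} f Z := by
    change tw f Z.of ≫ free _ = free _ ≫ tl Z.of f
    rw [tl, ← Category.assoc, ← free_comp, SymmetricCategory.symmetry, free_id, Category.id_comp]
  hexagon_forward X Y Z := by
    change free _ ≫ free _ ≫ free _ = tw (free _) Z.of ≫ free _ ≫ tl Y.of (free _)
    rw [tw_free, tl_free]
    simp only [← free_comp]
    exact congrArg free (BraidedCategory.hexagon_forward X.of Y.of Z.of)
  hexagon_reverse X Y Z := by
    change free _ ≫ free _ ≫ free _ = tl X.of (free _) ≫ free _ ≫ tw (free _) Y.of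
    rw [tw_free, tl_free]
    simp only [← free_comp]
    exact congrArg free (BraidedCategory.hexagon_reverse X.of Y.of Z.of)
  symmetry X Y := by
    change free _ ≫ free _ = 𝟙 _
    rw [← free_comp, SymmetricCategory.symmetry, free_id]

instance : MonoidalPreadditive (Kl k A) where
  whiskerLeft_zero {X Y Z} := by
    change free _ ≫ tw 0 _ ≫ free _ = 0
    have : tw (0 : Y ⟶ Z) X.of = 0 := ext fun s => by simp [twist]
    rw [this, zero_comp, comp_zero]
  zero_whiskerRight := ext fun s => by
    change twist _ 0 _ = 0
    simp [twist]
  whiskerLeft_add f g := by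
    change free _ ≫ tw (f + g) _ ≫ free _ = free _ ≫ tw f _ ≫ free _ + free _ ≫ tw g _ ≫ free _
    rw [tw_add, Preadditive.add_comp, Preadditive.comp_add]
  add_whiskerRight f g := tw_add f g _

instance : MonoidalLinear k (Kl k A) where
  whiskerLeft_smul X _ _ a f := by
    change free _ ≫ tw (a • f) _ ≫ free _ = a • (free _ ≫ tw f _ ≫ free _)
    rw [tw_smul, Linear.smul_comp, Linear.comp_smul]
  smul_whiskerRight a _ _ f X := tw_smul a f _

variable (k A) in
/-- The functor sending an object to the free modules on it. -/
def freeFunctor : D ⥤ Kl k A where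
  obj X := ⟨X⟩
  map f := free f
  map_id := free_id
  map_comp := free_comp

instance : (freeFunctor k A).Additive where
  map_add := free_add _ _

instance : (freeFunctor k A).Linear k where
  map_smul f a := free_smul a f

/-- The free module functor is strictly monoidal. -/
def freeCoreMonoidal : (freeFunctor k A).CoreMonoidal where
  εIso := Iso.refl _
  μIso X Y := Iso.refl _
  μIso_hom_natural_left f X' := (Category.comp_id _).trans ((tw_free f X').trans (Category.id_comp _).symm)
  μIso_hom_natural_right X' f := (Category.comp_id _).trans ((tl_free X' f).trans (Category.id_comp _).symm)
  associativity X Y Z := by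
    change tw (𝟙 (⟨X ⊗ Y⟩ : Kl k A)) Z ≫ 𝟙 (⟨(X ⊗ Y) ⊗ Z⟩ : Kl k A) ≫ free (α_ X Y Z).hom =
      free (α_ X Y Z).hom ≫ tl X (𝟙 (⟨Y ⊗ Z⟩ : Kl k A)) ≫ 𝟙 (⟨X ⊗ (Y ⊗ Z)⟩ : Kl k A)
    rw [tw_id, tl_id, Category.id_comp, Category.id_comp, Category.id_comp, Category.comp_id]
  left_unitality X := by
    change free _ = tw (𝟙 _) X ≫ 𝟙 _ ≫ free _
    rw [tw_id]
    exact ((Category.id_comp _).trans (Category.id_comp _)).symm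
  right_unitality X := by
    change free _ = tl X (𝟙 _) ≫ 𝟙 _ ≫ free _
    rw [tl_id]
    exact ((Category.id_comp _).trans (Category.id_comp _)).symm

instance : (freeFunctor k A).Monoidal := freeCoreMonoidal.toMonoidal

instance : (freeFunctor k A).Braided where
  braided X Y := (Category.id_comp _).trans (Category.comp_id _).symm

/-- The morphism of free modules extending morphisms to free modules. -/
def lift {X : D} {Y : Kl k A} (f : ∀ s, X ⟶ (A s).X ⊗ Y.of) : (⟨X⟩ : Kl k A) ⟶ Y := fun s =>
  ⟨extend (f s), isLin_extend (f s)⟩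

lemma ext_unit {f g : X ⟶ Y} (h : ∀ s, (λ_ X.of).inv ≫ η ▷ X.of ≫ (f s).1 =
    (λ_ X.of).inv ≫ η ▷ X.of ≫ (g s).1) : f = g :=
  ext fun s => (f s).2.ext (g s).2 (by rw [← cancel_epi (λ_ X.of).inv, h])

lemma unit_free_comp {X Y : D} {Z : Kl k A} (f : X ⟶ Y) (g : (⟨Y⟩ : Kl k A) ⟶ Z) (s : σ) :
    (λ_ X).inv ≫ η ▷ X ≫ ((free f ≫ g) s).1 = f ≫ (λ_ Y).inv ≫ η ▷ Y ≫ (g s).1 := by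
  rw [comp_val, free_val, ← whisker_exchange_assoc]
  simp

lemma unit_zero (X Y : Kl k A) (s : σ) :
    (λ_ X.of).inv ≫ η ▷ X.of ≫ ((0 : X ⟶ Y) s).1 = 0 := by
  change _ ≫ _ ≫ (0 : _ ⟶ (A s).X ⊗ Y.of) = 0
  rw [comp_zero, comp_zero]

lemma unit_lift {X : D} {Y : Kl k A} (f : ∀ s, X ⟶ (A s).X ⊗ Y.of) (s : σ) :
    (λ_ X).inv ≫ η ▷ X ≫ (lift f s).1 = f s := unit_extend (f s)

/-- Linear morphisms out of free modules are families of morphisms out of the generators, so the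
universal property is checked on generators for each algebra. Exactness of `A ⊗ -` plays no role. -/
lemma isCok_free {X Y Z : D} {f : X ⟶ Y} {π : Y ⟶ Z} (h : IsCok f π) :
    IsCok ((freeFunctor k A).map f) ((freeFunctor k A).map π) where
  cancel W w hw := by
    refine ext_unit fun s => ?_
    have := congrArg (fun t : (⟨Y⟩ : Kl k A) ⟶ W => (λ_ Y).inv ≫ η ▷ Y ≫ (t s).1) hw
    exact (h.cancel _ ((unit_free_comp π w s).symm.trans (this.trans (unit_zero _ _ s)))).trans
      (unit_zero _ _ s).symm
  comp := by rw [← Functor.map_comp, h.comp, Functor.map_zero]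
  desc W w hw := by
    have hl (s : σ) : ∃ l, π ≫ l = (λ_ Y).inv ≫ η ▷ Y ≫ (w s).1 := by
      refine h.desc _ ((unit_free_comp f w s).symm.trans ?_)
      have := congrArg (fun t : (⟨X⟩ : Kl k A) ⟶ W => (λ_ X).inv ≫ η ▷ X ≫ (t s).1) hw
      exact this.trans (unit_zero _ _ s)
    choose l hl using hl
    refine ⟨lift l, ext_unit fun s => ?_⟩
    exact (unit_free_comp π (lift l) s).trans ((congrArg (π ≫ ·) (unit_lift l s)).trans (hl s))

end Kl
end family
end TensorCat
/-! ### Quotients by tensor ideals -/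

namespace TensorCat

section quotient
variable (k : Type w) [Field k] (L : Type u) [Category.{v} L] [Preadditive L] [Linear k L]
  [MonoidalCategory L]

/-- A tensor ideal of `k`-linear morphisms. -/
structure TensorIdeal where
  sub (P Q : L) : Submodule k (P ⟶ Q)
  comp_mem {P Q R : L} {f : P ⟶ Q} (hf : f ∈ sub P Q) (g : Q ⟶ R) : f ≫ g ∈ sub P R
  precomp_mem {P Q R : L} (g : P ⟶ Q) {f : Q ⟶ R} (hf : f ∈ sub Q R) : g ≫ f ∈ sub P R
  whiskerLeft_mem (Z : L) {P Q : L} {f : P ⟶ Q} (hf : f ∈ sub P Q) : Z ◁ f ∈ sub (Z ⊗ P) (Z ⊗ Q)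
  whiskerRight_mem (Z : L) {P Q : L} {f : P ⟶ Q} (hf : f ∈ sub P Q) :
    f ▷ Z ∈ sub (P ⊗ Z) (Q ⊗ Z)

variable {k L}

namespace TensorIdeal

/-- The quotient of a category by a tensor ideal. -/
structure Quot (N : TensorIdeal k L) where
  of : L

namespace Quot
variable {N : TensorIdeal k L}

lemma comp_aux {P Q R : L} {f f' : P ⟶ Q} {g g' : Q ⟶ R} (hf : f - f' ∈ N.sub P Q)
    (hg : g - g' ∈ N.sub Q R) : f ≫ g - f' ≫ g' ∈ N.sub P R := by
  have : f ≫ g - f' ≫ g' = (f - f') ≫ g + f' ≫ (g - g') := by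
    simp [Preadditive.sub_comp, Preadditive.comp_sub]
  rw [this]
  exact Submodule.add_mem _ (N.comp_mem hf g) (N.precomp_mem f' hg)

instance : CategoryStruct.{v} (Quot N) where
  Hom X Y := (X.of ⟶ Y.of) ⧸ N.sub X.of Y.of
  id X := Submodule.Quotient.mk (𝟙 X.of)
  comp := Quotient.map₂ (· ≫ ·) fun _ _ hf _ _ hg => by
    rw [← Quotient.eq_iff_equiv] at *
    exact (Submodule.Quotient.eq _).2
      (comp_aux ((Submodule.Quotient.eq _).1 hf) ((Submodule.Quotient.eq _).1 hg))

/-- The class of a morphism. -/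
def cls {X Y : Quot N} (f : X.of ⟶ Y.of) : X ⟶ Y := Submodule.Quotient.mk f

lemma cls_surjective {X Y : Quot N} (f : X ⟶ Y) : ∃ g, cls g = f := Submodule.Quotient.mk_surjective _ f

lemma cls_eq {X Y : Quot N} {f g : X.of ⟶ Y.of} :
    (cls f : X ⟶ Y) = cls g ↔ f - g ∈ N.sub X.of Y.of := Submodule.Quotient.eq _

lemma cls_comp {X Y Z : Quot N} (f : X.of ⟶ Y.of) (g : Y.of ⟶ Z.of) :
    (cls (f ≫ g) : X ⟶ Z) = cls f ≫ (cls g : Y ⟶ Z) := rfl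

lemma cls_id (X : Quot N) : cls (𝟙 X.of) = 𝟙 X := rfl

instance : Category.{v} (Quot N) where
  id_comp f := by
    obtain ⟨f, rfl⟩ := cls_surjective f
    exact congrArg cls (Category.id_comp f)
  comp_id f := by
    obtain ⟨f, rfl⟩ := cls_surjective f
    exact congrArg cls (Category.comp_id f)
  assoc f g h := by
    obtain ⟨f, rfl⟩ := cls_surjective f
    obtain ⟨g, rfl⟩ := cls_surjective g
    obtain ⟨h, rfl⟩ := cls_surjective h
    exact congrArg cls (Category.assoc f g h)

instance (X Y : Quot N) : AddCommGroup (X ⟶ Y) :=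
  inferInstanceAs (AddCommGroup ((X.of ⟶ Y.of) ⧸ N.sub X.of Y.of))

instance (X Y : Quot N) : Module k (X ⟶ Y) :=
  inferInstanceAs (Module k ((X.of ⟶ Y.of) ⧸ N.sub X.of Y.of))

lemma cls_zero {X Y : Quot N} : (cls 0 : X ⟶ Y) = 0 := rfl

lemma cls_eq_zero {X Y : Quot N} {f : X.of ⟶ Y.of} :
    (cls f : X ⟶ Y) = 0 ↔ f ∈ N.sub X.of Y.of := by
  rw [← cls_zero, cls_eq, sub_zero]

instance : Preadditive (Quot N) where
  add_comp X Y Z f f' g := by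
    obtain ⟨f, rfl⟩ := cls_surjective f
    obtain ⟨f', rfl⟩ := cls_surjective f'
    obtain ⟨g, rfl⟩ := cls_surjective g
    exact congrArg cls (Preadditive.add_comp _ _ _ f f' g)
  comp_add X Y Z f g g' := by
    obtain ⟨f, rfl⟩ := cls_surjective f
    obtain ⟨g, rfl⟩ := cls_surjective g
    obtain ⟨g', rfl⟩ := cls_surjective g'
    exact congrArg cls (Preadditive.comp_add _ _ _ f g g')

instance : Linear k (Quot N) where
  smul_comp X Y Z a f g := by
    obtain ⟨f, rfl⟩ := cls_surjective f
    obtain ⟨g, rfl⟩ := cls_surjective g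
    exact congrArg cls (Linear.smul_comp _ _ _ a f g)
  comp_smul X Y Z f a g := by
    obtain ⟨f, rfl⟩ := cls_surjective f
    obtain ⟨g, rfl⟩ := cls_surjective g
    exact congrArg cls (Linear.comp_smul _ _ _ f a g)

variable [MonoidalPreadditive L] [MonoidalLinear k L]

/-- Isomorphisms in the quotient from isomorphisms. -/
@[simps]
def isoMk {X Y : Quot N} (e : X.of ≅ Y.of) : X ≅ Y where
  hom := cls e.hom
  inv := cls e.inv
  hom_inv_id := by rw [← cls_comp, e.hom_inv_id, cls_id]
  inv_hom_id := by rw [← cls_comp, e.inv_hom_id, cls_id]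

instance : MonoidalCategoryStruct (Quot N) where
  tensorObj X Y := ⟨X.of ⊗ Y.of⟩
  tensorUnit := ⟨𝟙_ L⟩
  whiskerLeft Z X Y f := (N.sub X.of Y.of).mapQ (N.sub _ _)
    (LinTensor.whiskerLeftLin k Z.of X.of Y.of) (fun _ hf => N.whiskerLeft_mem _ hf) f
  whiskerRight {X Y} f Z := (N.sub X.of Y.of).mapQ (N.sub _ _)
    (LinTensor.whiskerRightLin k Z.of X.of Y.of) (fun _ hf => N.whiskerRight_mem _ hf) f
  associator X Y Z := isoMk (α_ X.of Y.of Z.of)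
  leftUnitor X := isoMk (λ_ X.of)
  rightUnitor X := isoMk (ρ_ X.of)

lemma cls_tensorHom {X Y X' Y' : Quot N} (f : X.of ⟶ Y.of) (g : X'.of ⟶ Y'.of) :
    (cls (f ⊗ₘ g) : X ⊗ X' ⟶ Y ⊗ Y') = (cls f : X ⟶ Y) ⊗ₘ (cls g : X' ⟶ Y') := by
  rw [MonoidalCategory.tensorHom_def]
  rfl

instance : MonoidalCategory (Quot N) where
  tensorHom_def _ _ := rfl
  id_tensorHom_id X Y := (cls_tensorHom _ _).symm.trans (congrArg cls (id_tensorHom_id X.of Y.of))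
  tensorHom_comp_tensorHom f₁ f₂ g₁ g₂ := by
    obtain ⟨f₁, rfl⟩ := cls_surjective f₁
    obtain ⟨f₂, rfl⟩ := cls_surjective f₂
    obtain ⟨g₁, rfl⟩ := cls_surjective g₁
    obtain ⟨g₂, rfl⟩ := cls_surjective g₂
    rw [← cls_tensorHom, ← cls_tensorHom, ← cls_comp, ← cls_comp, ← cls_comp, ← cls_tensorHom]
    exact congrArg cls (tensorHom_comp_tensorHom f₁ f₂ g₁ g₂)
  whiskerLeft_id X Y := congrArg cls (MonoidalCategory.whiskerLeft_id X.of Y.of)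
  id_whiskerRight X Y := congrArg cls (MonoidalCategory.id_whiskerRight X.of Y.of)
  associator_naturality f₁ f₂ f₃ := by
    obtain ⟨f₁, rfl⟩ := cls_surjective f₁
    obtain ⟨f₂, rfl⟩ := cls_surjective f₂
    obtain ⟨f₃, rfl⟩ := cls_surjective f₃
    rw [← cls_tensorHom, ← cls_tensorHom, ← cls_tensorHom, ← cls_tensorHom]
    exact congrArg cls (associator_naturality f₁ f₂ f₃)
  leftUnitor_naturality f := by
    obtain ⟨f, rfl⟩ := cls_surjective f
    exact congrArg cls (leftUnitor_naturality f)
  rightUnitor_naturality f := by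
    obtain ⟨f, rfl⟩ := cls_surjective f
    exact congrArg cls (rightUnitor_naturality f)
  pentagon W X Y Z := congrArg cls (pentagon W.of X.of Y.of Z.of)
  triangle X Y := congrArg cls (triangle X.of Y.of)

instance : MonoidalPreadditive (Quot N) where
  whiskerLeft_zero := map_zero (Submodule.mapQ ..)
  zero_whiskerRight := map_zero (Submodule.mapQ ..)
  whiskerLeft_add f g := map_add (Submodule.mapQ ..) f g
  add_whiskerRight f g := map_add (Submodule.mapQ ..) f g

instance : MonoidalLinear k (Quot N) where
  whiskerLeft_smul _ _ _ a f := map_smul (Submodule.mapQ ..) a f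
  smul_whiskerRight a _ _ f _ := map_smul (Submodule.mapQ ..) a f

instance [SymmetricCategory L] : SymmetricCategory (Quot N) where
  braiding X Y := isoMk (β_ X.of Y.of)
  braiding_naturality_right X Y Z f := by
    obtain ⟨f, rfl⟩ := cls_surjective f
    exact congrArg cls (BraidedCategory.braiding_naturality_right X.of f)
  braiding_naturality_left f Z := by
    obtain ⟨f, rfl⟩ := cls_surjective f
    exact congrArg cls (BraidedCategory.braiding_naturality_left f Z.of)
  hexagon_forward X Y Z := congrArg cls (BraidedCategory.hexagon_forward X.of Y.of Z.of)
  hexagon_reverse X Y Z := congrArg cls (BraidedCategory.hexagon_reverse X.of Y.of Z.of)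
  symmetry X Y := congrArg cls (SymmetricCategory.symmetry X.of Y.of)

end Quot

variable [MonoidalPreadditive L] [MonoidalLinear k L]

/-- The functor to the quotient by a tensor ideal. -/
def proj (N : TensorIdeal k L) : L ⥤ Quot N where
  obj X := ⟨X⟩
  map f := Quot.cls f

instance (N : TensorIdeal k L) : N.proj.Additive where

instance (N : TensorIdeal k L) : N.proj.Linear k where

/-- The functor to the quotient by a tensor ideal is strictly monoidal. -/
def projCore (N : TensorIdeal k L) : N.proj.CoreMonoidal where
  εIso := Iso.refl _
  μIso X Y := Iso.refl _
  μIso_hom_natural_left f X' := (Category.comp_id _).trans (Category.id_comp _).symm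
  μIso_hom_natural_right X' f := (Category.comp_id _).trans (Category.id_comp _).symm
  associativity X Y Z := by
    change (𝟙 (N.proj.obj (X ⊗ Y))) ▷ N.proj.obj Z ≫ 𝟙 (N.proj.obj ((X ⊗ Y) ⊗ Z)) ≫ Quot.cls _ =
      Quot.cls _ ≫ N.proj.obj X ◁ (𝟙 (N.proj.obj (Y ⊗ Z))) ≫ 𝟙 (N.proj.obj (X ⊗ (Y ⊗ Z)))
    rw [id_whiskerRight, MonoidalCategory.whiskerLeft_id]
    exact (Category.id_comp _).trans ((Category.id_comp _).trans
      (((Category.assoc _ _ _).symm.trans (Category.comp_id _)).trans (Category.comp_id _)).symm)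
  left_unitality X := by
    change Quot.cls _ = (𝟙 (N.proj.obj (𝟙_ L))) ▷ N.proj.obj X ≫ 𝟙 (N.proj.obj (𝟙_ L ⊗ X)) ≫ Quot.cls _
    rw [id_whiskerRight]
    exact ((Category.id_comp _).trans (Category.id_comp _)).symm
  right_unitality X := by
    change Quot.cls _ = N.proj.obj X ◁ (𝟙 (N.proj.obj (𝟙_ L))) ≫ 𝟙 (N.proj.obj (X ⊗ 𝟙_ L)) ≫ Quot.cls _
    rw [MonoidalCategory.whiskerLeft_id]
    exact ((Category.id_comp _).trans (Category.id_comp _)).symm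

instance (N : TensorIdeal k L) : N.proj.Monoidal := N.projCore.toMonoidal

instance [SymmetricCategory L] (N : TensorIdeal k L) : N.proj.Braided where
  braided X Y := (Category.id_comp _).trans (Category.comp_id _).symm

lemma proj_map_eq_zero (N : TensorIdeal k L) {X Y : L} {f : X ⟶ Y} :
    N.proj.map f = 0 ↔ f ∈ N.sub X Y := Quot.cls_eq_zero

end TensorIdeal
end quotient

/-! ### Endomorphisms of the unit acting as scalars. -/

section scalars
variable {L : Type u} [Category.{v} L] [MonoidalCategory L]

/-- The action of the endomorphisms of the unit on an object. -/
def sc (r : 𝟙_ L ⟶ 𝟙_ L) (X : L) : X ⟶ X := (λ_ X).inv ≫ r ▷ X ≫ (λ_ X).hom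

lemma sc_naturality (r : 𝟙_ L ⟶ 𝟙_ L) {X Y : L} (f : X ⟶ Y) : sc r X ≫ f = f ≫ sc r Y := by
  simp only [sc, Category.assoc]
  rw [← leftUnitor_naturality, ← whisker_exchange_assoc, leftUnitor_inv_naturality_assoc]

lemma sc_id (X : L) : sc (𝟙 _) X = 𝟙 X := by simp [sc]

lemma sc_unit (r : 𝟙_ L ⟶ 𝟙_ L) : sc r (𝟙_ L) = r := by
  rw [sc, unitors_equal, rightUnitor_naturality, unitors_inv_equal, Iso.inv_hom_id_assoc]

lemma unit_comp_comm (r s : 𝟙_ L ⟶ 𝟙_ L) : r ≫ s = s ≫ r := by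
  have := sc_naturality r s
  rwa [sc_unit] at this

lemma sc_whiskerRight (r : 𝟙_ L ⟶ 𝟙_ L) (X Y : L) : sc r X ▷ Y = sc r (X ⊗ Y) := by
  simp [sc]

lemma sc_zero [Preadditive L] [MonoidalPreadditive L] (X : L) :
    sc (0 : 𝟙_ L ⟶ 𝟙_ L) X = 0 := by simp [sc]

instance (r : 𝟙_ L ⟶ 𝟙_ L) [IsIso r] (X : L) : IsIso (sc r X) := by
  unfold sc
  infer_instance

end scalars

/-! ### Negligible morphisms. -/

section negligible
variable (k : Type w) [Field k] {L : Type u} [Category.{v} L] [Preadditive L] [Linear k L]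
  [MonoidalCategory L] [MonoidalPreadditive L] [MonoidalLinear k L] [SymmetricCategory L]
  {K : Type v₁} [CommRing K] [Algebra k K] (χ : (𝟙_ L ⟶ 𝟙_ L) →ₗ[k] K)

/-- The morphisms that are negligible for a character of the endomorphism ring of the unit. -/
def negligible : TensorIdeal k L where
  sub P Q :=
    { carrier := { f | ∀ (W : L) (x : 𝟙_ L ⟶ P ⊗ W) (y : Q ⊗ W ⟶ 𝟙_ L), χ (x ≫ f ▷ W ≫ y) = 0 }
      add_mem' := fun hf hg W x y => by
        rw [MonoidalPreadditive.add_whiskerRight, Preadditive.add_comp, Preadditive.comp_add,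
          map_add, hf, hg, add_zero]
      zero_mem' := fun W x y => by simp
      smul_mem' := fun a f hf W x y => by
        rw [MonoidalLinear.smul_whiskerRight, Linear.smul_comp, Linear.comp_smul, map_smul, hf,
          smul_zero] }
  comp_mem hf g W x y := by simpa using hf W x (g ▷ W ≫ y)
  precomp_mem g f hf W x y := by simpa using hf W (x ≫ g ▷ W) y
  whiskerRight_mem Z P Q f hf W x y := by
    have := hf (Z ⊗ W) (x ≫ (α_ P Z W).hom) ((α_ Q Z W).inv ≫ y)
    simpa using this
  whiskerLeft_mem Z P Q f hf W x y := by
    have h : Z ◁ f = (β_ Z P).hom ≫ f ▷ Z ≫ (β_ Q Z).hom := by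
      rw [← BraidedCategory.braiding_naturality_right_assoc, SymmetricCategory.symmetry,
        Category.comp_id]
    have := hf (Z ⊗ W) (x ≫ (β_ Z P).hom ▷ W ≫ (α_ P Z W).hom)
      ((α_ Q Z W).inv ≫ (β_ Q Z).hom ▷ W ≫ y)
    simp only [whiskerRight_tensor, Category.assoc, Iso.hom_inv_id_assoc] at this
    simpa only [h, comp_whiskerRight, Category.assoc] using this

variable {k χ}

/-- If the target is the unit, the auxiliary object `W` can be contracted with `y` before `h` is
applied, which turns `x` into a point of `P`. -/
lemma mem_negligible_iff {P : L} {h : P ⟶ 𝟙_ L} :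
    h ∈ (negligible k χ).sub P (𝟙_ L) ↔ ∀ v : 𝟙_ L ⟶ P, χ (v ≫ h) = 0 := by
  refine ⟨fun H v => ?_, fun H W x y => ?_⟩
  · have := H (𝟙_ L) (v ≫ (ρ_ P).inv) (ρ_ _).hom
    simpa using this
  · have := H (x ≫ P ◁ ((λ_ W).inv ≫ y) ≫ (ρ_ P).hom)
    have e : P ◁ ((λ_ W).inv ≫ y) ≫ (ρ_ P).hom ≫ h = h ▷ W ≫ y := by
      rw [← rightUnitor_naturality, whisker_exchange_assoc, ← unitors_equal]
      simp
    rwa [Category.assoc, Category.assoc, e] at this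

lemma mem_negligible_unit (hχ : ∀ f g, χ (f ≫ g) = χ f * χ g) {r : 𝟙_ L ⟶ 𝟙_ L} :
    r ∈ (negligible k χ).sub _ _ ↔ χ r = 0 := by
  rw [mem_negligible_iff]
  refine ⟨fun h => by simpa using h (𝟙 _), fun h v => by rw [hχ, h, mul_zero]⟩

end negligible
end TensorCat
/-! ### Nilpotency of morphisms to the unit -/

namespace TensorCat
open Functor.LaxMonoidal Functor.OplaxMonoidal Functor.Monoidal

section star
variable {C : Type u} [Category.{v} C] [MonoidalCategory C]

/-- The tensor product of morphisms to the unit. -/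
def star {X Y : C} (f : X ⟶ 𝟙_ C) (g : Y ⟶ 𝟙_ C) : X ⊗ Y ⟶ 𝟙_ C := f ▷ Y ≫ (λ_ Y).hom ≫ g

lemma star_eq {X Y : C} (f : X ⟶ 𝟙_ C) (g : Y ⟶ 𝟙_ C) :
    star f g = X ◁ g ≫ (ρ_ X).hom ≫ f := by
  rw [star, ← leftUnitor_naturality, ← whisker_exchange_assoc, unitors_equal,
    rightUnitor_naturality]

lemma whiskerRight_star {X X' Y : C} (a : X' ⟶ X) (f : X ⟶ 𝟙_ C) (g : Y ⟶ 𝟙_ C) :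
    a ▷ Y ≫ star f g = star (a ≫ f) g := by simp [star]

lemma whiskerLeft_star {X Y Y' : C} (b : Y' ⟶ Y) (f : X ⟶ 𝟙_ C) (g : Y ⟶ 𝟙_ C) :
    X ◁ b ≫ star f g = star f (b ≫ g) := by simp [star_eq]

lemma star_comp {X Y : C} (f : X ⟶ 𝟙_ C) (g : Y ⟶ 𝟙_ C) (r : 𝟙_ C ⟶ 𝟙_ C) :
    star f (g ≫ r) = star f g ≫ r := by simp [star]

lemma comp_star {X Y : C} (f : X ⟶ 𝟙_ C) (g : Y ⟶ 𝟙_ C) (r : 𝟙_ C ⟶ 𝟙_ C) :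
    star (f ≫ r) g = star f g ≫ r := by simp [star_eq]

lemma associator_star {X Y Z : C} (f : X ⟶ 𝟙_ C) (g : Y ⟶ 𝟙_ C) (h : Z ⟶ 𝟙_ C) :
    (α_ X Y Z).hom ≫ star f (star g h) = star (star f g) h := by simp [star]

lemma braiding_star [SymmetricCategory C] {X Y : C} (f : X ⟶ 𝟙_ C) (g : Y ⟶ 𝟙_ C) :
    (β_ X Y).hom ≫ star g f = star f g := by
  rw [star, star_eq, ← BraidedCategory.braiding_naturality_right_assoc]
  simp

lemma star_zero [Preadditive C] [MonoidalPreadditive C] {X Y : C} (f : X ⟶ 𝟙_ C) :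
    star f (0 : Y ⟶ 𝟙_ C) = 0 := by simp [star]

lemma zero_star [Preadditive C] [MonoidalPreadditive C] {X Y : C} (f : Y ⟶ 𝟙_ C) :
    star (0 : X ⟶ 𝟙_ C) f = 0 := by simp [star]

lemma add_star [Preadditive C] [MonoidalPreadditive C] {X Y : C} (f f' : X ⟶ 𝟙_ C)
    (g : Y ⟶ 𝟙_ C) : star (f + f') g = star f g + star f' g := by simp [star]

/-- The iterated tensor product of a morphism to the unit. -/
def starPow {X W : C} (h : X ⟶ 𝟙_ C) (z : W ⟶ 𝟙_ C) : ℕ → (W' : C) × (W' ⟶ 𝟙_ C)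
  | 0 => ⟨W, z⟩
  | n + 1 => ⟨X ⊗ (starPow h z n).1, star h (starPow h z n).2⟩

/-- `h` is nilpotent up to morphisms in `M`. -/
def IsNilpotentUpTo (M : Set (𝟙_ C ⟶ 𝟙_ C)) [HasZeroMorphisms C] {X : C} (h : X ⟶ 𝟙_ C) : Prop :=
  ∃ n, ∃ s ∈ M, ∀ (W : C) (z : W ⟶ 𝟙_ C), (starPow h z n).2 ≫ s = 0

end star

/-! ### Tensor powers of morphisms to the unit, and symmetric powers. -/

section power
variable {V : Type u₁} [Category.{v₁} V] [MonoidalCategory V] [SymmetricCategory V]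
  {C : Type u₂} [Category.{v₂} C] [MonoidalCategory C] [SymmetricCategory C]
  (F : V ⥤ C) [F.Braided] {X : V} (h : F.obj X ⟶ 𝟙_ C)

/-- The tensor powers of a morphism to the unit. -/
def fpow : (n : ℕ) → (F.obj (tensorPow X n) ⟶ 𝟙_ C)
  | 0 => η F
  | n + 1 => δ F _ _ ≫ star (fpow n) h

lemma map_whiskerRight_comp_star {P Q X : V} (s : P ⟶ Q) (p : F.obj Q ⟶ 𝟙_ C)
    (h : F.obj X ⟶ 𝟙_ C) :
    F.map (s ▷ X) ≫ δ F Q X ≫ star p h = δ F P X ≫ star (F.map s ≫ p) h := by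
  rw [← δ_natural_left_assoc, whiskerRight_star]

lemma map_swap_comp_star {P X : V} (p : F.obj P ⟶ 𝟙_ C) (h : F.obj X ⟶ 𝟙_ C) :
    F.map ((α_ P X X).hom ≫ P ◁ (β_ X X).hom ≫ (α_ P X X).inv) ≫
      δ F (P ⊗ X) X ≫ star (δ F P X ≫ star p h) h = δ F (P ⊗ X) X ≫ star (δ F P X ≫ star p h) h := by
  have e₁ : δ F (P ⊗ X) X ≫ star (δ F P X ≫ star p h) h = F.map (α_ _ _ _).hom ≫ δ F _ _ ≫
      F.obj P ◁ δ F X X ≫ star p (star h h) := by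
    have := associativity_assoc F P X X (star p (star h h))
    rw [← this, associator_star, whiskerRight_star]
  rw [e₁, Functor.map_comp, Functor.map_comp, Category.assoc, Category.assoc,
    ← Functor.map_comp_assoc F (α_ _ _ _).inv, Iso.inv_hom_id, CategoryTheory.Functor.map_id,
    Category.id_comp, ← δ_natural_right_assoc, ← MonoidalCategory.whiskerLeft_comp_assoc,
    Functor.map_braiding, Category.assoc, Category.assoc, μ_δ, Category.comp_id,
    MonoidalCategory.whiskerLeft_comp_assoc, whiskerLeft_star, braiding_star]

/-- The swapped factors carry the same morphism to the unit, and products of morphisms to the unit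
are compatible with the braiding. This symmetry is what makes symmetric powers relevant. -/
lemma swap_fpow (n : ℕ) (i : Fin (n - 1)) : F.map (swap X n i) ≫ fpow F h n = fpow F h n := by
  match n, i with
  | 0, i => exact i.elim0
  | 1, i => exact i.elim0
  | n + 2, i =>
    induction i using Fin.lastCases with
    | last =>
      have e : swap X (n + 2) (Fin.last n) = (α_ (tensorPow X n) X X).hom ≫
          tensorPow X n ◁ (β_ X X).hom ≫ (α_ (tensorPow X n) X X).inv := by
        rw [swap]
        exact Fin.lastCases_last ..
      exact (congrArg (fun t => F.map t ≫ fpow F h (n + 2)) e).trans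
        (map_swap_comp_star F (fpow F h n) h)
    | cast i =>
      have e : swap X (n + 2) i.castSucc = swap X (n + 1) i ▷ X := by
        rw [swap]
        exact Fin.lastCases_castSucc ..
      refine (congrArg (fun t => F.map t ≫ fpow F h (n + 2)) e).trans
        ((map_whiskerRight_comp_star F (swap X (n + 1) i) (fpow F h (n + 1)) h).trans ?_)
      rw [swap_fpow (n + 1) i]
      rfl

lemma star_star_aux {P W W' : C} (h : P ⟶ 𝟙_ C) {Q R : V} (j : W' ⟶ F.obj Q ⊗ W)
    (p : F.obj Q ⟶ 𝟙_ C) (r : F.obj R ⟶ 𝟙_ C) (e : P ⟶ F.obj R) (he : e ≫ r = h) (z : W ⟶ 𝟙_ C) :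
    ∃ j', star h (j ≫ star p z) = j' ≫ star (δ F Q R ≫ star p r) z := by
  refine ⟨P ◁ j ≫ (α_ _ _ _).inv ≫ (β_ _ _).hom ▷ W ≫ (F.obj Q ◁ e) ▷ W ≫ μ F _ _ ▷ W, ?_⟩
  simp only [Category.assoc, whiskerRight_star, whiskerLeft_star, he, μ_δ_assoc, braiding_star]
  rw [← associator_star, Iso.inv_hom_id_assoc, whiskerLeft_star]

/-- Rebracketing and braiding move all copies of `h` to the image of a tensor power under `F`.
Vanishing of `fpow` then kills the powers started at any `z`. -/
lemma exists_starPow_eq {W : C} (z : W ⟶ 𝟙_ C) (n : ℕ) :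
    ∃ j, (starPow h z n).2 = j ≫ star (fpow F h n) z := by
  induction n with
  | zero =>
    change ∃ j : W ⟶ _, z = j ≫ star (η F) z
    refine ⟨(λ_ W).inv ≫ ε F ▷ W, ?_⟩
    simp [star]
  | succ n ih =>
    obtain ⟨j, hj⟩ := ih
    change ∃ j : F.obj X ⊗ (starPow h z n).1 ⟶ _, star h (starPow h z n).2 = j ≫ _
    rw [hj]
    exact star_star_aux F h j (fpow F h n) h (𝟙 _) (Category.id_comp _) z

lemma comp_star_unit {P Q : C} (v : 𝟙_ C ⟶ P) (w : 𝟙_ C ⟶ Q) (f : P ⟶ 𝟙_ C) (g : Q ⟶ 𝟙_ C) :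
    ((ρ_ _).inv ≫ 𝟙_ C ◁ v ≫ w ▷ P) ≫ star g f = (w ≫ g) ≫ v ≫ f := by
  simp only [Category.assoc, whiskerRight_star, whiskerLeft_star]
  simp [star, unitors_equal]

/-- Take for `w` the tensor power of the point `v`. It follows that `v ≫ h` is nilpotent as soon as
`fpow` vanishes. -/
lemma exists_pow_eq (v : 𝟙_ C ⟶ F.obj X) (n : ℕ) :
    ∃ w, w ≫ fpow F h n = (show End (𝟙_ C) from v ≫ h) ^ n := by
  induction n with
  | zero => exact ⟨ε F, ε_η F⟩
  | succ n ih =>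
    obtain ⟨w, hw⟩ := ih
    change ∃ w : 𝟙_ C ⟶ F.obj (tensorPow X n ⊗ X), w ≫ δ F _ _ ≫ star _ _ = _
    refine ⟨((ρ_ _).inv ≫ 𝟙_ C ◁ v ≫ w ▷ _) ≫ μ F _ _, ?_⟩
    rw [Category.assoc, μ_δ_assoc, comp_star_unit, hw, pow_succ']
    rfl

variable [Preadditive V] [IsAbelian V] [Preadditive C] [MonoidalPreadditive C] [F.Additive]

/-- By symmetry the power is killed by all `swap - 1`. If the symmetric power is zero, these are
jointly an epimorphism, which splits by semisimplicity; so the additive functor `F` keeps it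
epimorphic. -/
lemma fpow_eq_zero {k : Type w} [Field k] [Linear k V] (hV : IsSchurianSemisimple k V) (n : ℕ)
    (hn : IsZero (symPow X n)) : fpow F h n = 0 := by
  let d := Sigma.desc fun i : Fin (n - 1) => swap X n i - 𝟙 (tensorPow X n)
  let := abelianOfIsAbelian V
  have : Epi d := Preadditive.epi_of_isZero_cokernel d hn
  obtain ⟨τ, hτ⟩ := (hV.isRegular d).splitEpi
  have hd : F.map d ≫ fpow F h n = 0 := by
    have hs : (𝟙 _ : (∐ fun _ : Fin (n - 1) => tensorPow X n) ⟶ _) =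
        ∑ i, Sigma.π _ i ≫ Sigma.ι _ i := by
      refine Sigma.hom_ext _ _ fun j => ?_
      rw [Preadditive.comp_sum, Finset.sum_eq_single j]
      · simp
      · intro i _ hi
        rw [← Category.assoc, Sigma.ι_π_of_ne _ hi.symm, zero_comp]
      · simp
    rw [← Category.id_comp d, hs, Preadditive.sum_comp, Functor.map_sum, Preadditive.sum_comp]
    refine Finset.sum_eq_zero fun i _ => ?_
    simp only [Category.assoc, d, colimit.ι_desc, Cofan.mk_pt, Cofan.mk_ι_app, Functor.map_comp,
      Functor.map_sub, Preadditive.sub_comp, swap_fpow, CategoryTheory.Functor.map_id,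
      Category.id_comp, sub_self, comp_zero]
  rw [← Category.id_comp (fpow F h n), ← F.map_id, ← hτ, F.map_comp, Category.assoc, hd, comp_zero]

end power
end TensorCat
/-! ### Semisimplicity of pointed symmetric monoidal categories -/

namespace TensorCat
open Functor.LaxMonoidal Functor.OplaxMonoidal Functor.Monoidal

section pairing
variable {C : Type u} [Category.{v} C] [MonoidalCategory C]

lemma tensorRightHomEquiv_unit_symm {P Q Z : C} [ExactPairing Z Q] (f : P ⟶ Q) :
    (tensorRightHomEquiv P Z Q (𝟙_ C)).symm (f ≫ (λ_ Q).inv) = f ▷ Z ≫ ε_ Z Q := by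
  simp [tensorRightHomEquiv, ← unitors_equal]

/-- With the next lemma this is the bijection between morphisms `P ⟶ Q` and morphisms `P ⊗ Z ⟶ 𝟙`;
it reduces the study of all morphisms to that of morphisms to the unit. -/
lemma exists_whiskerRight_evaluation {P Q Z : C} [ExactPairing Z Q] (g : P ⊗ Z ⟶ 𝟙_ C) :
    ∃ f : P ⟶ Q, f ▷ Z ≫ ε_ Z Q = g := by
  refine ⟨tensorRightHomEquiv P Z Q (𝟙_ C) g ≫ (λ_ Q).hom, ?_⟩
  rw [← tensorRightHomEquiv_unit_symm]
  simp

lemma whiskerRight_evaluation_injective {P Q Z : C} [ExactPairing Z Q] {f f' : P ⟶ Q}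
    (h : f ▷ Z ≫ ε_ Z Q = f' ▷ Z ≫ ε_ Z Q) : f = f' := by
  rw [← tensorRightHomEquiv_unit_symm, ← tensorRightHomEquiv_unit_symm] at h
  simpa using (tensorRightHomEquiv P Z Q (𝟙_ C)).symm.injective h

end pairing

/-- Endomorphisms of the unit are zero or invertible, and morphisms to the unit are detected on
points. -/
structure IsPointed (C : Type u) [Category.{v} C] [MonoidalCategory C] [HasZeroMorphisms C] :
    Prop where
  unit_ne : 𝟙 (𝟙_ C) ≠ 0
  zero_or_isIso (c : 𝟙_ C ⟶ 𝟙_ C) : c = 0 ∨ IsIso c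
  eq_zero {Z : C} (h : Z ⟶ 𝟙_ C) : (∀ v : 𝟙_ C ⟶ Z, v ≫ h = 0) → h = 0

section semisimple
variable {k : Type w} [Field k] {V : Type u₁} [Category.{v₁} V] [EssentiallySmall.{v₁} V]
  [Preadditive V] [IsAbelian V] [Linear k V] [MonoidalCategory V] [SymmetricCategory V]
  [MonoidalPreadditive V] [MonoidalLinear k V]
  {C : Type u₂} [Category.{v₂} C] [Preadditive C] [Linear k C] [MonoidalCategory C]
  [SymmetricCategory C] [MonoidalPreadditive C] [MonoidalLinear k C]

lemma IsPointed.eq_zero_of_pow (hC : IsPointed C) (c : 𝟙_ C ⟶ 𝟙_ C) (n : ℕ)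
    (h : (show End (𝟙_ C) from c) ^ n = 0) : c = 0 := by
  refine (hC.zero_or_isIso c).resolve_right fun hc => hC.unit_ne ?_
  have hu : IsUnit (show End (𝟙_ C) from c) :=
    ⟨⟨c, inv c, IsIso.inv_hom_id c, IsIso.hom_inv_id c⟩, rfl⟩
  have := hu.pow n
  rw [h] at this
  exact (isUnit_zero_iff.1 this).symm

variable (F : V ⥤ C) [F.Braided] [F.Additive]

/-- The vanishing symmetric power makes every value `v ≫ h` nilpotent. It is therefore not
invertible, hence zero, and morphisms to the unit are detected by these values. -/
lemma IsPointed.hom_unit_eq_zero (hC : IsPointed C) (hV : IsSchurianSemisimple k V)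
    (hsym : SymPowersVanish V) {S : V} (hS : Simple S) (h1 : ¬ Nonempty (S ≅ 𝟙_ V))
    (h : F.obj S ⟶ 𝟙_ C) : h = 0 := by
  obtain ⟨N, hN⟩ := hsym S hS h1
  refine hC.eq_zero h fun v => hC.eq_zero_of_pow _ N ?_
  obtain ⟨w, hw⟩ := exists_pow_eq F h v N
  rw [← hw, fpow_eq_zero F h hV N hN, comp_zero]

/-- The morphisms to the unit that come from `V`, up to endomorphisms of the unit. -/
def unitSpan (Z : V) : AddSubgroup (F.obj Z ⟶ 𝟙_ C) :=
  AddSubgroup.closure { h | ∃ (g : Z ⟶ 𝟙_ V) (c : 𝟙_ C ⟶ 𝟙_ C), h = F.map g ≫ η F ≫ c }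

lemma map_comp_mem_unitSpan {Z Z' : V} (a : Z' ⟶ Z) {h : F.obj Z ⟶ 𝟙_ C} (hh : h ∈ unitSpan F Z) :
    F.map a ≫ h ∈ unitSpan F Z' := by
  induction hh using AddSubgroup.closure_induction with
  | mem h hh =>
    obtain ⟨g, c, rfl⟩ := hh
    exact AddSubgroup.subset_closure ⟨a ≫ g, c, by simp⟩
  | zero => simpa using AddSubgroup.zero_mem _
  | add x y _ _ hx hy => simpa using AddSubgroup.add_mem _ hx hy
  | neg x _ hx => simpa using AddSubgroup.neg_mem _ hx

/-- On a simple summand isomorphic to the unit, a morphism to the unit is the canonical one followed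
by an endomorphism; on the other simple summands it is zero by the lemma above. -/
lemma IsPointed.mem_unitSpan (hC : IsPointed C) (hV : IsSchurianSemisimple k V)
    (hsym : SymPowersVanish V) (Z : V) (h : F.obj Z ⟶ 𝟙_ C) : h ∈ unitSpan F Z := by
  induction hV.isSum Z with
  | @zero Z hZ =>
    have : h = 0 := by
      rw [← Category.id_comp h, ← F.map_id, hZ, F.map_zero, zero_comp]
    rw [this]
    exact AddSubgroup.zero_mem _
  | @add S Y Z hS _ d ih =>
    have e : h = F.map d.fst ≫ F.map d.inl ≫ h + F.map d.snd ≫ F.map d.inr ≫ h := by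
      simp only [← Category.assoc, ← F.map_comp, ← Preadditive.add_comp, ← F.map_add, d.total]
      simp
    rw [e]
    refine AddSubgroup.add_mem _ (map_comp_mem_unitSpan F _ ?_) (map_comp_mem_unitSpan F _ (ih _))
    by_cases h1 : Nonempty (S ≅ 𝟙_ V)
    · obtain ⟨e⟩ := h1
      refine AddSubgroup.subset_closure ⟨e.hom, ε F ≫ F.map e.inv ≫ F.map d.inl ≫ h, ?_⟩
      rw [η_ε_assoc, ← F.map_comp_assoc, e.hom_inv_id, CategoryTheory.Functor.map_id,
        Category.id_comp]
    · rw [hC.hom_unit_eq_zero F hV hsym hS h1 (F.map d.inl ≫ h)]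
      exact AddSubgroup.zero_mem _

variable [F.Linear k]

/-- Endomorphisms of `F S` correspond to morphisms `F (S ⊗ Z) ⟶ 𝟙`. These come from morphisms `S ⊗ Z
⟶ 𝟙` of `V`, that is, from endomorphisms of `S`, which are scalars. -/
lemma IsPointed.end_eq_sc (hC : IsPointed C) (hV : IsSchurianSemisimple k V)
    (hsym : SymPowersVanish V) {S Z : V} [Simple S] [ExactPairing Z S] (f : F.obj S ⟶ F.obj S) :
    ∃ c, f = sc c (F.obj S) := by
  let := exactPairingMap F Z S
  have hε : ε_ (F.obj Z) (F.obj S) = μ F S Z ≫ F.map (ε_ Z S) ≫ η F := rfl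
  have key : ∀ h ∈ unitSpan F (S ⊗ Z), ∃ c, h = F.map (ε_ Z S) ≫ η F ≫ c := by
    intro h hh
    induction hh using AddSubgroup.closure_induction with
    | mem h hh =>
      obtain ⟨g, c, rfl⟩ := hh
      obtain ⟨g', rfl⟩ := exists_whiskerRight_evaluation (Q := S) g
      obtain ⟨a, rfl⟩ := (hV.schurian S).2 g'
      refine ⟨a • c, ?_⟩
      simp
    | zero => exact ⟨0, by simp⟩
    | add x y _ _ hx hy =>
      obtain ⟨c, rfl⟩ := hx
      obtain ⟨c', rfl⟩ := hy
      exact ⟨c + c', by simp⟩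
    | neg x _ hx =>
      obtain ⟨c, rfl⟩ := hx
      exact ⟨-c, by simp⟩
  obtain ⟨c, hc⟩ := key _ (hC.mem_unitSpan F hV hsym _
    (δ F S Z ≫ f ▷ F.obj Z ≫ ε_ (F.obj Z) (F.obj S)))
  refine ⟨c, whiskerRight_evaluation_injective (Z := F.obj Z) ?_⟩
  rw [← cancel_epi (δ F S Z), hc, sc_whiskerRight, sc_naturality, sc_unit, hε]
  simp

/-- For isomorphic `S` and `S'` the morphism is a scalar times an isomorphism, and scalars are zero
or invertible. Otherwise the duality argument applies again, and there is no non-zero morphism from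
`S` to `S'` to start from. -/
lemma IsPointed.zeroOrIso (hC : IsPointed C) (hk : IsTensorCategory k V)
    (hV : IsSchurianSemisimple k V) (hsym : SymPowersVanish V) :
    ZeroOrIso (fun Z : C => ∃ S : V, Simple S ∧ Nonempty (F.obj S ≅ Z)) := by
  rintro _ _ ⟨S, hS, ⟨i⟩⟩ ⟨S', hS', ⟨i'⟩⟩ f
  obtain ⟨Z, ⟨p⟩⟩ := hk.dualisable S'
  let := BraidedCategory.exactPairing_swap S' Z
  by_cases h : Nonempty (S ≅ S')
  · obtain ⟨e⟩ := h
    obtain ⟨c, hc⟩ := hC.end_eq_sc F hV hsym (Z := Z) (F.map e.inv ≫ i.hom ≫ f ≫ i'.inv)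
    have hf : f = i.inv ≫ F.map e.hom ≫ sc c (F.obj S') ≫ i'.hom := by
      simp [← hc, ← F.map_comp_assoc]
    rw [hf]
    rcases hC.zero_or_isIso c with rfl | hc
    · left
      simp [sc_zero]
    · right
      infer_instance
  · left
    let := exactPairingMap F Z S'
    have key : ∀ h ∈ unitSpan F (S ⊗ Z), h = 0 := by
      intro h' hh
      induction hh using AddSubgroup.closure_induction with
      | mem h' hh =>
        obtain ⟨g, c, rfl⟩ := hh
        obtain ⟨g', rfl⟩ := exists_whiskerRight_evaluation (Q := S') g
        have : g' = 0 := (zeroOrIso_simple hS hS' g').resolve_right fun hg => h ⟨asIso g'⟩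
        simp [this]
      | zero => rfl
      | add x y _ _ hx hy => rw [hx, hy, add_zero]
      | neg x _ hx => rw [hx, neg_zero]
    have h0 : i.hom ≫ f ≫ i'.inv = 0 := by
      refine whiskerRight_evaluation_injective (Z := F.obj Z) ?_
      rw [← cancel_epi (δ F S Z), key (δ F S Z ≫ (i.hom ≫ f ≫ i'.inv) ▷ F.obj Z ≫ _)
        (hC.mem_unitSpan F hV hsym _ _)]
      simp
    rw [← cancel_epi i.hom, ← cancel_mono i'.inv, Category.assoc, h0]
    simp

lemma IsPointed.isRegular (hC : IsPointed C) (hF : ∀ Z : C, ∃ X, Nonempty (Retract Z (F.obj X)))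
    (hk : IsTensorCategory k V) (hV : IsSchurianSemisimple k V) (hsym : SymPowersVanish V) {Z W : C}
    (f : Z ⟶ W) :
    IsRegular f := by
  obtain ⟨X, ⟨r⟩⟩ := hF Z
  obtain ⟨Y, ⟨r'⟩⟩ := hF W
  have hs (X : V) := (hV.isSum X).map F (P' := fun Z : C => ∃ S : V, Simple S ∧ Nonempty (F.obj S ≅ Z))
    (fun S hS => ⟨S, hS, ⟨Iso.refl _⟩⟩)
  exact .of_retract r r' f fun f => (hs X).isRegular (hC.zeroOrIso F hk hV hsym) (hs Y) f

/-- The direct sum of two retracts is split off the image of a biproduct of `V` by the sum of the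
two idempotents. -/
lemma hasFiniteProducts_of_retract [IsIdempotentComplete C]
    (hF : ∀ Z : C, ∃ X, Nonempty (Retract Z (F.obj X))) : HasFiniteProducts C := by
  refine hasFiniteProducts_of_hasDirectSums (fun A B => ?_)
    (Z := F.obj (⨁ (fun j : Fin 0 => j.elim0 : Fin 0 → V))) ?_
  · obtain ⟨X, ⟨r⟩⟩ := hF A
    obtain ⟨Y, ⟨r'⟩⟩ := hF B
    have := hasBinaryBiproducts_of_finite_biproducts V
    let d := (DirectSum.biprod X Y).map F
    obtain ⟨Z, i, p, hip, hpi⟩ := IsIdempotentComplete.idempotents_split (F.obj (X ⊞ Y))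
      (d.fst ≫ r.r ≫ r.i ≫ d.inl + d.snd ≫ r'.r ≫ r'.i ≫ d.inr) (by simp)
    refine ⟨Z, ⟨⟨r.i ≫ d.inl ≫ p, r'.i ≫ d.inr ≫ p, i ≫ d.fst ≫ r.r, i ≫ d.snd ≫ r'.r,
      ?_, ?_, ?_, ?_, ?_⟩⟩⟩
    all_goals simp only [Category.assoc, reassoc_of% hpi]
    · simp
    · simp
    · simp
    · simp
    · have h := congrArg (fun t => i ≫ t ≫ p) hpi
      simp only [Category.assoc, hip, reassoc_of% hip, Category.comp_id] at h
      rw [h]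
      simp
  · have : 𝟙 (⨁ (fun j : Fin 0 => j.elim0 : Fin 0 → V)) = 0 :=
      biproduct.hom_ext _ _ fun j => j.elim0
    rw [← F.map_id, this, F.map_zero]

lemma IsPointed.isAbelian [IsIdempotentComplete C] (hC : IsPointed C)
    (hF : ∀ Z : C, ∃ X, Nonempty (Retract Z (F.obj X)))
    (hk : IsTensorCategory k V) (hV : IsSchurianSemisimple k V) (hsym : SymPowersVanish V) :
    IsAbelian C :=
  have := hasFiniteProducts_of_retract F hF
  isAbelian_of_isRegular fun _ _ f => hC.isRegular F hF hk hV hsym f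

/-- Additive functors on a category whose morphisms are regular are right exact, in particular the
tensor products with fixed objects. -/
lemma IsPointed.isSMC [IsAbelian C] (hC : IsPointed C) (h : ∀ ⦃X Y : C⦄ (f : X ⟶ Y), IsRegular f) :
    IsSMC k C where
  unit_nonzero h0 := hC.unit_ne ((IsZero.iff_id_eq_zero _).1 h0)
  rightExact_left X :=
    have : (tensorLeft X).Additive := ⟨fun {_ _ f g} => MonoidalPreadditive.whiskerLeft_add f g⟩
    preservesFiniteColimits_of_isRegular h _
  rightExact_right X :=
    have : (tensorRight X).Additive := ⟨fun {_ _ f g} => MonoidalPreadditive.add_whiskerRight f g⟩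
    preservesFiniteColimits_of_isRegular h _

end semisimple
end TensorCat
/-! ### Splitting short exact sequences up to a scalar -/

namespace TensorCat
open Functor.LaxMonoidal Functor.OplaxMonoidal Functor.Monoidal

section torsion
variable {E : Type u₂} [Category.{v₂} E] [Preadditive E] [MonoidalCategory E]
  [SymmetricCategory E] [MonoidalPreadditive E] (M : Set (𝟙_ E ⟶ 𝟙_ E))

/-- Morphisms to the unit that are killed by an element of `M`. -/
def IsTorsion {W : E} (z : W ⟶ 𝟙_ E) : Prop := ∃ s ∈ M, z ≫ s = 0

variable {M}

lemma IsTorsion.comp {W W' : E} {z : W ⟶ 𝟙_ E} (h : IsTorsion M z) (a : W' ⟶ W) :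
    IsTorsion M (a ≫ z) := by
  obtain ⟨s, hs, h⟩ := h
  exact ⟨s, hs, by rw [Category.assoc, h, comp_zero]⟩

lemma IsTorsion.star {U W : E} {z : W ⟶ 𝟙_ E} (h : IsTorsion M z) (u : U ⟶ 𝟙_ E) :
    IsTorsion M (star u z) := by
  obtain ⟨s, hs, h⟩ := h
  exact ⟨s, hs, by rw [← star_comp, h, star_zero]⟩

lemma IsTorsion.star_swap {U U' W : E} {z : W ⟶ 𝟙_ E} {u' : U' ⟶ 𝟙_ E}
    (h : IsTorsion M (TensorCat.star u' z)) (u : U ⟶ 𝟙_ E) :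
    IsTorsion M (TensorCat.star u' (TensorCat.star u z)) := by
  have e : TensorCat.star u' (TensorCat.star u z) = (α_ _ _ _).inv ≫ (β_ _ _).hom ▷ _ ≫
      (α_ _ _ _).hom ≫ TensorCat.star u (TensorCat.star u' z) := by
    rw [associator_star, whiskerRight_star, braiding_star, ← associator_star,
      Iso.inv_hom_id_assoc]
  rw [e]
  exact (((h.star u).comp _).comp _).comp _

lemma IsTorsion.add (hM : ∀ s ∈ M, ∀ t ∈ M, s ≫ t ∈ M) {W : E} {z z' : W ⟶ 𝟙_ E}
    (h : IsTorsion M z) (h' : IsTorsion M z') : IsTorsion M (z + z') := by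
  obtain ⟨s, hs, h⟩ := h
  obtain ⟨t, ht, h'⟩ := h'
  refine ⟨s ≫ t, hM s hs t ht, ?_⟩
  rw [Preadditive.add_comp, reassoc_of% h, zero_comp, zero_add, unit_comp_comm, reassoc_of% h',
    zero_comp]

end torsion

/-! ### Nilpotency up to a set of endomorphisms of the unit. -/

section nilpotent
variable {k : Type w} [Field k] {V : Type u₁} [Category.{v₁} V]
  [Preadditive V] [IsAbelian V] [Linear k V] [MonoidalCategory V] [SymmetricCategory V]
  {E : Type u₂} [Category.{v₂} E] [Preadditive E] [MonoidalCategory E]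
  [SymmetricCategory E] [MonoidalPreadditive E] (F : V ⥤ E) [F.Braided] [F.Additive]
  {M : Set (𝟙_ E ⟶ 𝟙_ E)}

/-- The powers of an endomorphism of the unit. -/
def endPow (r : 𝟙_ E ⟶ 𝟙_ E) : ℕ → (𝟙_ E ⟶ 𝟙_ E)
  | 0 => 𝟙 _
  | n + 1 => endPow r n ≫ r

lemma comp_star_comp {X W W' : E} (a : X ⟶ 𝟙_ E) (r : 𝟙_ E ⟶ 𝟙_ E) (j : W' ⟶ W) (z : W ⟶ 𝟙_ E)
    (t : 𝟙_ E ⟶ 𝟙_ E) : star (a ≫ r) (j ≫ z ≫ t) = (a ▷ W' ≫ (λ_ W').hom ≫ j) ≫ z ≫ t ≫ r := by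
  rw [comp_star, star]
  simp

lemma starPow_of_comp {X W : E} (a : X ⟶ 𝟙_ E) (r : 𝟙_ E ⟶ 𝟙_ E) (z : W ⟶ 𝟙_ E) (n : ℕ) :
    ∃ j, (starPow (a ≫ r) z n).2 = j ≫ z ≫ endPow r n := by
  induction n with
  | zero => exact ⟨𝟙 W, ((Category.id_comp _).trans (Category.comp_id z)).symm⟩
  | succ n ih =>
    obtain ⟨j, hj⟩ := ih
    change ∃ j : X ⊗ (starPow (a ≫ r) z n).1 ⟶ W, star (a ≫ r) (starPow (a ≫ r) z n).2 = _
    rw [hj]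
    exact ⟨a ▷ _ ≫ (λ_ _).hom ≫ j, comp_star_comp a r j z _⟩

/-- There are two sources of nilpotency. If `S` is the unit, then `h` is a trivialisation followed
by an endomorphism outside `M`, to which `hnil` applies; otherwise a symmetric power of `S`
vanishes. -/
lemma isNilpotentUpTo_of_simple (hV : IsSchurianSemisimple k V) (hsym : SymPowersVanish V)
    (h1 : 𝟙 _ ∈ M) (hnil : ∀ r ∉ M, ∃ s ∈ M, ∃ n, endPow r n ≫ s = 0)
    {S : V} (hS : Simple S) (h : F.obj S ⟶ 𝟙_ E) (hh : ∀ v : 𝟙_ E ⟶ F.obj S, v ≫ h ∉ M) :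
    IsNilpotentUpTo M h := by
  by_cases hi : Nonempty (S ≅ 𝟙_ V)
  · obtain ⟨e⟩ := hi
    obtain ⟨s, hs, n, hn⟩ := hnil _ (hh (ε F ≫ F.map e.inv))
    refine ⟨n, s, hs, fun W z => ?_⟩
    have he : h = (F.map e.hom ≫ η F) ≫ (ε F ≫ F.map e.inv) ≫ h := by
      simp only [Category.assoc]
      rw [η_ε_assoc, ← F.map_comp_assoc, e.hom_inv_id, CategoryTheory.Functor.map_id,
        Category.id_comp]
    have := starPow_of_comp (F.map e.hom ≫ η F) ((ε F ≫ F.map e.inv) ≫ h) z n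
    rw [← he] at this
    obtain ⟨j, hj⟩ := this
    rw [hj, Category.assoc, Category.assoc, hn, comp_zero, comp_zero]
  · obtain ⟨N, hN⟩ := hsym S hS hi
    refine ⟨N, 𝟙 _, h1, fun W z => ?_⟩
    obtain ⟨j, hj⟩ := exists_starPow_eq F h z N
    rw [hj, fpow_eq_zero F h hV N hN, zero_star, comp_zero, zero_comp]

/-- A sum of nilpotent morphisms is nilpotent, so it cannot be cancelled unless everything is
torsion. Rather than expanding a power of the sum, the induction removes one simple summand at a
time, for which the class `P` of morphisms on which `h` can be cancelled must be allowed to shrink.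
-/
lemma isTorsion_of_isSum (hV : IsSchurianSemisimple k V) (hsym : SymPowersVanish V)
    (h1 : 𝟙 _ ∈ M) (hM : ∀ s ∈ M, ∀ t ∈ M, s ≫ t ∈ M)
    (hnil : ∀ r ∉ M, ∃ s ∈ M, ∃ n, endPow r n ≫ s = 0)
    {X : V} (hX : IsSum (fun S => Simple S) X) (h : F.obj X ⟶ 𝟙_ E)
    (hh : ∀ v : 𝟙_ E ⟶ F.obj X, v ≫ h ∉ M) (P : ∀ {W : E}, (W ⟶ 𝟙_ E) → Prop)
    (hP : ∀ {U W : E} (u : U ⟶ 𝟙_ E) (z : W ⟶ 𝟙_ E), P z → P (star u z))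
    (hz : ∀ {W : E} (z : W ⟶ 𝟙_ E), P z → IsTorsion M (star h z) → IsTorsion M z)
    {W : E} (z : W ⟶ 𝟙_ E) (hPz : P z) : IsTorsion M z := by
  induction hX generalizing W P with
  | @zero X hX =>
    have h0 : h = 0 := by rw [← Category.id_comp h, ← F.map_id, hX, F.map_zero, zero_comp]
    exact hz z hPz ⟨_, h1, by rw [h0, zero_star, zero_comp]⟩
  | @add S Y X hS _ d ih =>
    have hdec : h = F.map d.fst ≫ F.map d.inl ≫ h + F.map d.snd ≫ F.map d.inr ≫ h := by
      simp only [← Category.assoc, ← F.map_comp, ← Preadditive.add_comp, ← F.map_add, d.total]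
      simp
    -- On the smaller class where the product with the `S`-part of `h` is torsion, the product with
    -- `h` is torsion as soon as the product with the `Y`-part is. So the `Y`-part can be cancelled
    -- there, and the induction hypothesis applies to it.
    have step {W : E} (z : W ⟶ 𝟙_ E) (hPz : P z) (ht : IsTorsion M (star (F.map d.inl ≫ h) z)) :
        IsTorsion M z := by
      refine ih (F.map d.inr ≫ h) (fun v => ?_)
        (fun z => P z ∧ IsTorsion M (star (F.map d.inl ≫ h) z))
        (fun u z hz => ⟨hP u z hz.1, hz.2.star_swap u⟩) (fun z hz' ht' => hz z hz'.1 ?_) z ⟨hPz, ht⟩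
      · rw [← Category.assoc]
        exact hh _
      · rw [hdec, add_star, ← whiskerRight_star (F.map d.fst), ← whiskerRight_star (F.map d.snd)]
        exact (hz'.2.comp _).add hM (ht'.comp _)
    obtain ⟨n, s, hs, hn⟩ := isNilpotentUpTo_of_simple F hV hsym h1 hnil hS (F.map d.inl ≫ h)
      (fun v => by
        rw [← Category.assoc]
        exact hh _)
    have hpow (m : ℕ) : P (starPow (F.map d.inl ≫ h) z m).2 := by
      induction m with
      | zero => exact hPz
      | succ m ihm => exact hP _ _ ihm
    -- By `step` the `S`-part can be cancelled one factor at a time, starting from its power that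
    -- vanishes up to `M`.
    have desc (m : ℕ) (hm : IsTorsion M (starPow (F.map d.inl ≫ h) z m).2) : IsTorsion M z := by
      induction m with
      | zero => exact hm
      | succ m ihm => exact ihm (step _ (hpow m) hm)
    exact desc n ⟨s, hs, hn _ z⟩

end nilpotent

/-! ### Splitting epimorphisms to the unit and short exact sequences up to scalars. -/

section split
variable {k : Type w} [Field k] {V : Type u₁} [Category.{v₁} V] [Preadditive V] [IsAbelian V]
  [Linear k V] [MonoidalCategory V] [SymmetricCategory V]
  {B : Type u} [Category.{v} B] [EssentiallySmall.{v} B] [Preadditive B] [IsAbelian B] [Linear k B]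
  [MonoidalCategory B] [SymmetricCategory B] [MonoidalPreadditive B] [MonoidalLinear k B]
  {E : Type u₂} [Category.{v₂} E] [Preadditive E] [MonoidalCategory E]
  [SymmetricCategory E] [MonoidalPreadditive E]
  (J : V ⥤ B) [J.Braided] [J.Additive] (G : B ⥤ E) [G.Braided] [G.Additive]
  {M : Set (𝟙_ E ⟶ 𝟙_ E)}

/-- Every object becomes a summand of a free object over `V` after inverting an element of `M`. -/
def LocallyFreeUpTo (M : Set (𝟙_ E ⟶ 𝟙_ E)) : Prop :=
  ∀ X : B, ∃ X₀ : V, ∃ s ∈ M, ∃ (a : G.obj X ⟶ G.obj (J.obj X₀)) (b : G.obj (J.obj X₀) ⟶ G.obj X),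
    a ≫ b = sc s _

/-- The data of a morphism to a commutative ring detecting a multiplicative set, of which every
element outside is nilpotent up to the set. -/
structure IsLocalizing (M : Set (𝟙_ E ⟶ 𝟙_ E)) : Prop where
  one : 𝟙 _ ∈ M
  mul : ∀ s ∈ M, ∀ t ∈ M, s ≫ t ∈ M
  zero : 0 ∉ M
  nil : ∀ r ∉ M, ∃ s ∈ M, ∃ n, endPow r n ≫ s = 0

lemma isCok_kernel {X Y : B} (g : X ⟶ Y) [Epi g] : IsCok (kernel.ι g) g where
  cancel W w hw := by rw [← cancel_epi g, hw, comp_zero]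
  comp := kernel.condition g
  desc W w hw :=
    let := abelianOfIsAbelian B
    ⟨Abelian.epiDesc g w (by
      rw [← kernel.lift_ι g (kernel.ι g) (kernel.condition g), Category.assoc, hw, comp_zero]),
      Abelian.comp_epiDesc g w _⟩

/-- The source of `z` is the image of a dualisable object, so `g` stays an epimorphism after
tensoring with it; `G` keeps it epimorphic because it preserves cokernels. -/
lemma eq_zero_of_star_eq_zero
    (hB : IsTensorCategory k B)
    (hG : ∀ P : E, ∃ X, Nonempty (G.obj X ≅ P))
    (hcok : ∀ ⦃X Y Z : B⦄ (f : X ⟶ Y) (g : Y ⟶ Z), IsCok f g → IsCok (G.map f) (G.map g))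
    {P : B} (g : P ⟶ 𝟙_ B) [Epi g] {W : E} (z : W ⟶ 𝟙_ E)
    (h : star (G.map g ≫ η G) z = 0) : z = 0 := by
  obtain ⟨Q, ⟨e⟩⟩ := hG W
  obtain ⟨Q', ⟨p⟩⟩ := hB.dualisable Q
  have := whiskerRight_epi_of_exactPairing Q Q' g
  have h₁ : Epi (G.map (g ▷ Q)) := (hcok _ _ (isCok_kernel (g ▷ Q))).epi
  have h₂ : G.map (g ▷ Q) = δ G _ _ ≫ G.map g ▷ G.obj Q ≫ μ G _ _ := by simp
  have h₃ : G.map (g ▷ Q) ≫ δ G _ _ ≫ η G ▷ G.obj Q ≫ (λ_ _).hom ≫ e.hom ≫ z = 0 := by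
    rw [h₂]
    simp only [Category.assoc, μ_δ_assoc]
    have := whiskerLeft_star e.hom (G.map g ≫ η G) z
    rw [h, comp_zero, star, comp_whiskerRight, Category.assoc] at this
    rw [← this, comp_zero]
  rw [← comp_zero (f := G.map (g ▷ Q)), cancel_epi] at h₃
  rw [← cancel_epi e.hom, ← cancel_epi (λ_ (G.obj Q)).hom, ← cancel_epi (η G ▷ G.obj Q),
    ← cancel_epi (δ G (𝟙_ B) Q), h₃]
  simp

/-- Otherwise no point of `P` has a value in `M`, and neither has any point of the object of `V`
approximating `P`. The morphism that `g` induces there is then nilpotent up to `M`, whereas an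
epimorphism to the unit can be cancelled. So the identity of the unit is torsion and `0` lies in
`M`. -/
lemma exists_section_of_epi
    (hV : IsSchurianSemisimple k V)
    (hsym : SymPowersVanish V)
    (hB : IsTensorCategory k B)
    (hG : ∀ P : E, ∃ X, Nonempty (G.obj X ≅ P))
    (hcok : ∀ ⦃X Y Z : B⦄ (f : X ⟶ Y) (g : Y ⟶ Z), IsCok f g → IsCok (G.map f) (G.map g))
    (hM : IsLocalizing M)
    (hfree : LocallyFreeUpTo J G M)
    {P : B} (g : P ⟶ 𝟙_ B) [Epi g] :
    ∃ w : 𝟙_ E ⟶ G.obj P, w ≫ G.map g ≫ η G ∈ M := by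
  by_contra! hcon
  obtain ⟨X₀, s, hs, a, b, hab⟩ := hfree P
  obtain ⟨t, ht, h0⟩ := isTorsion_of_isSum (J ⋙ G) hV hsym hM.one hM.mul hM.nil (hV.isSum X₀)
    (b ≫ G.map g ≫ η G) (fun v => by
      rw [← Category.assoc]
      exact hcon _) (fun _ => True) (fun _ _ _ => trivial) (fun {W} z _ hz => by
        obtain ⟨t, ht, hz⟩ := hz
        -- The factor `s` accounts for the fact that `a ≫ b` is only the scalar `s`: going to the
        -- object of `V` and back multiplies `g` by `s`.
        refine ⟨t ≫ s, hM.mul t ht s hs, ?_⟩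
        refine eq_zero_of_star_eq_zero G hB hG hcok g _ ?_
        have h₁ : a ≫ b ≫ G.map g ≫ η G = (G.map g ≫ η G) ≫ s := by
          rw [reassoc_of% hab, sc_naturality, sc_unit]
        rw [← Category.assoc, star_comp, ← comp_star, ← h₁, ← whiskerRight_star, star_comp]
        exact (congrArg (a ▷ W ≫ ·) hz).trans comp_zero) (𝟙 (𝟙_ E)) trivial
  rw [Category.id_comp] at h0
  exact hM.zero (h0 ▸ ht)

/-- After tensoring with the dual of `X` and pushing out along the evaluation, the inclusion `f`
becomes a monomorphism from the unit. A retraction of it, up to a scalar, is a section of its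
transpose, which is an epimorphism to the unit; transposing back retracts `f` up to the same scalar.
-/
lemma exists_splitting
    (hV : IsSchurianSemisimple k V)
    (hsym : SymPowersVanish V)
    (hB : IsTensorCategory k B)
    (hG : ∀ P : E, ∃ X, Nonempty (G.obj X ≅ P))
    (hcok : ∀ ⦃X Y Z : B⦄ (f : X ⟶ Y) (g : Y ⟶ Z), IsCok f g → IsCok (G.map f) (G.map g))
    (hM : IsLocalizing M)
    (hfree : LocallyFreeUpTo J G M)
    {X Y Z : B} (f : X ⟶ Y) [Mono f] (g : Y ⟶ Z) (hfg : IsCok f g) :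
    ∃ s ∈ M, ∃ (ρ : G.obj Y ⟶ G.obj X) (σ : G.obj Z ⟶ G.obj Y),
      G.map f ≫ ρ = sc s _ ∧ ρ ≫ G.map f + G.map g ≫ σ = sc s _ ∧ σ ≫ G.map g = sc s _ := by
  let := abelianOfIsAbelian B
  obtain ⟨X', ⟨p⟩⟩ := hB.dualisable X
  let := BraidedCategory.exactPairing_swap X X'
  have : Mono (f ▷ X') := whiskerRight_mono_of_exactPairing X' X f
  -- The morphism `u` is the pushout of the monomorphism `f ▷ X'` along the evaluation, hence a
  -- monomorphism and non-zero.
  obtain ⟨P, u, q, hq, hu⟩ : ∃ (P : B) (u : 𝟙_ B ⟶ P) (q : Y ⊗ X' ⟶ P),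
      f ▷ X' ≫ q = ε_ X' X ≫ u ∧ u ≠ 0 := by
    refine ⟨_, pushout.inr _ _, pushout.inl _ _, pushout.condition, fun h0 => ?_⟩
    have : Mono (pushout.inr (f ▷ X') (ε_ X' X)) := inferInstance
    refine hB.unit_nonzero ((IsZero.iff_id_eq_zero _).2 ?_)
    rw [← cancel_mono (pushout.inr (f ▷ X') (ε_ X' X)), h0, comp_zero, comp_zero]
  obtain ⟨P', ⟨p'⟩⟩ := hB.dualisable P
  have := hB.epi_to_unit _ (coTranspose_ne_zero (Y := P') hu)
  obtain ⟨w, hw⟩ := exists_section_of_epi J G hV hsym hB hG hcok hM hfree (coTranspose u (Y := P'))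
  refine ⟨_, hw, ?_⟩
  set s := w ≫ G.map (coTranspose u (Y := P')) ≫ η G with hs
  -- Contracting with the point `w` of the dual of `P` gives a morphism to the unit whose composite
  -- with `u` is the scalar `s`.
  let w' : G.obj P ⟶ 𝟙_ E := (λ_ _).inv ≫ w ▷ _ ≫ μ G _ _ ≫ G.map (ε_ P P') ≫ η G
  have hw' : ε G ≫ G.map u ≫ w' = s := by
    simp only [w', hs, coTranspose, Functor.map_comp, Category.assoc]
    rw [← Category.assoc (ε G), leftUnitor_inv_naturality_assoc, whisker_exchange_assoc,
      MonoidalCategory.whiskerLeft_comp_assoc, μ_natural_right_assoc, Functor.Monoidal.map_rightUnitor_inv]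
    simp [unitors_inv_equal]
  let := exactPairingMap G X' X
  have hε : ε_ (G.obj X') (G.obj X) = μ G X X' ≫ G.map (ε_ X' X) ≫ η G := rfl
  obtain ⟨ρ, hρ⟩ := exists_whiskerRight_evaluation (Q := G.obj X) (μ G Y X' ≫ G.map q ≫ w')
  have h₁ : G.map f ≫ ρ = sc s _ := by
    refine whiskerRight_evaluation_injective (Z := G.obj X') ?_
    rw [comp_whiskerRight, Category.assoc, hρ, sc_whiskerRight, sc_naturality, sc_unit, hε,
      ← hw', μ_natural_left_assoc, ← Functor.map_comp_assoc, hq]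
    simp
  obtain ⟨σ, hσ⟩ := (hcok f g hfg).desc (sc s _ - ρ ≫ G.map f) (by
    rw [Preadditive.comp_sub, reassoc_of% h₁, sc_naturality, sub_self])
  refine ⟨ρ, σ, h₁, by rw [hσ]; abel, ?_⟩
  have := (hcok f g hfg).epi
  rw [← cancel_epi (G.map g), reassoc_of% hσ, Preadditive.sub_comp, Category.assoc,
    ← Functor.map_comp, hfg.comp, Functor.map_zero, comp_zero, sub_zero, sc_naturality]

end split
end TensorCat
/-! ### The semisimple quotient -/

namespace TensorCat

section pointed
variable {k : Type w} [Field k] {L : Type u} [Category.{v} L] [Preadditive L] [Linear k L]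
  [MonoidalCategory L] [MonoidalPreadditive L] [MonoidalLinear k L] [SymmetricCategory L]
  {K : Type v₁} [CommRing K] [Algebra k K] {χ : (𝟙_ L ⟶ 𝟙_ L) →ₗ[k] K}

/-- A multiplicative linear map to a ring, with the property that non-zero values have inverses that
are values. -/
structure IsCharacter (χ : (𝟙_ L ⟶ 𝟙_ L) →ₗ[k] K) : Prop where
  map_id : χ (𝟙 _) = 1
  map_comp f g : χ (f ≫ g) = χ f * χ g
  exists_inv f : χ f ≠ 0 → ∃ g, χ (f ≫ g) = 1

variable (χ) in
/-- The idempotent completion of the quotient by the negligible morphisms. -/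
abbrev Semisimplification := Karoubi (TensorIdeal.Quot (negligible k χ))

variable (χ) in
/-- The functor to the semisimplification. -/
abbrev toSemisimplification : L ⥤ Semisimplification χ := (negligible k χ).proj ⋙ toKaroubi _

lemma isIso_toSemisimplification (hχ : IsCharacter χ) (r : 𝟙_ L ⟶ 𝟙_ L) (hr : χ r ≠ 0) :
    IsIso ((toSemisimplification χ).map r) := by
  obtain ⟨r', h⟩ := hχ.exists_inv r hr
  have h₁ : (negligible k χ).proj.map (r ≫ r') = 𝟙 _ := by
    rw [← sub_eq_zero, ← CategoryTheory.Functor.map_id, ← Functor.map_sub,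
      TensorIdeal.proj_map_eq_zero, mem_negligible_unit hχ.map_comp, map_sub, h, hχ.map_id, sub_self]
  refine ⟨(toSemisimplification χ).map r', ?_, ?_⟩
  · rw [← Functor.map_comp, Functor.comp_map, h₁]
    exact CategoryTheory.Functor.map_id _ _
  · rw [← Functor.map_comp, unit_comp_comm, Functor.comp_map, h₁]
    exact CategoryTheory.Functor.map_id _ _

/-- An endomorphism of the unit is negligible exactly when `χ` kills it, and otherwise it has an
inverse modulo negligible morphisms. Negligibility of a morphism to the unit is tested on points by
`mem_negligible_iff`. -/
lemma isPointed_semisimplification [Nontrivial K] (hχ : IsCharacter χ) :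
    IsPointed (Semisimplification χ) where
  unit_ne h := by
    have h' := congrArg Karoubi.Hom.f h
    have : (negligible k χ).proj.map (𝟙 (𝟙_ L)) = 0 := h'
    rw [TensorIdeal.proj_map_eq_zero, mem_negligible_unit hχ.map_comp, hχ.map_id] at this
    exact one_ne_zero this
  zero_or_isIso c := by
    obtain ⟨r, hr⟩ := TensorIdeal.Quot.cls_surjective c.f
    have hc : (toSemisimplification χ).map r = c := by
      ext
      exact hr
    by_cases h : χ r = 0
    · left
      rw [← hc, Functor.comp_map, (TensorIdeal.proj_map_eq_zero _).2
        ((mem_negligible_unit hχ.map_comp).2 h), Functor.map_zero]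
      rfl
    · right
      exact hc ▸ isIso_toSemisimplification hχ r h
  eq_zero {Z} h hv := by
    obtain ⟨r, hr⟩ := TensorIdeal.Quot.cls_surjective h.f
    ext
    rw [← hr]
    refine TensorIdeal.Quot.cls_eq_zero.2 (mem_negligible_iff.2 fun v => ?_)
    have h₁ := congrArg Karoubi.Hom.f (hv ⟨TensorIdeal.Quot.cls v ≫ Z.p, by simp⟩)
    simp only [Karoubi.comp_f, Category.assoc, Karoubi.p_comp] at h₁
    rw [← hr, ← TensorIdeal.Quot.cls_comp] at h₁
    exact (mem_negligible_unit hχ.map_comp).1 (TensorIdeal.Quot.cls_eq_zero.1 h₁)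

lemma exists_retract_toSemisimplification (Z : Semisimplification χ) :
    ∃ P : L, Nonempty (Retract Z ((toSemisimplification χ).obj P)) :=
  ⟨Z.X.of, ⟨⟨⟨Z.p, (congrArg (Z.p ≫ ·) (Category.comp_id _)).trans Z.idem⟩,
    ⟨Z.p, (Category.id_comp _).trans Z.idem⟩, Karoubi.hom_ext _ _ Z.idem⟩⟩⟩

end pointed

/-- The category with one object and a given ring of endomorphisms. -/
structure Pt (K : Type v) : Type

namespace Pt
variable {k : Type w} [Field k] {K : Type v} [CommRing K] [Algebra k K]

instance : Category.{v} (Pt K) where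
  Hom _ _ := K
  id _ := 1
  comp f g := f * g
  id_comp _ := one_mul _
  comp_id _ := mul_one _
  assoc _ _ _ := mul_assoc ..

instance : Preadditive (Pt K) where
  homGroup _ _ := inferInstanceAs (AddCommGroup K)
  add_comp _ _ _ := add_mul
  comp_add _ _ _ := mul_add

instance : Linear k (Pt K) where
  homModule _ _ := inferInstanceAs (Module k K)
  smul_comp _ _ _ := smul_mul_assoc
  comp_smul _ _ _ f a g := mul_smul_comm a f g

instance : MonoidalCategory (Pt K) where
  tensorObj _ _ := ⟨⟩
  tensorUnit := ⟨⟩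
  whiskerLeft _ _ _ f := f
  whiskerRight f _ := f
  tensorHom f g := (show K from f) * g
  associator _ _ _ := ⟨(1 : K), (1 : K), one_mul (1 : K), one_mul (1 : K)⟩
  leftUnitor _ := ⟨(1 : K), (1 : K), one_mul (1 : K), one_mul (1 : K)⟩
  rightUnitor _ := ⟨(1 : K), (1 : K), one_mul (1 : K), one_mul (1 : K)⟩
  tensorHom_def _ _ := rfl
  id_tensorHom_id _ _ := one_mul (1 : K)
  tensorHom_comp_tensorHom f₁ f₂ g₁ g₂ := mul_mul_mul_comm (G := K) f₁ f₂ g₁ g₂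
  whiskerLeft_id _ _ := rfl
  id_whiskerRight _ _ := rfl
  associator_naturality f₁ f₂ f₃ := (mul_one (M := K) _).trans
    ((mul_assoc (G := K) f₁ f₂ f₃).trans (one_mul (M := K) _).symm)
  leftUnitor_naturality f := (mul_one (M := K) f).trans (one_mul (M := K) f).symm
  rightUnitor_naturality f := (mul_one (M := K) f).trans (one_mul (M := K) f).symm
  pentagon _ _ _ _ := one_mul (M := K) (1 * 1)
  triangle _ _ := one_mul (1 : K)

instance : MonoidalPreadditive (Pt K) where
  whiskerLeft_zero := rfl
  zero_whiskerRight := rfl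
  whiskerLeft_add _ _ := rfl
  add_whiskerRight _ _ := rfl

instance : MonoidalLinear k (Pt K) where
  whiskerLeft_smul _ _ _ _ _ := rfl
  smul_whiskerRight _ _ _ _ _ := rfl

instance : SymmetricCategory (Pt K) where
  braiding _ _ := ⟨(1 : K), (1 : K), one_mul (1 : K), one_mul (1 : K)⟩
  braiding_naturality_right _ _ _ f := (mul_one (M := K) f).trans (one_mul (M := K) f).symm
  braiding_naturality_left f _ := (mul_one (M := K) f).trans (one_mul (M := K) f).symm
  hexagon_forward _ _ _ := rfl
  hexagon_reverse _ _ _ := rfl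
  symmetry _ _ := one_mul (1 : K)

end Pt

/-! ### Extension of scalars to a field. -/

section extension
variable {k : Type w} [Field k] {E : Type u} [Category.{v} E] [Preadditive E] [Linear k E]
  [MonoidalCategory E] [MonoidalPreadditive E] [MonoidalLinear k E] [SymmetricCategory E]
  {K : Type v} [Field K] [Algebra k K] (φ : (𝟙_ E ⟶ 𝟙_ E) →ₗ[k] K)

/-- The extension of a `K`-valued linear map to the extension of scalars to `K`. -/
def extendScalars : (𝟙_ (LinTensor k (Pt K) E) ⟶ 𝟙_ (LinTensor k (Pt K) E)) →ₗ[k] K :=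
  LinearMap.mul' k K ∘ₗ TensorProduct.map (LinearMap.id : K →ₗ[k] K) φ

lemma extendScalars_homMk (c : K) (r : 𝟙_ E ⟶ 𝟙_ E) :
    extendScalars φ (LinTensor.homMk (X := 𝟙_ (LinTensor k (Pt K) E))
      (Y := 𝟙_ (LinTensor k (Pt K) E)) c r) = c * φ r := rfl

lemma extendScalars_comp (hφ : ∀ f g, φ (f ≫ g) = φ f * φ g)
    (f g : 𝟙_ (LinTensor k (Pt K) E) ⟶ 𝟙_ (LinTensor k (Pt K) E)) :
    extendScalars φ (f ≫ g) = extendScalars φ f * extendScalars φ g := by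
  induction f using LinTensor.hom_induction with
  | zero => simp
  | add a b ha hb => simp only [Preadditive.add_comp, map_add, ha, hb, add_mul]
  | mk c r =>
    induction g using LinTensor.hom_induction with
    | zero => simp
    | add a b ha hb => simp only [Preadditive.comp_add, map_add, ha, hb, mul_add]
    | mk c' r' =>
      refine (extendScalars_homMk φ ((show K from c) * c') (r ≫ r')).trans ?_
      rw [hφ]
      exact mul_mul_mul_comm ..

/-- This is the purpose of extending scalars: the inverse of a non-zero value of `φ` in `K` need not
be a value of `φ`, but after the extension every element of `K` is a value. -/
lemma isCharacter_extendScalars (h1 : φ (𝟙 _) = 1) (hφ : ∀ f g, φ (f ≫ g) = φ f * φ g) :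
    IsCharacter (extendScalars φ) where
  map_id := by
    refine (extendScalars_homMk φ (1 : K) (𝟙 _)).trans ?_
    rw [h1, one_mul]
  map_comp := extendScalars_comp φ hφ
  exists_inv f hf := by
    refine ⟨LinTensor.homMk (X := 𝟙_ (LinTensor k (Pt K) E)) (Y := 𝟙_ (LinTensor k (Pt K) E))
      (extendScalars φ f)⁻¹ (𝟙 _), ?_⟩
    rw [extendScalars_comp φ hφ, extendScalars_homMk]
    refine (congrArg (fun t => _ * (_ * t)) h1).trans ?_
    rw [mul_one, mul_inv_cancel₀ hf]

/-- The semisimplification after extension of scalars. -/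
abbrev SemisimpleExt := Semisimplification (extendScalars φ)

/-- The functor to the semisimplification after extension of scalars. -/
abbrev toSemisimpleExt : E ⥤ SemisimpleExt φ :=
  LinTensor.fixLeft k E (𝟙_ (Pt K)) ⋙ toSemisimplification (extendScalars φ)

lemma isIso_toSemisimpleExt_sc (h1 : φ (𝟙 _) = 1) (hφ : ∀ f g, φ (f ≫ g) = φ f * φ g)
    {s : 𝟙_ E ⟶ 𝟙_ E} (hs : φ s ≠ 0) (X : E) : IsIso ((toSemisimpleExt φ).map (sc s X)) := by
  have : IsIso ((toSemisimpleExt φ).map s) :=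
    isIso_toSemisimplification (isCharacter_extendScalars φ h1 hφ)
      (LinTensor.homMk (X := 𝟙_ (LinTensor k (Pt K) E)) (Y := 𝟙_ (LinTensor k (Pt K) E)) (1 : K) s)
      (by rwa [extendScalars_homMk, one_mul])
  rw [sc, Functor.map_comp, Functor.map_comp, Functor.Monoidal.map_whiskerRight]
  infer_instance

lemma exists_retract_toSemisimpleExt (Z : SemisimpleExt φ) :
    ∃ P : E, Nonempty (Retract Z ((toSemisimpleExt φ).obj P)) := by
  obtain ⟨P, h⟩ := exists_retract_toSemisimplification Z
  exact ⟨P.snd, h⟩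

end extension
end TensorCat
/-! ### Tensor functors that split short exact sequences -/

namespace TensorCat

section exact
variable {B : Type u} [Category.{v} B] [Preadditive B] [IsAbelian B]
  {C : Type u₂} [Category.{v₂} C] [Preadditive C]

lemma isCok_of_shortExact {S : ShortComplex B} (hS : S.ShortExact) : IsCok S.f S.g where
  cancel W w hw := by
    have := hS.epi_g
    rw [← cancel_epi S.g, hw, comp_zero]
  comp := S.zero
  desc W w hw :=
    let := abelianOfIsAbelian B
    ⟨hS.gIsCokernel.desc (CokernelCofork.ofπ w hw), hS.gIsCokernel.fac _ .one⟩

lemma shortExact_of_isCok {X Y Z : B} (f : X ⟶ Y) [Mono f] (g : Y ⟶ Z) (h : IsCok f g) :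
    (ShortComplex.mk f g h.comp).ShortExact := by
  let := abelianOfIsAbelian B
  have := h.epi
  exact { exact := ShortComplex.exact_of_g_is_cokernel _ h.isColimit }

lemma isCok_of_splitting {S : ShortComplex C} (s : S.Splitting) : IsCok S.f S.g where
  cancel W w hw := by rw [← Category.id_comp w, ← s.s_g, Category.assoc, hw, comp_zero]
  comp := S.zero
  desc W w hw := ⟨s.s ≫ w, by rw [← Category.assoc, s.g_s]; simp [hw]⟩

/-- Factor a morphism through its image: this leaves an epimorphism and a monomorphism with their
short exact sequences, and split sequences remain cokernel sequences. -/
lemma preservesFiniteColimits_of_splitting [HasZeroObject C] (F : B ⥤ C) [F.Additive]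
    (hF : ∀ S : ShortComplex B, S.ShortExact → Nonempty (S.map F).Splitting) :
    PreservesFiniteColimits F := by
  have key ⦃X Y Z : B⦄ (f : X ⟶ Y) [Mono f] (g : Y ⟶ Z) (h : IsCok f g) :
      IsCok (F.map f) (F.map g) := by
    obtain ⟨s⟩ := hF _ (shortExact_of_isCok f g h)
    exact isCok_of_splitting s
  refine preservesFiniteColimits_of_isCok F fun X Y Z f π h => ?_
  obtain ⟨K, Q, I, i, q, e, m, rfl, hi, hq, he, hm⟩ := hasCanonicalFactorization f
  have := hi.mono
  have := hm.mono
  have hm' : IsCok m π := by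
    have := he.epi
    refine ⟨h.cancel, ?_, fun W w hw => h.desc w (by rw [Category.assoc, hw, comp_zero])⟩
    rw [← cancel_epi e, ← Category.assoc, h.comp, comp_zero]
  have h₁ := key m π hm'
  have h₂ := (key i e he).epi
  refine ⟨h₁.cancel, ?_, fun W w hw => h₁.desc w ?_⟩
  · rw [← F.map_comp, h.comp, F.map_zero]
  · rw [← cancel_epi (F.map e), ← Category.assoc, ← F.map_comp, hw, comp_zero]

end exact

section upTo
variable {B : Type u} [Category.{v} B] [Preadditive B]
  {E : Type u₂} [Category.{v₂} E] [Preadditive E] [MonoidalCategory E] [SymmetricCategory E]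
  {C : Type u₃} [Category.{v₃} C] [Preadditive C] (G : B ⥤ E) [G.Additive] (F : E ⥤ C) [F.Additive]

/-- A sequence that splits up to an endomorphism of the unit splits where that is invertible. -/
def splittingOfUpTo (S : ShortComplex B) {s : 𝟙_ E ⟶ 𝟙_ E} (hs : ∀ X, IsIso (F.map (sc s X)))
    {ρ : G.obj S.X₂ ⟶ G.obj S.X₁} {σ : G.obj S.X₃ ⟶ G.obj S.X₂} (h₁ : G.map S.f ≫ ρ = sc s _)
    (h₂ : ρ ≫ G.map S.f + G.map S.g ≫ σ = sc s _) (h₃ : σ ≫ G.map S.g = sc s _) :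
    (S.map (G ⋙ F)).Splitting :=
  have hn {X Y : E} (f : X ⟶ Y) :
      inv (F.map (sc s X)) ≫ F.map f = F.map f ≫ inv (F.map (sc s Y)) := by
    rw [IsIso.inv_comp_eq, ← F.map_comp_assoc, sc_naturality, F.map_comp, Category.assoc,
      IsIso.hom_inv_id, Category.comp_id]
  { r := show F.obj (G.obj S.X₂) ⟶ F.obj (G.obj S.X₁) from
      F.map ρ ≫ inv (F.map (sc s (G.obj S.X₁)))
    s := show F.obj (G.obj S.X₃) ⟶ F.obj (G.obj S.X₂) from
      F.map σ ≫ inv (F.map (sc s (G.obj S.X₂)))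
    f_r := by
      change F.map (G.map S.f) ≫ F.map ρ ≫ inv (F.map (sc s (G.obj S.X₁))) = 𝟙 _
      rw [← F.map_comp_assoc, h₁, IsIso.hom_inv_id]
    s_g := by
      change (F.map σ ≫ inv (F.map (sc s (G.obj S.X₂)))) ≫ F.map (G.map S.g) = 𝟙 _
      rw [Category.assoc, hn, ← F.map_comp_assoc, h₃, IsIso.hom_inv_id]
    id := by
      change (F.map ρ ≫ inv (F.map (sc s (G.obj S.X₁)))) ≫ F.map (G.map S.f) +
        F.map (G.map S.g) ≫ F.map σ ≫ inv (F.map (sc s (G.obj S.X₂))) = 𝟙 _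
      rw [Category.assoc, hn, ← F.map_comp_assoc, ← F.map_comp_assoc, ← Preadditive.add_comp,
        ← F.map_add, h₂, IsIso.hom_inv_id] }

end upTo

section splitting
variable {k : Type w} [Field k] {V : Type u₁} [Category.{v₁} V] [Preadditive V]
  [IsAbelian V] [Linear k V] [MonoidalCategory V] [SymmetricCategory V]
  {B : Type u} [Category.{v} B] [EssentiallySmall.{v} B] [Preadditive B] [IsAbelian B] [Linear k B]
  [MonoidalCategory B] [SymmetricCategory B] [MonoidalPreadditive B] [MonoidalLinear k B]
  {E : Type u₂} [Category.{v₂} E] [Preadditive E] [Linear k E] [MonoidalCategory E]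
  [SymmetricCategory E] [MonoidalPreadditive E] [MonoidalLinear k E]
  (J : V ⥤ B) [J.Braided] [J.Additive] (G : B ⥤ E) [G.Braided] [G.Additive]
  {K : Type v₂} [Field K] [Algebra k K] (φ : (𝟙_ E ⟶ 𝟙_ E) →ₗ[k] K)

/-- The morphisms with invertible image. -/
def unitSet : Set (𝟙_ E ⟶ 𝟙_ E) := { s | φ s ≠ 0 }

lemma exists_splitting_toSemisimpleExt (hφ₁ : φ (𝟙 _) = 1)
    (hφ : ∀ f g, φ (f ≫ g) = φ f * φ g) (hV : IsSchurianSemisimple k V) (hsym : SymPowersVanish V)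
    (hB : IsTensorCategory k B) (hG : ∀ P : E, ∃ X, Nonempty (G.obj X ≅ P))
    (hcok : ∀ ⦃X Y Z : B⦄ (f : X ⟶ Y) (g : Y ⟶ Z), IsCok f g → IsCok (G.map f) (G.map g))
    (hM : IsLocalizing (unitSet φ)) (hfree : LocallyFreeUpTo J G (unitSet φ))
    (S : ShortComplex B) (hS : S.ShortExact) :
    Nonempty (S.map (G ⋙ toSemisimpleExt φ)).Splitting := by
  have := hS.mono_f
  obtain ⟨s, hs, ρ, σ, h₁, h₂, h₃⟩ := exists_splitting J G hV hsym hB hG hcok hM hfree S.f S.g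
    (isCok_of_shortExact hS)
  exact ⟨splittingOfUpTo G (toSemisimpleExt φ) S
    (fun X => isIso_toSemisimpleExt_sc φ hφ₁ hφ hs X) h₁ h₂ h₃⟩

/-- Objects of `E` are summands of objects from `V` up to an element that becomes invertible here,
and all other objects are retracts of images of objects of `E`. -/
lemma exists_retract_semisimpleExt (hφ₁ : φ (𝟙 _) = 1)
    (hφ : ∀ f g, φ (f ≫ g) = φ f * φ g) (hG : ∀ P : E, ∃ X, Nonempty (G.obj X ≅ P))
    (hfree : LocallyFreeUpTo J G (unitSet φ)) (Z : SemisimpleExt φ) :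
    ∃ X : V, Nonempty (Retract Z ((J ⋙ G ⋙ toSemisimpleExt φ).obj X)) := by
  obtain ⟨P, ⟨r⟩⟩ := exists_retract_toSemisimpleExt φ Z
  obtain ⟨Y, ⟨e⟩⟩ := hG P
  obtain ⟨X, s, hs, a, b, hab⟩ := hfree Y
  have := isIso_toSemisimpleExt_sc φ hφ₁ hφ hs (G.obj Y)
  let r' : Retract ((toSemisimpleExt φ).obj (G.obj Y)) ((J ⋙ G ⋙ toSemisimpleExt φ).obj X) :=
    { i := (toSemisimpleExt φ).map a
      r := (toSemisimpleExt φ).map b ≫ inv ((toSemisimpleExt φ).map (sc s (G.obj Y)))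
      retract := by
        rw [← Functor.map_comp_assoc, hab, IsIso.hom_inv_id] }
  exact ⟨X, ⟨(r.trans (Retract.ofIso ((toSemisimpleExt φ).mapIso e.symm))).trans r'⟩⟩

end splitting
end TensorCat
/-! ### Essential images of braided functors -/

namespace TensorCat
open Functor.Monoidal

section essImage
variable {B : Type u₁} [Category.{v₁} B] [MonoidalCategory B] [SymmetricCategory B]
  {D : Type u₂} [Category.{v₂} D] [MonoidalCategory D] [SymmetricCategory D]
  (H : B ⥤ D) [H.Braided]

instance : H.essImage.IsMonoidal where
  prop_unit := ⟨𝟙_ B, ⟨(εIso H).symm⟩⟩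
  prop_tensor _ _ h₁ h₂ :=
    ⟨h₁.witness ⊗ h₂.witness, ⟨(μIso H _ _).symm ≪≫ (h₁.getIso ⊗ᵢ h₂.getIso)⟩⟩

/-- The corestriction to the essential image is monoidal. -/
def toEssImageCoreMonoidal : H.toEssImage.CoreMonoidal where
  εIso := H.essImage.isoMk (εIso H)
  μIso X Y := H.essImage.isoMk (μIso H X Y)
  μIso_hom_natural_left f X' := H.essImage.ι.map_injective (Functor.LaxMonoidal.μ_natural_left H f X')
  μIso_hom_natural_right X' f := H.essImage.ι.map_injective (Functor.LaxMonoidal.μ_natural_right H X' f)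
  associativity X Y Z := H.essImage.ι.map_injective (Functor.LaxMonoidal.associativity H X Y Z)
  left_unitality X := H.essImage.ι.map_injective (Functor.LaxMonoidal.left_unitality H X)
  right_unitality X := H.essImage.ι.map_injective (Functor.LaxMonoidal.right_unitality H X)

instance : H.toEssImage.Monoidal := (toEssImageCoreMonoidal H).toMonoidal

instance : H.toEssImage.Braided where
  braided X Y := H.essImage.ι.map_injective (Functor.LaxBraided.braided X Y)

instance [Preadditive B] [Preadditive D] [H.Additive] : H.toEssImage.Additive where
  map_add := H.essImage.ι.map_injective (H.map_add)

instance {k : Type w} [Field k] [Preadditive B] [Preadditive D] [Linear k B] [Linear k D]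
    [H.Linear k] : H.toEssImage.Linear k where
  map_smul f a := H.essImage.ι.map_injective (H.map_smul a f)

lemma toEssImage_isCok [Preadditive B] [Preadditive D] {X Y Z : B} {f : X ⟶ Y} {g : Y ⟶ Z}
    (h : IsCok (H.map f) (H.map g)) : IsCok (H.toEssImage.map f) (H.toEssImage.map g) where
  cancel W w hw := H.essImage.ι.map_injective (h.cancel w.hom (congrArg (·.hom) hw))
  comp := H.essImage.ι.map_injective h.comp
  desc W w hw := by
    obtain ⟨l, hl⟩ := h.desc w.hom (congrArg (·.hom) hw)
    exact ⟨ObjectProperty.homMk l, H.essImage.ι.map_injective hl⟩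

end essImage

/-! ### Residue fields of the endomorphism ring of the unit -/

section residue
variable {k : Type w} [Field k] {E : Type u} [Category.{v} E] [Preadditive E] [Linear k E]
  [MonoidalCategory E]

variable (E) in
/-- The endomorphism ring of the unit is commutative. -/
abbrev unitRing : CommRing (End (𝟙_ E)) where
  mul_comm r s := unit_comp_comm s r

/-- If no such product vanished, some prime would avoid both the complement of `p` and the powers of
`x`. It would lie in `p` without containing `x`, against minimality. -/
lemma exists_pow_mul_eq_zero {R : Type*} [CommRing R] {p : Ideal R} (hp : p ∈ (⊥ : Ideal R).minimalPrimes)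
    {x : R} (hx : x ∈ p) : ∃ s ∉ p, ∃ n : ℕ, s * x ^ n = 0 := by
  have := hp.isPrime
  by_contra! hcon
  obtain ⟨q, hq, -, hd⟩ := Ideal.exists_le_prime_disjoint ⊥ (p.primeCompl ⊔ Submonoid.powers x) (by
    rw [Set.disjoint_left]
    intro y hy hy'
    obtain ⟨s, hs, t, ⟨n, rfl⟩, rfl⟩ := Submonoid.mem_sup.1 hy'
    exact hcon s hs n hy)
  rw [Set.disjoint_left] at hd
  have hqp : q ≤ p := fun y hy => by
    by_contra h
    exact hd hy ((le_sup_left : p.primeCompl ≤ _) h)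
  exact hd (hp.2 ⟨hq, bot_le⟩ hqp hx)
    ((le_sup_right : Submonoid.powers x ≤ _) (Submonoid.mem_powers x))

/-- The monoid generated by the `e i` does not contain zero, so some prime avoids it, and so does
any minimal prime `p` below. `K` is the fraction field of the quotient by `p`. -/
lemma exists_residueField {I : Type*} (e : I → End (𝟙_ E))
    (he : ∀ l : List I, (l.map e).prod ≠ 0) :
    ∃ (K : Type v) (_ : Field K) (_ : Algebra k K) (φ : (𝟙_ E ⟶ 𝟙_ E) →ₗ[k] K), φ (𝟙 _) = 1 ∧
      (∀ f g, φ (f ≫ g) = φ f * φ g) ∧ IsLocalizing (unitSet φ) ∧ ∀ i, φ (e i) ≠ 0 := by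
  let := unitRing E
  obtain ⟨q, hq, -, hd⟩ := Ideal.exists_le_prime_disjoint (⊥ : Ideal (End (𝟙_ E)))
    (Submonoid.closure (Set.range e)) (by
      rw [Set.disjoint_left]
      intro y hy hy'
      obtain ⟨l, hl, rfl⟩ := Submonoid.exists_list_of_mem_closure hy'
      obtain ⟨l', rfl⟩ : ∃ l' : List I, l'.map e = l := by
        rw [← Set.mem_range, Set.range_list_map]
        exact hl
      exact he l' hy)
  -- Minimality makes the elements of `p` nilpotent up to elements outside `p`, which is the
  -- property `nil` of `IsLocalizing`; an arbitrary prime would not do.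
  obtain ⟨p, hp, hpq⟩ := Ideal.exists_minimalPrimes_le (bot_le : ⊥ ≤ q)
  have := hp.isPrime
  obtain ⟨K, _, ψ, hψ⟩ : ∃ (K : Type v) (_ : Field K) (ψ : End (𝟙_ E) →+* K),
      ∀ f, ψ f = 0 ↔ f ∈ p :=
    ⟨FractionRing (End (𝟙_ E) ⧸ p), inferInstance, (algebraMap _ _).comp (Ideal.Quotient.mk p),
      fun f => by
        rw [RingHom.comp_apply, FaithfulSMul.algebraMap_eq_zero_iff, Ideal.Quotient.eq_zero_iff_mem]⟩
  let := (ψ.comp (algebraMap k (End (𝟙_ E)))).toAlgebra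
  let φ : (𝟙_ E ⟶ 𝟙_ E) →ₗ[k] K :=
    { toFun := ψ
      map_add' := ψ.map_add
      map_smul' a f := by
        change ψ (a • (show End (𝟙_ E) from f)) = algebraMap k K a * ψ f
        rw [Algebra.smul_def, map_mul]
        rfl }
  have hpow (r : End (𝟙_ E)) (n : ℕ) : endPow r n = r ^ n := by
    induction n with
    | zero => rfl
    | succ n ih => rw [endPow, ih, pow_succ']; rfl
  have hmul (f g : 𝟙_ E ⟶ 𝟙_ E) : φ (f ≫ g) = φ f * φ g := (ψ.map_mul g f).trans (mul_comm _ _)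
  refine ⟨K, inferInstance, this, φ, ψ.map_one, hmul, ⟨?_, ?_, ?_, ?_⟩, fun i hi => ?_⟩
  · exact fun h => one_ne_zero (ψ.map_one.symm.trans h)
  · intro s hs t ht h
    rw [hmul] at h
    exact (mul_ne_zero hs ht) h
  · exact fun h => h ψ.map_zero
  · intro r hr
    obtain ⟨s, hs, n, h⟩ := exists_pow_mul_eq_zero hp ((hψ r).1 (not_not.1 hr))
    refine ⟨s, fun h' => hs ((hψ s).1 h'), n, ?_⟩
    rw [hpow]
    exact h
  · exact Set.disjoint_left.1 hd (hpq ((hψ _).1 hi)) (Submonoid.subset_closure ⟨i, rfl⟩)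

end residue
end TensorCat
/-! ### Tensor products of families of algebras -/

namespace TensorCat
open MonObj

section algebras
variable {D : Type u} [Category.{v} D] [MonoidalCategory D]

/-- The base change of a morphism of free modules along a morphism of algebras. -/
def baseChange {A A' : D} [MonObj A] [MonObj A'] (i : A ⟶ A') {X Y : D} (f : A ⊗ X ⟶ A ⊗ Y) :
    A' ⊗ X ⟶ A' ⊗ Y :=
  extend ((λ_ X).inv ≫ η ▷ X ≫ f ≫ i ▷ Y)

section
variable {A A' : D} [MonObj A] [MonObj A'] (i : A ⟶ A') [IsMonHom i]

lemma isLin_baseChange {X Y : D} (f : A ⊗ X ⟶ A ⊗ Y) : IsLin A' (baseChange i f) :=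
  isLin_extend _

lemma whiskerRight_baseChange {X Y : D} {f : A ⊗ X ⟶ A ⊗ Y} (hf : IsLin A f) :
    i ▷ X ≫ baseChange i f = f ≫ i ▷ Y := by
  conv_rhs => rw [hf.eq_extend]
  rw [baseChange, extend, extend]
  simp only [MonoidalCategory.whiskerLeft_comp, Category.assoc]
  rw [← whisker_exchange_assoc, ← whisker_exchange_assoc, ← whisker_exchange_assoc,
    ← whisker_exchange_assoc, ← comp_whiskerRight, IsMonHom.mul_hom]
  simp [MonoidalCategory.tensorHom_def']

lemma unit_baseChange {X Y : D} {f : A ⊗ X ⟶ A ⊗ Y} (hf : IsLin A f) :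
    η ▷ X ≫ baseChange i f = η ▷ X ≫ f ≫ i ▷ Y := by
  rw [← whiskerRight_baseChange i hf, ← comp_whiskerRight_assoc, IsMonHom.one_hom]

lemma baseChange_comp {X Y Z : D} {f : A ⊗ X ⟶ A ⊗ Y} {g : A ⊗ Y ⟶ A ⊗ Z} (hf : IsLin A f)
    (hg : IsLin A g) : baseChange i f ≫ baseChange i g = baseChange i (f ≫ g) := by
  refine ((isLin_baseChange i f).comp (isLin_baseChange i g)).ext (isLin_baseChange i _) ?_
  rw [unit_baseChange i (hf.comp hg), ← Category.assoc, unit_baseChange i hf]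
  simp only [Category.assoc]
  rw [whiskerRight_baseChange i hg]

lemma baseChange_id (X : D) : baseChange i (𝟙 (A ⊗ X)) = 𝟙 _ := by
  have h (A : D) [MonObj A] : IsLin A (𝟙 (A ⊗ X)) := by
    have := isLin_whiskerLeft A (𝟙 X)
    rwa [MonoidalCategory.whiskerLeft_id] at this
  refine (isLin_baseChange i _).ext (h A') ?_
  rw [unit_baseChange i (h A), Category.id_comp, ← comp_whiskerRight, IsMonHom.one_hom,
    Category.comp_id]

end

variable [SymmetricCategory D] {I : Type v} (A : I → CommMon D)

/-- The tensor product of a list of algebras of a family. -/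
def listAlgebra : List I → CommMon D
  | [] => ⟨𝟙_ D⟩
  | i :: l => ⟨(A i).X ⊗ (listAlgebra l).X⟩

lemma exists_hom_listAlgebra {i : I} {l : List I} (h : i ∈ l) :
    ∃ f : (A i).X ⟶ (listAlgebra A l).X, IsMonHom f := by
  have hη (B : D) [MonObj B] : IsMonHom η[B] := (default : Mon.trivial D ⟶ ⟨B⟩).isMonHom_hom
  induction l with
  | nil => simp at h
  | cons j l ih =>
    obtain rfl | h := List.mem_cons.1 h
    · have := hη (listAlgebra A l).X
      let f : (A i).X ⟶ (A i).X ⊗ (listAlgebra A l).X := (ρ_ _).inv ≫ (A i).X ◁ η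
      exact ⟨f, inferInstanceAs (IsMonHom ((ρ_ _).inv ≫ (A i).X ◁ η[(listAlgebra A l).X]))⟩
    · obtain ⟨f, hf⟩ := ih h
      have := hη (A j).X
      let g : (listAlgebra A l).X ⟶ (A j).X ⊗ (listAlgebra A l).X := (λ_ _).inv ≫ η ▷ _
      exact ⟨f ≫ g, inferInstanceAs
        (IsMonHom (f ≫ (λ_ _).inv ≫ η[(A j).X] ▷ (listAlgebra A l).X))⟩

variable [Preadditive D] [MonoidalPreadditive D]

lemma isZero_of_unit_eq_zero (A : D) [MonObj A] (h : η[A] = 0) : IsZero A := by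
  rw [IsZero.iff_id_eq_zero, ← cancel_epi (λ_ A).hom, Category.comp_id, ← MonObj.one_mul, h]
  simp

lemma unit_listAlgebra_ne_zero (hD : ∀ {M N : D} (a : 𝟙_ D ⟶ M) (b : 𝟙_ D ⟶ N), a ≠ 0 → b ≠ 0 →
    a ⊗ₘ b ≠ 0) (h1 : 𝟙 (𝟙_ D) ≠ 0) (hA : ∀ i, ¬ IsZero (A i).X) (l : List I) :
    η[(listAlgebra A l).X] ≠ 0 := by
  induction l with
  | nil => exact h1
  | cons i l ih =>
    intro h
    change (λ_ (𝟙_ D)).inv ≫ (η[(A i).X] ⊗ₘ η[(listAlgebra A l).X]) = 0 at h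
    rw [← comp_zero (f := (λ_ (𝟙_ D)).inv), cancel_epi] at h
    exact hD _ _ (fun h => hA i (isZero_of_unit_eq_zero _ h)) ih h

variable {k : Type w} [Field k] [Linear k D] [MonoidalLinear k D]

/-! ### Indicators of the factors of finite tensor products. -/

namespace Kl
open Classical in
/-- The endomorphism of the unit that is the identity over the products with the factor `i`. -/
def indicator (k : Type w) [Field k] [Linear k D] [MonoidalLinear k D] (i : I) :
    𝟙_ (Kl k (listAlgebra A)) ⟶ 𝟙_ (Kl k (listAlgebra A)) :=
  fun l => if i ∈ l then 𝟙 (𝟙_ (Kl k (listAlgebra A))) l else 0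

lemma indicator_apply {i : I} {l : List I} (h : i ∈ l) :
    indicator A k i l = 𝟙 (𝟙_ (Kl k (listAlgebra A))) l := if_pos h

lemma sc_apply {σ : Type v} {A : σ → CommMon D} {r r' : 𝟙_ (Kl k A) ⟶ 𝟙_ (Kl k A)} {s : σ}
    (h : r s = r' s) (X : Kl k A) : (sc r X s).1 = (sc r' X s).1 := by
  change (A s).X ◁ (λ_ X.of).inv ≫ twist _ (r s).1 X.of ≫ _ = _
  rw [h]
  rfl

open Classical in
/-- Linear morphisms over one factor extend to a morphism over all products. -/
def ofFactor (i : I) {X Y : D} (f : linHom k (A i).X X Y) : (⟨X⟩ : Kl k (listAlgebra A)) ⟶ ⟨Y⟩ :=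
  fun l => if h : i ∈ l then ⟨baseChange (exists_hom_listAlgebra A h).choose f.1,
    isLin_extend _⟩ else 0

/-- Where the factor `i` occurs, base change along the inclusion of this factor preserves the
relation; elsewhere both sides are zero. -/
lemma ofFactor_comp (i : I) {X Y : D} {f : linHom k (A i).X X Y} {g : linHom k (A i).X Y X}
    (h : f.1 ≫ g.1 = 𝟙 _) : ofFactor A i f ≫ ofFactor A i g = sc (indicator A k i) _ := by
  refine ext fun l => ?_
  by_cases hl : i ∈ l
  · rw [sc_apply (indicator_apply A hl), sc_id, comp_val, ofFactor, ofFactor]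
    simp only [hl, dite_true]
    have := (exists_hom_listAlgebra A hl).choose_spec
    exact (baseChange_comp _ f.2 g.2).trans ((congrArg _ h).trans (baseChange_id _ _))
  · have : indicator A k i l = (0 : 𝟙_ (Kl k (listAlgebra A)) ⟶ _) l := if_neg hl
    rw [sc_apply this, sc_zero, comp_val, ofFactor, ofFactor]
    simp only [hl, dite_false]
    exact zero_comp

lemma prod_indicator_apply (l l' : List I) (h : ∀ i ∈ l, i ∈ l') :
    (List.map (β := End (𝟙_ (Kl k (listAlgebra A)))) (indicator A k) l).prod l' =
      𝟙 (𝟙_ (Kl k (listAlgebra A))) l' := by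
  induction l with
  | nil => rfl
  | cons i l ih =>
    rw [List.map_cons, List.prod_cons]
    refine Subtype.ext ((Kl.comp_val _ _ _).trans ?_)
    rw [ih fun j hj => h j (List.mem_cons_of_mem _ hj), indicator_apply A (h i List.mem_cons_self)]
    exact Category.comp_id _

/-- At the index `l` itself all indicators in the product are identities, and the algebra there is
non-zero. -/
lemma prod_indicator_ne_zero (hA : ∀ l, η[(listAlgebra A l).X] ≠ 0) (l : List I) :
    (List.map (β := End (𝟙_ (Kl k (listAlgebra A)))) (indicator A k) l).prod ≠ 0 := by
  intro h
  have h₁ := prod_indicator_apply (k := k) A l l fun _ => id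
  rw [h] at h₁
  have h₂ : (0 : (listAlgebra A l).X ⊗ 𝟙_ D ⟶ _) = 𝟙 _ := congrArg Subtype.val h₁
  refine hA l ?_
  rw [← Category.comp_id η, ← Iso.inv_hom_id (ρ_ (listAlgebra A l).X),
    ← Category.id_comp (ρ_ (listAlgebra A l).X).hom, ← h₂]
  simp

end Kl
end algebras
end TensorCat
/-! ### A tensor functor that splits all short exact sequences -/

namespace TensorCat
open Functor.LaxMonoidal Functor.OplaxMonoidal Functor.Monoidal IndTensor MonObj

section cok
variable {C : Type u} [Category.{v} C] [Preadditive C] {C' : Type u₂} [Category.{v₂} C']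
  [Preadditive C']

lemma isCok_map_of_preservesFiniteColimits (F : C ⥤ C') [F.Additive] [PreservesFiniteColimits F]
    {X Y Z : C} {f : X ⟶ Y} {g : Y ⟶ Z} (h : IsCok f g) : IsCok (F.map f) (F.map g) := by
  have hc : IsColimit (CokernelCofork.ofπ (f := F.map f) (F.map g)
      (by rw [← F.map_comp, h.comp, F.map_zero])) :=
    CokernelCofork.mapIsColimit _ h.isColimit F
  refine ⟨fun W w hw => Cofork.IsColimit.hom_ext hc (hw.trans comp_zero.symm),
    by rw [← F.map_comp, h.comp, F.map_zero], fun W w hw => ?_⟩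
  exact ⟨hc.desc (CokernelCofork.ofπ w hw), hc.fac _ .one⟩

end cok

section upTo
variable {E : Type u₂} [Category.{v₂} E] [MonoidalCategory E]

lemma isIso_of_isIso_comp {C : Type u₃} [Category.{v₃} C] {X Y : C} (f : X ⟶ Y) (g : Y ⟶ X) [IsIso (f ≫ g)] [IsIso (g ≫ f)] :
    IsIso f := by
  have : Mono f := mono_of_mono f g
  have : IsSplitEpi f := ⟨⟨inv (g ≫ f) ≫ g, by rw [Category.assoc, IsIso.inv_hom_id]⟩⟩
  exact isIso_of_mono_of_isSplitEpi f

lemma isIso_map_of_upTo {C : Type u₃} [Category.{v₃} C] (F : E ⥤ C) {s : 𝟙_ E ⟶ 𝟙_ E}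
    (hs : ∀ X : E, IsIso (F.map (sc s X))) {X Y : E} {a : X ⟶ Y} {b : Y ⟶ X}
    (hab : a ≫ b = sc s X)
    (hba : b ≫ a = sc s Y) : IsIso (F.map a) := by
  have h₁ : IsIso (F.map a ≫ F.map b) := by
    rw [← F.map_comp, hab]
    exact hs X
  have h₂ : IsIso (F.map b ≫ F.map a) := by
    rw [← F.map_comp, hba]
    exact hs Y
  exact isIso_of_isIso_comp (F.map a) (F.map b)

/-- `P` is a summand of `Q` up to an endomorphism of the unit. -/
def IsRetractUpTo (s : 𝟙_ E ⟶ 𝟙_ E) (P Q : E) : Prop :=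
  ∃ (a : P ⟶ Q) (b : Q ⟶ P), a ≫ b = sc s P

variable {s : 𝟙_ E ⟶ 𝟙_ E}

lemma IsRetractUpTo.tensor {P Q : E} (h : IsRetractUpTo s P Q) (R : E) :
    IsRetractUpTo s (P ⊗ R) (Q ⊗ R) := by
  obtain ⟨a, b, h⟩ := h
  exact ⟨a ▷ R, b ▷ R, by rw [← comp_whiskerRight, h, sc_whiskerRight]⟩

lemma IsRetractUpTo.comp_retract {P P' Q Q' : E} (h : IsRetractUpTo s P Q) (r : Retract P' P)
    (r' : Retract Q Q') : IsRetractUpTo s P' Q' := by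
  obtain ⟨a, b, h⟩ := h
  refine ⟨r.i ≫ a ≫ r'.i, r'.r ≫ b ≫ r.r, ?_⟩
  simp only [Category.assoc]
  rw [r'.retract_assoc, reassoc_of% h, sc_naturality, r.retract_assoc]

end upTo

section splitting
variable {k : Type w} [Field k] {V : Type u₁} [Category.{v₁} V] [EssentiallySmall.{v₁} V]
  [Preadditive V] [IsAbelian V] [Linear k V] [MonoidalCategory V] [SymmetricCategory V]
  [MonoidalPreadditive V] [MonoidalLinear k V]
  {B : Type u} [Category.{v} B] [EssentiallySmall.{v} B] [Preadditive B] [IsAbelian B] [Linear k B]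
  [MonoidalCategory B] [SymmetricCategory B] [MonoidalPreadditive B] [MonoidalLinear k B]
  {E : Type u₂} [Category.{v₂} E] [Preadditive E] [Linear k E] [MonoidalCategory E]
  [SymmetricCategory E] [MonoidalPreadditive E] [MonoidalLinear k E]
  {T : Type u₃} [Category.{v₃} T] (I : T ⥤ B) (J : V ⥤ B) [J.Braided] [J.Additive] [J.Linear k] (G : B ⥤ E) [G.Braided] [G.Additive]
  [G.Linear k] {K : Type v₂} [Field K] [Algebra k K] (φ : (𝟙_ E ⟶ 𝟙_ E) →ₗ[k] K)

/-- In the semisimplification over `K` all scalars in `unitSet φ` are invertible, so splittings and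
isomorphisms up to such a scalar become genuine. -/
lemma exists_splitting_functor_of_upTo (hφ₁ : φ (𝟙 _) = 1)
    (hφ : ∀ f g, φ (f ≫ g) = φ f * φ g) (hV : IsTensorCategory k V)
    (hss : IsSchurianSemisimple k V) (hsym : SymPowersVanish V)
    (hB : IsTensorCategory k B) (hG : ∀ P : E, ∃ X, Nonempty (G.obj X ≅ P))
    (hcok : ∀ ⦃X Y Z : B⦄ (f : X ⟶ Y) (g : Y ⟶ Z), IsCok f g → IsCok (G.map f) (G.map g))
    (hM : IsLocalizing (unitSet φ)) (hfree : LocallyFreeUpTo J G (unitSet φ))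
    (hI : ∀ X, ∃ X₀ s, φ s ≠ 0 ∧ ∃ (a : G.obj (I.obj X) ⟶ G.obj (J.obj X₀))
      (b : G.obj (J.obj X₀) ⟶ G.obj (I.obj X)), a ≫ b = sc s _ ∧ b ≫ a = sc s _) :
    ∃ (C : Type (max u₂ v₂)) (_ : Category.{v₂} C) (_ : Preadditive C) (_ : IsAbelian C)
      (_ : Linear k C) (_ : MonoidalCategory C) (_ : SymmetricCategory C)
      (_ : MonoidalPreadditive C) (_ : MonoidalLinear k C) (F : B ⥤ C) (_ : F.Braided)
      (_ : F.Additive) (_ : F.Linear k) (_ : PreservesFiniteColimits F), IsSMC k C ∧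
      (∀ ⦃X Y : C⦄ (f : X ⟶ Y), IsRegular f) ∧
      (∀ S : ShortComplex B, S.ShortExact → Nonempty (S.map F).Splitting) ∧
      ∀ X, ∃ X₀, Nonempty (F.obj (I.obj X) ≅ F.obj (J.obj X₀)) := by
  let F := G ⋙ toSemisimpleExt φ
  have hC := isPointed_semisimplification (isCharacter_extendScalars φ hφ₁ hφ)
  have hF := exists_retract_semisimpleExt J G φ hφ₁ hφ hG hfree
  have := hC.isAbelian (k := k) (J ⋙ G ⋙ toSemisimpleExt φ) hF hV hss hsym
  have hreg ⦃X Y : SemisimpleExt φ⦄ (f : X ⟶ Y) : IsRegular f :=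
    hC.isRegular (k := k) (J ⋙ G ⋙ toSemisimpleExt φ) hF hV hss hsym f
  have hsplit := exists_splitting_toSemisimpleExt J G φ hφ₁ hφ hss hsym hB hG hcok hM hfree
  have : HasZeroObject (SemisimpleExt φ) := hasZeroObject_of_hasFiniteBiproducts _
  refine ⟨SemisimpleExt φ, inferInstance, inferInstance, inferInstance, inferInstance,
    inferInstance, inferInstance, inferInstance, inferInstance, F, inferInstance, inferInstance,
    inferInstance, preservesFiniteColimits_of_splitting F hsplit, hC.isSMC hreg, hreg, hsplit,
    fun X => ?_⟩
  obtain ⟨X₀, s, hs, a, b, hab, hba⟩ := hI X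
  have := isIso_map_of_upTo (toSemisimpleExt φ) (isIso_toSemisimpleExt_sc φ hφ₁ hφ hs) hab hba
  exact ⟨X₀, ⟨asIso ((toSemisimpleExt φ).map a)⟩⟩

end splitting

section freeMod
variable {D : Type u} [Category.{v} D] [MonoidalCategory D] {A : D} [MonObj A]

lemma isLin_hom {M N : D} (f : (freeMod A).obj M ⟶ (freeMod A).obj N) : IsLin A f.hom :=
  (Category.assoc _ _ _).symm.trans f.isModHom.smul_hom

end freeMod

/-! ### The splitting functor on the product. -/

section box
attribute [local instance] indPreadditive indLinear
variable {k : Type w} [Field k] {T V : Type u}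
  [Category.{v} T] [EssentiallySmall.{v} T] [Preadditive T] [IsAbelian T] [Linear k T]
  [MonoidalCategory T] [SymmetricCategory T] [MonoidalPreadditive T] [MonoidalLinear k T]
  [Category.{v} V] [EssentiallySmall.{v} V] [Preadditive V] [IsAbelian V] [Linear k V]
  [MonoidalCategory V] [SymmetricCategory V] [MonoidalPreadditive V] [MonoidalLinear k V]

/-- A linear isomorphism of free modules is given by a pair of inverse linear morphisms. -/
lemma LocallyFree.exists_linHom [IsAbelian (Box k T V)] {X : T} (h : LocallyFree k V X) :
    ∃ (A : CommMon (Ind (Box k T V))) (X₀ : V)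
      (a : linHom k A.X (Ind.yoneda.obj ((inT k T V).obj X)) (Ind.yoneda.obj ((inV k T V).obj X₀)))
      (b : linHom k A.X (Ind.yoneda.obj ((inV k T V).obj X₀)) (Ind.yoneda.obj ((inT k T V).obj X))),
      ¬ IsZero A.X ∧ a.1 ≫ b.1 = 𝟙 _ ∧ b.1 ≫ a.1 = 𝟙 _ := by
  obtain ⟨A, hA, X₀, ⟨e⟩⟩ := h
  exact ⟨A, X₀, ⟨e.hom.hom, isLin_hom e.hom⟩, ⟨e.inv.hom, isLin_hom e.inv⟩, hA,
    congrArg (·.hom) e.hom_inv_id, congrArg (·.hom) e.inv_hom_id⟩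

lemma exists_retract_tensor_box (Z : Box k T V) :
    ∃ (X : T) (Y : V), Nonempty (Retract Z ((inT k T V).obj X ⊗ (inV k T V).obj Y)) := by
  obtain ⟨r⟩ := retract_box (k := k) (A := Z) (Retract.refl _) (Retract.refl _)
  refine ⟨Z.X.fst, Z.X.snd, ⟨r.trans (Retract.ofIso ?_)⟩⟩
  exact (toKaroubi (LinTensor k T V)).mapIso (LinTensor.isoMk (ρ_ _).symm (λ_ _).symm) ≪≫
    (μIso (toKaroubi (LinTensor k T V)) ⟨Z.X.fst, 𝟙_ V⟩ ⟨𝟙_ T, Z.X.snd⟩).symm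

/-- Over each algebra only one object of `T` is known to be free. Families of modules over all
finite tensor products, restricted to a residue field of End(𝟙) where no indicator vanishes, play
the role of the tensor product of all the algebras. -/
theorem exists_splitting_functor (hT : IsTensorCategory k T) (hV : IsTensorCategory k V)
    (hss : IsSchurianSemisimple k V) (hsym : SymPowersVanish V) (hfree : ∀ X : T, LocallyFree k V X)
    [IsAbelian (Box k T V)] :
    ∃ (C : Type (max u (v + 1))) (_ : Category.{v} C) (_ : Preadditive C) (_ : IsAbelian C)
      (_ : Linear k C) (_ : MonoidalCategory C) (_ : SymmetricCategory C)
      (_ : MonoidalPreadditive C) (_ : MonoidalLinear k C) (F : Box k T V ⥤ C) (_ : F.Braided)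
      (_ : F.Additive) (_ : F.Linear k) (_ : PreservesFiniteColimits F), IsSMC k C ∧
      (∀ ⦃X Y : C⦄ (f : X ⟶ Y), IsRegular f) ∧
      (∀ S : ShortComplex (Box k T V), S.ShortExact → Nonempty (S.map F).Splitting) ∧
      ∀ X : T, ∃ X₀ : V, Nonempty (F.obj ((inT k T V).obj X) ≅ F.obj ((inV k T V).obj X₀)) := by
  have hB := isTensorCategory_box hT hV
  choose A' X₀' a' b' hA' hab' hba' using fun X : T => (hfree X).exists_linHom
  -- One algebra per isomorphism class suffices; a small set of indices keeps the products of Hom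
  -- groups in the universe `v`.
  let eT := equivSmallModel.{v} T
  let A (i : SmallModel.{v} T) : CommMon (Ind (Box k T V)) := A' (eT.inverse.obj i)
  have hA (i) : ¬ IsZero (A i).X := hA' _
  have h1 : 𝟙 (𝟙_ (Ind (Box k T V))) ≠ 0 := fun h => by
    refine hB.unit_nonzero ((IsZero.iff_id_eq_zero _).2 ((Ind.yoneda (C := Box k T V)).map_injective ?_))
    rw [CategoryTheory.Functor.map_id, Functor.map_zero, ← cancel_epi (εIso Ind.yoneda).hom,
      comp_zero, Category.comp_id, ← Category.id_comp (εIso Ind.yoneda).hom, h, zero_comp]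
  have hη := unit_listAlgebra_ne_zero A (fun a b => hB.tensorHom_ne_zero) h1 hA
  let H : Box k T V ⥤ Kl k (listAlgebra A) := Ind.yoneda ⋙ Kl.freeFunctor k (listAlgebra A)
  -- In the essential image every object comes from the product category, so duals are available as
  -- `hG` requires, and cokernels are preserved as before.
  let G := H.toEssImage
  have hG (P : H.EssImageSubcategory) : ∃ X, Nonempty (G.obj X ≅ P) :=
    ⟨_, ⟨G.objObjPreimageIso P⟩⟩
  have hcok ⦃X Y Z : Box k T V⦄ (f : X ⟶ Y) (g : Y ⟶ Z) (h : IsCok f g) :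
      IsCok (G.map f) (G.map g) :=
    toEssImage_isCok H (Kl.isCok_free (isCok_map_of_preservesFiniteColimits Ind.yoneda h))
  let e (i : SmallModel.{v} T) : End (𝟙_ H.EssImageSubcategory) :=
    ObjectProperty.homMk (Kl.indicator A k i)
  have he (l : List (SmallModel.{v} T)) : (l.map e).prod ≠ 0 := fun h => by
    refine Kl.prod_indicator_ne_zero (k := k) A hη l ?_
    have : (List.map (β := End (𝟙_ (Kl k (listAlgebra A)))) (Kl.indicator A k) l).prod =
        (l.map e).prod.hom := by
      clear h
      induction l with
      | nil => rfl
      | cons i l ih =>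
        rw [List.map_cons, List.prod_cons, ih]
        rfl
    rw [this, h]
    rfl
  -- All indicators are non-zero in `K` at once, so every object of `T` is free up to an element
  -- that will be inverted.
  obtain ⟨K, _, _, φ, hφ₁, hφ, hM, hφe⟩ := exists_residueField (k := k) e he
  let a (X : SmallModel.{v} T) : G.obj ((inT k T V).obj (eT.inverse.obj X)) ⟶
      G.obj ((inV k T V).obj (X₀' (eT.inverse.obj X))) :=
    ObjectProperty.homMk (Kl.ofFactor A X (a' (eT.inverse.obj X)))
  let b (X : SmallModel.{v} T) : G.obj ((inV k T V).obj (X₀' (eT.inverse.obj X))) ⟶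
      G.obj ((inT k T V).obj (eT.inverse.obj X)) :=
    ObjectProperty.homMk (Kl.ofFactor A X (b' (eT.inverse.obj X)))
  have hab (X : SmallModel.{v} T) : a X ≫ b X = sc (e X) _ :=
    H.essImage.ι.map_injective (Kl.ofFactor_comp A X (hab' _))
  have hba (X : SmallModel.{v} T) : b X ≫ a X = sc (e X) _ :=
    H.essImage.ι.map_injective (Kl.ofFactor_comp A X (hba' _))
  -- Objects of the product are retracts of `X ⊗ Y` with `X` in `T` and `Y` in `V`. Replacing `X` by
  -- its free form leaves a tensor product of two objects of `V`.
  have hloc : LocallyFreeUpTo (inV k T V) G (unitSet φ) := fun Z => by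
    obtain ⟨X, Y, ⟨r⟩⟩ := exists_retract_tensor_box Z
    let i := eT.functor.obj X
    let r' : Retract X (eT.inverse.obj i) := Retract.ofIso (eT.unitIso.app X)
    have h : IsRetractUpTo (e i) _ _ := ⟨a i, b i, hab i⟩
    have h' := (h.tensor (G.obj ((inV k T V).obj Y))).comp_retract
      (((r.trans ((r'.map (inT k T V)).map (tensorRight _))).map G).trans
        (Retract.ofIso (μIso G _ _).symm))
      (Retract.ofIso (μIso G _ _ ≪≫ G.mapIso (μIso (inV k T V) _ _)))
    obtain ⟨c, d, hcd⟩ := h'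
    exact ⟨_, _, hφe i, c, d, hcd⟩
  refine exists_splitting_functor_of_upTo (inT k T V) (inV k T V) G φ hφ₁ hφ hV hss hsym hB hG hcok
    hM hloc fun X => ⟨X₀' (eT.inverse.obj (eT.functor.obj X)), e (eT.functor.obj X), hφe _, ?_⟩
  let u := G.mapIso ((inT k T V).mapIso (eT.unitIso.app X))
  refine ⟨u.hom ≫ a (eT.functor.obj X), b (eT.functor.obj X) ≫ u.inv, ?_, ?_⟩
  · rw [Category.assoc, reassoc_of% (hab (eT.functor.obj X)), sc_naturality, u.hom_inv_id_assoc]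
  · rw [Category.assoc, u.inv_hom_id_assoc, hba]

end box
end TensorCat
/-! ### Modules from lax monoidal functors -/

namespace TensorCat
open Functor.LaxMonoidal

section lax
variable {C : Type u₁} [Category.{v₁} C] [MonoidalCategory C] [SymmetricCategory C]
  {D : Type u₂} [Category.{v₂} D] [MonoidalCategory D] [SymmetricCategory D]
  (L : C ⥤ D) [L.LaxBraided]

/-- The image of the unit under a lax symmetric monoidal functor. -/
def laxAlgebra : CommMon D := L.mapCommMon.obj (CommMon.trivial C)

lemma one_laxAlgebra : MonObj.one (X := (laxAlgebra L).X) = ε L :=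
  (congrArg (ε L ≫ ·) (L.map_id _)).trans (Category.comp_id _)

/-- The action of the image of the unit on the image of an object. -/
def laxAct (Z : C) : (laxAlgebra L).X ⊗ L.obj Z ⟶ L.obj Z := μ L (𝟙_ C) Z ≫ L.map (λ_ Z).hom

lemma one_laxAct (Z : C) :
    MonObj.one (X := (laxAlgebra L).X) ▷ L.obj Z ≫ laxAct L Z = (λ_ (L.obj Z)).hom := by
  rw [one_laxAlgebra, left_unitality]
  rfl

lemma laxAct_μ (Z W : C) : laxAct L Z ▷ L.obj W ≫ μ L Z W =
    (α_ _ _ _).hom ≫ (laxAlgebra L).X ◁ μ L Z W ≫ laxAct L (Z ⊗ W) := by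
  change (μ L (𝟙_ C) Z ≫ L.map (λ_ Z).hom) ▷ L.obj W ≫ μ L Z W =
    (α_ (L.obj (𝟙_ C)) (L.obj Z) (L.obj W)).hom ≫
      L.obj (𝟙_ C) ◁ μ L Z W ≫ μ L (𝟙_ C) (Z ⊗ W) ≫ L.map (λ_ (Z ⊗ W)).hom
  rw [comp_whiskerRight, Category.assoc, μ_natural_left, ← associativity_assoc, ← L.map_comp,
    leftUnitor_tensor_hom, Iso.hom_inv_id_assoc]

lemma mul_laxAct (Z : C) : MonObj.mul (X := (laxAlgebra L).X) ▷ L.obj Z ≫ laxAct L Z =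
    (α_ _ _ _).hom ≫ (laxAlgebra L).X ◁ laxAct L Z ≫ laxAct L Z := by
  have h₁ := congrArg (· ≫ L.map (λ_ Z).hom) (laxAct_μ L (𝟙_ C) Z)
  simp only [Category.assoc] at h₁
  have h₂ : (laxAlgebra L).X ◁ laxAct L Z ≫ laxAct L Z = (laxAlgebra L).X ◁ μ L (𝟙_ C) Z ≫
      laxAct L (𝟙_ C ⊗ Z) ≫ L.map (λ_ Z).hom := by
    change L.obj (𝟙_ C) ◁ (μ L (𝟙_ C) Z ≫ L.map (λ_ Z).hom) ≫ μ L (𝟙_ C) Z ≫ L.map (λ_ Z).hom =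
      L.obj (𝟙_ C) ◁ μ L (𝟙_ C) Z ≫ (μ L (𝟙_ C) _ ≫ L.map (λ_ _).hom) ≫ L.map (λ_ Z).hom
    rw [MonoidalCategory.whiskerLeft_comp, Category.assoc, μ_natural_right_assoc, Category.assoc,
      ← L.map_comp, ← L.map_comp, leftUnitor_naturality]
  exact h₁.trans (congrArg ((α_ _ _ _).hom ≫ ·) h₂.symm)

lemma laxAct_naturality {Z W : C} (f : Z ⟶ W) :
    laxAct L Z ≫ L.map f = (laxAlgebra L).X ◁ L.map f ≫ laxAct L W := by
  change (μ L (𝟙_ C) Z ≫ L.map (λ_ Z).hom) ≫ L.map f =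
    L.obj (𝟙_ C) ◁ L.map f ≫ μ L (𝟙_ C) W ≫ L.map (λ_ W).hom
  rw [μ_natural_right_assoc, Category.assoc, ← L.map_comp, ← L.map_comp, leftUnitor_naturality]

lemma braiding_laxAct (Z : C) : (β_ (L.obj Z) (laxAlgebra L).X).hom ≫ laxAct L Z =
    μ L Z (𝟙_ C) ≫ L.map (ρ_ Z).hom := by
  change (β_ (L.obj Z) (L.obj (𝟙_ C))).hom ≫ μ L (𝟙_ C) Z ≫ L.map (λ_ Z).hom = _
  rw [← Functor.LaxBraided.braided_assoc, ← L.map_comp, braiding_leftUnitor]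

lemma laxAct_balanced (Z W : C) :
    (((β_ (L.obj Z) (laxAlgebra L).X).hom ≫ laxAct L Z) ▷ L.obj W) ≫ μ L Z W =
      ((α_ _ _ _).hom ≫ L.obj Z ◁ laxAct L W) ≫ μ L Z W := by
  rw [braiding_laxAct]
  change (μ L Z (𝟙_ C) ≫ L.map (ρ_ Z).hom) ▷ L.obj W ≫ μ L Z W =
    ((α_ (L.obj Z) (L.obj (𝟙_ C)) (L.obj W)).hom ≫
      L.obj Z ◁ (μ L (𝟙_ C) W ≫ L.map (λ_ W).hom)) ≫ μ L Z W
  rw [comp_whiskerRight, Category.assoc, μ_natural_left, Category.assoc,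
    MonoidalCategory.whiskerLeft_comp, Category.assoc, μ_natural_right, ← associativity_assoc,
    ← L.map_comp, triangle]

/-- The functor to modules over the image of the unit. -/
def laxMod : C ⥤ Mod D (laxAlgebra L).X where
  obj Z :=
    { X := L.obj Z
      mod :=
        { smul := laxAct L Z
          one_smul := one_laxAct L Z
          mul_smul := mul_laxAct L Z } }
  map f := Mod.Hom.mk' (L.map f) (laxAct_naturality L f)
  map_id Z := Mod.hom_ext _ _ (L.map_id Z)
  map_comp f g := Mod.hom_ext _ _ (L.map_comp f g)

end lax

/-! ### The additive structure of module categories. -/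

section preadditive
variable {D : Type u} [Category.{v} D] [MonoidalCategory D] [Preadditive D]
  [MonoidalPreadditive D] (A : D) [MonObj A]

instance {M N : Mod D A} : Zero (M ⟶ N) :=
  ⟨Mod.Hom.mk' 0 (by
    change act M ≫ 0 = A ◁ (0 : M.X ⟶ N.X) ≫ act N
    simp)⟩

instance {M N : Mod D A} : Add (M ⟶ N) :=
  ⟨fun f g => Mod.Hom.mk' (f.hom + g.hom) (by
    change act M ≫ (f.hom + g.hom) = A ◁ (f.hom + g.hom) ≫ act N
    rw [Preadditive.comp_add, MonoidalPreadditive.whiskerLeft_add, Preadditive.add_comp]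
    exact congrArg₂ (· + ·) f.isModHom.smul_hom g.isModHom.smul_hom)⟩

instance {M N : Mod D A} : Neg (M ⟶ N) :=
  ⟨fun f => Mod.Hom.mk' (-f.hom) (by
    change act M ≫ (-f.hom) = A ◁ (-f.hom) ≫ act N
    have : A ◁ (-f.hom) = -(A ◁ f.hom) := by
      rw [eq_neg_iff_add_eq_zero, ← MonoidalPreadditive.whiskerLeft_add]
      simp
    rw [this, Preadditive.comp_neg, Preadditive.neg_comp]
    exact congrArg (- ·) f.isModHom.smul_hom)⟩

/-- Morphisms of modules are added pointwise. -/
instance : Preadditive (Mod D A) where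
  homGroup M N :=
    { add_assoc f g h := Mod.hom_ext _ _ (add_assoc f.hom g.hom h.hom)
      zero_add f := Mod.hom_ext _ _ (zero_add f.hom)
      add_zero f := Mod.hom_ext _ _ (add_zero f.hom)
      nsmul := nsmulRec
      zsmul := zsmulRec
      neg_add_cancel f := Mod.hom_ext _ _ (neg_add_cancel f.hom)
      add_comm f g := Mod.hom_ext _ _ (add_comm f.hom g.hom) }
  add_comp _ _ _ f f' g := Mod.hom_ext _ _ (Preadditive.add_comp _ _ _ f.hom f'.hom g.hom)
  comp_add _ _ _ f g g' := Mod.hom_ext _ _ (Preadditive.comp_add _ _ _ f.hom g.hom g'.hom)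

end preadditive

/-! ### Right exactness of the functor to modules. -/

section additive
variable {C : Type u₁} [Category.{v₁} C] [MonoidalCategory C] [SymmetricCategory C] [Preadditive C]
  {D : Type u₂} [Category.{v₂} D] [MonoidalCategory D] [SymmetricCategory D] [Preadditive D]
  [MonoidalPreadditive D] (L : C ⥤ D) [L.LaxBraided] [L.Additive]

instance : (laxMod L).Additive where
  map_add := Mod.hom_ext _ _ L.map_add

/-- Semisimplicity of the source is what makes it hold; nothing about colimits of modules is needed.
-/
lemma preservesFiniteColimits_laxMod [IsAbelian C] (hC : ∀ ⦃X Y : C⦄ (f : X ⟶ Y), IsRegular f) :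
    PreservesFiniteColimits (laxMod L) := by
  have : HasZeroObject C := hasZeroObject_of_hasFiniteBiproducts _
  have : HasZeroObject (Mod D (laxAlgebra L).X) :=
    ⟨_, (laxMod L).map_isZero (isZero_zero C)⟩
  exact preservesFiniteColimits_of_isRegular hC _

end additive
end TensorCat
/-! ### The right adjoint of a symmetric monoidal functor -/

namespace IndTensor
open Functor.LaxMonoidal Functor.OplaxMonoidal

section ext
variable {C : Type u} [Category.{v} C] [EssentiallySmall.{v} C] [MonoidalCategory C]

/-- The predicate in question and the constantly true one agree on products of elements, so they
agree by the uniqueness part of the universal property of Day convolution. -/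
lemma exists_tmul_res {M N : Ind C} {P : C} (z : El (M ⊗ N) P) :
    ∃ (A B : C) (m : El M A) (n : El N B) (f : P ⟶ A ⊗ B), (tmul m n).res f = z := by
  let := dayConvolution M N
  let S : El (M ⊗ N) P → ULift.{v} Prop := fun z => ⟨∃ (A B : C) (m : El M A) (n : El N B)
    (f : P ⟶ A ⊗ B), (tmul m n).res f = z⟩
  have h : (↾ S : (((Ind.inclusion C).obj (M ⊗ N)).obj (op P)) ⟶ ULift.{v} Prop) =
      ↾ fun _ => ⟨True⟩ := by
    refine DayConvolution.convolution_hom_ext_at ((Ind.inclusion C).obj M)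
      ((Ind.inclusion C).obj N) (op P) fun {x y} f => ?_
    ext ⟨m, n⟩
    exact iff_true_intro ⟨x.unop, y.unop, m, n, f.unop, rfl⟩
  have := congrArg (fun t => (t.hom z).down) h
  exact this.mpr trivial

lemma tensor_hom_ext₃ {M N L K : Ind C} {φ ψ : (M ⊗ N) ⊗ L ⟶ K}
    (h : ∀ (P Q R : C) (m : El M P) (n : El N Q) (l : El L R),
      elMap φ (tmul (tmul m n) l) = elMap ψ (tmul (tmul m n) l)) : φ = ψ := by
  refine tensor_hom_ext fun A B z l => ?_
  obtain ⟨P, Q, m, n, f, rfl⟩ := exists_tmul_res z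
  rw [← l.res_id, tmul_res, elMap_res, elMap_res, h]

lemma unit_tensor_hom_ext {M K : Ind C} {φ ψ : 𝟙_ _ ⊗ M ⟶ K}
    (h : ∀ (P : C) (m : El M P), elMap φ (tmul elUnit m) = elMap ψ (tmul elUnit m)) : φ = ψ := by
  rw [← cancel_epi (λ_ M).inv]
  refine hom_ext_el fun P m => ?_
  have hm : elMap (λ_ M).inv m = (tmul elUnit m).res (λ_ P).inv := by
    have := congrArg (fun t => (elMap (λ_ M).inv t).res (λ_ P).inv) (elMap_leftUnitor m)
    rw [← elMap_comp, Iso.hom_inv_id, elMap_id, ← elMap_res] at this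
    simpa using this.symm
  rw [elMap_comp, elMap_comp, hm, elMap_res, elMap_res, h]

lemma tensor_unit_hom_ext {M K : Ind C} {φ ψ : M ⊗ 𝟙_ _ ⟶ K}
    (h : ∀ (P : C) (m : El M P), elMap φ (tmul m elUnit) = elMap ψ (tmul m elUnit)) : φ = ψ := by
  rw [← cancel_epi (ρ_ M).inv]
  refine hom_ext_el fun P m => ?_
  have hm : elMap (ρ_ M).inv m = (tmul m elUnit).res (ρ_ P).inv := by
    have := congrArg (fun t => (elMap (ρ_ M).inv t).res (ρ_ P).inv) (elMap_rightUnitor m)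
    rw [← elMap_comp, Iso.hom_inv_id, elMap_id, ← elMap_res] at this
    simpa using this.symm
  rw [elMap_comp, elMap_comp, hm, elMap_res, elMap_res, h]

end ext

section adjoint
variable {C : Type u} [Category.{v} C] [EssentiallySmall.{v} C] [HasFiniteColimits C]
  [MonoidalCategory C] [SymmetricCategory C]
  {E : Type u₁} [Category.{v} E] [MonoidalCategory E] [SymmetricCategory E]
  (F : C ⥤ E) [PreservesFiniteColimits F] [F.Braided]

variable {F} in
lemma exists_elAdj {P : C} {Z : E} (m : El ((adj F).obj Z) P) : ∃ a, elAdj a = m :=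
  ⟨homAdj m, elAdj_homAdj m⟩

/-- The lax monoidal structure of the right adjoint: multiplication. -/
def adjμ (Z W : E) : (adj F).obj Z ⊗ (adj F).obj W ⟶ (adj F).obj (Z ⊗ W) :=
  tensorDesc (fun P Q m n => elAdj (δ F P Q ≫ (homAdj m ⊗ₘ homAdj n))) (fun _ _ _ _ f g m n => by
    rw [homAdj_res, homAdj_res, elAdj_res, ← tensorHom_comp_tensorHom, δ_natural_assoc])

/-- The lax monoidal structure of the right adjoint: unit. -/
def adjε : 𝟙_ (Ind C) ⟶ (adj F).obj (𝟙_ E) := inv (elHom elUnit) ≫ elHom (elAdj (η F))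

@[simp]
lemma elMap_adjμ {Z W : E} {P Q : C} (a : F.obj P ⟶ Z) (b : F.obj Q ⟶ W) :
    elMap (adjμ F Z W) (tmul (elAdj a) (elAdj b)) = elAdj (δ F P Q ≫ (a ⊗ₘ b)) := by
  rw [adjμ, elMap_tensorDesc, homAdj_elAdj, homAdj_elAdj]

@[simp]
lemma elMap_adjε : elMap (adjε F) elUnit = elAdj (η F) := by
  have : elMap (elHom elUnit ≫ adjε F) (elOfHom (𝟙 _)) = elAdj (η F) := by
    rw [adjε, IsIso.hom_inv_id_assoc, elMap_elHom_id]
  rwa [elMap_comp, elMap_elHom_id] at this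

/-- The right adjoint of a strong monoidal functor is lax monoidal. On elements the axioms become
the oplax axioms of `F`. -/
instance : (adj F).LaxMonoidal where
  ε := adjε F
  μ := adjμ F
  μ_natural_left f X := tensor_hom_ext fun P Q m n => by
    obtain ⟨a, rfl⟩ := exists_elAdj m
    obtain ⟨b, rfl⟩ := exists_elAdj n
    simp [elMap_whiskerRight, elMap_adj, MonoidalCategory.tensorHom_def']
  μ_natural_right X f := tensor_hom_ext fun P Q m n => by
    obtain ⟨a, rfl⟩ := exists_elAdj m
    obtain ⟨b, rfl⟩ := exists_elAdj n
    simp [elMap_whiskerLeft, elMap_adj, MonoidalCategory.tensorHom_def]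
  associativity X Y Z := tensor_hom_ext₃ fun P Q R m n l => by
    obtain ⟨a, rfl⟩ := exists_elAdj m
    obtain ⟨b, rfl⟩ := exists_elAdj n
    obtain ⟨c, rfl⟩ := exists_elAdj l
    simp only [elMap_comp, elMap_whiskerRight, elMap_whiskerLeft, elMap_adjμ, elMap_adj,
      elMap_associator, elMap_res, elAdj_res, Category.assoc]
    have h₁ : (δ F P Q ≫ (a ⊗ₘ b)) ⊗ₘ c = δ F P Q ▷ F.obj R ≫ ((a ⊗ₘ b) ⊗ₘ c) := by
      rw [← tensorHom_id, tensorHom_comp_tensorHom, Category.id_comp]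
    have h₂ : a ⊗ₘ (δ F Q R ≫ (b ⊗ₘ c)) = F.obj P ◁ δ F Q R ≫ (a ⊗ₘ (b ⊗ₘ c)) := by
      rw [← id_tensorHom, tensorHom_comp_tensorHom, Category.id_comp]
    rw [h₁, h₂, Category.assoc, associator_naturality, Functor.OplaxMonoidal.associativity_assoc]
  left_unitality X := unit_tensor_hom_ext fun P m => by
    obtain ⟨a, rfl⟩ := exists_elAdj m
    rw [elMap_comp, elMap_comp, elMap_whiskerRight, elMap_adjε, elMap_adjμ, elMap_adj,
      elMap_leftUnitor, elAdj_res, MonoidalCategory.tensorHom_def, Category.assoc, Category.assoc,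
      leftUnitor_naturality, left_unitality_hom_assoc]
  right_unitality X := tensor_unit_hom_ext fun P m => by
    obtain ⟨a, rfl⟩ := exists_elAdj m
    rw [elMap_comp, elMap_comp, elMap_whiskerLeft, elMap_adjε, elMap_adjμ, elMap_adj,
      elMap_rightUnitor, elAdj_res, MonoidalCategory.tensorHom_def', Category.assoc, Category.assoc,
      rightUnitor_naturality, right_unitality_hom_assoc]

instance : (adj F).LaxBraided where
  braided X Y := tensor_hom_ext fun P Q m n => by
    obtain ⟨a, rfl⟩ := exists_elAdj m
    obtain ⟨b, rfl⟩ := exists_elAdj n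
    change elMap (adjμ F X Y ≫ _) _ = elMap (_ ≫ adjμ F Y X) _
    rw [elMap_comp, elMap_comp, elMap_adjμ, elMap_adj, elMap_braiding, elMap_res, elMap_adjμ,
      elAdj_res]
    simp

end adjoint
end IndTensor
/-! ### The projection formula -/

namespace IndTensor
open Functor.LaxMonoidal Functor.OplaxMonoidal

section projection
variable {C : Type u} [Category.{v} C] [EssentiallySmall.{v} C] [HasFiniteColimits C]
  [MonoidalCategory C] [SymmetricCategory C]
  {E : Type u₁} [Category.{v} E] [MonoidalCategory E] [SymmetricCategory E]
  (F : C ⥤ E) [PreservesFiniteColimits F] [F.Braided]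

/-- The unit of the adjunction. -/
def adjUnit (Q : C) : Ind.yoneda.obj Q ⟶ (adj F).obj (F.obj Q) := elHom (elAdj (𝟙 _))

lemma elMap_adjUnit {P Q : C} (f : P ⟶ Q) : elMap (adjUnit F Q) (elOfHom f) = elAdj (F.map f) := by
  rw [adjUnit, elMap_elHom, elAdj_res, Category.comp_id]

lemma adjUnit_naturality {P Q : C} (f : P ⟶ Q) :
    adjUnit F P ≫ (adj F).map (F.map f) = Ind.yoneda.map f ≫ adjUnit F Q :=
  yoneda_hom_ext (by
    rw [elMap_comp, elMap_comp, elMap_yoneda_map, elMap_adjUnit, elMap_adjUnit, elMap_adj,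
      ← F.map_comp])

/-- The comparison morphism of the projection formula. -/
def projection (Q : C) (W : E) : Ind.yoneda.obj Q ⊗ (adj F).obj W ⟶ (adj F).obj (F.obj Q ⊗ W) :=
  adjUnit F Q ▷ _ ≫ μ (adj F) _ _

lemma elMap_projection {P A Q : C} {W : E} (f : P ⟶ Q) (b : F.obj A ⟶ W) :
    elMap (projection F Q W) (tmul (elOfHom f) (elAdj b)) = elAdj (δ F P A ≫ (F.map f ⊗ₘ b)) := by
  change elMap (_ ≫ adjμ F _ _) _ = _
  rw [elMap_comp, elMap_whiskerRight, elMap_adjUnit, elMap_adjμ]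

/-- By duality a morphism from `F P` to `F Q ⊗ W` is the same as one from `F (Q' ⊗ P)` to `W`; the
inverse is built from this transposition on elements. -/
lemma isIso_projection (Q Q' : C) [ExactPairing Q Q'] (W : E) : IsIso (projection F Q W) := by
  let := TensorCat.exactPairingMap F Q Q'
  -- `d` transposes an element, and `c` is the coevaluation. The inverse pairs the identity of `Q`
  -- with `d b` and restricts along `c`.
  let d {P : C} (b : F.obj P ⟶ F.obj Q ⊗ W) : F.obj (Q' ⊗ P) ⟶ W :=
    δ F Q' P ≫ (tensorLeftHomEquiv (F.obj P) (F.obj Q) (F.obj Q') W).symm b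
  let c (P : C) : P ⟶ Q ⊗ Q' ⊗ P := tensorLeftHomEquiv P Q Q' _ (𝟙 _)
  have hd {P A : C} (g : A ⟶ P) (b : F.obj P ⟶ F.obj Q ⊗ W) :
      d (F.map g ≫ b) = F.map (Q' ◁ g) ≫ d b := by
    simp only [d, tensorLeftHomEquiv, Equiv.coe_fn_symm_mk]
    simp
  have hc {P A : C} (g : A ⟶ P) : g ≫ c P = c A ≫ Q ◁ Q' ◁ g := by
    apply (tensorLeftHomEquiv A Q Q' _).symm.injective
    rw [tensorLeftHomEquiv_symm_naturality, ← tensorLeftHomEquiv_naturality,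
      Equiv.symm_apply_apply, Equiv.symm_apply_apply, Category.comp_id, Category.id_comp]
  let inve : (adj F).obj (F.obj Q ⊗ W) ⟶ Ind.yoneda.obj Q ⊗ (adj F).obj W :=
    homOfEl (fun P m => (tmul (elOfHom (𝟙 Q)) (elAdj (d (homAdj m)))).res (c P))
      (fun P A g m => by
        rw [homAdj_res, hd, ← elAdj_res, El.res_res, hc, ← El.res_res, ← id_tensorHom Q, ← tmul_res,
          El.res_id])
  refine ⟨inve, tensor_hom_ext fun P A m n => ?_, hom_ext_el fun P m => ?_⟩
  · obtain ⟨b, rfl⟩ := exists_elAdj n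
    obtain ⟨f, rfl⟩ : ∃ f, elOfHom f = m := ⟨_, elOfHom_homOfElt m⟩
    rw [elMap_comp, elMap_projection, elMap_homOfEl, homAdj_elAdj, elMap_id]
    have h₁ : d (δ F P A ≫ (F.map f ⊗ₘ b)) =
        F.map ((tensorLeftHomEquiv _ Q Q' _).symm (f ▷ A)) ≫ b := by
      dsimp only [d, tensorLeftHomEquiv, Equiv.coe_fn_symm_mk]
      change δ F Q' (P ⊗ A) ≫ F.obj Q' ◁ (δ F P A ≫ (F.map f ⊗ₘ b)) ≫ (α_ _ _ _).inv ≫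
        (μ F Q' Q ≫ F.map (ε_ Q Q') ≫ η F) ▷ W ≫ (λ_ W).hom = _
      have h₃ : F.map (α_ Q' Q A).inv ≫ δ F (Q' ⊗ Q) A = δ F Q' (Q ⊗ A) ≫ F.obj Q' ◁ δ F Q A ≫
          (α_ _ _ _).inv ≫ μ F Q' Q ▷ _ := by
        rw [Functor.OplaxMonoidal.associativity_inv_assoc, ← comp_whiskerRight,
          Functor.Monoidal.δ_μ, id_whiskerRight, Category.comp_id]
      simp only [F.map_comp, Category.assoc]
      rw [← left_unitality_hom_assoc, ← δ_natural_left_assoc, reassoc_of% h₃,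
        ← δ_natural_right_assoc, MonoidalCategory.whiskerLeft_comp, Category.assoc,
        MonoidalCategory.tensorHom_def, ← MonoidalCategory.whiskerLeft_comp_assoc,
        δ_natural_left_assoc]
      simp only [MonoidalCategory.whiskerLeft_comp, comp_whiskerRight, Category.assoc]
      rw [associator_inv_naturality_right_assoc, whisker_exchange_assoc, whisker_exchange_assoc,
        whisker_exchange_assoc, leftUnitor_naturality]
    have h₂ : c (P ⊗ A) ≫ Q ◁ (tensorLeftHomEquiv _ Q Q' _).symm (f ▷ A) = f ▷ A := by
      rw [← tensorLeftHomEquiv_naturality, Category.id_comp, Equiv.apply_symm_apply]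
    rw [h₁, ← elAdj_res, ← (elOfHom (𝟙 Q)).res_id, tmul_res, El.res_res, id_tensorHom, h₂,
      ← tensorHom_id, ← tmul_res, elOfHom_res, Category.comp_id, El.res_id]
  · obtain ⟨b, rfl⟩ := exists_elAdj m
    rw [elMap_comp, elMap_homOfEl, elMap_res, elMap_projection, homAdj_elAdj, elAdj_res, elMap_id,
      CategoryTheory.Functor.map_id, id_tensorHom]
    congr 1
    have h : b = tensorLeftHomEquiv (F.obj P) (F.obj Q) (F.obj Q') W
      ((tensorLeftHomEquiv (F.obj P) (F.obj Q) (F.obj Q') W).symm b) := by simp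
    conv_rhs => rw [h]
    dsimp only [d]
    generalize (tensorLeftHomEquiv (F.obj P) (F.obj Q) (F.obj Q') W).symm b = t
    dsimp only [c, tensorLeftHomEquiv, Equiv.coe_fn_mk]
    change _ = (λ_ _).inv ≫ (ε F ≫ F.map (η_ Q Q') ≫ δ F Q Q') ▷ F.obj P ≫ (α_ _ _ _).hom ≫
      F.obj Q ◁ t
    simp

end projection
end IndTensor
/-! ### Free modules and relative tensor products from lax monoidal functors -/

namespace TensorCat
open Functor.LaxMonoidal

section lax
variable {C : Type u₁} [Category.{v₁} C] [MonoidalCategory C] [SymmetricCategory C]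
  {D : Type u₂} [Category.{v₂} D] [MonoidalCategory D] [SymmetricCategory D]
  (L : C ⥤ D) [L.LaxBraided] {Y : D} {Z : C} (v : Y ⟶ L.obj Z)

lemma smul_whiskerLeft_laxAct :
    ((α_ _ _ Y).inv ≫ MonObj.mul (X := (laxAlgebra L).X) ▷ Y) ≫
      (laxAlgebra L).X ◁ v ≫ laxAct L Z =
    (laxAlgebra L).X ◁ ((laxAlgebra L).X ◁ v ≫ laxAct L Z) ≫ laxAct L Z := by
  rw [Category.assoc, ← whisker_exchange_assoc, mul_laxAct, MonoidalCategory.whiskerLeft_comp,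
    Category.assoc, associator_naturality_right_assoc, Iso.inv_hom_id_assoc]

/-- The morphism of modules from a free module determined by a morphism. -/
def freeModDesc : (freeMod (laxAlgebra L).X).obj Y ⟶ (laxMod L).obj Z :=
  Mod.Hom.mk' ((laxAlgebra L).X ◁ v ≫ laxAct L Z) (smul_whiskerLeft_laxAct L v)

lemma isIso_whiskerLeft_laxAct [IsIso (v ▷ L.obj (𝟙_ C) ≫ μ L Z (𝟙_ C))] :
    IsIso ((laxAlgebra L).X ◁ v ≫ laxAct L Z) := by
  have h : (β_ Y (laxAlgebra L).X).hom ≫ (laxAlgebra L).X ◁ v ≫ laxAct L Z =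
      (v ▷ L.obj (𝟙_ C) ≫ μ L Z (𝟙_ C)) ≫ L.map (ρ_ Z).hom := by
    rw [← BraidedCategory.braiding_naturality_left_assoc, braiding_laxAct, Category.assoc]
    rfl
  have : IsIso ((v ▷ L.obj (𝟙_ C) ≫ μ L Z (𝟙_ C)) ≫ L.map (ρ_ Z).hom) := inferInstance
  rw [← h] at this
  exact @IsIso.of_isIso_comp_left _ _ _ _ _ (β_ Y (laxAlgebra L).X).hom _ _ this

lemma isIso_of_isIso_hom {A : D} [MonObj A] {M N : Mod D A} (f : M ⟶ N) [IsIso f.hom] :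
    IsIso f := by
  have : act N ≫ inv f.hom = A ◁ inv f.hom ≫ act M := by
    have h : act M ≫ f.hom = A ◁ f.hom ≫ act N := f.isModHom.smul_hom
    rw [IsIso.comp_inv_eq, Category.assoc, h, ← MonoidalCategory.whiskerLeft_comp_assoc,
      IsIso.inv_hom_id, MonoidalCategory.whiskerLeft_id, Category.id_comp]
  exact ⟨Mod.Hom.mk' (inv f.hom) this, Mod.hom_ext _ _ (IsIso.hom_inv_id f.hom),
    Mod.hom_ext _ _ (IsIso.inv_hom_id f.hom)⟩

instance [IsIso (v ▷ L.obj (𝟙_ C) ≫ μ L Z (𝟙_ C))] : IsIso (freeModDesc L v) :=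
  have : IsIso (freeModDesc L v).hom := isIso_whiskerLeft_laxAct L v
  isIso_of_isIso_hom _

/-- The image of a tensor product is a relative tensor product if one factor is free. -/
def isColimitOfIsIso (W : C) [IsIso (v ▷ L.obj (𝟙_ C) ≫ μ L Z (𝟙_ C))]
    [IsIso (v ▷ L.obj W ≫ μ L Z W)] : IsColimit (Cofork.ofπ _ (laxAct_balanced L Z W)) := by
  let t := v ▷ L.obj W ≫ μ L Z W
  -- As `t` identifies `L (Z ⊗ W)` with `Y ⊗ L W`, the inclusion of the generators gives a section
  -- of the structure map.
  let s : L.obj (Z ⊗ W) ⟶ L.obj Z ⊗ L.obj W := inv t ≫ v ▷ L.obj W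
  have hs : s ≫ μ L Z W = 𝟙 _ := by
    rw [Category.assoc, IsIso.inv_comp_eq, Category.comp_id]
  -- `ψ` presents `L Z` as the free module on `Y`. By `hψ` a balanced morphism is determined by its
  -- restriction along `v`, which is why it factors through `s`.
  let ψ : Y ⊗ (laxAlgebra L).X ⟶ L.obj Z :=
    v ▷ (laxAlgebra L).X ≫ (β_ (L.obj Z) (laxAlgebra L).X).hom ≫ laxAct L Z
  have : IsIso ψ := by
    have : ψ = (v ▷ L.obj (𝟙_ C) ≫ μ L Z (𝟙_ C)) ≫ L.map (ρ_ Z).hom := by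
      rw [Category.assoc, ← braiding_laxAct]
      rfl
    rw [this]
    exact IsIso.comp_isIso' ‹_› inferInstance
  have hψ {K : D} (h : L.obj Z ⊗ L.obj W ⟶ K)
      (hh : (((β_ (L.obj Z) (laxAlgebra L).X).hom ≫ laxAct L Z) ▷ L.obj W) ≫ h =
      ((α_ _ _ _).hom ≫ L.obj Z ◁ laxAct L W) ≫ h) :
      ψ ▷ L.obj W ≫ h = (α_ _ _ _).hom ≫ Y ◁ laxAct L W ≫ v ▷ L.obj W ≫ h := by
    rw [comp_whiskerRight, Category.assoc, hh, Category.assoc, associator_naturality_left_assoc,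
      ← whisker_exchange_assoc]
  refine Cofork.IsColimit.mk' _ fun c => ⟨s ≫ c.π, ?_, fun {m} hm => ?_⟩
  · change μ L Z W ≫ s ≫ c.π = c.π
    rw [← cancel_epi (ψ ▷ L.obj W), reassoc_of% hψ _ (laxAct_balanced L Z W), hψ _ c.condition]
    have : v ▷ L.obj W ≫ μ L Z W ≫ s = v ▷ L.obj W := by
      rw [← Category.assoc]
      exact IsIso.hom_inv_id_assoc t _
    rw [reassoc_of% this]
  · change μ L Z W ≫ m = c.π at hm
    rw [← hm, reassoc_of% hs]

end lax
end TensorCat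
/-! ### Fibre functors and splitting algebras from splitting functors -/

namespace TensorCat
open IndTensor Functor.LaxMonoidal
attribute [local instance] indPreadditive indLinear

lemma hasFiniteColimits_of_isAbelian (C : Type u) [Category.{v} C] [Preadditive C] [IsAbelian C] :
    HasFiniteColimits C :=
  let := abelianOfIsAbelian C
  Abelian.hasFiniteColimits

section
variable {C : Type u} [Category.{v} C] [EssentiallySmall.{v} C] [HasFiniteColimits C]
  [MonoidalCategory C] [SymmetricCategory C]
  {E : Type u₁} [Category.{v} E] [MonoidalCategory E] [SymmetricCategory E]
  (F : C ⥤ E) [PreservesFiniteColimits F] [F.Braided]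

lemma isIso_whiskerRight_μ_adj (hdual : ∀ Q : C, ∃ Q', Nonempty (ExactPairing Q Q')) {Q : C} {Z : E}
    (e : F.obj Q ≅ Z) (W : E) :
    IsIso ((adjUnit F Q ≫ (adj F).map e.hom) ▷ (adj F).obj W ≫ μ (adj F) Z W) := by
  obtain ⟨Q', ⟨_⟩⟩ := hdual Q
  have := isIso_projection F Q Q' W
  have h : (adjUnit F Q ≫ (adj F).map e.hom) ▷ (adj F).obj W ≫ μ (adj F) Z W =
      projection F Q W ≫ (adj F).map (e.hom ▷ W) := by
    rw [comp_whiskerRight, Category.assoc, μ_natural_left, projection, Category.assoc]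
  rw [h]
  infer_instance

/-- Free modules over the algebra of a symmetric monoidal functor. -/
def freeModIso (hdual : ∀ Q : C, ∃ Q', Nonempty (ExactPairing Q Q')) :
    Ind.yoneda ⋙ freeMod (laxAlgebra (adj F)).X ≅ F ⋙ laxMod (adj F) :=
  have h (Q : C) : IsIso (adjUnit F Q ▷ (adj F).obj (𝟙_ E) ≫ μ (adj F) (F.obj Q) (𝟙_ E)) := by
    obtain ⟨Q', ⟨_⟩⟩ := hdual Q
    exact isIso_projection F Q Q' (𝟙_ E)
  NatIso.ofComponents (fun Q => asIso (freeModDesc (adj F) (adjUnit F Q))) (fun {P Q} f => by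
    refine Mod.hom_ext _ _ ?_
    change (laxAlgebra (adj F)).X ◁ Ind.yoneda.map f ≫
      (laxAlgebra (adj F)).X ◁ adjUnit F Q ≫ laxAct (adj F) (F.obj Q) =
      ((laxAlgebra (adj F)).X ◁ adjUnit F P ≫ laxAct (adj F) (F.obj P)) ≫ (adj F).map (F.map f)
    rw [← MonoidalCategory.whiskerLeft_comp_assoc, ← adjUnit_naturality, Category.assoc,
      laxAct_naturality, MonoidalCategory.whiskerLeft_comp_assoc])

/-- Otherwise the elements given by the unit constraint of `F` and by zero would coincide, and the
unit of `E` would be zero. -/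
lemma not_isZero_laxAlgebra_adj [HasZeroMorphisms E] (hE : ¬ IsZero (𝟙_ E)) :
    ¬ IsZero (laxAlgebra (adj F)).X := by
  intro h
  have h₁ := congrArg (elMap · (elOfHom (𝟙 _)))
    (h.eq_of_tgt (elHom (elAdj (Functor.OplaxMonoidal.η F))) (elHom (elAdj 0)))
  have h₂ : elAdj (Functor.OplaxMonoidal.η F) = elAdj 0 :=
    ((elMap_elHom_id _).symm.trans h₁).trans (elMap_elHom_id _)
  have h₃ : Functor.OplaxMonoidal.η F = 0 :=
    ((homAdj_elAdj _).symm.trans (congrArg homAdj h₂)).trans (homAdj_elAdj _)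
  refine hE ((IsZero.iff_id_eq_zero _).2 ?_)
  rw [← Functor.Monoidal.ε_η F, h₃, comp_zero]

end

section fibre
variable {k : Type w} [Field k] {T : Type u₁} {V : Type u₂} [Category.{v} T] [Category.{v} V]
  [Preadditive T] [Preadditive V] [IsAbelian V] [Linear k T] [Linear k V]
  [MonoidalCategory T] [MonoidalCategory V] [SymmetricCategory T] [SymmetricCategory V]
  [EssentiallySmall.{v} V] [HasFiniteColimits V] [MonoidalPreadditive V]
  {C : Type u} [Category.{v} C] [Preadditive C] [IsAbelian C] [Linear k C] [MonoidalCategory C]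
  [SymmetricCategory C]
  (G : T ⥤ C) [G.Braided] [G.Additive] [G.Linear k] [PreservesFiniteColimits G]
  (H : V ⥤ C) [H.Braided] [H.Additive] [H.Linear k] [PreservesFiniteColimits H]

/-- The fibre functor on `T` over the algebra of `H` given by a functor `G` with values among those
of `H`. -/
def fibreFunctor (hC : ∀ ⦃X Y : C⦄ (f : X ⟶ Y), IsRegular f)
    (hdual : ∀ Q : V, ∃ Q', Nonempty (ExactPairing Q Q'))
    (h : ∀ X : T, ∃ Q : V, Nonempty (H.obj Q ≅ G.obj X)) :
    FibreFunctor k T V (laxAlgebra (adj H)) where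
  F := G ⋙ laxMod (adj H)
  additive := inferInstanceAs (G ⋙ adj H).Additive
  linear := inferInstanceAs ((G ⋙ adj H).Linear k)
  rightExact :=
    have := preservesFiniteColimits_laxMod (adj H) hC
    comp_preservesFiniteColimits G (laxMod (adj H))
  laxBraided := inferInstanceAs (G ⋙ adj H).LaxBraided
  μ_linear X Y := by
    change laxAct (adj H) (G.obj X) ▷ (adj H).obj (G.obj Y) ≫ μ (adj H) _ _ ≫
        (adj H).map (μ G X Y) = (α_ _ _ _).hom ≫ (laxAlgebra (adj H)).X ◁
        (μ (adj H) _ _ ≫ (adj H).map (μ G X Y)) ≫ laxAct (adj H) _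
    rw [MonoidalCategory.whiskerLeft_comp, Category.assoc, ← laxAct_naturality,
      reassoc_of% laxAct_μ (adj H) (G.obj X) (G.obj Y)]
  μ_balanced X Y := by
    change ((β_ _ _).hom ≫ laxAct (adj H) (G.obj X)) ▷ (adj H).obj (G.obj Y) ≫ μ (adj H) _ _ ≫
        (adj H).map (μ G X Y) = ((α_ _ _ _).hom ≫ (adj H).obj (G.obj X) ◁ laxAct (adj H) (G.obj Y)) ≫
        μ (adj H) _ _ ≫ (adj H).map (μ G X Y)
    rw [reassoc_of% laxAct_balanced (adj H) (G.obj X) (G.obj Y), Category.assoc]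
  isColimit X Y := by
    -- The module attached to `G X` is free on `Q`, because `G X` is isomorphic to `H Q`; hence its
    -- tensor products over the algebra are computed by `isColimitOfIsIso`.
    let Q := (h X).choose
    let e : H.obj Q ≅ G.obj X := (h X).choose_spec.some
    have := isIso_whiskerRight_μ_adj H hdual e
    exact IsColimit.ofIsoColimit (isColimitOfIsIso (adj H)
        (adjUnit H Q ≫ (adj H).map e.hom) (G.obj Y))
      (Cofork.ext ((adj H).mapIso (asIso (μ G X Y))) rfl)
  unit_isIso := by
    have h : (ρ_ (laxAlgebra (adj H)).X).inv ≫ (laxAlgebra (adj H)).X ◁ (ε (adj H) ≫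
        (adj H).map (ε G)) ≫ laxAct (adj H) (G.obj (𝟙_ T)) = (adj H).map (ε G) := by
      rw [MonoidalCategory.whiskerLeft_comp, Category.assoc, ← laxAct_naturality]
      change (ρ_ ((adj H).obj (𝟙_ C))).inv ≫ (adj H).obj (𝟙_ C) ◁ ε (adj H) ≫ (μ (adj H) _ _ ≫
        (adj H).map (λ_ (𝟙_ C)).hom) ≫ (adj H).map (ε G) = _
      rw [unitors_equal, Category.assoc, ← right_unitality_assoc, Iso.inv_hom_id_assoc]
    change IsIso ((ρ_ (laxAlgebra (adj H)).X).inv ≫ (laxAlgebra (adj H)).X ◁ (ε (adj H) ≫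
        (adj H).map (ε G)) ≫ laxAct (adj H) (G.obj (𝟙_ T)))
    rw [h]
    exact Functor.map_isIso (adj H) (ε G)

end fibre
end TensorCat
/-! ### Splitting algebras -/

namespace TensorCat
open IndTensor
attribute [local instance] indPreadditive indLinear

section box
variable {k : Type w} [Field k] {T V : Type u}
  [Category.{v} T] [EssentiallySmall.{v} T] [Preadditive T] [IsAbelian T] [Linear k T]
  [MonoidalCategory T] [SymmetricCategory T] [MonoidalPreadditive T] [MonoidalLinear k T]
  [Category.{v} V] [EssentiallySmall.{v} V] [Preadditive V] [IsAbelian V] [Linear k V]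
  [MonoidalCategory V] [SymmetricCategory V] [MonoidalPreadditive V] [MonoidalLinear k V]
  [IsAbelian (Box k T V)]
  {C : Type u₁} [Category.{v} C] [Preadditive C] [MonoidalCategory C] [SymmetricCategory C]
  (F : Box k T V ⥤ C) [PreservesFiniteColimits F] [F.Braided] [F.Additive]

lemma shortExact_inT {S : ShortComplex T} (hS : S.ShortExact) :
    (S.map (inT k T V)).ShortExact := by
  have := preservesFiniteColimits_inT (k := k) (T := T) (V := V)
  have := hS.mono_f
  have := mono_inT_map (k := k) (V := V) S.f
  exact shortExact_of_isCok _ _ (isCok_map_of_preservesFiniteColimits _ (isCok_of_shortExact hS))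

variable [HasFiniteColimits (Box k T V)] in
/-- A functor splitting short exact sequences gives a splitting algebra. -/
lemma isSplittingAlgebra_laxAlgebra_adj
    (hdual : ∀ Q : Box k T V, ∃ Q', Nonempty (ExactPairing Q Q')) (hC : ¬ IsZero (𝟙_ C))
    (hsplit : ∀ S : ShortComplex (Box k T V), S.ShortExact → Nonempty (S.map F).Splitting)
    (hF : ∀ X : T, ∃ X₀ : V,
      Nonempty (F.obj ((inT k T V).obj X) ≅ F.obj ((inV k T V).obj X₀))) :
    IsSplittingAlgebra k T V (laxAlgebra (adj F)) where
  nonzero := not_isZero_laxAlgebra_adj F hC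
  splits S hS := by
    obtain ⟨s⟩ := hsplit _ (shortExact_inT (k := k) (V := V) hS)
    -- Free modules on objects of the product are images of objects of `C`, so splittings and
    -- isomorphisms in `C` carry over to modules.
    let e := freeModIso F hdual
    let L := laxMod (adj F)
    obtain ⟨r, hr⟩ : ∃ r, F.map ((inT k T V).map S.f) ≫ r = 𝟙 _ := ⟨s.r, s.f_r⟩
    obtain ⟨t, ht⟩ : ∃ t, t ≫ F.map ((inT k T V).map S.g) = 𝟙 _ := ⟨s.s, s.s_g⟩
    have h {X Y : T} (f : X ⟶ Y) : (freeT k T V (laxAlgebra (adj F))).map f =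
        e.hom.app _ ≫ L.map (F.map ((inT k T V).map f)) ≫ e.inv.app _ :=
      (NatIso.naturality_2 e ((inT k T V).map f)).symm
    constructor
    · refine ⟨⟨⟨e.hom.app _ ≫ L.map r ≫ e.inv.app _, ?_⟩⟩⟩
      rw [h, Category.assoc, Category.assoc, Iso.inv_hom_id_app_assoc, ← L.map_comp_assoc, hr,
        CategoryTheory.Functor.map_id, Category.id_comp, Iso.hom_inv_id_app]
      rfl
    · refine ⟨⟨⟨e.hom.app _ ≫ L.map t ≫ e.inv.app _, ?_⟩⟩⟩
      rw [h, Category.assoc, Category.assoc, Iso.inv_hom_id_app_assoc, ← L.map_comp_assoc, ht,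
        CategoryTheory.Functor.map_id, Category.id_comp, Iso.hom_inv_id_app]
      rfl
  free X := by
    obtain ⟨X₀, ⟨e⟩⟩ := hF X
    exact ⟨X₀, ⟨(freeModIso F hdual).app _ ≪≫ (laxMod (adj F)).mapIso e ≪≫
      ((freeModIso F hdual).app _).symm⟩⟩

end box
end TensorCat

end

theorem proposition3 {k : Type w} [Field k] {T V : Type u}
    [CategoryTheory.Category.{v} T] [CategoryTheory.EssentiallySmall.{v} T]
    [CategoryTheory.Preadditive T] [TensorCat.IsAbelian T] [CategoryTheory.Linear k T]
    [CategoryTheory.MonoidalCategory T] [CategoryTheory.SymmetricCategory T]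
    [CategoryTheory.MonoidalPreadditive T] [CategoryTheory.MonoidalLinear k T]
    [CategoryTheory.Category.{v} V] [CategoryTheory.EssentiallySmall.{v} V]
    [CategoryTheory.Preadditive V] [TensorCat.IsAbelian V] [CategoryTheory.Linear k V]
    [CategoryTheory.MonoidalCategory V] [CategoryTheory.SymmetricCategory V]
    [CategoryTheory.MonoidalPreadditive V] [CategoryTheory.MonoidalLinear k V]
    (hT : TensorCat.IsTensorCategory k T) (hV : TensorCat.IsTensorCategory k V)
    (hss : TensorCat.IsSchurianSemisimple k V) (hsym : TensorCat.SymPowersVanish V)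
    (hfree : ∀ X : T, TensorCat.LocallyFree k V X) :
    ((∃ _ : TensorCat.IsAbelian (TensorCat.Box k T V),
        TensorCat.IsTensorCategory k (TensorCat.Box k T V)) ∧
      TensorCat.LocallySemisimple k T ∧ TensorCat.LocallySemisimple k (TensorCat.Box k T V)) ∧
    (∃ A : CategoryTheory.CommMon (CategoryTheory.Ind (TensorCat.Box k T V)),
      TensorCat.IsSplittingAlgebra k T V A) ∧
    (∃ R : CategoryTheory.CommMon (CategoryTheory.Ind V),
      ¬ CategoryTheory.Limits.IsZero R.X ∧ Nonempty (TensorCat.FibreFunctor k T V R)) := by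
  have := TensorCat.isAbelian_box (k := k) (T := T) hss
  have hB := TensorCat.isTensorCategory_box hT hV
  obtain ⟨C, _, _, _, _, _, _, _, _, F, _, _, _, _, hC, hreg, hsplit, hF⟩ :=
    TensorCat.exists_splitting_functor hT hV hss hsym hfree
  have := TensorCat.preservesFiniteColimits_inT (k := k) (T := T) (V := V)
  have := TensorCat.preservesFiniteColimits_inV (k := k) (T := T) hss
  have := TensorCat.hasFiniteColimits_of_isAbelian V
  have := TensorCat.hasFiniteColimits_of_isAbelian (TensorCat.Box k T V)
  have := comp_preservesFiniteColimits (TensorCat.inT k T V) F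
  have := comp_preservesFiniteColimits (TensorCat.inV k T V) F
  refine ⟨⟨⟨inferInstance, hB⟩, ⟨C, inferInstance, inferInstance, inferInstance, inferInstance,
    inferInstance, inferInstance, inferInstance, inferInstance, hC,
    ⟨TensorCat.inT k T V ⋙ F, inferInstance, inferInstance, inferInstance, inferInstance⟩,
    fun S hS => hsplit _ (TensorCat.shortExact_inT (k := k) (V := V) hS)⟩,
    ⟨C, inferInstance, inferInstance, inferInstance, inferInstance,
    inferInstance, inferInstance, inferInstance, inferInstance, hC,
    ⟨F, inferInstance, inferInstance, inferInstance, inferInstance⟩, hsplit⟩⟩,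
    -- The splitting algebra comes from `F` on the whole product, the algebra of the fibre functor
    -- from the restriction of `F` to `V`.
    ⟨_, TensorCat.isSplittingAlgebra_laxAlgebra_adj F hB.dualisable hC.unit_nonzero hsplit hF⟩,
    ⟨_, TensorCat.not_isZero_laxAlgebra_adj (TensorCat.inV k T V ⋙ F) hC.unit_nonzero,
    ⟨TensorCat.fibreFunctor (TensorCat.inT k T V ⋙ F) (TensorCat.inV k T V ⋙ F) hreg hV.dualisable
      fun X => (hF X).imp fun _ ⟨e⟩ => ⟨e.symm⟩⟩⟩⟩
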